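/- Setting. Let $n\ge 1$ and let $M$ be an $n$-dimensional connected compact oriented $C^\infty$ manifold (without boundary). Let $M=\bigcup_{i=1}^k M_i$, where each $M_i$ is compact and connected, is the closure of its interior $M_i^o$, and has piecewise-$C^\infty$ boundary (away from a subset of $\partial M_i$ whose $(n-1)$-dimensional Hausdorff measure is zero, $\partial M_i$ is a $C^\infty$ hypersurface with $M_i$ on one side), and where $M_i\cap M_j=\partial M_i\cap\partial M_j$ for $i\neq j$. A piecewise-$C^2$ weak immersion is a continuous map $X:M\to\mathbb R^{n+1}$ such that, for every $i$, $X|_{M_i}$ is of class $C^2$, $X|_{M_i^o}$ is an immersion, and its unit normal $\nu_i:M_i^o\to S^n$ (chosen such that $(\nu_i,\partial X/\partial u^1,\dots,\partial X/\partial u^n)$ is positively oriented in oriented local coordinates) extends to a $C^1$ map $\nu_i:M_i\to S^n$. Let $\gamma:S^n\to\mathbb R_{>0}$ be of class $C^2$, with gradient $D\gamma$ on $S^n$ and Cahn–Hoffman map $\xi(\nu)=D\gamma|_\nu+\gamma(\nu)\nu$, and put $\tilde\xi_i=\xi\circ\nu_i:M_i\to\mathbb R^{n+1}$. Let $\mathcal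 F_\gamma(X)=\int_M\gamma(\nu)\,dA$, where $\nu$ is the unit normal (defined almost everywhere) and $dA$ the $n$-dimensional volume induced by $X$, and let $V(X)=\frac1{n+1}\int_M\langle X,\nu\rangle\,dA$ be the enclosed $(n+1)$-dimensional volume. A variation of $X$ is a family $X_\epsilon$, $|\epsilon|<\epsilon_0$, of piecewise-$C^2$ weak immersions of $M=\bigcup_i M_i$ with $X_0=X$, which is $C^\infty$ in $\epsilon$ and, on each $M_i$, jointly $C^2$ in $\epsilon$ and the point. It is volume-preserving if $V(X_\epsilon)=V(X)$ for all $\epsilon$. The map $X$ is critical for $\mathcal F_\gamma$ for volume-preserving variations if $\frac{d}{d\epsilon}\big|_{\epsilon=0}\mathcal F_\gamma(X_\epsilon)$ exists and equals $0$ for each of them. Let $S(X)$ be the set of points of $M$ near which $X$ is not a $C^2$ immersion. On $M\setminus S(X)$ the anisotropic mean curvature is $\Lambda=-\frac1n\operatorname{trace} d(\xi\circ\nu)$, where $T_pM$ is identified with $dX(T_pM)=\nu(p)^\perp$. Proposition (Euler–Lagrange equations). A piecewise-$C^2$ weak immersion $X:M=\bigcup_{i=1}^k M_i\to\mathbb R^{n+1}$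 is a critical point of $\mathcal F_\gamma$ for volume-preserving variations if and only if (i) the anisotropic mean curvature $\Lambda$ of $X$ is constant on $M\setminus S(X)$, and (ii) for all $i\ne j$, $\tilde\xi_i(\zeta)-\tilde\xi_j(\zeta)\in T_\zeta(\partial M_i\cap\partial M_j)$ for every point $\zeta$ of the common edge of $M_i$ and $M_j$ at which the restriction of $X$ to the edge is an immersion. Here the common edge consists of the points of $\partial M_i\cap\partial M_j$ near which, in suitable $C^\infty$ coordinates $x$ of $M$, $M_i=\{x_1\ge0\}$ and $M_j=\{x_1\le0\}$, so that $\partial M_i\cap\partial M_j=\{x_1=0\}$; and $T_\zeta(\partial M_i\cap\partial M_j)$ is the linear subspace $d(X|_{\partial M_i\cap\partial M_j})_\zeta\big(T_\zeta(\partial M_i\cap\partial M_j)\big)$ of $\mathbb R^{n+1}$. -/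

import Mathlib

open Set MeasureTheory
open scoped Manifold ContDiff RealInnerProductSpace

noncomputable section

namespace AnisoSurface

/-! ### The energy density on the unit sphere and the Cahn-Hoffman map -/

/-- The dimension of `ℝ^{n+1}`; it activates Mathlib's manifold structure on the unit sphere. -/
instance factFinrank (n : ℕ) :
    Fact (Module.finrank ℝ (EuclideanSpace ℝ (Fin (n + 1))) = n + 1) :=
  ⟨finrank_euclideanSpace_fin⟩

/-- The extension `x ↦ γ (x / ‖x‖)` of a function on `S^n`, constant along rays (and `0` at the
origin). -/
def radialExt {n : ℕ} (γ : Metric.sphere (0 : EuclideanSpace ℝ (Fin (n + 1))) 1 → ℝ)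
    (x : EuclideanSpace ℝ (Fin (n + 1))) : ℝ :=
  open Classical in
  if h : x ≠ 0 then
    γ ⟨‖x‖⁻¹ • x, by simp [norm_smul, inv_mul_cancel₀ (norm_ne_zero_iff.mpr h)]⟩
  else 0

/-- The gradient `Dγ` on the sphere `S^n` at `ν ∈ S^n`, as a vector of `ℝ^{n+1}` orthogonal to `ν`:
it is the gradient in `ℝ^{n+1}` of the extension that is constant along rays. -/
def sphereGrad {n : ℕ} (γ : Metric.sphere (0 : EuclideanSpace ℝ (Fin (n + 1))) 1 → ℝ)
    (ν : EuclideanSpace ℝ (Fin (n + 1))) : EuclideanSpace ℝ (Fin (n + 1)) :=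
  gradient (radialExt γ) ν

/-- The Cahn-Hoffman map `ξ(ν) = Dγ(ν) + γ(ν) ν`, `ν ∈ S^n`. -/
def cahnHoffman {n : ℕ} (γ : Metric.sphere (0 : EuclideanSpace ℝ (Fin (n + 1))) 1 → ℝ)
    (ν : EuclideanSpace ℝ (Fin (n + 1))) : EuclideanSpace ℝ (Fin (n + 1)) :=
  sphereGrad γ ν + radialExt γ ν • ν

/-- The generalized cross product of `n` vectors of `ℝ^{n+1}`:
`⟪crossProd w, v⟫ = det (v, w₁, …, w_n)` for all `v`. -/
def crossProd {n : ℕ} (w : Fin n → EuclideanSpace ℝ (Fin (n + 1))) :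
    EuclideanSpace ℝ (Fin (n + 1)) :=
  WithLp.toLp 2 fun k =>
    Matrix.det (Matrix.of (Fin.cons (Pi.single k (1 : ℝ)) fun i => (w i).ofLp))

section Manifold

variable {n : ℕ} {M : Type*} [TopologicalSpace M] [ChartedSpace (EuclideanSpace ℝ (Fin n)) M]

/-! ### Oriented manifolds, first order data of a map `X : M → ℝ^{n+1}` -/

variable (n M) in
/-- The charts of the given atlas of `M` define an orientation: all coordinate changes have positive
Jacobian determinant. The charts of the atlas are the positively oriented ones. -/
def IsOrientedAtlas : Prop :=
  ∀ e ∈ atlas (EuclideanSpace ℝ (Fin n)) M, ∀ e' ∈ atlas (EuclideanSpace ℝ (Fin n)) M,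
    ∀ u ∈ (e.symm.trans e').source, 0 < (fderiv ℝ (e.symm.trans e') u).det

/-- The differential at `p` of a map from `M` to `ℝ^{n+1}`. The tangent space of `M` at `p` is
identified with `ℝ^n` by the preferred chart at `p`. -/
def diffAt (f : M → EuclideanSpace ℝ (Fin (n + 1))) (p : M) :
    EuclideanSpace ℝ (Fin n) →L[ℝ] EuclideanSpace ℝ (Fin (n + 1)) :=
  mfderiv (𝓡 n) 𝓘(ℝ, EuclideanSpace ℝ (Fin (n + 1))) f p

/-- The coordinate derivatives `∂X/∂u¹, …, ∂X/∂uⁿ` at `p`, in the preferred (positively oriented)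
chart at `p`. -/
def coordFrame (X : M → EuclideanSpace ℝ (Fin (n + 1))) (p : M) :
    Fin n → EuclideanSpace ℝ (Fin (n + 1)) :=
  fun j => diffAt X p (EuclideanSpace.single j 1)

/-- The unit normal of `X` at a point where the differential is injective: the unit vector `ν`
orthogonal to the image of the differential such that `(ν, ∂X/∂u¹, …, ∂X/∂uⁿ)` is a positively
oriented basis of `ℝ^{n+1}`. -/
def unitNormal (X : M → EuclideanSpace ℝ (Fin (n + 1))) (p : M) :
    EuclideanSpace ℝ (Fin (n + 1)) :=
  ‖crossProd (coordFrame X p)‖⁻¹ • crossProd (coordFrame X p)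

/-- The area density `√(det g)`, `g_{ij} = ⟪∂_i X, ∂_j X⟫`, of `X` in the chart `e`. -/
def areaDensity (X : M → EuclideanSpace ℝ (Fin (n + 1)))
    (e : OpenPartialHomeomorph M (EuclideanSpace ℝ (Fin n))) (u : EuclideanSpace ℝ (Fin n)) : ℝ :=
  √(Matrix.gram ℝ fun j : Fin n => fderiv ℝ (X ∘ e.symm) u (EuclideanSpace.single j 1)).det

/-- The `n`-dimensional volume `dA` on `M` induced by `X`. In the domain of a chart it is
`√(det g) du¹ ⋯ duⁿ`; these measures agree on overlaps, and `dA` is their supremum, that is, the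
measure on `M` which restricts to each of them. -/
def areaMeasure [MeasurableSpace M] (X : M → EuclideanSpace ℝ (Fin (n + 1))) : Measure M :=
  ⨆ p : M, Measure.map (chartAt (EuclideanSpace ℝ (Fin n)) p).symm
    ((volume.withDensity fun u =>
      ENNReal.ofReal (areaDensity X (chartAt (EuclideanSpace ℝ (Fin n)) p) u)).restrict
        (chartAt (EuclideanSpace ℝ (Fin n)) p).target)

/-- The anisotropic energy `∫_M γ(ν) dA`. -/
def anisoEnergy [MeasurableSpace M]
    (γ : Metric.sphere (0 : EuclideanSpace ℝ (Fin (n + 1))) 1 → ℝ)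
    (X : M → EuclideanSpace ℝ (Fin (n + 1))) : ℝ :=
  ∫ p, radialExt γ (unitNormal X p) ∂(areaMeasure X)

/-- The (algebraic) `(n+1)`-dimensional volume enclosed by `X`, `(n+1)⁻¹ ∫_M ⟪X, ν⟫ dA`. -/
def enclosedVolume [MeasurableSpace M] (X : M → EuclideanSpace ℝ (Fin (n + 1))) : ℝ :=
  ((n : ℝ) + 1)⁻¹ * ∫ p, ⟪X p, unitNormal X p⟫ ∂(areaMeasure X)

/-! ### Anisotropic mean curvature -/

/-- `p` is a regular point of `X`: near `p`, the map `X` is a `C²` immersion. -/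
def IsRegularPoint (X : M → EuclideanSpace ℝ (Fin (n + 1))) (p : M) : Prop :=
  ContMDiffAt (𝓡 n) 𝓘(ℝ, EuclideanSpace ℝ (Fin (n + 1))) 2 X p ∧
    Function.Injective (diffAt X p)

/-- `S` is the anisotropic shape operator `-d(ξ ∘ ν)` of `X` at `p`, where the tangent space of `M`
at `p` is identified with its image under the differential of `X`. At a regular point there is
exactly one such `S`. -/
def IsAnisoShapeOperator (γ : Metric.sphere (0 : EuclideanSpace ℝ (Fin (n + 1))) 1 → ℝ)
    (X : M → EuclideanSpace ℝ (Fin (n + 1))) (p : M)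
    (S : EuclideanSpace ℝ (Fin n) →ₗ[ℝ] EuclideanSpace ℝ (Fin n)) : Prop :=
  ∀ v, diffAt X p (S v) = - diffAt (fun q => cahnHoffman γ (unitNormal X q)) p v

/-- The anisotropic mean curvature `Λ` of `X` at a regular point `p`: the mean value
`(1/n) trace S` of the eigenvalues of the anisotropic shape operator. -/
def anisoMeanCurvature (γ : Metric.sphere (0 : EuclideanSpace ℝ (Fin (n + 1))) 1 → ℝ)
    (X : M → EuclideanSpace ℝ (Fin (n + 1))) (p : M) : ℝ :=
  open Classical in
  if h : ∃ S, IsAnisoShapeOperator γ X p S then LinearMap.trace ℝ _ h.choose / n else 0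

/-! ### Decomposition of `M` into pieces with piecewise smooth boundary -/

/-- `φ` is a smooth chart of `M` around `p`, with `0`-th coordinate vanishing at `p`, in whose domain
`A` is the half space `{x₀ ≥ 0}`. -/
def IsBoundaryChart [NeZero n] (A : Set M) (p : M)
    (φ : OpenPartialHomeomorph M (EuclideanSpace ℝ (Fin n))) : Prop :=
  φ ∈ IsManifold.maximalAtlas (𝓡 n) ∞ M ∧ p ∈ φ.source ∧ φ p 0 = 0 ∧
    ∀ q ∈ φ.source, q ∈ A ↔ 0 ≤ φ q 0

/-- The boundary points of `A` (such as corners) at which the boundary is not smooth. -/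
def cornerSet [NeZero n] (A : Set M) : Set M :=
  {p ∈ frontier A | ¬ ∃ φ, IsBoundaryChart (n := n) A p φ}

/-- `A` is an `n`-dimensional connected compact submanifold of `M` with piecewise-`C^∞` boundary: it
is the closure of its interior, and its boundary is smooth, with `A` on one side, except on a set
whose `(n-1)`-dimensional Hausdorff measure (in charts) is zero. -/
structure IsPiece [NeZero n] (A : Set M) : Prop where
  isCompact : IsCompact A
  isConnected : IsConnected A
  closure_interior : closure (interior A) = A
  corner_null : ∀ e ∈ atlas (EuclideanSpace ℝ (Fin n)) M,
    μH[(n : ℝ) - 1] (e '' (cornerSet (n := n) A ∩ e.source)) = 0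

/-- `M = ⋃ M_i` with pieces `M_i` as above, and `M_i ∩ M_j = ∂M_i ∩ ∂M_j` for `i ≠ j`. -/
structure IsPieceDecomposition [NeZero n] {k : ℕ} (P : Fin k → Set M) : Prop where
  isPiece : ∀ i, IsPiece (n := n) (P i)
  cover : ⋃ i, P i = univ
  inter : ∀ i j, i ≠ j → P i ∩ P j = frontier (P i) ∩ frontier (P j)

/-- `φ` is a smooth chart of `M` around the point `ζ` of the common edge of `M_i` and `M_j`: in its
domain `M_i` and `M_j` are the half spaces `{x₀ ≥ 0}` and `{x₀ ≤ 0}`, hence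
`∂M_i ∩ ∂M_j` is the hypersurface `{x₀ = 0}`. -/
def IsEdgeChart [NeZero n] {k : ℕ} (P : Fin k → Set M) (i j : Fin k) (ζ : M)
    (φ : OpenPartialHomeomorph M (EuclideanSpace ℝ (Fin n))) : Prop :=
  φ ∈ IsManifold.maximalAtlas (𝓡 n) ∞ M ∧ ζ ∈ φ.source ∧ φ ζ 0 = 0 ∧
    ∀ q ∈ φ.source, (q ∈ P i ↔ 0 ≤ φ q 0) ∧ (q ∈ P j ↔ φ q 0 ≤ 0)

/-- The derivative of `X` at `ζ` in the direction with coordinates `v` in the chart `φ`. In an edge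
chart and for `v` with `v₀ = 0`, it only depends on `X` along the edge. -/
def edgeDeriv (X : M → EuclideanSpace ℝ (Fin (n + 1))) (ζ : M)
    (φ : OpenPartialHomeomorph M (EuclideanSpace ℝ (Fin n))) (v : EuclideanSpace ℝ (Fin n)) :
    EuclideanSpace ℝ (Fin (n + 1)) :=
  lineDeriv ℝ (X ∘ φ.symm) (φ ζ) v

/-- The restriction of `X` to the edge `{x₀ = 0}` is an immersion at `ζ`. -/
def IsEdgeImmersionAt [NeZero n] (X : M → EuclideanSpace ℝ (Fin (n + 1))) (ζ : M)
    (φ : OpenPartialHomeomorph M (EuclideanSpace ℝ (Fin n))) : Prop :=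
  ∀ v : EuclideanSpace ℝ (Fin n), v 0 = 0 → edgeDeriv X ζ φ v = 0 → v = 0

/-- The tangent space at `ζ` of (the image under `X` of) the edge `{x₀ = 0}`, as a subset of
`ℝ^{n+1}`. -/
def edgeTangent [NeZero n] (X : M → EuclideanSpace ℝ (Fin (n + 1))) (ζ : M)
    (φ : OpenPartialHomeomorph M (EuclideanSpace ℝ (Fin n))) :
    Set (EuclideanSpace ℝ (Fin (n + 1))) :=
  edgeDeriv X ζ φ '' {v | v 0 = 0}

/-! ### Piecewise weak immersions, variations, critical points -/

/-- `X` is a piecewise-`C^r` weak immersion (`r ≥ 1`) of `M = ⋃ M_i`, with unit normals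
`ν_i : M_i → S^n`: it is continuous on `M`, of class `C^r` on each `M_i`, an immersion in the
interior of each `M_i`, and `ν_i` is of class `C^{r-1}` on `M_i` and extends the unit normal given
in the interior of `M_i`. Only the values of `ν_i` on `M_i` matter, and they are determined
by `X`. -/
structure IsPiecewiseWeakImmersion (r : ℕ) {k : ℕ} (P : Fin k → Set M)
    (X : M → EuclideanSpace ℝ (Fin (n + 1)))
    (ν : Fin k → M → EuclideanSpace ℝ (Fin (n + 1))) : Prop where
  continuous : Continuous X
  contMDiffOn : ∀ i, ContMDiffOn (𝓡 n) 𝓘(ℝ, EuclideanSpace ℝ (Fin (n + 1))) r X (P i)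
  immersion : ∀ i, ∀ p ∈ interior (P i), Function.Injective (diffAt X p)
  normal_contMDiffOn : ∀ i,
    ContMDiffOn (𝓡 n) 𝓘(ℝ, EuclideanSpace ℝ (Fin (n + 1))) (r - 1 : ℕ) (ν i) (P i)
  normal_eq : ∀ i, ∀ p ∈ interior (P i), ν i p = unitNormal X p

/-- `Y ε`, `ε ∈ (-ε₀, ε₀)`, is a variation of `X` through piecewise-`C²` weak immersions which
is `C^∞` in `ε` (and of class `C²` jointly in `(ε, p)` on each piece). -/
structure IsVariation {k : ℕ} (P : Fin k → Set M) (X : M → EuclideanSpace ℝ (Fin (n + 1)))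
    (ε₀ : ℝ) (Y : ℝ → M → EuclideanSpace ℝ (Fin (n + 1))) : Prop where
  pos : 0 < ε₀
  zero : Y 0 = X
  weakImmersion : ∀ ε ∈ Ioo (-ε₀) ε₀, ∃ ν, IsPiecewiseWeakImmersion 2 P (Y ε) ν
  smooth_param : ∀ p, ContDiffOn ℝ ∞ (fun ε => Y ε p) (Ioo (-ε₀) ε₀)
  contMDiffOn : ∀ i, ContMDiffOn (𝓘(ℝ, ℝ).prod (𝓡 n)) 𝓘(ℝ, EuclideanSpace ℝ (Fin (n + 1))) 2
    (fun z : ℝ × M => Y z.1 z.2) (Ioo (-ε₀) ε₀ ×ˢ P i)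

/-- `X` is a critical point of the anisotropic energy for variations which preserve the enclosed
`(n+1)`-dimensional volume. -/
def IsCritical [MeasurableSpace M]
    (γ : Metric.sphere (0 : EuclideanSpace ℝ (Fin (n + 1))) 1 → ℝ) {k : ℕ} (P : Fin k → Set M)
    (X : M → EuclideanSpace ℝ (Fin (n + 1))) : Prop :=
  ∀ (ε₀ : ℝ) (Y : ℝ → M → EuclideanSpace ℝ (Fin (n + 1))), IsVariation P X ε₀ Y →
    (∀ ε ∈ Ioo (-ε₀) ε₀, enclosedVolume (Y ε) = enclosedVolume X) →
    HasDerivAt (fun ε => anisoEnergy γ (Y ε)) 0 0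

end Manifold

end AnisoSurface

end

open AnisoSurface

namespace AnisoSurface

/-! ### The generalized cross product -/

/-! In a chart, let `N` be the cross product of the coordinate derivatives of `X` (`normalIn`). Its
length is the area density (`sqrt_det_gram`), its direction is the unit normal, and under coordinate
changes it is multiplied by the Jacobian determinant (`crossL_comp`). With `h` the positively
1-homogeneous extension of `γ`, the energy is the integral of `h(N)`, and the enclosed volume is
`1/(n+1)` times the integral of `⟪X, N⟫`. The gradient of `h` at `N` is the Cahn-Hoffman vector `ξ`,
so a variation with velocity `W` changes the energy at the rate `∫ ⟪ξ, dN(W)⟫`, where `dN(W)` is the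
derivative of `N` in the direction `W`.

The main tool is a symmetry: `⟪Z, dN(W)⟫ - ⟪W, dN(Z)⟫` is a divergence, and its flux through a
hypersurface is the determinant of `Z`, `W` and the tangent vectors (`sum_div_boxFlux`,
`integral_box_crossForm`). Over all pieces, the fluxes on the two sides of an edge combine to the
flux of the jump of `Z` (`stokesDefect_edge`). Corners contribute nothing: an `(n-1)`-null compact
set has cutoff functions with arbitrarily small gradient in `L¹`
(`exists_cutoff_of_hausdorffMeasure_eq_zero`, `stokesDefect_eq_zero`).

For `Z = X` there is no jump and `dN(X) = nN`, so the volume changes at the rate `∫ ⟪W, N⟫`. For `Z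
= ξ`, homogeneity of `h` makes `dξ` tangential, hence `dN(ξ) = -nΛN` (`crossDer_cahnField`), and the
first variation of energy is `-n ∫ Λ ⟪W, N⟫` plus the edge flux of the jump of `ξ`. If the jump is
tangent to the edge wherever the edge is immersed, the flux is zero everywhere, because at the other
points the tangent vectors are dependent. With `Λ` constant, the two first variations are then
proportional, which proves sufficiency (`isCritical_of_eulerLagrange`).

For necessity, the competitors must again be weak immersions with `C¹` normals, although `dX` may
degenerate on the boundaries of the pieces. The variations `X + εηw` in a fixed direction `w`, with
`dη = ⟪θ, dX⟫` for a field `θ` of class `C¹` on the pieces, have this property: they replace `dX` by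
`(1 + ε w⊗θ) dX`, and the new normal is an explicit function of `θ` and the old normal
(`normalIn_pushVar`). Along them the volume is affine in `ε`, so first-order preservation is exact
preservation, and for each `w` criticality supplies a Lagrange multiplier
(`IsCritical.formInt_proportional`). Localized test functions make `Λ` constant on the interiors of
the pieces, and then, by density and continuity, at every regular point.

At an immersed edge point the test functions are `ρ · ψ(X)`. The factor `ψ(X)` always has the
required differential; `ρ` varies only where `X` is an immersion or `ψ(X)` vanishes. This is
possible because `X` is injective along the edge near such a point. If the jump of `ξ` were not
tangent there, some `w` would give a flux of one sign near the point and contradict the multiplier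
rule (`IsCritical.mem_edgeTangent_of_hasSign`). -/

/-- The coordinate space `ℝ^m` with its Euclidean norm. -/
abbrev Euc (m : ℕ) := EuclideanSpace ℝ (Fin m)

section CrossProduct

variable {n : ℕ}

/-- The determinant of the vectors `v, w₁, …, w_n` of `ℝ^{n+1}`. -/
noncomputable def consDet (v : Euc (n + 1)) (w : Fin n → Euc (n + 1)) : ℝ :=
  Matrix.det (Matrix.of (Fin.cons v.ofLp fun i => (w i).ofLp) :
    Matrix (Fin (n + 1)) (Fin (n + 1)) ℝ)

lemma consDet_update (v : Euc (n + 1)) (w : Fin n → Euc (n + 1)) (i : Fin n) (z : Euc (n + 1)) :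
    consDet v (Function.update w i z) =
      Matrix.det (Matrix.updateRow (Matrix.of (Fin.cons v.ofLp fun i => (w i).ofLp) :
        Matrix (Fin (n + 1)) (Fin (n + 1)) ℝ) i.succ z.ofLp) := by
  unfold consDet
  congr 1
  ext a b
  refine Fin.cases ?_ (fun a => ?_) a
  · simp [Matrix.updateRow_apply, (Fin.succ_ne_zero i).symm]
  · by_cases h : a = i
    · subst h; simp [Matrix.updateRow_apply]
    · simp [Matrix.updateRow_apply, h]

lemma consDet_update_add (v : Euc (n + 1)) (w : Fin n → Euc (n + 1)) (i : Fin n)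
    (x y : Euc (n + 1)) :
    consDet v (Function.update w i (x + y)) =
      consDet v (Function.update w i x) + consDet v (Function.update w i y) := by
  rw [consDet_update, consDet_update, consDet_update, ← Matrix.det_updateRow_add]
  rfl

lemma consDet_update_smul (v : Euc (n + 1)) (w : Fin n → Euc (n + 1)) (i : Fin n)
    (c : ℝ) (x : Euc (n + 1)) :
    consDet v (Function.update w i (c • x)) = c * consDet v (Function.update w i x) := by
  rw [consDet_update, consDet_update, ← Matrix.det_updateRow_smul]
  rfl

/-- The determinant is linear in its first row, and the components of `crossProd w` are its values
on the standard basis. -/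
lemma inner_crossProd (w : Fin n → Euc (n + 1)) (v : Euc (n + 1)) :
    ⟪crossProd w, v⟫ = consDet v w := by
  let A : Matrix (Fin (n + 1)) (Fin (n + 1)) ℝ := Matrix.of (Fin.cons 0 fun i => (w i).ofLp)
  let f : (Fin (n + 1) → ℝ) →ₗ[ℝ] ℝ :=
    { toFun := fun v => Matrix.det (A.updateRow 0 v)
      map_add' := fun x y => Matrix.det_updateRow_add _ _ _ _
      map_smul' := fun c x => Matrix.det_updateRow_smul _ _ _ _ }
  have hA : ∀ v : Fin (n + 1) → ℝ, A.updateRow 0 v =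
      Matrix.of (Fin.cons v fun i => (w i).ofLp) := by
    intro v
    ext a b
    refine Fin.cases ?_ (fun a => ?_) a
    · simp [Matrix.updateRow_apply, A]
    · simp [Matrix.updateRow_apply, A]
  have h1 : consDet v w = f v.ofLp := by simp only [f, LinearMap.coe_mk, AddHom.coe_mk, hA]; rfl
  rw [h1, LinearMap.pi_apply_eq_sum_univ f, PiLp.inner_apply]
  refine Finset.sum_congr rfl fun k _ => ?_
  simp only [f, LinearMap.coe_mk, AddHom.coe_mk, hA, crossProd, smul_eq_mul]
  simp only [RCLike.inner_apply, conj_trivial]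
  congr 3
  ext a b
  refine Fin.cases ?_ (fun a => ?_) a
  · simp [Pi.single_apply, eq_comm]
  · simp

/-- The cross product as a continuous multilinear map. -/
noncomputable def crossMulti (n : ℕ) :
    ContinuousMultilinearMap ℝ (fun _ : Fin n => Euc (n + 1)) (Euc (n + 1)) where
  toFun := crossProd
  map_update_add' := by
    intro inst m i x y
    have : inst = instDecidableEqFin n := Subsingleton.elim _ _
    subst this
    refine ext_inner_right ℝ fun v => ?_
    rw [inner_add_left, inner_crossProd, inner_crossProd, inner_crossProd, consDet_update_add]
  map_update_smul' := by
    intro inst m i c x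
    have : inst = instDecidableEqFin n := Subsingleton.elim _ _
    subst this
    refine ext_inner_right ℝ fun v => ?_
    rw [inner_smul_left, inner_crossProd, inner_crossProd, consDet_update_smul]
    simp
  cont := by
    refine (PiLp.continuous_toLp 2 _).comp (continuous_pi fun k => Continuous.matrix_det ?_)
    refine continuous_matrix fun a b => ?_
    refine Fin.cases ?_ (fun a => ?_) a
    · simpa using continuous_const
    · simp only [Matrix.of_apply, Fin.cons_succ]
      fun_prop

@[simp] lemma crossMulti_apply (w : Fin n → Euc (n + 1)) : crossMulti n w = crossProd w := rfl

lemma consDet_eq_zero_of_eq {v : Euc (n + 1)} {w : Fin n → Euc (n + 1)} {i j : Fin n}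
    (hij : i ≠ j) (h : w i = w j) : consDet v w = 0 := by
  refine Matrix.det_zero_of_row_eq (i := i.succ) (j := j.succ) (by simpa using hij) ?_
  ext b
  simp [h]

lemma consDet_self_eq_zero {w : Fin n → Euc (n + 1)} (i : Fin n) : consDet (w i) w = 0 := by
  refine Matrix.det_zero_of_row_eq (i := 0) (j := i.succ) (Fin.succ_ne_zero i).symm ?_
  ext b
  simp

lemma inner_crossProd_self (w : Fin n → Euc (n + 1)) (i : Fin n) : ⟪crossProd w, w i⟫ = 0 := by
  rw [inner_crossProd, consDet_self_eq_zero]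

lemma consDet_swap (v : Euc (n + 1)) (w : Fin n → Euc (n + 1)) {i j : Fin n} (hij : i ≠ j) :
    consDet v (w ∘ Equiv.swap i j) = - consDet v w := by
  unfold consDet
  have hs : i.succ ≠ j.succ := by simpa using hij
  have := Matrix.det_permute (Equiv.swap i.succ j.succ)
    (Matrix.of (Fin.cons v.ofLp fun i => (w i).ofLp) : Matrix (Fin (n + 1)) (Fin (n + 1)) ℝ)
  rw [Equiv.Perm.sign_swap hs] at this
  simp only [Units.val_neg, Units.val_one, Int.cast_neg, Int.cast_one, neg_mul, one_mul] at this
  rw [← this]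
  congr 1
  ext a b
  refine Fin.cases ?_ (fun a => ?_) a
  · simp [Equiv.swap_apply_of_ne_of_ne (Fin.succ_ne_zero i).symm (Fin.succ_ne_zero j).symm]
  · have : (Equiv.swap i.succ j.succ) a.succ = (Equiv.swap i j a).succ := by
      simp only [Equiv.swap_apply_def, Fin.succ_inj]
      split_ifs <;> rfl
    simp [this]

/-- Exchanging the first vector with the `j`-th one changes the sign of the determinant. -/
lemma consDet_update_swap (v x : Euc (n + 1)) (w : Fin n → Euc (n + 1)) (j : Fin n) :
    consDet v (Function.update w j x) = - consDet x (Function.update w j v) := by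
  unfold consDet
  have hs : (0 : Fin (n + 1)) ≠ j.succ := (Fin.succ_ne_zero j).symm
  have := Matrix.det_permute (Equiv.swap 0 j.succ)
    (Matrix.of (Fin.cons x.ofLp fun i => (Function.update w j v i).ofLp) :
      Matrix (Fin (n + 1)) (Fin (n + 1)) ℝ)
  rw [Equiv.Perm.sign_swap hs] at this
  simp only [Units.val_neg, Units.val_one, Int.cast_neg, Int.cast_one, neg_mul, one_mul] at this
  rw [← this]
  congr 1
  ext a b
  refine Fin.cases ?_ (fun a => ?_) a
  · simp
  · by_cases h : a = j
    · subst h; simp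
    · have h1 : (Equiv.swap 0 j.succ) a.succ = a.succ :=
        Equiv.swap_apply_of_ne_of_ne (Fin.succ_ne_zero a) (by simpa using h)
      simp [h1, h]

lemma consDet_ne_zero_of_linearIndependent {v : Euc (n + 1)} {w : Fin n → Euc (n + 1)}
    (h : LinearIndependent ℝ (Fin.cons v w : Fin (n + 1) → Euc (n + 1))) : consDet v w ≠ 0 := by
  have h2 : LinearIndependent ℝ (fun a : Fin (n + 1) =>
      (Matrix.of (Fin.cons v.ofLp fun i => (w i).ofLp) : Matrix _ _ ℝ).row a) := by
    have := h.map' (WithLp.linearEquiv 2 ℝ (Fin (n + 1) → ℝ)).toLinearMap (LinearEquiv.ker _)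
    have heq : (⇑(WithLp.linearEquiv 2 ℝ (Fin (n + 1) → ℝ)).toLinearMap ∘
        (Fin.cons v w : Fin (n + 1) → Euc (n + 1))) = fun a =>
        (Matrix.of (Fin.cons v.ofLp fun i => (w i).ofLp) : Matrix _ _ ℝ).row a := by
      ext a b
      refine Fin.cases ?_ (fun a => ?_) a
      · simp [Matrix.row]
      · simp [Matrix.row]
    rw [heq] at this
    exact this
  rw [Matrix.linearIndependent_rows_iff_isUnit, Matrix.isUnit_iff_isUnit_det] at h2
  exact h2.ne_zero

lemma linearIndependent_of_consDet_ne_zero {v : Euc (n + 1)} {w : Fin n → Euc (n + 1)}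
    (h : consDet v w ≠ 0) :
    LinearIndependent ℝ (Fin.cons v w : Fin (n + 1) → Euc (n + 1)) := by
  have h2 : LinearIndependent ℝ (fun a : Fin (n + 1) =>
      (Matrix.of (Fin.cons v.ofLp fun i => (w i).ofLp) : Matrix _ _ ℝ).row a) := by
    rw [Matrix.linearIndependent_rows_iff_isUnit, Matrix.isUnit_iff_isUnit_det]
    exact isUnit_iff_ne_zero.2 h
  have := h2.map' (WithLp.linearEquiv 2 ℝ (Fin (n + 1) → ℝ)).symm.toLinearMap (LinearEquiv.ker _)
  have heq : (⇑(WithLp.linearEquiv 2 ℝ (Fin (n + 1) → ℝ)).symm.toLinearMap ∘ fun a =>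
      (Matrix.of (Fin.cons v.ofLp fun i => (w i).ofLp) : Matrix _ _ ℝ).row a) =
      (Fin.cons v w : Fin (n + 1) → Euc (n + 1)) := by
    ext a b
    refine Fin.cases ?_ (fun a => ?_) a
    · simp [Matrix.row]
    · simp [Matrix.row]
  rw [heq] at this
  exact this

/-- If `N = crossProd w` is nonzero, then `det (N, w) = ‖N‖²` is nonzero, so the rows are
independent. Conversely, `n` independent vectors miss some `v` of `ℝ^{n+1}`, and then `⟪N, v⟫ = det
(v, w)` is nonzero. -/
lemma crossProd_ne_zero_iff {w : Fin n → Euc (n + 1)} :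
    crossProd w ≠ 0 ↔ LinearIndependent ℝ w := by
  constructor
  · intro h
    have h1 : consDet (crossProd w) w ≠ 0 := by
      rw [← inner_crossProd]
      exact inner_self_ne_zero.2 h
    have := linearIndependent_of_consDet_ne_zero h1
    exact (linearIndependent_finCons.1 this).1
  · intro h h0
    have hex : ∃ v, v ∉ Submodule.span ℝ (range w) := by
      by_contra! hc
      have htop : Submodule.span ℝ (range w) = ⊤ := eq_top_iff.2 fun v _ => hc v
      have h1 := finrank_span_eq_card h
      rw [htop, finrank_top, finrank_euclideanSpace_fin, Fintype.card_fin] at h1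
      omega
    obtain ⟨v, hv⟩ := hex
    have := consDet_ne_zero_of_linearIndependent (linearIndependent_finCons.2 ⟨h, hv⟩)
    rw [← inner_crossProd, h0, inner_zero_left] at this
    exact this rfl

/-- For the matrix `A` with rows `N, w₁, …, w_n`, `det A = ‖N‖²`, while `A Aᵀ` is block diagonal
with blocks `‖N‖²` and the Gram matrix. For dependent vectors both sides vanish. Thus the area
density is the length of the unnormalized normal. -/
lemma sqrt_det_gram (w : Fin n → Euc (n + 1)) : √(Matrix.gram ℝ w).det = ‖crossProd w‖ := by
  by_cases h : LinearIndependent ℝ w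
  · set c := crossProd w with hc
    have hc0 : c ≠ 0 := crossProd_ne_zero_iff.2 h
    let A : Matrix (Fin (n + 1)) (Fin (n + 1)) ℝ := Matrix.of (Fin.cons c.ofLp fun i => (w i).ofLp)
    have hA : A.det = ‖c‖ ^ 2 := by
      have : A.det = consDet c w := rfl
      rw [this, ← inner_crossProd, ← hc, real_inner_self_eq_norm_sq]
    have hdot : ∀ x y : Euc (n + 1), ∑ j, x.ofLp j * y.ofLp j = ⟪x, y⟫ := by
      intro x y
      rw [PiLp.inner_apply]
      exact Finset.sum_congr rfl fun _ _ => by simp [mul_comm]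
    have hAA : (A * A.transpose).det = ‖c‖ ^ 2 * (Matrix.gram ℝ w).det := by
      rw [Matrix.det_succ_row_zero, Fin.sum_univ_succ]
      have h0 : ∀ j : Fin n, (A * A.transpose) 0 j.succ = 0 := by
        intro j
        simp only [Matrix.mul_apply, Matrix.transpose_apply, A, Matrix.of_apply, Fin.cons_zero,
          Fin.cons_succ, hdot]
        rw [hc, inner_crossProd_self]
      have h1 : (A * A.transpose) 0 0 = ‖c‖ ^ 2 := by
        simp only [Matrix.mul_apply, Matrix.transpose_apply, A, Matrix.of_apply, Fin.cons_zero,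
          hdot, real_inner_self_eq_norm_sq]
      have h2 : (A * A.transpose).submatrix Fin.succ Fin.succ = Matrix.gram ℝ w := by
        ext i j
        simp only [Matrix.submatrix_apply, Matrix.mul_apply, Matrix.transpose_apply, A,
          Matrix.of_apply, Fin.cons_succ, hdot, Matrix.gram_apply]
      simp [h0, h1, h2]
    rw [Matrix.det_mul, Matrix.det_transpose, hA] at hAA
    have hn : ‖c‖ ^ 2 ≠ 0 := pow_ne_zero _ (norm_ne_zero_iff.2 hc0)
    rw [← mul_left_cancel₀ hn hAA, Real.sqrt_sq (norm_nonneg _)]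
  · have h0 : crossProd w = 0 := by
      by_contra h1
      exact h (crossProd_ne_zero_iff.1 h1)
    rw [h0, norm_zero]
    have : (Matrix.gram ℝ w).det = 0 := by
      obtain ⟨g, hg, i, hi⟩ := Fintype.not_linearIndependent_iff.1 h
      refine Matrix.exists_mulVec_eq_zero_iff.1 ⟨g, fun h => hi (congrFun h i), ?_⟩
      ext a
      have : ∑ j, ⟪w a, w j⟫ * g j = ⟪w a, ∑ j, g j • w j⟫ := by
        rw [inner_sum]
        exact Finset.sum_congr rfl fun _ _ => by rw [inner_smul_right, mul_comm]
      simp only [Matrix.mulVec, dotProduct, Matrix.gram_apply, Pi.zero_apply]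
      rw [this, hg, inner_zero_right]
    rw [this, Real.sqrt_zero]

/-- The image of the standard basis under `L`. -/
noncomputable def frame (L : Euc n →L[ℝ] Euc (n + 1)) : Fin n → Euc (n + 1) :=
  fun j => L (EuclideanSpace.single j 1)

/-- The cross product of the columns of `L`. -/
noncomputable def crossL (L : Euc n →L[ℝ] Euc (n + 1)) : Euc (n + 1) := crossProd (frame L)

lemma linearIndependent_frame_iff {L : Euc n →L[ℝ] Euc (n + 1)} :
    LinearIndependent ℝ (frame L) ↔ Function.Injective L := by
  have hb : frame L = (L : Euc n →ₗ[ℝ] Euc (n + 1)) ∘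
      (EuclideanSpace.basisFun (Fin n) ℝ).toBasis := by
    ext j
    simp [frame]
  have hb' := (EuclideanSpace.basisFun (Fin n) ℝ).toBasis.linearIndependent
  constructor
  · intro h
    rw [hb] at h
    rw [injective_iff_map_eq_zero]
    intro v hv
    have hv' : v = ∑ j, v j • (EuclideanSpace.basisFun (Fin n) ℝ).toBasis j := by
      have := (EuclideanSpace.basisFun (Fin n) ℝ).toBasis.sum_repr v
      simpa using this.symm
    have h0 : ∑ j, v j • ((L : Euc n →ₗ[ℝ] Euc (n + 1)) ∘
      (EuclideanSpace.basisFun (Fin n) ℝ).toBasis) j = 0 := by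
      rw [hv', map_sum] at hv
      simpa using hv
    have := Fintype.linearIndependent_iff.1 h (fun j => v j) h0
    ext j
    exact this j
  · intro h
    rw [hb]
    exact hb'.map' _ (LinearMap.ker_eq_bot.2 h)

lemma crossL_ne_zero_iff {L : Euc n →L[ℝ] Euc (n + 1)} : crossL L ≠ 0 ↔ Function.Injective L := by
  rw [crossL, crossProd_ne_zero_iff, linearIndependent_frame_iff]

lemma inner_crossL_apply (L : Euc n →L[ℝ] Euc (n + 1)) (v : Euc n) : ⟪crossL L, L v⟫ = 0 := by
  have hv : v = ∑ j, v j • EuclideanSpace.single j (1 : ℝ) := by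
    have := (EuclideanSpace.basisFun (Fin n) ℝ).toBasis.sum_repr v
    simpa using this.symm
  rw [hv, map_sum, inner_sum]
  refine Finset.sum_eq_zero fun j _ => ?_
  rw [map_smul, inner_smul_right]
  have := inner_crossProd_self (frame L) j
  rw [crossL]
  unfold frame at this ⊢
  rw [this, mul_zero]

end CrossProduct

/-! ### Derivative of the cross product and its transformation laws -/

section CrossDerivative

variable {n : ℕ}

/-- The map sending `L` to its columns, as a continuous linear map. -/
noncomputable def frameCLM (n : ℕ) : (Euc n →L[ℝ] Euc (n + 1)) →L[ℝ] (Fin n → Euc (n + 1)) :=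
  ContinuousLinearMap.pi fun j => ContinuousLinearMap.apply ℝ (Euc (n + 1))
    (EuclideanSpace.single j (1 : ℝ) : Euc n)

lemma frameCLM_apply (L : Euc n →L[ℝ] Euc (n + 1)) : frameCLM n L = frame L := rfl

lemma contDiff_crossProd {r : WithTop ℕ∞} :
    ContDiff ℝ r (crossProd : (Fin n → Euc (n + 1)) → Euc (n + 1)) :=
  (crossMulti n).contDiff

lemma contDiff_crossL {r : WithTop ℕ∞} :
    ContDiff ℝ r (crossL : (Euc n →L[ℝ] Euc (n + 1)) → Euc (n + 1)) :=
  contDiff_crossProd.comp (frameCLM n).contDiff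

/-- The derivative of `crossL` at `L` in the direction `B`. -/
noncomputable def crossDer (L B : Euc n →L[ℝ] Euc (n + 1)) : Euc (n + 1) := fderiv ℝ crossL L B

lemma hasFDerivAt_crossL (L : Euc n →L[ℝ] Euc (n + 1)) :
    HasFDerivAt crossL (fderiv ℝ crossL L) L :=
  ((contDiff_crossL (r := 1)).differentiable one_ne_zero L).hasFDerivAt

lemma crossDer_eq_sum (L B : Euc n →L[ℝ] Euc (n + 1)) :
    crossDer L B = ∑ j, crossProd (Function.update (frame L) j (frame B j)) := by
  have h := ((crossMulti n).hasFDerivAt (frameCLM n L)).comp L (frameCLM n).hasFDerivAt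
  have h2 : HasFDerivAt crossL ((crossMulti n).linearDeriv (frameCLM n L) ∘L frameCLM n) L := h
  rw [crossDer, h2.fderiv, ContinuousLinearMap.comp_apply,
    ContinuousMultilinearMap.linearDeriv_apply]
  rfl

lemma crossDer_add (L B C : Euc n →L[ℝ] Euc (n + 1)) :
    crossDer L (B + C) = crossDer L B + crossDer L C := map_add _ _ _

lemma crossDer_smul (c : ℝ) (L B : Euc n →L[ℝ] Euc (n + 1)) :
    crossDer L (c • B) = c • crossDer L B := map_smul _ _ _

lemma crossDer_neg (L B : Euc n →L[ℝ] Euc (n + 1)) :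
    crossDer L (-B) = - crossDer L B := map_neg _ _

lemma continuous_crossDer :
    Continuous fun p : (Euc n →L[ℝ] Euc (n + 1)) × (Euc n →L[ℝ] Euc (n + 1)) =>
      crossDer p.1 p.2 :=
  (((contDiff_crossL (r := 1)).continuous_fderiv one_ne_zero).comp continuous_fst).clm_apply
    continuous_snd

/-- The cross product as an alternating map. -/
noncomputable def crossAlt (n : ℕ) : AlternatingMap ℝ (Euc (n + 1)) (Euc (n + 1)) (Fin n) :=
  { (crossMulti n).toMultilinearMap with
    map_eq_zero_of_eq' := by
      intro w i j h hij
      refine ext_inner_right ℝ fun v => ?_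
      have : ⟪crossProd w, v⟫ = 0 := by rw [inner_crossProd, consDet_eq_zero_of_eq hij h]
      rw [inner_zero_left]
      exact this }

lemma crossAlt_apply (w : Fin n → Euc (n + 1)) : crossAlt n w = crossProd w := rfl

/-- Paired with a fixed vector, the cross product of the images under `L` is an alternating `n`-form
on `ℝⁿ`, hence a multiple of the determinant. This law turns all integrands below into `n`-forms. -/
lemma crossL_comp (L : Euc n →L[ℝ] Euc (n + 1)) (A : Euc n →L[ℝ] Euc n) :
    crossL (L ∘L A) = A.det • crossL L := by
  refine ext_inner_left ℝ fun v => ?_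
  let b := (EuclideanSpace.basisFun (Fin n) ℝ).toBasis
  let f : AlternatingMap ℝ (Euc n) ℝ (Fin n) :=
    ((innerₛₗ ℝ v).compAlternatingMap (crossAlt n)).compLinearMap (L : Euc n →ₗ[ℝ] Euc (n + 1))
  have hf : ∀ w, f w = ⟪v, crossProd fun i => L (w i)⟫ := fun w => rfl
  have hb : ∀ j, b j = EuclideanSpace.single j (1 : ℝ) := fun j => by simp [b]
  have h1 : ⟪v, crossL (L ∘L A)⟫ = f fun i => A (b i) := by
    rw [hf, crossL]
    congr 2
    ext1 i
    simp [frame, hb]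
  have h2 : ⟪v, crossL L⟫ = f b := by
    rw [hf, crossL]
    congr 2
    ext1 i
    simp [frame, hb]
  rw [inner_smul_right, h1, h2, f.eq_smul_basis_det b]
  have h3 := b.det_comp (A : Euc n →ₗ[ℝ] Euc n) b
  simp only [AlternatingMap.smul_apply, smul_eq_mul, b.det_self] at *
  have h4 : b.det (fun i => A (b i)) = A.det := by
    rw [mul_one] at h3
    exact h3
  rw [h4]
  ring

/-- Differentiate `crossL_comp` with respect to `L`. -/
lemma crossDer_comp (L B : Euc n →L[ℝ] Euc (n + 1)) (A : Euc n →L[ℝ] Euc n) :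
    crossDer (L ∘L A) (B ∘L A) = A.det • crossDer L B := by
  let R : (Euc n →L[ℝ] Euc (n + 1)) →L[ℝ] (Euc n →L[ℝ] Euc (n + 1)) :=
    (ContinuousLinearMap.compL ℝ (Euc n) (Euc n) (Euc (n + 1))).flip A
  have hR : ∀ K, R K = K ∘L A := fun K => rfl
  have h1 : HasFDerivAt (fun K => crossL (R K)) (fderiv ℝ crossL (R L) ∘L R) L :=
    (hasFDerivAt_crossL (R L)).comp L R.hasFDerivAt
  have h2 : HasFDerivAt (fun K => crossL (R K)) (A.det • fderiv ℝ crossL L) L := by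
    simp only [hR, crossL_comp]
    exact (hasFDerivAt_crossL L).const_smul A.det
  have := congrArg (fun T => T B) (h1.unique h2)
  simpa [crossDer, hR] using this

/-- Replacing the `j`-th column by a combination of all columns leaves only the `j`-th coefficient,
as repeated columns give zero; the sum over `j` is the trace. This is how the mean curvature
appears. -/
lemma crossDer_comp_right (L : Euc n →L[ℝ] Euc (n + 1)) (C : Euc n →ₗ[ℝ] Euc n) :
    crossDer L (L ∘L LinearMap.toContinuousLinearMap C) = LinearMap.trace ℝ _ C • crossL L := by
  let b := (EuclideanSpace.basisFun (Fin n) ℝ).toBasis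
  have hb : ∀ j, b j = EuclideanSpace.single j (1 : ℝ) := fun j => by simp [b]
  rw [crossDer_eq_sum, LinearMap.trace_eq_matrix_trace ℝ b C, Matrix.trace, Finset.sum_smul]
  refine Finset.sum_congr rfl fun j _ => ?_
  have h1 : frame (L ∘L LinearMap.toContinuousLinearMap C) j =
      ∑ k, (C (EuclideanSpace.single j 1)) k • frame L k := by
    have hv := b.sum_repr (C (EuclideanSpace.single j 1))
    have : frame (L ∘L LinearMap.toContinuousLinearMap C) j =
      L (C (EuclideanSpace.single j 1)) := rfl
    rw [this]
    conv_lhs => rw [← hv]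
    rw [map_sum]
    refine Finset.sum_congr rfl fun k _ => ?_
    rw [map_smul, hb]
    simp [frame, b]
  rw [h1]
  have h2 := (crossMulti n).toMultilinearMap.map_update_sum Finset.univ j
    (fun k => (C (EuclideanSpace.single j 1)) k • frame L k) (frame L)
  have h3 : ∀ w, (crossMulti n).toMultilinearMap w = crossProd w := fun w => rfl
  simp only [h3] at h2
  rw [h2, Finset.sum_eq_single j]
  · have h4 := (crossMulti n).toMultilinearMap.map_update_smul (frame L) j
      ((C (EuclideanSpace.single j 1)) j) (frame L j)
    simp only [h3] at h4
    rw [h4, Function.update_eq_self, Matrix.diag_apply, LinearMap.toMatrix_apply, hb]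
    simp [b, crossL]
  · intro k _ hk
    have h4 := (crossMulti n).toMultilinearMap.map_update_smul (frame L) j
      ((C (EuclideanSpace.single j 1)) k) (frame L k)
    simp only [h3] at h4
    rw [h4]
    have : crossProd (Function.update (frame L) j (frame L k)) = 0 :=
      (crossAlt n).map_update_self (frame L) hk.symm
    rw [this, smul_zero]
  · intro h
    exact absurd (Finset.mem_univ j) h

/-- Euler's relation for a map homogeneous of degree `n`; it computes the first variation of volume.
-/
lemma crossDer_self (L : Euc n →L[ℝ] Euc (n + 1)) : crossDer L L = (n : ℝ) • crossL L := by
  have h := crossDer_comp_right L LinearMap.id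
  rw [LinearMap.trace_id, finrank_euclideanSpace_fin] at h
  rw [← h]
  rfl

/-- The cross product of the columns of `L` after the rank one change of `L` by the linear
transformation `x ↦ x + ⟪θ, x⟫ w` of `ℝ^{n+1}`. -/
lemma crossL_rank_one (L S : Euc n →L[ℝ] Euc (n + 1)) (θ w : Euc (n + 1))
    (hS : ∀ v, S v = ⟪θ, L v⟫ • w) (h1 : 1 + ⟪θ, w⟫ ≠ 0) :
    crossL (L + S) = (1 + ⟪θ, w⟫) • crossL L - ⟪w, crossL L⟫ • θ := by
  -- With `T y = y + ⟪θ, y⟫ w` one has `L + S = T ∘ L`, so `det (T y, T L)` is `det T · det (y, L)`;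
  -- the matrix determinant lemma gives `det T = 1 + ⟪θ, w⟫`.
  have hK : ∀ y : Euc (n + 1), ⟪crossL (L + S), y + ⟪θ, y⟫ • w⟫ = (1 + ⟪θ, w⟫) * ⟪crossL L, y⟫ := by
    intro y
    have hdet : ∀ x y : Euc (n + 1), ∑ j, x.ofLp j * y.ofLp j = ⟪x, y⟫ := by
      intro x y
      rw [PiLp.inner_apply]
      exact Finset.sum_congr rfl fun _ _ => by simp [mul_comm]
    rw [crossL, crossL, inner_crossProd, inner_crossProd]
    have hm : (Matrix.of (Fin.cons (y + ⟪θ, y⟫ • w).ofLp fun i => (frame (L + S) i).ofLp) :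
        Matrix (Fin (n + 1)) (Fin (n + 1)) ℝ) =
        (Matrix.of (Fin.cons y.ofLp fun i => (frame L i).ofLp) :
          Matrix (Fin (n + 1)) (Fin (n + 1)) ℝ) *
          (1 + Matrix.replicateCol Unit θ.ofLp * Matrix.replicateRow Unit w.ofLp) := by
      have hx : ∀ (x : Euc (n + 1)) (b : Fin (n + 1)),
          ∑ j, x.ofLp j * (θ.ofLp j * w.ofLp b) = ⟪θ, x⟫ * w.ofLp b := by
        intro x b
        rw [real_inner_comm, ← hdet, Finset.sum_mul]
        exact Finset.sum_congr rfl fun _ _ => by ring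
      rw [mul_add, mul_one]
      ext a b
      refine Fin.cases ?_ (fun a => ?_) a
      · simp [Matrix.mul_apply, hx]
      · simp [Matrix.mul_apply, hx, frame, hS]
    unfold consDet
    rw [hm, Matrix.det_mul, Matrix.det_one_add_replicateCol_mul_replicateRow, mul_comm]
    congr 2
  refine ext_inner_right ℝ fun v => ?_
  -- This is `T⁻¹ v` by the Sherman-Morrison formula.
  set y := v - (⟪θ, v⟫ / (1 + ⟪θ, w⟫)) • w with hy
  have hv : v = y + ⟪θ, y⟫ • w := by
    have : ⟪θ, y⟫ = ⟪θ, v⟫ / (1 + ⟪θ, w⟫) := by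
      rw [hy, inner_sub_right, inner_smul_right]
      field_simp
      ring
    rw [this, hy]
    abel
  have := hK y
  rw [hv, this, inner_sub_left, inner_smul_left, inner_smul_left, inner_add_right, inner_add_right,
    inner_smul_right, inner_smul_right, real_inner_comm w (crossL L)]
  simp only [conj_trivial]
  ring

/-- A vector representing the linear form with coefficients `a` with respect to the columns
of `L`. -/
noncomputable def dualVec (L : Euc n →L[ℝ] Euc (n + 1)) (a : Fin n → ℝ) : Euc (n + 1) :=
  -(‖crossL L‖ ^ 2)⁻¹ • ∑ j, a j • crossProd (Function.update (frame L) j (crossL L))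

/-- Exchanging the first row with the `j`-th one turns each summand into `-det (N, …)` with `frame L
l` in position `j`: this is `-‖N‖²` for `j = l`, and zero otherwise because a row is repeated. -/
lemma inner_dualVec {L : Euc n →L[ℝ] Euc (n + 1)} (hL : Function.Injective L) (a : Fin n → ℝ)
    (l : Fin n) : ⟪dualVec L a, frame L l⟫ = a l := by
  have h0 := crossL_ne_zero_iff.2 hL
  rw [dualVec, inner_smul_left, sum_inner, Finset.sum_eq_single l]
  · rw [inner_smul_left, inner_crossProd, consDet_update_swap, Function.update_eq_self,
      ← inner_crossProd]
    have : ⟪crossProd (frame L), crossL L⟫ = ‖crossL L‖ ^ 2 := real_inner_self_eq_norm_sq _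
    rw [this]
    have := norm_ne_zero_iff.2 h0
    simp only [conj_trivial]
    field_simp
  · intro j _ hj
    rw [inner_smul_left, inner_crossProd, consDet_update_swap,
      consDet_eq_zero_of_eq hj (by rw [Function.update_self, Function.update_of_ne hj.symm])]
    simp
  · intro h
    exact absurd (Finset.mem_univ l) h

lemma update_update_swap {w : Fin n → Euc (n + 1)} {k l : Fin n} (hkl : k ≠ l)
    (x y : Euc (n + 1)) :
    Function.update (Function.update w k x) l y =
      Function.update (Function.update w l x) k y ∘ Equiv.swap k l := by
  ext1 j
  by_cases h1 : j = k
  · subst h1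
    simp [Function.update_of_ne hkl, Function.update_of_ne hkl.symm]
  · by_cases h2 : j = l
    · subst h2
      simp
    · simp [Equiv.swap_apply_of_ne_of_ne h1 h2, h1, h2]

/-- The second order terms in the divergence of a field of minors cancel. -/
lemma sum_consDet_update_update_eq_zero (z x : Euc (n + 1)) (w : Fin n → Euc (n + 1))
    (H : Fin n → Fin n → Euc (n + 1)) (hH : ∀ k l, H k l = H l k) :
    ∑ k, ∑ l, (if k = l then 0 else
      consDet z (Function.update (Function.update w k x) l (H k l))) = 0 := by
  set S := ∑ k, ∑ l, (if k = l then 0 else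
      consDet z (Function.update (Function.update w k x) l (H k l))) with hS
  -- Exchanging `k` and `l` swaps two columns and leaves the symmetric `H` unchanged.
  have h : S = -S := by
    conv_lhs => rw [hS, Finset.sum_comm]
    rw [hS, ← Finset.sum_neg_distrib]
    refine Finset.sum_congr rfl fun k _ => ?_
    rw [← Finset.sum_neg_distrib]
    refine Finset.sum_congr rfl fun l _ => ?_
    by_cases hkl : k = l
    · simp [hkl]
    · rw [if_neg hkl, if_neg (Ne.symm hkl), update_update_swap (Ne.symm hkl), Equiv.swap_comm,
        consDet_swap _ _ hkl, hH l k]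
  linarith

/-- This antisymmetry is the algebraic source of integration by parts: up to a divergence, it moves
the derivative from one field to the other. -/
lemma inner_crossProd_update_swap (z x : Euc (n + 1)) (w : Fin n → Euc (n + 1)) (j : Fin n) :
    ⟪z, crossProd (Function.update w j x)⟫ = -⟪x, crossProd (Function.update w j z)⟫ := by
  rw [real_inner_comm, inner_crossProd, consDet_update_swap, ← inner_crossProd, real_inner_comm]

end CrossDerivative

/-! ### Homogeneous extension of the energy density; its gradient is the Cahn-Hoffman map -/

section EnergyDensity

variable {n : ℕ} {γ : Metric.sphere (0 : EuclideanSpace ℝ (Fin (n + 1))) 1 → ℝ}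

lemma contDiffAt_radialExt (hγ : ContMDiff (𝓡 n) 𝓘(ℝ, ℝ) 2 γ) {x : Euc (n + 1)} (hx : x ≠ 0) :
    ContDiffAt ℝ 2 (radialExt γ) x := by
  let U : TopologicalSpace.Opens (Euc (n + 1)) := ⟨{x | x ≠ 0}, isOpen_ne⟩
  have h1 : ContMDiff 𝓘(ℝ, Euc (n + 1)) 𝓘(ℝ, Euc (n + 1)) 2
      (fun y : U => ‖(y : Euc (n + 1))‖⁻¹ • (y : Euc (n + 1))) := by
    intro y
    have : ContMDiffAt 𝓘(ℝ, Euc (n + 1)) 𝓘(ℝ, Euc (n + 1)) 2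
        (fun y : Euc (n + 1) => ‖y‖⁻¹ • y) (y : Euc (n + 1)) := by
      rw [contMDiffAt_iff_contDiffAt]
      have hy : (y : Euc (n + 1)) ≠ 0 := y.2
      exact ((contDiffAt_norm ℝ hy).inv (norm_ne_zero_iff.2 hy)).smul contDiffAt_id
    exact contMDiffAt_subtype_iff.2 this
  have hmem : ∀ y : U, ‖(y : Euc (n + 1))‖⁻¹ • (y : Euc (n + 1)) ∈
      Metric.sphere (0 : Euc (n + 1)) 1 := by
    intro y
    have hy : (y : Euc (n + 1)) ≠ 0 := y.2
    simp [norm_smul, inv_mul_cancel₀ (norm_ne_zero_iff.mpr hy)]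
  have h2 := hγ.comp (h1.codRestrict_sphere hmem)
  have h3 : ContMDiffAt 𝓘(ℝ, Euc (n + 1)) 𝓘(ℝ, ℝ) 2 (radialExt γ) ((⟨x, hx⟩ : U) : Euc (n + 1)) := by
    refine contMDiffAt_subtype_iff.1 ((h2 ⟨x, hx⟩).congr_of_eventuallyEq
      (Filter.Eventually.of_forall fun y => ?_))
    have hy : (y : Euc (n + 1)) ≠ 0 := y.2
    simp only [radialExt, hy, ne_eq, not_false_eq_true, dif_pos, Function.comp_apply]
    rfl
  exact contMDiffAt_iff_contDiffAt.1 h3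

lemma radialExt_smul {c : ℝ} (hc : 0 < c) (x : Euc (n + 1)) :
    radialExt γ (c • x) = radialExt γ x := by
  by_cases hx : x = 0
  · simp [hx]
  · have hcx : c • x ≠ 0 := smul_ne_zero hc.ne' hx
    simp only [radialExt, hx, hcx, ne_eq, not_false_eq_true, dif_pos]
    congr 2
    rw [norm_smul, Real.norm_of_nonneg hc.le, smul_smul]
    congr 1
    field_simp

variable (γ) in
/-- The positively `1`-homogeneous extension of the energy density. -/
noncomputable def homExt (x : Euc (n + 1)) : ℝ := ‖x‖ * radialExt γ x

variable (γ) in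
/-- The gradient of the `1`-homogeneous extension of the energy density. -/
noncomputable def homGrad (x : Euc (n + 1)) : Euc (n + 1) := gradient (homExt γ) x

@[simp] lemma homExt_zero : homExt γ 0 = 0 := by simp [homExt]

lemma homExt_smul {c : ℝ} (hc : 0 ≤ c) (x : Euc (n + 1)) :
    homExt γ (c • x) = c * homExt γ x := by
  rcases hc.eq_or_lt with rfl | hc
  · simp
  · rw [homExt, homExt, radialExt_smul hc, norm_smul, Real.norm_of_nonneg hc.le, mul_assoc]

lemma contDiffAt_homExt (hγ : ContMDiff (𝓡 n) 𝓘(ℝ, ℝ) 2 γ) {x : Euc (n + 1)} (hx : x ≠ 0) :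
    ContDiffAt ℝ 2 (homExt γ) x :=
  (contDiffAt_norm ℝ hx).mul (contDiffAt_radialExt hγ hx)

lemma fderiv_homExt_apply (x v : Euc (n + 1)) :
    fderiv ℝ (homExt γ) x v = ⟪homGrad γ x, v⟫ := by
  rw [homGrad, gradient, InnerProductSpace.toDual_symm_apply]

lemma contDiffAt_homGrad (hγ : ContMDiff (𝓡 n) 𝓘(ℝ, ℝ) 2 γ) {x : Euc (n + 1)} (hx : x ≠ 0) :
    ContDiffAt ℝ 1 (homGrad γ) x := by
  have h : ContDiffAt ℝ 1 (fderiv ℝ (homExt γ)) x :=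
    (contDiffAt_homExt hγ hx).fderiv_right (by norm_num)
  exact (InnerProductSpace.toDual ℝ (Euc (n + 1))).symm.toContinuousLinearEquiv.contDiff.contDiffAt.comp
    x h

/-- The gradient of a 1-homogeneous function is 0-homogeneous, so `ξ` can be evaluated on the
unnormalized normal. -/
lemma homGrad_smul {c : ℝ} (hc : 0 < c) (x : Euc (n + 1)) :
    homGrad γ (c • x) = homGrad γ x := by
  have h1 : (fun y => homExt γ (c • y)) = fun y => c • homExt γ y :=
    funext fun y => homExt_smul hc.le y
  have h2 : fderiv ℝ (fun y => homExt γ (c • y)) x = c • fderiv ℝ (homExt γ) (c • x) :=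
    fderiv_comp_smul c
  rw [h1] at h2
  have h3 : fderiv ℝ (fun y => c • homExt γ y) x = c • fderiv ℝ (homExt γ) x :=
    congrFun (fderiv_const_smul_field (f := homExt γ) c) x
  rw [h3] at h2
  have h4 := smul_right_injective _ hc.ne' h2
  rw [homGrad, homGrad, gradient, gradient, h4]

/-- The product rule for `‖x‖ · γ(x/‖x‖)` at a unit vector, where the differential of the norm is
`⟪ν, ·⟫`. -/
lemma homGrad_eq_cahnHoffman (hγ : ContMDiff (𝓡 n) 𝓘(ℝ, ℝ) 2 γ) {ν : Euc (n + 1)}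
    (hν : ‖ν‖ = 1) : homGrad γ ν = cahnHoffman γ ν := by
  have h0 : ν ≠ 0 := by
    rintro rfl
    simp at hν
  have hr : HasFDerivAt (radialExt γ) (fderiv ℝ (radialExt γ) ν) ν :=
    ((contDiffAt_radialExt hγ h0).differentiableAt two_ne_zero).hasFDerivAt
  have hn : HasFDerivAt (fun x : Euc (n + 1) => ‖x‖) (innerSL ℝ ν) ν := by
    have h1 : HasFDerivAt (fun x : Euc (n + 1) => ‖x‖) (fderiv ℝ (fun x => ‖x‖) ν) ν :=
      ((contDiffAt_norm ℝ h0 (n := 1)).differentiableAt one_ne_zero).hasFDerivAt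
    have h2 := (hasStrictFDerivAt_norm_sq ν).hasFDerivAt
    have h3 := h1.pow 2
    have h4 := h3.unique h2
    have h5 : fderiv ℝ (fun x : Euc (n + 1) => ‖x‖) ν = innerSL ℝ ν := by
      ext v
      have := congrArg (fun T => T v) h4
      simp [hν] at this
      simpa using this
    rwa [h5] at h1
  refine ext_inner_right ℝ fun v => ?_
  have hm : HasFDerivAt (homExt γ) _ ν := hn.mul hr
  rw [← fderiv_homExt_apply, hm.fderiv, cahnHoffman, sphereGrad, inner_add_left, inner_smul_left,
    gradient, InnerProductSpace.toDual_symm_apply]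
  simp [hν]

lemma homGrad_eq_cahnHoffman_normalize (hγ : ContMDiff (𝓡 n) 𝓘(ℝ, ℝ) 2 γ) {x : Euc (n + 1)}
    (hx : x ≠ 0) : homGrad γ x = cahnHoffman γ (‖x‖⁻¹ • x) := by
  have hp : 0 < ‖x‖⁻¹ := inv_pos.2 (norm_pos_iff.2 hx)
  rw [← homGrad_eq_cahnHoffman hγ, homGrad_smul hp]
  rw [norm_smul, norm_inv, norm_norm, inv_mul_cancel₀ (norm_ne_zero_iff.2 hx)]

/-- Compactness of the sphere and 0-homogeneity. The bound does not deteriorate at the origin, which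
matters because the normal of a weak immersion may tend to zero at the boundary of a piece. -/
lemma exists_norm_homGrad_le (hγ : ContMDiff (𝓡 n) 𝓘(ℝ, ℝ) 2 γ) :
    ∃ C, 0 ≤ C ∧ ∀ x : Euc (n + 1), x ≠ 0 → ‖homGrad γ x‖ ≤ C := by
  have hc : ContinuousOn (homGrad γ) (Metric.sphere 0 1) := fun x hx =>
    (contDiffAt_homGrad hγ (ne_zero_of_mem_unit_sphere (⟨x, hx⟩ :
      Metric.sphere (0 : Euc (n + 1)) 1))).continuousAt.continuousWithinAt
  obtain ⟨C, hC⟩ := (isCompact_sphere (0 : Euc (n + 1)) 1).exists_bound_of_continuousOn hc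
  refine ⟨max C 0, le_max_right _ _, fun x hx => ?_⟩
  have hp : 0 < ‖x‖⁻¹ := inv_pos.2 (norm_pos_iff.2 hx)
  rw [← homGrad_smul hp]
  refine (hC _ ?_).trans (le_max_left _ _)
  simp [norm_smul, inv_mul_cancel₀ (norm_ne_zero_iff.2 hx)]

/-- Euler's relation: differentiate `t ↦ h(t x) = t h(x)` at `t = 1`. -/
lemma inner_homGrad_self (hγ : ContMDiff (𝓡 n) 𝓘(ℝ, ℝ) 2 γ) {x : Euc (n + 1)} (hx : x ≠ 0) :
    ⟪homGrad γ x, x⟫ = homExt γ x := by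
  have h1 : HasDerivAt (fun t : ℝ => homExt γ (t • x)) (⟪homGrad γ x, x⟫) 1 := by
    have h := ((contDiffAt_homExt hγ hx).differentiableAt two_ne_zero).hasFDerivAt
    rw [← one_smul ℝ x] at h
    have h2 : HasDerivAt (fun t : ℝ => t • x) x 1 := by
      simpa using (hasDerivAt_id (1 : ℝ)).smul_const x
    have := h.comp_hasDerivAt (1 : ℝ) h2
    rwa [one_smul, fderiv_homExt_apply] at this
  have h2 : HasDerivAt (fun t : ℝ => homExt γ (t • x)) (homExt γ x) 1 := by
    have h3 : HasDerivAt (fun t : ℝ => t * homExt γ x) (homExt γ x) 1 := by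
      simpa using (hasDerivAt_id (1 : ℝ)).mul_const (homExt γ x)
    refine h3.congr_of_eventuallyEq ?_
    filter_upwards [lt_mem_nhds (zero_lt_one (α := ℝ))] with t ht
    exact homExt_smul ht.le x
  exact h1.unique h2

lemma exists_abs_homExt_le (hγ : ContMDiff (𝓡 n) 𝓘(ℝ, ℝ) 2 γ) :
    ∃ C, 0 ≤ C ∧ ∀ x : Euc (n + 1), |homExt γ x| ≤ C * ‖x‖ := by
  obtain ⟨C, hC0, hC⟩ := exists_norm_homGrad_le hγ
  refine ⟨C, hC0, fun x => ?_⟩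
  by_cases hx : x = 0
  · simp [hx]
  · rw [← inner_homGrad_self hγ hx]
    exact (abs_real_inner_le_norm _ _).trans (mul_le_mul_of_nonneg_right (hC x hx) (norm_nonneg _))

/-- The derivative of the gradient of the `1`-homogeneous extension at `x` takes values in the
orthogonal complement of `x`. -/
lemma inner_fderiv_homGrad (hγ : ContMDiff (𝓡 n) 𝓘(ℝ, ℝ) 2 γ) {x : Euc (n + 1)} (hx : x ≠ 0)
    (v : Euc (n + 1)) : ⟪fderiv ℝ (homGrad γ) x v, x⟫ = 0 := by
  have hd : HasFDerivAt (homGrad γ) (fderiv ℝ (homGrad γ) x) x :=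
    ((contDiffAt_homGrad hγ hx).differentiableAt one_ne_zero).hasFDerivAt
  -- Euler's relation is differentiated once more; the terms `⟪homGrad γ x, v⟫` on the two sides
  -- cancel.
  have hx' : HasFDerivAt (fun y => ⟪homGrad γ y, y⟫) _ x := hd.inner ℝ (hasFDerivAt_id x)
  have hx2 : HasFDerivAt (fun y => ⟪homGrad γ y, y⟫) (fderiv ℝ (homExt γ) x) x := by
    have h := ((contDiffAt_homExt hγ hx).differentiableAt two_ne_zero).hasFDerivAt
    refine h.congr_of_eventuallyEq ?_
    filter_upwards [isOpen_ne.mem_nhds hx] with y hy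
    exact inner_homGrad_self hγ hy
  have h := congrArg (fun T => T v) (hx'.unique hx2)
  simp only [fderiv_homExt_apply] at h
  simpa using h

end EnergyDensity

/-! ### Integration by parts on a box -/

section BoxDivergence

variable {n : ℕ}

/-- The closed box with corners `a`, `b` in Euclidean space. -/
def euBox (a b : Fin n → ℝ) : Set (Euc n) := {u | ∀ k, u k ∈ Icc (a k) (b k)}

lemma euBox_eq_preimage (a b : Fin n → ℝ) :
    euBox a b = EuclideanSpace.equiv (Fin n) ℝ ⁻¹' Icc a b := by
  ext u
  simp only [euBox, mem_ofPred_eq, mem_preimage, mem_Icc, Pi.le_def]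
  exact ⟨fun h => ⟨fun k => (h k).1, fun k => (h k).2⟩, fun h k => ⟨h.1 k, h.2 k⟩⟩

lemma isCompact_euBox (a b : Fin n → ℝ) : IsCompact (euBox a b) := by
  rw [euBox_eq_preimage]
  exact (EuclideanSpace.equiv (Fin n) ℝ).toHomeomorph.isCompact_preimage.2 isCompact_Icc

lemma convex_euBox (a b : Fin n → ℝ) : Convex ℝ (euBox a b) := by
  rw [euBox_eq_preimage]
  exact (convex_Icc a b).linear_preimage (EuclideanSpace.equiv (Fin n) ℝ).toLinearMap

lemma interior_euBox (a b : Fin n → ℝ) :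
    interior (euBox a b) = {u : Euc n | ∀ k, u k ∈ Ioo (a k) (b k)} := by
  rw [euBox_eq_preimage]
  have := (EuclideanSpace.equiv (Fin n) ℝ).toHomeomorph.preimage_interior (Icc a b)
  have h2 : interior (⇑(EuclideanSpace.equiv (Fin n) ℝ) ⁻¹' Icc a b) =
      ⇑(EuclideanSpace.equiv (Fin n) ℝ) ⁻¹' interior (Icc a b) := this.symm
  rw [h2, ← pi_univ_Icc, interior_pi_set finite_univ]
  ext u
  simp [mem_pi]

lemma uniqueDiffOn_euBox {a b : Fin n → ℝ} (hab : ∀ k, a k < b k) :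
    UniqueDiffOn ℝ (euBox a b) := by
  refine uniqueDiffOn_convex (convex_euBox a b) ⟨WithLp.toLp 2 fun k => (a k + b k) / 2, ?_⟩
  rw [interior_euBox]
  intro k
  have := hab k
  constructor <;> simp <;> linarith

lemma volume_euBox_diff_interior (a b : Fin n → ℝ) :
    volume (euBox a b \ interior (euBox a b)) = 0 := by
  have h1 : euBox a b \ interior (euBox a b) = frontier (euBox a b) := by
    rw [frontier, (isCompact_euBox a b).isClosed.closure_eq]
  rw [h1]
  exact (convex_euBox a b).addHaar_frontier volume

/-- The `k`-th component of the flux in the integration by parts formula: the minor in which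
the `k`-th derivative of `x` is replaced by `w`. -/
noncomputable def boxFlux (x z w : Euc n → Euc (n + 1)) (Q : Set (Euc n)) (k : Fin n) (u : Euc n) :
    ℝ :=
  ⟪z u, crossProd (Function.update (frame (fderivWithin ℝ x Q u)) k (w u))⟫

lemma boxFlux_of_eq_zero {x z w : Euc n → Euc (n + 1)} {Q : Set (Euc n)} {k : Fin n} {u : Euc n}
    (h : w u = 0) : boxFlux x z w Q k u = 0 := by
  rw [boxFlux, h]
  have : crossProd (Function.update (frame (fderivWithin ℝ x Q u)) k (0 : Euc (n + 1))) = 0 :=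
    (crossMulti n).toMultilinearMap.map_update_zero _ _
  rw [this, inner_zero_right]

/-- Product rule. The last sum collects the derivatives of the columns left in place; these are the
second derivatives of `x` that cancel in the divergence. -/
lemma hasFDerivAt_boxFlux {x z w : Euc n → Euc (n + 1)} {u : Euc n} (hx : ContDiffAt ℝ 2 x u)
    (hz : DifferentiableAt ℝ z u) (hw : DifferentiableAt ℝ w u) (k : Fin n) :
    ∃ f' : Euc n →L[ℝ] ℝ, HasFDerivAt
      (fun v => ⟪z v, crossProd (Function.update (frame (fderiv ℝ x v)) k (w v))⟫) f' u ∧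
      ∀ e, f' e = ⟪fderiv ℝ z u e, crossProd (Function.update (frame (fderiv ℝ x u)) k (w u))⟫ +
        ⟪z u, crossProd (Function.update (frame (fderiv ℝ x u)) k (fderiv ℝ w u e))⟫ +
        ∑ l, (if k = l then 0 else ⟪z u, crossProd (Function.update (Function.update
          (frame (fderiv ℝ x u)) k (w u)) l
            (fderiv ℝ (fderiv ℝ x) u e (EuclideanSpace.single l 1)))⟫) := by
  have hL : HasFDerivAt (fderiv ℝ x) (fderiv ℝ (fderiv ℝ x) u) u :=
    ((hx.fderiv_right (m := 1) (by norm_num)).differentiableAt one_ne_zero).hasFDerivAt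
  have hfr : HasFDerivAt (fun v => frame (fderiv ℝ x v))
      (frameCLM n ∘L fderiv ℝ (fderiv ℝ x) u) u := (frameCLM n).hasFDerivAt.comp u hL
  have hup : HasFDerivAt (fun v => Function.update (frame (fderiv ℝ x v)) k (w v))
      (ContinuousLinearMap.pi fun l => if l = k then fderiv ℝ w u else
        (ContinuousLinearMap.proj l ∘L (frameCLM n ∘L fderiv ℝ (fderiv ℝ x) u))) u := by
    rw [hasFDerivAt_pi]
    intro l
    by_cases hl : l = k
    · subst hl
      simpa using hw.hasFDerivAt
    · simp only [Function.update_of_ne hl, if_neg hl]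
      exact hasFDerivAt_pi'.1 hfr l
  have hcr := ((crossMulti n).hasFDerivAt
    (Function.update (frame (fderiv ℝ x u)) k (w u))).comp u hup
  have hin := hz.hasFDerivAt.inner ℝ hcr
  refine ⟨_, hin, fun e => ?_⟩
  simp only [ContinuousLinearMap.comp_apply, ContinuousLinearMap.prod_apply,
    fderivInnerCLM_apply, ContinuousMultilinearMap.linearDeriv_apply, crossMulti_apply,
    Function.comp_apply]
  rw [add_comm, add_assoc]
  congr 1
  rw [inner_sum, ← Finset.add_sum_erase _ _ (Finset.mem_univ k),
    ← Finset.add_sum_erase (Finset.univ) (fun l => if k = l then (0 : ℝ) else _)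
      (Finset.mem_univ k)]
  simp only [if_true, zero_add]
  congr 1
  · simp
  · refine Finset.sum_congr rfl fun l hl => ?_
    have hne : l ≠ k := (Finset.mem_erase.1 hl).1
    rw [if_neg hne.symm]
    simp only [ContinuousLinearMap.pi_apply, if_neg hne]
    rfl

/-- The second-order terms cancel by symmetry of the Hessian, the derivatives of `w` add up to `⟪z,
dN(w)⟫`, and those of `z` give `-⟪w, dN(z)⟫` after exchanging `w` with the derivative of `z`. -/
lemma sum_div_boxFlux {x z w : Euc n → Euc (n + 1)} {u : Euc n} (hx : ContDiffAt ℝ 2 x u) :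
    ∑ k, (⟪fderiv ℝ z u (EuclideanSpace.single k 1),
          crossProd (Function.update (frame (fderiv ℝ x u)) k (w u))⟫ +
        ⟪z u, crossProd (Function.update (frame (fderiv ℝ x u)) k
          (fderiv ℝ w u (EuclideanSpace.single k 1)))⟫ +
        ∑ l, (if k = l then 0 else ⟪z u, crossProd (Function.update (Function.update
          (frame (fderiv ℝ x u)) k (w u)) l
            (fderiv ℝ (fderiv ℝ x) u (EuclideanSpace.single k 1)
              (EuclideanSpace.single l 1)))⟫)) =
      ⟪z u, crossDer (fderiv ℝ x u) (fderiv ℝ w u)⟫ -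
        ⟪w u, crossDer (fderiv ℝ x u) (fderiv ℝ z u)⟫ := by
  rw [Finset.sum_add_distrib, Finset.sum_add_distrib]
  have h3 := sum_consDet_update_update_eq_zero (z u) (w u) (frame (fderiv ℝ x u))
    (fun k l => fderiv ℝ (fderiv ℝ x) u (EuclideanSpace.single k 1) (EuclideanSpace.single l 1))
    (fun k l => (hx.isSymmSndFDerivAt (by simp)).eq _ _)
  have h3' : ∀ k l, (if k = l then 0 else ⟪z u, crossProd (Function.update (Function.update
      (frame (fderiv ℝ x u)) k (w u)) l (fderiv ℝ (fderiv ℝ x) u (EuclideanSpace.single k 1)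
        (EuclideanSpace.single l 1)))⟫) = (if k = l then 0 else consDet (z u) (Function.update
          (Function.update (frame (fderiv ℝ x u)) k (w u)) l (fderiv ℝ (fderiv ℝ x) u
            (EuclideanSpace.single k 1) (EuclideanSpace.single l 1)))) := by
    intro k l
    split_ifs
    · rfl
    · rw [real_inner_comm, inner_crossProd]
  simp only [h3', h3, add_zero]
  rw [crossDer_eq_sum, crossDer_eq_sum, inner_sum, inner_sum, add_comm, sub_eq_add_neg,
    ← Finset.sum_neg_distrib]
  congr 1
  refine Finset.sum_congr rfl fun k _ => ?_
  rw [inner_crossProd_update_swap]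
  rfl

lemma contDiffOn_boxFlux {x z w : Euc n → Euc (n + 1)} {Q : Set (Euc n)} (hQ : UniqueDiffOn ℝ Q)
    (hx : ContDiffOn ℝ 2 x Q) (hz : ContDiffOn ℝ 1 z Q) (hw : ContDiffOn ℝ 1 w Q) (k : Fin n) :
    ContDiffOn ℝ 1 (boxFlux x z w Q k) Q := by
  have h1 : ContDiffOn ℝ 1 (fderivWithin ℝ x Q) Q := hx.fderivWithin hQ (by norm_num)
  have h2 : ContDiffOn ℝ 1 (fun u => frame (fderivWithin ℝ x Q u)) Q :=
    (frameCLM n).contDiff.comp_contDiffOn h1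
  have h3 : ContDiffOn ℝ 1 (fun u => Function.update (frame (fderivWithin ℝ x Q u)) k (w u)) Q := by
    rw [contDiffOn_pi]
    intro l
    by_cases hl : l = k
    · subst hl
      simpa using hw
    · simp only [Function.update_of_ne hl]
      exact contDiffOn_pi.1 h2 l
  exact hz.inner ℝ (contDiff_crossProd.comp_contDiffOn h3)

lemma toLp_preserving (n : ℕ) : MeasurePreserving
    (EuclideanSpace.equiv (Fin n) ℝ).symm (volume : Measure (Fin n → ℝ)) volume :=
  (EuclideanSpace.volume_preserving_symm_measurableEquiv_toLp (Fin n)).symm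

/-- The integrand in the integration by parts formula. -/
noncomputable def crossForm (x z w : Euc n → Euc (n + 1)) (u : Euc n) : ℝ :=
  ⟪z u, crossDer (fderiv ℝ x u) (fderiv ℝ w u)⟫ - ⟪w u, crossDer (fderiv ℝ x u) (fderiv ℝ z u)⟫

/-- Integration by parts on a box, for maps which are regular up to the boundary. -/
theorem integral_box_crossForm {m : ℕ} {a b : Fin (m + 1) → ℝ} (hab : ∀ k, a k < b k)
    {x z w : Euc (m + 1) → Euc (m + 1 + 1)} (hx : ContDiffOn ℝ 2 x (euBox a b))
    (hz : ContDiffOn ℝ 1 z (euBox a b)) (hw : ContDiffOn ℝ 1 w (euBox a b)) :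
    IntegrableOn (crossForm x z w) (euBox a b) ∧ ∫ u in euBox a b, crossForm x z w u =
      ∑ k : Fin (m + 1),
        ((∫ y in Icc (a ∘ Fin.succAbove k) (b ∘ Fin.succAbove k),
            boxFlux x z w (euBox a b) k (WithLp.toLp 2 (Fin.insertNth k (b k) y))) -
          ∫ y in Icc (a ∘ Fin.succAbove k) (b ∘ Fin.succAbove k),
            boxFlux x z w (euBox a b) k (WithLp.toLp 2 (Fin.insertNth k (a k) y))) := by
  set Q := euBox a b with hQ
  have hud := uniqueDiffOn_euBox hab
  have hF := fun k => contDiffOn_boxFlux hud hx hz hw k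
  -- With derivatives taken within the closed box, `D` is continuous up to the faces, hence
  -- integrable. It agrees with `crossForm` in the interior, that is, almost everywhere.
  let D : Euc (m + 1) → ℝ := fun u => ⟪z u, crossDer (fderivWithin ℝ x Q u) (fderivWithin ℝ w Q u)⟫ -
    ⟪w u, crossDer (fderivWithin ℝ x Q u) (fderivWithin ℝ z Q u)⟫
  have hD : ContinuousOn D Q := by
    have h1 : ContinuousOn (fderivWithin ℝ x Q) Q := hx.continuousOn_fderivWithin hud (by norm_num)
    have h2 : ContinuousOn (fderivWithin ℝ z Q) Q := hz.continuousOn_fderivWithin hud le_rfl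
    have h3 : ContinuousOn (fderivWithin ℝ w Q) Q := hw.continuousOn_fderivWithin hud le_rfl
    exact (hz.continuousOn.inner (continuous_crossDer.comp_continuousOn (h1.prodMk h3))).sub
      (hw.continuousOn.inner (continuous_crossDer.comp_continuousOn (h1.prodMk h2)))
  have hDeq : ∀ u ∈ interior Q, D u = crossForm x z w u := by
    intro u hu
    have hn := mem_interior_iff_mem_nhds.1 hu
    simp only [D, crossForm, fderivWithin_of_mem_nhds hn]
  have hae : D =ᵐ[volume.restrict Q] crossForm x z w := by
    rw [Filter.EventuallyEq, ae_restrict_iff' (isCompact_euBox a b).measurableSet, ae_iff]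
    refine measure_mono_null ?_ (volume_euBox_diff_interior a b)
    intro u hu
    simp only [mem_ofPred_eq, Classical.not_imp] at hu
    exact ⟨hu.1, fun h => hu.2 (hDeq u h)⟩
  have hDi : IntegrableOn D Q := hD.integrableOn_compact (isCompact_euBox a b)
  refine ⟨(integrable_congr hae).1 hDi, ?_⟩
  rw [← integral_congr_ae hae]
  let e := EuclideanSpace.equiv (Fin (m + 1)) ℝ
  have he : MeasurableEmbedding e.symm := e.symm.toHomeomorph.measurableEmbedding
  have hpre : e.symm ⁻¹' Q = Icc a b := by
    rw [hQ, euBox_eq_preimage, ← preimage_comp]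
    have : (⇑(EuclideanSpace.equiv (Fin (m + 1)) ℝ) ∘ ⇑e.symm) = id := by
      ext y; simp [e]
    rw [this, preimage_id]
  rw [← (toLp_preserving (m + 1)).setIntegral_preimage_emb he, hpre]
  have hin : ∀ y ∈ (Set.pi univ fun i => Ioo (a i) (b i)) \ (∅ : Set (Fin (m + 1) → ℝ)),
      e.symm y ∈ interior Q := by
    intro y hy
    rw [hQ, interior_euBox]
    intro k
    exact hy.1 k (mem_univ k)
  have hex : ∀ k : Fin (m + 1), ∀ u ∈ interior Q, HasFDerivAt (boxFlux x z w Q k)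
      (fderiv ℝ (boxFlux x z w Q k) u) u := fun k u hu =>
    (((hF k).contDiffAt (mem_interior_iff_mem_nhds.1 hu)).differentiableAt one_ne_zero).hasFDerivAt
  have hsum : ∀ u ∈ interior Q, ∑ k : Fin (m + 1), fderiv ℝ (boxFlux x z w Q k) u
      (EuclideanSpace.single k 1) = D u := by
    intro u hu
    have hn := mem_interior_iff_mem_nhds.1 hu
    have hxu : ContDiffAt ℝ 2 x u := hx.contDiffAt hn
    have hzu := (hz.contDiffAt hn).differentiableAt one_ne_zero
    have hwu := (hw.contDiffAt hn).differentiableAt one_ne_zero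
    rw [hDeq u hu, crossForm, ← sum_div_boxFlux hxu]
    refine Finset.sum_congr rfl fun k _ => ?_
    obtain ⟨f', hf', hfe⟩ := hasFDerivAt_boxFlux hxu hzu hwu k
    rw [← hfe]
    have : HasFDerivAt (boxFlux x z w Q k) f' u := by
      refine hf'.congr_of_eventuallyEq ?_
      filter_upwards [isOpen_interior.mem_nhds hu] with v hv
      rw [boxFlux, fderivWithin_of_mem_nhds (mem_interior_iff_mem_nhds.1 hv)]
    rw [this.fderiv]
  have hmaps : MapsTo e.symm (Icc a b) Q := by
    rw [← hpre]
    exact mapsTo_preimage _ _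
  have hpi : (Set.pi univ fun i => Ioo (a i) (b i)) =ᵐ[volume] Icc a b :=
    Measure.univ_pi_Ioo_ae_eq_Icc
  have hae2 : (fun y => D (e.symm y)) =ᵐ[volume.restrict (Icc a b)] fun y =>
      ∑ k : Fin (m + 1), (fderiv ℝ (boxFlux x z w Q k) (e.symm y) ∘L
        (e.symm : (Fin (m + 1) → ℝ) →L[ℝ] Euc (m + 1))) (Pi.single k 1) := by
    rw [← Measure.restrict_congr_set hpi]
    refine (ae_restrict_iff' (MeasurableSet.univ_pi fun i => measurableSet_Ioo)).2
      (Filter.Eventually.of_forall fun y hy => ?_)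
    exact (hsum _ (hin y ⟨hy, notMem_empty _⟩)).symm
  have hDi2 : IntegrableOn (fun y => D (e.symm y)) (Icc a b) :=
    (hD.comp e.symm.continuous.continuousOn hmaps).integrableOn_compact isCompact_Icc
  have hdiv := integral_divergence_of_hasFDerivAt_off_countable' a b (fun k => (hab k).le)
    (fun k y => boxFlux x z w Q k (e.symm y))
    (fun k y => fderiv ℝ (boxFlux x z w Q k) (e.symm y) ∘L
      (e.symm : (Fin (m + 1) → ℝ) →L[ℝ] Euc (m + 1))) ∅ countable_empty
    (fun k => (hF k).continuousOn.comp e.symm.continuous.continuousOn hmaps)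
    (fun y hy k => (hex k _ (hin y hy)).comp y e.symm.hasFDerivAt)
    ((integrable_congr hae2).1 hDi2)
  exact (integral_congr_ae hae2).trans hdiv

end BoxDivergence

/-! ### Cutoff functions with small gradient around Hausdorff null sets -/

section Cutoff

open Filter Topology

/-- There is a smooth function with values in `[0, 1]` which is `1` on `U`, whose integral is at
most `a` and whose gradient has integral at most `b`. -/
def HasCutoff {n : ℕ} (U : Set (Euc n)) (a b : ℝ) : Prop :=
  ∃ η : Euc n → ℝ, ContDiff ℝ ∞ η ∧ HasCompactSupport η ∧ (∀ u, 0 ≤ η u ∧ η u ≤ 1) ∧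
    (∀ u ∈ U, η u = 1) ∧ ∫ u, η u ≤ a ∧ ∫ u, ‖fderiv ℝ η u‖ ≤ b

lemma HasCutoff.mono {n : ℕ} {U V : Set (Euc n)} {a a' b b' : ℝ} (h : HasCutoff U a b)
    (hUV : V ⊆ U) (ha : a ≤ a') (hb : b ≤ b') : HasCutoff V a' b' := by
  obtain ⟨η, h1, h2, h3, h4, h5, h6⟩ := h
  exact ⟨η, h1, h2, h3, fun u hu => h4 u (hUV hu), h5.trans ha, h6.trans hb⟩

lemma hasCutoff_empty (n : ℕ) : HasCutoff (∅ : Set (Euc n)) 0 0 :=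
  ⟨fun _ => 0, contDiff_const, HasCompactSupport.zero, fun _ => by simp, by simp, by simp, by simp⟩

lemma integrable_of_contDiff_hasCompactSupport {n : ℕ} {η : Euc n → ℝ} (h : ContDiff ℝ ∞ η)
    (hc : HasCompactSupport η) : Integrable η ∧ Integrable fun u => ‖fderiv ℝ η u‖ := by
  refine ⟨h.continuous.integrable_of_hasCompactSupport hc, ?_⟩
  exact ((h.continuous_fderiv (by simp)).integrable_of_hasCompactSupport (hc.fderiv ℝ)).norm

/-- The function `1 - (1 - η)(1 - θ)` is a smooth substitute for the maximum. Its gradient is `(1 -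
θ) Dη + (1 - η) Dθ`, with weights in `[0, 1]`, so no constant is lost in finite unions. -/
lemma HasCutoff.union {n : ℕ} {U V : Set (Euc n)} {a a' b b' : ℝ} (h : HasCutoff U a b)
    (h' : HasCutoff V a' b') : HasCutoff (U ∪ V) (a + a') (b + b') := by
  obtain ⟨η, h1, h2, h3, h4, h5, h6⟩ := h
  obtain ⟨θ, k1, k2, k3, k4, k5, k6⟩ := h'
  obtain ⟨i1, i2⟩ := integrable_of_contDiff_hasCompactSupport h1 h2
  obtain ⟨j1, j2⟩ := integrable_of_contDiff_hasCompactSupport k1 k2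
  have hs : ContDiff ℝ ∞ fun u => η u + θ u - η u * θ u := (h1.add k1).sub (h1.mul k1)
  have hcs : HasCompactSupport fun u => η u + θ u - η u * θ u :=
    (h2.add k2).sub (h2.mul_right)
  obtain ⟨l1, l2⟩ := integrable_of_contDiff_hasCompactSupport hs hcs
  refine ⟨fun u => η u + θ u - η u * θ u, hs, hcs, fun u => ?_, fun u hu => ?_, ?_, ?_⟩
  · have := h3 u
    have := k3 u
    constructor <;> nlinarith
  · rcases hu with hu | hu
    · simp [h4 u hu]
    · simp [k4 u hu]
  · refine le_trans ?_ (add_le_add h5 k5)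
    rw [← integral_add i1 j1]
    refine integral_mono l1 (i1.add j1) fun u => ?_
    have := mul_nonneg (h3 u).1 (k3 u).1
    linarith
  · refine le_trans ?_ (add_le_add h6 k6)
    rw [← integral_add i2 j2]
    refine integral_mono l2 (i2.add j2) fun u => ?_
    have d1 := (h1.differentiable (by simp) u).hasFDerivAt
    have d2 := (k1.differentiable (by simp) u).hasFDerivAt
    have d3 := (d1.add d2).sub (d1.mul d2)
    have hd : fderiv ℝ (fun u => η u + θ u - η u * θ u) u =
        (1 - θ u) • fderiv ℝ η u + (1 - η u) • fderiv ℝ θ u := by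
      have d4 : HasFDerivAt (fun u => η u + θ u - η u * θ u) _ u := d3
      rw [d4.fderiv]
      ext v
      simp
      ring
    simp only [hd]
    refine (norm_add_le _ _).trans (add_le_add ?_ ?_)
    · rw [norm_smul]
      refine mul_le_of_le_one_left (norm_nonneg _) ?_
      rw [Real.norm_eq_abs, abs_le]
      have := k3 u
      constructor <;> linarith
    · rw [norm_smul]
      refine mul_le_of_le_one_left (norm_nonneg _) ?_
      rw [Real.norm_eq_abs, abs_le]
      have := h3 u
      constructor <;> linarith

lemma hasCutoff_biUnion {n : ℕ} {ι : Type*} (s : Finset ι) (U : ι → Set (Euc n)) (a b : ι → ℝ)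
    (h : ∀ i ∈ s, HasCutoff (U i) (a i) (b i)) :
    HasCutoff (⋃ i ∈ s, U i) (∑ i ∈ s, a i) (∑ i ∈ s, b i) := by
  classical
  induction s using Finset.induction_on with
  | empty => simpa using hasCutoff_empty n
  | insert i s hi ih =>
    rw [Finset.sum_insert hi, Finset.sum_insert hi, Finset.set_biUnion_insert]
    exact (h i (Finset.mem_insert_self _ _)).union
      (ih fun j hj => h j (Finset.mem_insert_of_mem hj))

/-- Rescaling one bump function: in dimension `m + 1` its integral scales like `r^(m+1)` and that of
its gradient like `r^m`. -/
lemma exists_hasCutoff_ball (m : ℕ) : ∃ C : ℝ, 0 ≤ C ∧ ∀ (x : Euc (m + 1)) (r : ℝ), 0 < r →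
    HasCutoff (Metric.ball x r) (C * r ^ (m + 1)) (C * r ^ m) := by
  let ψ : ContDiffBump (0 : Euc (m + 1)) := ⟨1, 2, one_pos, by norm_num⟩
  have hψ : ContDiff ℝ ∞ ψ := ψ.contDiff
  have I1 : 0 ≤ ∫ u, ψ u := integral_nonneg fun u => ψ.nonneg
  have I2 : 0 ≤ ∫ u, ‖fderiv ℝ ψ u‖ := integral_nonneg fun u => norm_nonneg _
  refine ⟨(∫ u, ψ u) + ∫ u, ‖fderiv ℝ ψ u‖, add_nonneg I1 I2, fun x r hr => ?_⟩
  have hr' : r⁻¹ ≠ 0 := inv_ne_zero hr.ne'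
  have hscale : ∀ g : Euc (m + 1) → ℝ,
      ∫ u, g (r⁻¹ • (u - x)) = r ^ (m + 1) * ∫ u, g u := by
    intro g
    rw [integral_sub_right_eq_self (fun u => g (r⁻¹ • u)) x, Measure.integral_comp_smul,
      finrank_euclideanSpace_fin, inv_pow, inv_inv, abs_of_pos (pow_pos hr _), smul_eq_mul]
  have hd : ∀ u, fderiv ℝ (fun u => ψ (r⁻¹ • (u - x))) u = r⁻¹ • fderiv ℝ ψ (r⁻¹ • (u - x)) := by
    intro u
    have h1 : fderiv ℝ (fun v => ψ (r⁻¹ • v)) (u - x) = r⁻¹ • fderiv ℝ ψ (r⁻¹ • (u - x)) :=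
      fderiv_comp_smul _
    rw [← h1]
    exact fderiv_comp_sub (𝕜 := ℝ) (f := fun v => ψ (r⁻¹ • v)) x
  refine ⟨fun u => ψ (r⁻¹ • (u - x)), ?_, ?_, fun u => ⟨ψ.nonneg, ψ.le_one⟩, ?_, ?_, ?_⟩
  · exact hψ.comp ((contDiff_id.sub contDiff_const).const_smul _)
  · refine HasCompactSupport.intro (isCompact_closedBall x (2 * r)) fun u hu => ?_
    refine ψ.zero_of_le_dist ?_
    rw [Metric.mem_closedBall, not_le, dist_eq_norm] at hu
    rw [dist_zero_right, norm_smul, norm_inv, Real.norm_of_nonneg hr.le]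
    change 2 ≤ _
    rw [inv_mul_eq_div, le_div_iff₀ hr]
    exact hu.le
  · intro u hu
    refine ψ.one_of_mem_closedBall ?_
    rw [Metric.mem_ball, dist_eq_norm] at hu
    rw [mem_closedBall_zero_iff, norm_smul, norm_inv, Real.norm_of_nonneg hr.le]
    change _ ≤ (1 : ℝ)
    rw [inv_mul_eq_div, div_le_one hr]
    exact hu.le
  · rw [hscale]
    have := pow_pos hr (m + 1)
    nlinarith
  · simp only [hd]
    have : ∀ u, ‖r⁻¹ • fderiv ℝ ψ (r⁻¹ • (u - x))‖ =
        (fun v => r⁻¹ * ‖fderiv ℝ ψ v‖) (r⁻¹ • (u - x)) := by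
      intro u
      rw [norm_smul, norm_inv, Real.norm_of_nonneg hr.le]
    simp only [this]
    rw [hscale (fun v => r⁻¹ * ‖fderiv ℝ ψ v‖), integral_const_mul, pow_succ]
    have h1 : r ^ m * r * (r⁻¹ * ∫ u, ‖fderiv ℝ ψ u‖) = r ^ m * ∫ u, ‖fderiv ℝ ψ u‖ := by
      field_simp
    rw [h1]
    have := pow_pos hr m
    nlinarith

/-- A compact set of vanishing `m`-dimensional Hausdorff measure can be covered by finitely many
small balls the `m`-th powers of whose radii have small sum. -/
lemma exists_finite_ball_cover {m : ℕ} (hm : m ≠ 0) {n : ℕ} {K : Set (Euc n)} (hK : IsCompact K)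
    (h0 : μH[(m : ℝ)] K = 0) {ε : ℝ} (hε : 0 < ε) :
    ∃ (s : Finset ℕ) (x : ℕ → Euc n) (r : ℕ → ℝ), (∀ k, 0 < r k ∧ r k ≤ 1) ∧
      K ⊆ ⋃ k ∈ s, Metric.ball (x k) (r k) ∧ ∑ k ∈ s, r k ^ m ≤ ε := by
  have hε2 : (0 : ENNReal) < ENNReal.ofReal (ε / 2) := ENNReal.ofReal_pos.2 (by linarith)
  rw [Measure.hausdorffMeasure_apply] at h0
  -- Hausdorff measure is a supremum over the scales; the scale `1/2` keeps all diameters below `1`,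
  -- which leaves room for radii below `1`.
  have h1 := (iSup₂_eq_bot.1 h0) (1 / 2 : ENNReal) (by simp)
  have h2 : (⨅ (t : ℕ → Set (Euc n)) (_ : K ⊆ ⋃ n, t n) (_ : ∀ n, Metric.ediam (t n) ≤ 1 / 2),
      ∑' n, ⨆ _ : (t n).Nonempty, Metric.ediam (t n) ^ (m : ℝ)) < ENNReal.ofReal (ε / 2) := by
    rw [h1]
    exact hε2
  simp only [iInf_lt_iff] at h2
  obtain ⟨t, htK, htd, hts⟩ := h2
  -- A summable excess lets each radius exceed the diameter strictly, so even a set of diameter zero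
  -- lies in an open ball.
  obtain ⟨δ, hδ0, hδs⟩ := ENNReal.exists_pos_sum_of_countable hε2.ne' ℕ
  have hfin : ∀ k, Metric.ediam (t k) ≠ ⊤ := fun k =>
    ((htd k).trans_lt (ENNReal.div_lt_top (by simp) (by simp))).ne
  have hr : ∀ k, ∃ r : ℝ, Metric.diam (t k) < r ∧ r < 1 ∧ r ^ m < Metric.diam (t k) ^ m + δ k := by
    intro k
    have hd : Metric.diam (t k) < 1 := by
      have : Metric.diam (t k) ≤ 1 / 2 := by
        rw [Metric.diam]
        have := ENNReal.toReal_mono (by simp) (htd k)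
        simpa using this
      linarith
    have hp : (0 : ℝ) < δ k := hδ0 k
    have e1 : ∀ᶠ r in 𝓝[>] Metric.diam (t k), r ^ m < Metric.diam (t k) ^ m + δ k :=
      (((continuous_pow m).tendsto (Metric.diam (t k))).eventually
        (gt_mem_nhds (by linarith))).filter_mono nhdsWithin_le_nhds
    have e2 : ∀ᶠ r in 𝓝[>] Metric.diam (t k), r < 1 :=
      (gt_mem_nhds hd).filter_mono nhdsWithin_le_nhds
    obtain ⟨r, ⟨h1, h2⟩, h3⟩ := ((e1.and e2).and self_mem_nhdsWithin).exists
    exact ⟨r, h3, h2, h1⟩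
  choose r hr1 hr2 hr3 using hr
  have hx : ∀ k, ∃ x : Euc n, t k ⊆ Metric.ball x (r k) := by
    intro k
    rcases (t k).eq_empty_or_nonempty with he | ⟨x, hx⟩
    · exact ⟨0, by simp [he]⟩
    · refine ⟨x, fun y hy => ?_⟩
      have hb : Bornology.IsBounded (t k) := Metric.isBounded_iff_ediam_ne_top.2 (hfin k)
      exact (Metric.dist_le_diam_of_mem hb hy hx).trans_lt (hr1 k)
  choose x hx using hx
  have hrp : ∀ k, 0 < r k := fun k => Metric.diam_nonneg.trans_lt (hr1 k)
  obtain ⟨s, hs⟩ := hK.elim_finite_subcover (fun k => Metric.ball (x k) (r k))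
    (fun k => Metric.isOpen_ball) (htK.trans (iUnion_mono hx))
  refine ⟨s, x, r, fun k => ⟨hrp k, (hr2 k).le⟩, hs, ?_⟩
  have hle : ENNReal.ofReal (∑ k ∈ s, r k ^ m) ≤ ENNReal.ofReal ε := by
    rw [ENNReal.ofReal_sum_of_nonneg fun k _ => pow_nonneg (hrp k).le _]
    calc ∑ k ∈ s, ENNReal.ofReal (r k ^ m)
        ≤ ∑ k ∈ s, ((⨆ _ : (t k).Nonempty, Metric.ediam (t k) ^ (m : ℝ)) + (δ k : ENNReal)) := by
          refine Finset.sum_le_sum fun k _ => ?_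
          refine (ENNReal.ofReal_le_ofReal (hr3 k).le).trans ?_
          rw [ENNReal.ofReal_add (pow_nonneg Metric.diam_nonneg _) (NNReal.coe_nonneg _),
            ENNReal.ofReal_coe_nnreal]
          refine add_le_add ?_ le_rfl
          rw [ENNReal.ofReal_pow Metric.diam_nonneg, Metric.diam, ENNReal.ofReal_toReal (hfin k)]
          rcases (t k).eq_empty_or_nonempty with he | hne
          · simp [he, hm]
          · refine le_iSup_of_le hne ?_
            rw [ENNReal.rpow_natCast]
      _ ≤ ∑' k, ((⨆ _ : (t k).Nonempty, Metric.ediam (t k) ^ (m : ℝ)) + (δ k : ENNReal)) :=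
          ENNReal.sum_le_tsum _
      _ = (∑' k, ⨆ _ : (t k).Nonempty, Metric.ediam (t k) ^ (m : ℝ)) + ∑' k, (δ k : ENNReal) :=
          ENNReal.tsum_add
      _ ≤ ENNReal.ofReal (ε / 2) + ENNReal.ofReal (ε / 2) := add_le_add hts.le hδs.le
      _ = ENNReal.ofReal ε := by
          rw [← ENNReal.ofReal_add (by linarith) (by linarith)]
          congr 1
          ring
  exact (ENNReal.ofReal_le_ofReal_iff hε.le).1 hle

/-- A compact set of vanishing `(n-1)`-dimensional Hausdorff measure has cutoff functions whose
gradients are small in the mean. -/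
theorem exists_cutoff_of_hausdorffMeasure_eq_zero {n : ℕ} [NeZero n] {K : Set (Euc n)}
    (hK : IsCompact K) (h0 : μH[(n : ℝ) - 1] K = 0) {ε : ℝ} (hε : 0 < ε) :
    ∃ U, IsOpen U ∧ K ⊆ U ∧ HasCutoff U ε ε := by
  obtain ⟨m, rfl⟩ := Nat.exists_eq_succ_of_ne_zero (NeZero.ne n)
  have hcast : ((m.succ : ℕ) : ℝ) - 1 = (m : ℝ) := by push_cast; ring
  rw [hcast] at h0
  -- For `n = 1` the relevant measure is the counting measure, and a null set is empty.
  rcases eq_or_ne m 0 with rfl | hm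
  · have hKe : K = ∅ := by
      by_contra hne
      have := Measure.one_le_hausdorffMeasure_zero_of_nonempty (nonempty_iff_ne_empty.2 hne)
      simp only [Nat.cast_zero] at h0
      rw [h0] at this
      simp at this
    exact ⟨∅, isOpen_empty, by simp [hKe], (hasCutoff_empty _).mono subset_rfl hε.le hε.le⟩
  · obtain ⟨C, hC0, hC⟩ := exists_hasCutoff_ball m
    have hε' : 0 < ε / (C + 1) := by positivity
    obtain ⟨s, x, r, hr, hcov, hsum⟩ := exists_finite_ball_cover hm hK h0 hε'
    have hfin := hasCutoff_biUnion s (fun k => Metric.ball (x k) (r k)) _ _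
      fun k _ => hC (x k) (r k) (hr k).1
    have hb : ∑ k ∈ s, C * r k ^ m ≤ ε := by
      rw [← Finset.mul_sum]
      calc C * ∑ k ∈ s, r k ^ m ≤ C * (ε / (C + 1)) := mul_le_mul_of_nonneg_left hsum hC0
        _ ≤ ε := by
          rw [mul_div_assoc', div_le_iff₀ (by positivity)]
          nlinarith
    refine ⟨_, isOpen_biUnion fun k _ => Metric.isOpen_ball, hcov, hfin.mono subset_rfl ?_ hb⟩
    -- As the radii are at most one, `r^(m+1) ≤ r^m`, and the gradient estimate also bounds the
    -- integral.
    refine le_trans (Finset.sum_le_sum fun k _ => ?_) hb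
    refine mul_le_mul_of_nonneg_left ?_ hC0
    rw [pow_succ]
    exact mul_le_of_le_one_right (pow_nonneg (hr k).1.le _) (hr k).2

/-- The cutoff functions are one on `K` and have arbitrarily small integral. -/
lemma volume_eq_zero_of_hausdorffMeasure_eq_zero {n : ℕ} [NeZero n] {K : Set (Euc n)}
    (hK : IsCompact K) (h0 : μH[(n : ℝ) - 1] K = 0) : volume K = 0 := by
  have hle : ∀ ε : ℝ, 0 < ε → volume.real K ≤ ε := by
    intro ε hε
    obtain ⟨U, -, hKU, η, h1, h2, h3, h4, h5, -⟩ := exists_cutoff_of_hausdorffMeasure_eq_zero hK h0 hε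
    have hi := (integrable_of_contDiff_hasCompactSupport h1 h2).1
    refine le_trans ?_ h5
    have : volume.real K = ∫ u in K, η u := by
      rw [setIntegral_congr_fun hK.measurableSet fun u hu => h4 u (hKU hu)]
      simp
    rw [this]
    exact setIntegral_le_integral hi (Eventually.of_forall fun u => (h3 u).1)
  have h := le_of_forall_pos_le_add (a := volume.real K) (b := 0) fun ε hε => by
    simpa using hle ε hε
  have h' := le_antisymm h measureReal_nonneg
  rwa [measureReal_eq_zero_iff hK.measure_ne_top] at h'

end Cutoff

end AnisoSurface

set_option linter.unusedSectionVars false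

namespace AnisoSurface

/-! ### Derivatives, normals and orientation in arbitrary smooth charts -/

section Charts

open Filter Topology

variable {n : ℕ} {M : Type*} [TopologicalSpace M] [ChartedSpace (EuclideanSpace ℝ (Fin n)) M]
  {F : Type*} [NormedAddCommGroup F] [NormedSpace ℝ F]

/-- The derivative of `f` at `p` in the chart `φ`. -/
noncomputable def derivIn (φ : OpenPartialHomeomorph M (Euc n)) (f : M → F) (p : M) :
    Euc n →L[ℝ] F :=
  fderiv ℝ (f ∘ φ.symm) (φ p)

/-- The derivative at `p` of the coordinate change from `φ` to `e`. -/
noncomputable def transD (φ e : OpenPartialHomeomorph M (Euc n)) (p : M) : Euc n →L[ℝ] Euc n :=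
  fderiv ℝ (e ∘ φ.symm) (φ p)

/-- The (non normalized) normal of `X` at `p` in the chart `φ`. -/
noncomputable def normalIn (φ : OpenPartialHomeomorph M (Euc n)) (X : M → Euc (n + 1)) (p : M) :
    Euc (n + 1) :=
  crossL (derivIn φ X p)

lemma contDiffAt_transition {φ e : OpenPartialHomeomorph M (Euc n)}
    (hφ : φ ∈ IsManifold.maximalAtlas (𝓡 n) ∞ M) (he : e ∈ IsManifold.maximalAtlas (𝓡 n) ∞ M)
    {p : M} (hp : p ∈ φ.source) (hp' : p ∈ e.source) : ContDiffAt ℝ ∞ (e ∘ φ.symm) (φ p) := by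
  have h := contMDiffOn_iff_contDiffOn.1
    (contMDiffOn_of_mem_contDiffGroupoid (IsManifold.compatible_of_mem_maximalAtlas hφ he))
  refine h.contDiffAt ((φ.symm ≫ₕ e).open_source.mem_nhds ?_)
  rw [OpenPartialHomeomorph.trans_source]
  exact ⟨φ.map_source hp, by simpa [φ.left_inv hp] using hp'⟩

lemma hasFDerivAt_transition {φ e : OpenPartialHomeomorph M (Euc n)}
    (hφ : φ ∈ IsManifold.maximalAtlas (𝓡 n) ∞ M) (he : e ∈ IsManifold.maximalAtlas (𝓡 n) ∞ M)
    {p : M} (hp : p ∈ φ.source) (hp' : p ∈ e.source) :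
    HasFDerivAt (e ∘ φ.symm) (transD φ e p) (φ p) :=
  ((contDiffAt_transition hφ he hp hp').differentiableAt (by simp)).hasFDerivAt

lemma eventually_comp_symm {φ e : OpenPartialHomeomorph M (Euc n)} {p : M} (hp : p ∈ φ.source)
    (hp' : p ∈ e.source) {α : Type*} (f : M → α) :
    (f ∘ e.symm) ∘ (e ∘ φ.symm) =ᶠ[𝓝 (φ p)] f ∘ φ.symm := by
  have h1 : ∀ᶠ u in 𝓝 (φ p), φ.symm u ∈ e.source := by
    refine (φ.continuousAt_symm (φ.map_source hp)).eventually ?_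
    rw [φ.left_inv hp]
    exact e.open_source.mem_nhds hp'
  filter_upwards [h1] with u hu
  simp [e.left_inv hu]

lemma differentiableAt_change {φ e : OpenPartialHomeomorph M (Euc n)}
    (hφ : φ ∈ IsManifold.maximalAtlas (𝓡 n) ∞ M) (he : e ∈ IsManifold.maximalAtlas (𝓡 n) ∞ M)
    {p : M} (hp : p ∈ φ.source) (hp' : p ∈ e.source) {f : M → F}
    (hf : DifferentiableAt ℝ (f ∘ e.symm) (e p)) : DifferentiableAt ℝ (f ∘ φ.symm) (φ p) := by
  refine DifferentiableAt.congr_of_eventuallyEq ?_ (eventually_comp_symm hp hp' f).symm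
  have h : (e ∘ φ.symm) (φ p) = e p := by simp [φ.left_inv hp]
  rw [← h] at hf
  exact hf.comp _ (hasFDerivAt_transition hφ he hp hp').differentiableAt

/-- Chain rule. No differentiability of `f` is needed: it does not depend on the chart, and where it
fails both derivatives have the default value zero. -/
lemma derivIn_change {φ e : OpenPartialHomeomorph M (Euc n)}
    (hφ : φ ∈ IsManifold.maximalAtlas (𝓡 n) ∞ M) (he : e ∈ IsManifold.maximalAtlas (𝓡 n) ∞ M)
    {p : M} (hp : p ∈ φ.source) (hp' : p ∈ e.source) (f : M → F) :
    derivIn φ f p = derivIn e f p ∘L transD φ e p := by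
  by_cases hf : DifferentiableAt ℝ (f ∘ e.symm) (e p)
  · have h : (e ∘ φ.symm) (φ p) = e p := by simp [φ.left_inv hp]
    have hd := hf.hasFDerivAt
    rw [← h] at hd
    have := (hd.comp _ (hasFDerivAt_transition hφ he hp hp')).congr_of_eventuallyEq
      (eventually_comp_symm hp hp' f).symm
    rw [derivIn, this.fderiv, h]
    rfl
  · have hf' : ¬ DifferentiableAt ℝ (f ∘ φ.symm) (φ p) := fun h =>
      hf (differentiableAt_change he hφ hp' hp h)
    rw [derivIn, derivIn, fderiv_zero_of_not_differentiableAt hf,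
      fderiv_zero_of_not_differentiableAt hf', ContinuousLinearMap.zero_comp]

lemma transD_comp {φ e : OpenPartialHomeomorph M (Euc n)}
    (hφ : φ ∈ IsManifold.maximalAtlas (𝓡 n) ∞ M) (he : e ∈ IsManifold.maximalAtlas (𝓡 n) ∞ M)
    {p : M} (hp : p ∈ φ.source) (hp' : p ∈ e.source) :
    (transD e φ p).det * (transD φ e p).det = 1 := by
  have h := derivIn_change hφ he hp hp' φ
  have h1 : derivIn φ φ p = ContinuousLinearMap.id ℝ (Euc n) := by
    have : φ ∘ φ.symm =ᶠ[𝓝 (φ p)] id := by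
      filter_upwards [φ.open_target.mem_nhds (φ.map_source hp)] with u hu
      exact φ.right_inv hu
    rw [derivIn, this.fderiv_eq, fderiv_id]
  have h2 : derivIn e φ p = transD e φ p := rfl
  rw [h1, h2] at h
  have := congrArg ContinuousLinearMap.det h
  have hid : (ContinuousLinearMap.id ℝ (Euc n)).det = 1 := LinearMap.det_id
  rw [hid] at this
  rw [this]
  exact (LinearMap.det_comp _ _).symm

lemma transD_trans {φ e ψ : OpenPartialHomeomorph M (Euc n)}
    (hφ : φ ∈ IsManifold.maximalAtlas (𝓡 n) ∞ M) (he : e ∈ IsManifold.maximalAtlas (𝓡 n) ∞ M)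
    {p : M} (hp : p ∈ φ.source) (hp' : p ∈ e.source) :
    (transD φ ψ p) = transD e ψ p ∘L transD φ e p :=
  derivIn_change hφ he hp hp' ψ

lemma normalIn_change {φ e : OpenPartialHomeomorph M (Euc n)}
    (hφ : φ ∈ IsManifold.maximalAtlas (𝓡 n) ∞ M) (he : e ∈ IsManifold.maximalAtlas (𝓡 n) ∞ M)
    {p : M} (hp : p ∈ φ.source) (hp' : p ∈ e.source) (X : M → Euc (n + 1)) :
    normalIn φ X p = (transD φ e p).det • normalIn e X p := by
  rw [normalIn, derivIn_change hφ he hp hp', crossL_comp, normalIn]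

/-- Both sides are zero at points of non-differentiability. For this, differentiability of the chart
expression has to yield the continuity of `X` that `MDifferentiableAt` demands separately. -/
lemma diffAt_eq_derivIn [IsManifold (𝓡 n) ∞ M] (X : M → Euc (n + 1)) (p : M) :
    diffAt X p = derivIn (chartAt (Euc n) p) X p := by
  have hp := mem_chart_source (Euc n) p
  by_cases h : MDifferentiableAt (𝓡 n) 𝓘(ℝ, Euc (n + 1)) X p
  · refine h.mfderiv.trans ?_
    simp [writtenInExtChartAt, extChartAt, derivIn, fderivWithin_univ, chartAt_self_eq,
      Function.comp_def]
    rfl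
  · refine (mfderiv_zero_of_not_mdifferentiableAt h).trans ?_
    rw [derivIn, fderiv_zero_of_not_differentiableAt]
    · rfl
    intro hd
    apply h
    rw [mdifferentiableAt_iff]
    constructor
    · have h1 : ContinuousAt ((X ∘ (chartAt (Euc n) p).symm) ∘ chartAt (Euc n) p) p :=
        ContinuousAt.comp hd.continuousAt ((chartAt (Euc n) p).continuousAt hp)
      refine h1.congr ?_
      filter_upwards [(chartAt (Euc n) p).open_source.mem_nhds hp] with q hq
      simp [(chartAt (Euc n) p).left_inv hq]
    · simp only [writtenInExtChartAt, extChartAt, chartAt_self_eq, mfld_simps]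
      exact hd.differentiableWithinAt

lemma coordFrame_eq_frame [IsManifold (𝓡 n) ∞ M] (X : M → Euc (n + 1)) (p : M) :
    coordFrame X p = frame (derivIn (chartAt (Euc n) p) X p) := by
  ext1 j
  rw [coordFrame, diffAt_eq_derivIn, frame]

lemma unitNormal_eq [IsManifold (𝓡 n) ∞ M] (X : M → Euc (n + 1)) (p : M) :
    unitNormal X p = ‖normalIn (chartAt (Euc n) p) X p‖⁻¹ • normalIn (chartAt (Euc n) p) X p := by
  rw [unitNormal, coordFrame_eq_frame]
  rfl

lemma mem_maximalAtlas_of_mem_atlas [IsManifold (𝓡 n) ∞ M] {e : OpenPartialHomeomorph M (Euc n)}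
    (he : e ∈ atlas (Euc n) M) : e ∈ IsManifold.maximalAtlas (𝓡 n) ∞ M :=
  IsManifold.subset_maximalAtlas he

lemma chartAt_mem_maximalAtlas [IsManifold (𝓡 n) ∞ M] (p : M) :
    chartAt (Euc n) p ∈ IsManifold.maximalAtlas (𝓡 n) ∞ M :=
  IsManifold.subset_maximalAtlas (chart_mem_atlas _ p)

/-- The coordinate change from `φ` to the oriented atlas has sign `σ` at all points of the domain
of `φ`. -/
def HasSign (φ : OpenPartialHomeomorph M (Euc n)) (σ : ℝ) : Prop :=
  ∀ p ∈ φ.source, ∀ e ∈ atlas (Euc n) M, p ∈ e.source → 0 < σ * (transD φ e p).det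

lemma hasSign_of_mem_atlas (hM : IsOrientedAtlas n M) {φ : OpenPartialHomeomorph M (Euc n)}
    (hφ : φ ∈ atlas (Euc n) M) : HasSign φ 1 := by
  intro p hp e he hpe
  rw [one_mul]
  refine hM φ hφ e he (φ p) ?_
  rw [OpenPartialHomeomorph.trans_source]
  exact ⟨φ.map_source hp, by simpa [φ.left_inv hp] using hpe⟩

/-- The change to the preferred chart multiplies the normal by a determinant `d` with `|d| = σ d`;
normalizing leaves only the sign. The hypothesis `σ * σ = 1` stands for `σ = ±1`. -/
lemma unitNormal_eq_of_hasSign [IsManifold (𝓡 n) ∞ M] {φ : OpenPartialHomeomorph M (Euc n)}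
    (hφ : φ ∈ IsManifold.maximalAtlas (𝓡 n) ∞ M) {σ : ℝ} (hσ : σ * σ = 1) (hs : HasSign φ σ) {p : M}
    (hp : p ∈ φ.source) (X : M → Euc (n + 1)) :
    unitNormal X p = σ • (‖normalIn φ X p‖⁻¹ • normalIn φ X p) := by
  have hd := hs p hp _ (chart_mem_atlas _ p) (mem_chart_source (Euc n) p)
  rw [unitNormal_eq, normalIn_change hφ (chartAt_mem_maximalAtlas p) hp (mem_chart_source _ p)]
  set d := (transD φ (chartAt (Euc n) p) p).det
  set N := normalIn (chartAt (Euc n) p) X p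
  by_cases hN : N = 0
  · simp [hN]
  rw [norm_smul, Real.norm_eq_abs]
  have habs : |d| = σ * d := by
    have h1 : |σ| = 1 := by
      have : |σ| * |σ| = 1 := by rw [← abs_mul, hσ, abs_one]
      nlinarith [abs_nonneg σ]
    rw [← abs_of_pos hd, abs_mul, h1, one_mul]
  have hd0 : d ≠ 0 := fun h => by simp [h] at hd
  have hN' := norm_ne_zero_iff.2 hN
  rw [habs, smul_smul, smul_smul]
  congr 1
  have hσ0 : σ ≠ 0 := fun h => by simp [h] at hσ
  field_simp

end Charts

/-! ### The area measure in charts -/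

section Area

open Filter Topology

variable {n : ℕ} {M : Type*} [TopologicalSpace M] [ChartedSpace (EuclideanSpace ℝ (Fin n)) M]

lemma image_eq_target_inter {φ : OpenPartialHomeomorph M (Euc n)} {B : Set M} (hB : B ⊆ φ.source) :
    φ '' B = φ.target ∩ φ.symm ⁻¹' B := by
  ext u
  constructor
  · rintro ⟨p, hp, rfl⟩
    exact ⟨φ.map_source (hB hp), by simpa [φ.left_inv (hB hp)] using hp⟩
  · rintro ⟨hu, hu'⟩
    exact ⟨φ.symm u, hu', φ.right_inv hu⟩

lemma image_image_transition {φ e : OpenPartialHomeomorph M (Euc n)} {B : Set M}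
    (hB : B ⊆ φ.source) : (e ∘ φ.symm) '' (φ '' B) = e '' B := by
  rw [← image_comp]
  refine image_congr fun p hp => ?_
  simp [φ.left_inv (hB hp)]

lemma injOn_transition {φ e : OpenPartialHomeomorph M (Euc n)} {B : Set M}
    (hB : B ⊆ φ.source) (hB' : B ⊆ e.source) : InjOn (e ∘ φ.symm) (φ '' B) := by
  rintro _ ⟨p, hp, rfl⟩ _ ⟨q, hq, rfl⟩ h
  simp only [Function.comp_apply, φ.left_inv (hB hp), φ.left_inv (hB hq)] at h
  rw [e.injOn (hB' hp) (hB' hq) h]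

lemma areaDensity_eq (X : M → Euc (n + 1)) {e : OpenPartialHomeomorph M (Euc n)} {u : Euc n}
    (hu : u ∈ e.target) : areaDensity X e u = ‖normalIn e X (e.symm u)‖ := by
  have : areaDensity X e u = √(Matrix.gram ℝ (frame (fderiv ℝ (X ∘ e.symm) u))).det := rfl
  rw [this, sqrt_det_gram, normalIn, derivIn, e.right_inv hu, crossL]

variable [MeasurableSpace M] [BorelSpace M]

lemma measurableSet_image {φ : OpenPartialHomeomorph M (Euc n)} {B : Set M} (hB : B ⊆ φ.source)
    (hm : MeasurableSet B) : MeasurableSet (φ '' B) := by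
  have h1 : Measurable (φ.target.domRestrict φ.symm) :=
    (continuousOn_iff_continuous_domRestrict.1 φ.continuousOn_symm).measurable
  have h2 := φ.open_target.measurableSet.subtype_image (h1 hm)
  convert h2 using 1
  rw [image_eq_target_inter hB]
  ext u
  simp [domRestrict_apply, and_comm]

lemma measurable_areaDensity (X : M → Euc (n + 1)) (e : OpenPartialHomeomorph M (Euc n)) :
    Measurable (areaDensity X e) := by
  have : areaDensity X e = fun u => ‖crossL (fderiv ℝ (X ∘ e.symm) u)‖ := by
    ext u
    rw [crossL, ← sqrt_det_gram]
    rfl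
  rw [this]
  exact (((contDiff_crossL (r := 0)).continuous).measurable.comp (measurable_fderiv ℝ _)).norm

/-- The area measure of `X` in the domain of a chart. -/
noncomputable def chartArea (X : M → Euc (n + 1)) (e : OpenPartialHomeomorph M (Euc n)) :
    Measure M :=
  Measure.map e.symm ((volume.withDensity fun u =>
    ENNReal.ofReal (areaDensity X e u)).restrict e.target)

lemma aemeasurable_symm (e : OpenPartialHomeomorph M (Euc n)) (μ : Measure (Euc n)) :
    AEMeasurable e.symm (μ.restrict e.target) :=
  e.continuousOn_symm.aemeasurable e.open_target.measurableSet

lemma chartArea_apply (X : M → Euc (n + 1)) (e : OpenPartialHomeomorph M (Euc n)) {B : Set M}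
    (hB : MeasurableSet B) : chartArea X e B =
      ∫⁻ u in e '' (B ∩ e.source), ENNReal.ofReal (areaDensity X e u) := by
  rw [chartArea, Measure.map_apply_of_aemeasurable (aemeasurable_symm e _) hB,
    Measure.restrict_apply' e.open_target.measurableSet, withDensity_apply']
  congr 2
  rw [image_eq_target_inter inter_subset_right]
  ext u
  simp only [mem_inter_iff, mem_preimage]
  exact ⟨fun h => ⟨h.2, h.1, e.map_target h.2⟩, fun h => ⟨h.2.1, h.1⟩⟩

lemma chartArea_apply_inter_source (X : M → Euc (n + 1)) (e : OpenPartialHomeomorph M (Euc n))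
    {B : Set M} (hB : MeasurableSet B) : chartArea X e B = chartArea X e (B ∩ e.source) := by
  rw [chartArea_apply X e hB, chartArea_apply X e (hB.inter e.open_source.measurableSet),
    inter_assoc, inter_self]

variable [IsManifold (𝓡 n) ∞ M]

/-- Change of variables: the density `‖N‖` acquires exactly the absolute Jacobian determinant. -/
lemma chartArea_eq_of_subset (X : M → Euc (n + 1)) {φ e : OpenPartialHomeomorph M (Euc n)}
    (hφ : φ ∈ IsManifold.maximalAtlas (𝓡 n) ∞ M) (he : e ∈ IsManifold.maximalAtlas (𝓡 n) ∞ M)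
    {B : Set M} (hm : MeasurableSet B) (hB : B ⊆ φ.source) (hB' : B ⊆ e.source) :
    chartArea X φ B = chartArea X e B := by
  rw [chartArea_apply X φ hm, chartArea_apply X e hm, inter_eq_left.2 hB, inter_eq_left.2 hB',
    ← image_image_transition (e := e) hB]
  rw [lintegral_image_eq_lintegral_abs_det_fderiv_mul volume (measurableSet_image hB hm)
    (f' := fun u => transD φ e (φ.symm u)) _ (injOn_transition hB hB')]
  · refine setLIntegral_congr_fun (measurableSet_image hB hm) ?_
    rintro _ ⟨p, hp, rfl⟩
    simp only [Function.comp_apply, φ.left_inv (hB hp)]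
    rw [← ENNReal.ofReal_mul (abs_nonneg _), areaDensity_eq X (φ.map_source (hB hp)),
      areaDensity_eq X (e.map_source (hB' hp)), φ.left_inv (hB hp), e.left_inv (hB' hp),
      normalIn_change hφ he (hB hp) (hB' hp), norm_smul, Real.norm_eq_abs]
  · rintro _ ⟨p, hp, rfl⟩
    rw [φ.left_inv (hB hp)]
    exact (hasFDerivAt_transition hφ he (hB hp) (hB' hp)).hasFDerivWithinAt

lemma areaMeasure_eq_iSup (X : M → Euc (n + 1)) :
    areaMeasure X = ⨆ p : M, chartArea X (chartAt (Euc n) p) := rfl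

/-- A finite family of pairwise disjoint measurable sets which cover the manifold and whose closures
are contained in the domains of charts. -/
structure ChartPartition (n : ℕ) (M : Type*) [TopologicalSpace M]
    [ChartedSpace (EuclideanSpace ℝ (Fin n)) M] [MeasurableSpace M] where
  /-- The number of sets. -/
  size : ℕ
  /-- The base points of the charts. -/
  pt : Fin size → M
  /-- The sets of the partition. -/
  part : Fin size → Set M
  measurableSet_part : ∀ a, MeasurableSet (part a)
  disjoint_part : Pairwise (Function.onFun Disjoint part)
  iUnion_part : ⋃ a, part a = univ
  closure_subset : ∀ a, closure (part a) ⊆ (chartAt (Euc n) (pt a)).source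

namespace ChartPartition

/-- The charts belonging to the sets of a partition. -/
noncomputable def chart (𝒞 : ChartPartition n M) (a : Fin 𝒞.size) :
    OpenPartialHomeomorph M (Euc n) := chartAt (Euc n) (𝒞.pt a)

lemma chart_mem (𝒞 : ChartPartition n M) (a : Fin 𝒞.size) :
    𝒞.chart a ∈ IsManifold.maximalAtlas (𝓡 n) ∞ M := chartAt_mem_maximalAtlas _

lemma chart_mem_atlas (𝒞 : ChartPartition n M) (a : Fin 𝒞.size) :
    𝒞.chart a ∈ atlas (Euc n) M := ChartedSpace.chart_mem_atlas _

lemma part_subset (𝒞 : ChartPartition n M) (a : Fin 𝒞.size) : 𝒞.part a ⊆ (𝒞.chart a).source :=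
  subset_closure.trans (𝒞.closure_subset a)

end ChartPartition

/-- A finite cover by closed neighbourhoods inside chart domains is made disjoint. Having the
closures inside the chart domains provides compact sets on which derivatives are bounded. -/
lemma exists_chartPartition (n : ℕ) (M : Type*) [TopologicalSpace M] [T2Space M] [CompactSpace M]
    [ChartedSpace (EuclideanSpace ℝ (Fin n)) M] [MeasurableSpace M] [BorelSpace M] :
    Nonempty (ChartPartition n M) := by
  have h1 : ∀ p : M, ∃ K ∈ 𝓝 p, K ⊆ (chartAt (Euc n) p).source ∧ IsClosed K := by
    intro p
    obtain ⟨K, hK, hKc, hKs⟩ := exists_mem_nhds_isClosed_subset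
      ((chartAt (Euc n) p).open_source.mem_nhds (mem_chart_source (Euc n) p))
    exact ⟨K, hK, hKs, hKc⟩
  choose K hK hKs hKc using h1
  obtain ⟨t, ht⟩ := isCompact_univ.elim_nhds_subcover K (fun p _ => hK p)
  let e := t.equivFin.symm
  let S : Fin t.card → Set M := fun a => K (e a)
  refine ⟨⟨t.card, fun a => e a, disjointed S, fun a => ?_, disjoint_disjointed S, ?_, fun a => ?_⟩⟩
  · rw [disjointed_apply, Finset.sup_set_eq_biUnion]
    exact (hKc _).measurableSet.diff
      (Finset.measurableSet_biUnion _ fun b _ => (hKc _).measurableSet)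
  · rw [iUnion_disjointed, eq_univ_iff_forall]
    intro q
    obtain ⟨p, hp, hq⟩ := mem_iUnion₂.1 (ht.2 (mem_univ q))
    refine mem_iUnion.2 ⟨t.equivFin ⟨p, hp⟩, ?_⟩
    simp only [S, e, Equiv.symm_apply_apply]
    exact hq
  · exact (closure_minimal (disjointed_subset S a) (hKc _)).trans (hKs _)

variable [T2Space M] [CompactSpace M]

/-- A supremum of measures is not computed set by set. The chart measures agree on overlaps, so
gluing their restrictions to the parts of a partition gives a measure that dominates all of them and
has the right value on `B`. -/
lemma areaMeasure_apply (X : M → Euc (n + 1)) (q : M) {B : Set M} (hm : MeasurableSet B)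
    (hB : B ⊆ (chartAt (Euc n) q).source) :
    areaMeasure X B = chartArea X (chartAt (Euc n) q) B := by
  obtain ⟨𝒞⟩ := exists_chartPartition n M
  refine le_antisymm ?_ ?_
  · have hle : areaMeasure X ≤
        Measure.sum fun a => (chartArea X (𝒞.chart a)).restrict (𝒞.part a) := by
      rw [areaMeasure_eq_iSup]
      refine iSup_le fun p => Measure.le_iff.2 fun S hS => ?_
      have hSp : S ∩ (chartAt (Euc n) p).source =
          ⋃ a, S ∩ (chartAt (Euc n) p).source ∩ 𝒞.part a := by
        rw [← inter_iUnion, 𝒞.iUnion_part, inter_univ]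
      have hms := hS.inter (chartAt (Euc n) p).open_source.measurableSet
      rw [chartArea_apply_inter_source _ _ hS, hSp, Measure.sum_apply _ hS,
        measure_iUnion (fun a b hab => ((𝒞.disjoint_part hab).mono inter_subset_right
          inter_subset_right)) fun a => hms.inter (𝒞.measurableSet_part a)]
      refine ENNReal.tsum_le_tsum fun a => ?_
      rw [chartArea_eq_of_subset X (chartAt_mem_maximalAtlas p) (𝒞.chart_mem a)
        (hms.inter (𝒞.measurableSet_part a)) (inter_subset_left.trans inter_subset_right)
        (inter_subset_right.trans (𝒞.part_subset a)), Measure.restrict_apply hS]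
      exact measure_mono (inter_subset_inter_left _ inter_subset_left)
    refine (hle B).trans ?_
    rw [Measure.sum_apply _ hm]
    have hBU : B = ⋃ a, B ∩ 𝒞.part a := by
      rw [← inter_iUnion, 𝒞.iUnion_part, inter_univ]
    conv_rhs => rw [hBU]
    rw [measure_iUnion (fun a b hab => ((𝒞.disjoint_part hab).mono inter_subset_right
          inter_subset_right)) fun a => hm.inter (𝒞.measurableSet_part a)]
    refine ENNReal.tsum_le_tsum fun a => ?_
    rw [Measure.restrict_apply hm, chartArea_eq_of_subset X (𝒞.chart_mem a)
      (chartAt_mem_maximalAtlas q) (hm.inter (𝒞.measurableSet_part a))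
      (inter_subset_right.trans (𝒞.part_subset a)) (inter_subset_left.trans hB)]
  · rw [areaMeasure_eq_iSup]
    exact le_iSup (fun p : M => chartArea X (chartAt (Euc n) p)) q B

lemma areaMeasure_restrict (X : M → Euc (n + 1)) (q : M) {A : Set M} (hm : MeasurableSet A)
    (hA : A ⊆ (chartAt (Euc n) q).source) :
    (areaMeasure X).restrict A = (chartArea X (chartAt (Euc n) q)).restrict A := by
  ext S hS
  rw [Measure.restrict_apply hS, Measure.restrict_apply hS,
    areaMeasure_apply X q (hS.inter hm) (inter_subset_right.trans hA)]

/-- Integrals with respect to the area measure in the domain of a chart. -/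
lemma setIntegral_areaMeasure (X : M → Euc (n + 1)) (q : M) {A : Set M} (hm : MeasurableSet A)
    (hA : A ⊆ (chartAt (Euc n) q).source) {f : M → ℝ}
    (hf : AEStronglyMeasurable f ((areaMeasure X).restrict A)) :
    ∫ p in A, f p ∂(areaMeasure X) = ∫ u in chartAt (Euc n) q '' A,
      ‖normalIn (chartAt (Euc n) q) X ((chartAt (Euc n) q).symm u)‖ *
        f ((chartAt (Euc n) q).symm u) := by
  set e := chartAt (Euc n) q
  have hres := areaMeasure_restrict X q hm hA
  rw [hres] at hf ⊢
  have hpre : e.symm ⁻¹' A ∩ e.target = e '' A := by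
    rw [image_eq_target_inter hA, inter_comm]
  have hmap : (chartArea X e).restrict A = Measure.map e.symm
      (((volume.withDensity fun u => ENNReal.ofReal (areaDensity X e u))).restrict (e '' A)) := by
    ext S hS
    rw [Measure.restrict_apply hS, chartArea,
      Measure.map_apply_of_aemeasurable (aemeasurable_symm e _) (hS.inter hm),
      Measure.map_apply_of_aemeasurable _ hS, Measure.restrict_apply' e.open_target.measurableSet,
      Measure.restrict_apply' (measurableSet_image hA hm), preimage_inter, inter_assoc, hpre]
    refine (e.continuousOn_symm.mono ?_).aemeasurable (measurableSet_image hA hm)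
    rw [← hpre]
    exact inter_subset_right
  rw [hmap] at hf ⊢
  rw [integral_map _ hf]
  · rw [setIntegral_withDensity_eq_setIntegral_toReal_smul
      (measurable_areaDensity X e).ennreal_ofReal (by simp) _ (measurableSet_image hA hm)]
    refine setIntegral_congr_fun (measurableSet_image hA hm) fun u hu => ?_
    have hut : u ∈ e.target := by
      rw [← hpre] at hu
      exact hu.2
    simp only [smul_eq_mul]
    rw [areaDensity_eq X hut, ENNReal.toReal_ofReal (norm_nonneg _)]
  · refine (e.continuousOn_symm.mono ?_).aemeasurable (measurableSet_image hA hm)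
    rw [← hpre]
    exact inter_subset_right

lemma areaMeasure_eq_zero (X : M → Euc (n + 1)) {A : Set M} (hm : MeasurableSet A)
    (h0 : ∀ q : M, volume (chartAt (Euc n) q '' (A ∩ (chartAt (Euc n) q).source)) = 0) :
    areaMeasure X A = 0 := by
  obtain ⟨𝒞⟩ := exists_chartPartition n M
  have hA : A = ⋃ a, A ∩ 𝒞.part a := by
    rw [← inter_iUnion, 𝒞.iUnion_part, inter_univ]
  rw [hA]
  refine measure_iUnion_null fun a => ?_
  rw [areaMeasure_apply X (𝒞.pt a) (hm.inter (𝒞.measurableSet_part a))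
    (inter_subset_right.trans (𝒞.part_subset a)),
    chartArea_apply _ _ (hm.inter (𝒞.measurableSet_part a))]
  refine setLIntegral_measure_zero _ _ (measure_mono_null (image_mono ?_) (h0 (𝒞.pt a)))
  exact inter_subset_inter_left _ inter_subset_left

end Area

/-! ### Geometry of the decomposition: edges, corners, null sets -/

section Pieces

open Filter Topology

variable {n : ℕ} [NeZero n] {M : Type*} [TopologicalSpace M]
  [ChartedSpace (EuclideanSpace ℝ (Fin n)) M]

lemma isOpen_coord_pos (φ : OpenPartialHomeomorph M (Euc n)) :
    IsOpen {q | q ∈ φ.source ∧ 0 < φ q 0} := by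
  have h : ContinuousOn (fun q => φ q 0) φ.source :=
    (continuous_apply (0 : Fin n)).comp_continuousOn
      ((PiLp.continuous_ofLp 2 _).comp_continuousOn φ.continuousOn)
  exact h.isOpen_inter_preimage φ.open_source isOpen_Ioi

lemma isOpen_coord_neg (φ : OpenPartialHomeomorph M (Euc n)) :
    IsOpen {q | q ∈ φ.source ∧ φ q 0 < 0} := by
  have h : ContinuousOn (fun q => φ q 0) φ.source :=
    (continuous_apply (0 : Fin n)).comp_continuousOn
      ((PiLp.continuous_ofLp 2 _).comp_continuousOn φ.continuousOn)
  exact h.isOpen_inter_preimage φ.open_source isOpen_Iio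

lemma IsBoundaryChart.mem_interior {A : Set M} {p : M} {φ : OpenPartialHomeomorph M (Euc n)}
    (h : IsBoundaryChart A p φ) {q : M} (hq : q ∈ φ.source) (h0 : 0 < φ q 0) : q ∈ interior A :=
  _root_.mem_interior.2 ⟨_, fun r hr => (h.2.2.2 r hr.1).2 hr.2.le, isOpen_coord_pos φ, hq, h0⟩

lemma IsBoundaryChart.eq_zero {A : Set M} {p : M} {φ : OpenPartialHomeomorph M (Euc n)}
    (h : IsBoundaryChart A p φ) (hA : IsClosed A) {q : M} (hq : q ∈ φ.source)
    (hf : q ∈ frontier A) : φ q 0 = 0 := by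
  refine le_antisymm ?_ ((h.2.2.2 q hq).1 (hA.frontier_subset hf))
  by_contra! hpos
  exact hf.2 (h.mem_interior hq hpos)

/-- Smoothness of the boundary is an open condition: a boundary chart at `p` also serves at the
nearby boundary points, whose `0`-th coordinate vanishes. -/
lemma isClosed_cornerSet {A : Set M} (hA : IsClosed A) : IsClosed (cornerSet (n := n) A) := by
  rw [← isOpen_compl_iff, isOpen_iff_mem_nhds]
  intro p hp
  by_cases hf : p ∈ frontier A
  · have hφ : ∃ φ, IsBoundaryChart (n := n) A p φ := by
      by_contra hc
      exact hp ⟨hf, hc⟩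
    obtain ⟨φ, hφ⟩ := hφ
    filter_upwards [φ.open_source.mem_nhds hφ.2.1] with q hq hqc
    exact hqc.2 ⟨φ, hφ.1, hq, hφ.eq_zero hA hq hqc.1, hφ.2.2.2⟩
  · filter_upwards [isClosed_frontier.isOpen_compl.mem_nhds hf] with q hq hqc
    exact hq hqc.1

/-- The union of the interiors of the pieces. -/
def regSet {k : ℕ} (P : Fin k → Set M) : Set M := ⋃ i, interior (P i)

lemma isOpen_regSet {k : ℕ} (P : Fin k → Set M) : IsOpen (regSet P) :=
  isOpen_iUnion fun _ => isOpen_interior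

/-- The union of the corner sets of the pieces. -/
def allCorners {k : ℕ} (P : Fin k → Set M) : Set M := ⋃ i, cornerSet (n := n) (P i)

lemma isClosed_piece [T2Space M] {k : ℕ} {P : Fin k → Set M} (hP : IsPieceDecomposition (n := n) P)
    (i : Fin k) : IsClosed (P i) := (hP.isPiece i).isCompact.isClosed

lemma isClosed_allCorners [T2Space M] {k : ℕ} {P : Fin k → Set M}
    (hP : IsPieceDecomposition (n := n) P) : IsClosed (allCorners (n := n) P) :=
  isClosed_iUnion_of_finite fun i => isClosed_cornerSet (isClosed_piece hP i)

lemma mem_frontier_of_notMem_regSet [T2Space M] {k : ℕ} {P : Fin k → Set M}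
    (hP : IsPieceDecomposition (n := n) P) {p : M} (hp : p ∉ regSet P) {i : Fin k}
    (hi : p ∈ P i) : p ∈ frontier (P i) := by
  rw [(isClosed_piece hP i).frontier_eq]
  exact ⟨hi, fun h => hp (mem_iUnion.2 ⟨i, h⟩)⟩

lemma notMem_of_mem_interior {k : ℕ} {P : Fin k → Set M} (hP : IsPieceDecomposition (n := n) P)
    {p : M} {i j : Fin k} (hij : i ≠ j) (hp : p ∈ interior (P i)) : p ∉ P j := by
  intro hj
  have : p ∈ P i ∩ P j := ⟨interior_subset hp, hj⟩
  rw [hP.inter i j hij] at this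
  exact this.1.2 hp

lemma tendsto_shift (φ : OpenPartialHomeomorph M (Euc n)) {q : M} (hq : q ∈ φ.source) (v : Euc n) :
    Tendsto (fun t : ℝ => φ.symm (φ q + t • v)) (𝓝 0) (𝓝 q) := by
  have h1 : Tendsto (fun t : ℝ => φ q + t • v) (𝓝 0) (𝓝 (φ q)) := by
    have : Continuous fun t : ℝ => φ q + t • v := by fun_prop
    simpa using this.tendsto 0
  have h2 := φ.continuousAt_symm (φ.map_source hq)
  rw [ContinuousAt, φ.left_inv hq] at h2
  exact h2.comp h1

lemma eventually_shift (φ : OpenPartialHomeomorph M (Euc n)) {q : M} (hq : q ∈ φ.source)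
    (v : Euc n) {U : Set M} (hU : U ∈ 𝓝 q) :
    ∀ᶠ t : ℝ in 𝓝[>] 0, φ.symm (φ q + t • v) ∈ U ∧ φ.symm (φ q + t • v) ∈ φ.source ∧
      φ (φ.symm (φ q + t • v)) = φ q + t • v := by
  have h1 : Tendsto (fun t : ℝ => φ q + t • v) (𝓝 0) (𝓝 (φ q)) := by
    have : Continuous fun t : ℝ => φ q + t • v := by fun_prop
    simpa using this.tendsto 0
  have h3 := h1.eventually (φ.open_target.mem_nhds (φ.map_source hq))
  have h4 := (tendsto_shift φ hq v).eventually hU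
  filter_upwards [nhdsWithin_le_nhds h3, nhdsWithin_le_nhds h4] with t h3 h4
  exact ⟨h4, φ.map_target h3, φ.right_inv h3⟩

/-- Two pieces with smooth boundary which meet at `p` lie on opposite sides of their boundary. -/
lemma eventually_shift_mem_interior {k : ℕ} {P : Fin k → Set M}
    (hP : IsPieceDecomposition (n := n) P) {p : M} {i j : Fin k} (hij : i ≠ j)
    {φ ψ : OpenPartialHomeomorph M (Euc n)} (hφ : IsBoundaryChart (P i) p φ)
    (hψ : IsBoundaryChart (P j) p ψ) :
    ∀ᶠ t : ℝ in 𝓝[>] 0,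
      φ.symm (φ p + t • (-EuclideanSpace.single 0 1 : Euc n)) ∈ interior (P j) := by
  -- The differential at `p`, in the chart `φ`, of the defining function of `P j`.
  let L : Euc n →L[ℝ] ℝ := EuclideanSpace.proj (0 : Fin n) ∘L transD φ ψ p
  have hL : ∀ v : Euc n, HasDerivAt (fun t : ℝ => ψ (φ.symm (φ p + t • v)) 0) (L v) 0 := by
    intro v
    have h1 := hasFDerivAt_transition hφ.1 hψ.1 hφ.2.1 hψ.2.1
    have h2 : HasDerivAt (fun t : ℝ => φ p + t • v) v 0 := by
      simpa using ((hasDerivAt_id (0 : ℝ)).smul_const v).const_add (φ p)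
    have h3 : HasFDerivAt (ψ ∘ φ.symm) (transD φ ψ p) (φ p + (0 : ℝ) • v) := by simpa using h1
    have h4 := h3.comp_hasDerivAt 0 h2
    exact (EuclideanSpace.proj (0 : Fin n) : Euc n →L[ℝ] ℝ).hasFDerivAt.comp_hasDerivAt 0 h4
  have h00 : ψ (φ.symm (φ p)) 0 = 0 := by rw [φ.left_inv hφ.2.1, hψ.2.2.1]
  have hpos : ∀ v : Euc n, 0 < L v →
      ∀ᶠ t : ℝ in 𝓝[>] 0, 0 < ψ (φ.symm (φ p + t • v)) 0 := by
    intro v hv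
    have := (hasDerivAt_iff_tendsto_slope.1 (hL v)).eventually (lt_mem_nhds hv)
    have h2 := nhdsWithin_mono (0 : ℝ) (fun t (ht : 0 < t) => (ne_of_gt ht : t ≠ 0)) this
    filter_upwards [h2, self_mem_nhdsWithin] with t ht ht0
    rw [slope_def_field, zero_smul, add_zero, h00] at ht
    simp only [sub_zero] at ht
    exact (div_pos_iff_of_pos_right ht0).1 ht
  -- A direction pointing into `P i` cannot increase the defining function of `P j`, as the interior
  -- of `P i` is disjoint from `P j`.
  have hle : ∀ v : Euc n, 0 < v 0 → L v ≤ 0 := by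
    intro v hv
    by_contra! hc
    obtain ⟨t, ⟨h1, h2, h3, h4⟩, ht0⟩ := ((hpos v hc).and (eventually_shift φ hφ.2.1 v
      (ψ.open_source.mem_nhds hψ.2.1)) |>.and self_mem_nhdsWithin).exists
    have h5 : φ.symm (φ p + t • v) ∈ interior (P i) := by
      refine hφ.mem_interior h3 ?_
      rw [h4]
      have : (0 : ℝ) < t := ht0
      simp only [PiLp.add_apply, PiLp.smul_apply, smul_eq_mul, hφ.2.2.1]
      positivity
    exact notMem_of_mem_interior hP hij h5 ((hψ.2.2.2 _ h2).2 h1.le)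
  -- If `L` vanished on this vector, adding large multiples of it would give `L ≤ 0` everywhere,
  -- hence `L = 0`; but `L` is a component of an invertible differential.
  have hneg : L (EuclideanSpace.single 0 1) < 0 := by
    refine lt_of_le_of_ne (hle _ (by simp)) fun h0 => ?_
    have hL0 : ∀ v, L v ≤ 0 := by
      intro v
      have h1 := hle (v + (|v 0| + 1) • EuclideanSpace.single 0 1) (by
        simp only [PiLp.add_apply, PiLp.smul_apply, PiLp.single_apply, if_true, smul_eq_mul,
          mul_one]
        have := neg_abs_le (v 0)
        linarith)
      rwa [map_add, map_smul, h0, smul_zero, add_zero] at h1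
    have hL1 : ∀ v, L v = 0 := fun v =>
      le_antisymm (hL0 v) (by have := hL0 (-v); rw [map_neg] at this; linarith)
    have hdet := transD_comp hφ.1 hψ.1 hφ.2.1 hψ.2.1
    have hne : (transD φ ψ p).det ≠ 0 := right_ne_zero_of_mul (hdet ▸ one_ne_zero)
    have hsurj : Function.Surjective (transD φ ψ p) :=
      ((LinearEquiv.ofIsUnitDet (f := (transD φ ψ p : Euc n →ₗ[ℝ] Euc n))
        (v := (EuclideanSpace.basisFun (Fin n) ℝ).toBasis)
        (v' := (EuclideanSpace.basisFun (Fin n) ℝ).toBasis) (by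
          rw [LinearMap.det_toMatrix]; exact isUnit_iff_ne_zero.2 hne))).surjective
    obtain ⟨v, hv⟩ := hsurj (EuclideanSpace.single 0 1)
    have := hL1 v
    simp [L, hv] at this
  have hgt : 0 < L (-EuclideanSpace.single 0 1) := by
    rw [map_neg]
    linarith
  filter_upwards [hpos _ hgt, eventually_shift φ hφ.2.1 (-EuclideanSpace.single 0 1)
    (ψ.open_source.mem_nhds hψ.2.1)] with t h1 h2
  exact hψ.mem_interior h2.1 h1

/-- A point which is neither in the interior of a piece nor a corner has an edge chart. -/
lemma exists_isEdgeChart [T2Space M] {k : ℕ} {P : Fin k → Set M}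
    (hP : IsPieceDecomposition (n := n) P) {p : M} (hp : p ∉ regSet P)
    (hc : p ∉ allCorners (n := n) P) : ∃ i j φ, IsEdgeChart (n := n) P i j p φ := by
  have hch : ∀ i, p ∈ P i → ∃ φ, IsBoundaryChart (n := n) (P i) p φ := by
    intro i hi
    by_contra hcon
    exact hc (mem_iUnion.2 ⟨i, mem_frontier_of_notMem_regSet hP hp hi, hcon⟩)
  have hcov : ∀ q, ∃ i, q ∈ P i := fun q => mem_iUnion.1 (hP.cover ▸ mem_univ q)
  obtain ⟨i, hi⟩ := hcov p
  obtain ⟨φ, hφ⟩ := hch i hi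
  -- Otherwise the other pieces, being finitely many closed sets, stay away from `p`, and `p` would
  -- be interior to `P i`.
  have hj : ∃ j, i ≠ j ∧ p ∈ P j := by
    by_contra! hno
    have hcl : IsClosed (⋃ j ∈ {j | i ≠ j}, P j) :=
      (toFinite _).isClosed_biUnion fun j _ => isClosed_piece hP j
    have hpn : p ∉ ⋃ j ∈ {j | i ≠ j}, P j := by
      simp only [mem_iUnion, not_exists]
      exact fun j hj => hno j hj
    refine hp (mem_iUnion.2 ⟨i, mem_interior_iff_mem_nhds.2 ?_⟩)
    filter_upwards [hcl.isOpen_compl.mem_nhds hpn] with q hq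
    obtain ⟨l, hl⟩ := hcov q
    by_cases hil : i = l
    · rwa [hil]
    · exact absurd (mem_biUnion (show l ∈ {j | i ≠ j} from hil) hl) hq
  obtain ⟨j, hij, hj⟩ := hj
  obtain ⟨ψ, hψ⟩ := hch j hj
  -- A third piece would, like `P j`, contain in its interior the points on the far side of the
  -- boundary of `P i`.
  have huniq : ∀ l, i ≠ l → j ≠ l → p ∉ P l := by
    intro l hil hjl hl
    obtain ⟨χ, hχ⟩ := hch l hl
    obtain ⟨t, h1, h2⟩ := ((eventually_shift_mem_interior hP hij hφ hψ).and
      (eventually_shift_mem_interior hP hil hφ hχ)).exists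
    exact notMem_of_mem_interior hP hjl h1 (interior_subset h2)
  have hcl : IsClosed (⋃ l ∈ {l | i ≠ l ∧ j ≠ l}, P l) :=
    (toFinite _).isClosed_biUnion fun l _ => isClosed_piece hP l
  set U := (⋃ l ∈ {l | i ≠ l ∧ j ≠ l}, P l)ᶜ with hU
  have hUo : IsOpen U := hcl.isOpen_compl
  have hpU : p ∈ U := by
    simp only [hU, mem_compl_iff, mem_iUnion, not_exists]
    exact fun l hl => huniq l hl.1 hl.2
  have hUij : ∀ q ∈ U, q ∈ P i ∨ q ∈ P j := by
    intro q hq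
    obtain ⟨l, hl⟩ := hcov q
    by_cases hil : i = l
    · left; rwa [hil]
    by_cases hjl : j = l
    · right; rwa [hjl]
    exact absurd (mem_biUnion (show l ∈ {l | i ≠ l ∧ j ≠ l} from ⟨hil, hjl⟩) hl) hq
  have hsrc : ∀ q, q ∈ (φ.restr U).source ↔ q ∈ φ.source ∧ q ∈ U := by
    intro q
    rw [φ.restr_source' U hUo]
    rfl
  refine ⟨i, j, φ.restr U, restr_mem_maximalAtlas _ hφ.1 hUo, (hsrc p).2 ⟨hφ.2.1, hpU⟩, hφ.2.2.1,
    fun q hq => ?_⟩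
  obtain ⟨hqs, hqU⟩ := (hsrc q).1 hq
  have hcoe : φ.restr U q = φ q := rfl
  rw [hcoe]
  refine ⟨hφ.2.2.2 q hqs, fun hqj => ?_, fun hq0 => ?_⟩
  · by_contra! hpos
    exact notMem_of_mem_interior hP hij (hφ.mem_interior hqs hpos) hqj
  · have hlt : ∀ r ∈ φ.source, r ∈ U → φ r 0 < 0 → r ∈ P j := by
      intro r hr hrU hr0
      rcases hUij r hrU with h | h
      · exact absurd ((hφ.2.2.2 r hr).1 h) (not_le.2 hr0)
      · exact h
    -- Points with coordinate zero are limits of points with negative coordinate, and `P j` is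
    -- closed.
    have htend := (tendsto_shift φ hqs (-EuclideanSpace.single 0 1)).mono_left
      (nhdsWithin_le_nhds (s := Ioi 0))
    refine (isClosed_piece hP j).mem_of_tendsto htend ?_
    filter_upwards [eventually_shift φ hqs (-EuclideanSpace.single 0 1) (hUo.mem_nhds hqU),
      self_mem_nhdsWithin] with t ht ht0
    refine hlt _ ht.2.1 ht.1 ?_
    rw [ht.2.2]
    have : (0 : ℝ) < t := ht0
    simp only [PiLp.add_apply, PiLp.smul_apply, PiLp.neg_apply, PiLp.single_apply, if_true,
      smul_eq_mul]
    linarith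

lemma volume_coord_zero : volume {u : Euc n | u 0 = 0} = 0 := by
  let f : Euc n →ₗ[ℝ] ℝ := (EuclideanSpace.proj (0 : Fin n) : Euc n →L[ℝ] ℝ)
  have hne : LinearMap.ker f ≠ ⊤ := by
    intro htop
    have : (EuclideanSpace.single 0 1 : Euc n) ∈ LinearMap.ker f := by
      rw [htop]
      exact Submodule.mem_top
    simp [f] at this
  exact Measure.addHaar_submodule (volume : Measure (Euc n)) (LinearMap.ker f) hne

variable [T2Space M] [CompactSpace M] [IsManifold (𝓡 n) ∞ M]

/-- Lebesgue null sets in a manifold may be recognized locally, in arbitrary charts. -/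
lemma volume_image_eq_zero_of_locally {S : Set M}
    (h : ∀ p ∈ S, ∃ U ∈ 𝓝 p, ∃ φ ∈ IsManifold.maximalAtlas (𝓡 n) ∞ M, p ∈ φ.source ∧
      volume (φ '' (S ∩ U ∩ φ.source)) = 0)
    {e : OpenPartialHomeomorph M (Euc n)} (he : e ∈ IsManifold.maximalAtlas (𝓡 n) ∞ M) :
    volume (e '' (S ∩ e.source)) = 0 := by
  refine measure_null_of_locally_null _ ?_
  rintro _ ⟨p, ⟨hpS, hpe⟩, rfl⟩
  obtain ⟨U, hU, φ, hφ, hpφ, h0⟩ := h p hpS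
  have hVn : interior U ∩ φ.source ∩ e.source ∈ 𝓝 p :=
    Filter.inter_mem (Filter.inter_mem (interior_mem_nhds.2 hU) (φ.open_source.mem_nhds hpφ))
      (e.open_source.mem_nhds hpe)
  refine ⟨e '' (S ∩ (interior U ∩ φ.source ∩ e.source)), ?_, ?_⟩
  · have h1 : e.target ∩ e.symm ⁻¹' (interior U ∩ φ.source ∩ e.source) ∈ 𝓝 (e p) := by
      refine Filter.inter_mem (e.open_target.mem_nhds (e.map_source hpe))
        ((e.continuousAt_symm (e.map_source hpe)).preimage_mem_nhds ?_)
      rwa [e.left_inv hpe]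
    filter_upwards [nhdsWithin_le_nhds h1, self_mem_nhdsWithin] with u hu hu2
    obtain ⟨q, ⟨hqS, hqe⟩, rfl⟩ := hu2
    have := hu.2
    rw [mem_preimage, e.left_inv hqe] at this
    exact ⟨q, ⟨hqS, this⟩, rfl⟩
  · have hsub : S ∩ (interior U ∩ φ.source ∩ e.source) ⊆ φ.source :=
      inter_subset_right.trans (inter_subset_left.trans inter_subset_right)
    rw [← image_image_transition (φ := φ) (e := e) hsub]
    refine addHaar_image_eq_zero_of_differentiableOn_of_addHaar_eq_zero _ ?_ ?_
    · rintro _ ⟨q, hq, rfl⟩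
      exact (hasFDerivAt_transition hφ he (hsub hq)
        hq.2.2).differentiableAt.differentiableWithinAt
    · refine measure_mono_null (image_mono fun q hq => ?_) h0
      exact ⟨⟨hq.1, interior_subset hq.2.1.1⟩, hq.2.1.2⟩

lemma volume_image_cornerSet {A : Set M} (hA : IsPiece (n := n) A)
    {e : OpenPartialHomeomorph M (Euc n)} (he : e ∈ IsManifold.maximalAtlas (𝓡 n) ∞ M) :
    volume (e '' (cornerSet (n := n) A ∩ e.source)) = 0 := by
  refine volume_image_eq_zero_of_locally (fun p hp => ?_) he
  set c := chartAt (Euc n) p with hc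
  obtain ⟨K, hK, hKc, hKs⟩ := exists_mem_nhds_isClosed_subset
    (c.open_source.mem_nhds (mem_chart_source (Euc n) p))
  refine ⟨K, hK, c, chartAt_mem_maximalAtlas p, mem_chart_source _ p, ?_⟩
  have hcl := isClosed_cornerSet (n := n) hA.isCompact.isClosed
  have hcomp : IsCompact (c '' (cornerSet (n := n) A ∩ K)) :=
    (hcl.inter hKc).isCompact.image_of_continuousOn
      (c.continuousOn.mono (inter_subset_right.trans hKs))
  refine measure_mono_null (image_mono inter_subset_left)
    (volume_eq_zero_of_hausdorffMeasure_eq_zero hcomp (measure_mono_null (image_mono ?_)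
      (hA.corner_null c (chart_mem_atlas _ p))))
  exact inter_subset_inter_right _ hKs

/-- The smooth part of the boundary lies in a hyperplane in suitable charts, and the corners are
null by the Hausdorff condition. -/
lemma volume_image_frontier {A : Set M} (hA : IsPiece (n := n) A)
    {e : OpenPartialHomeomorph M (Euc n)} (he : e ∈ IsManifold.maximalAtlas (𝓡 n) ∞ M) :
    volume (e '' (frontier A ∩ e.source)) = 0 := by
  have hAc : IsClosed A := hA.isCompact.isClosed
  have h1 : volume (e '' ((frontier A \ cornerSet (n := n) A) ∩ e.source)) = 0 := by
    refine volume_image_eq_zero_of_locally (fun p hp => ?_) he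
    have hφ : ∃ φ, IsBoundaryChart (n := n) A p φ := by
      by_contra hc
      exact hp.2 ⟨hp.1, hc⟩
    obtain ⟨φ, hφ⟩ := hφ
    refine ⟨univ, univ_mem, φ, hφ.1, hφ.2.1, measure_mono_null ?_ (volume_coord_zero (n := n))⟩
    rintro _ ⟨q, hq, rfl⟩
    exact hφ.eq_zero hAc hq.2 hq.1.1.1
  refine measure_mono_null ?_ (measure_union_null h1 (volume_image_cornerSet hA he))
  rintro _ ⟨q, hq, rfl⟩
  by_cases hqc : q ∈ cornerSet (n := n) A
  · exact Or.inr ⟨q, ⟨hqc, hq.2⟩, rfl⟩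
  · exact Or.inl ⟨q, ⟨⟨hq.1, hqc⟩, hq.2⟩, rfl⟩

lemma volume_image_compl_regSet {k : ℕ} {P : Fin k → Set M} (hP : IsPieceDecomposition (n := n) P)
    {e : OpenPartialHomeomorph M (Euc n)} (he : e ∈ IsManifold.maximalAtlas (𝓡 n) ∞ M) :
    volume (e '' ((regSet P)ᶜ ∩ e.source)) = 0 := by
  have hsub : e '' ((regSet P)ᶜ ∩ e.source) ⊆ ⋃ i, e '' (frontier (P i) ∩ e.source) := by
    rintro _ ⟨q, ⟨hq, hqe⟩, rfl⟩
    obtain ⟨i, hi⟩ := mem_iUnion.1 (hP.cover ▸ mem_univ q)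
    exact mem_iUnion.2 ⟨i, q, ⟨mem_frontier_of_notMem_regSet hP hq hi, hqe⟩, rfl⟩
  exact measure_mono_null hsub
    (measure_iUnion_null fun i => volume_image_frontier (hP.isPiece i) he)

end Pieces

/-! ### Regularity on the pieces up to their boundaries -/

section Regularity

open Filter Topology

/-- Being `C¹` within `s` supplies a continuous candidate `f'` for the derivative near `x`, which
coincides with the derivative at interior points of `s`. No unique differentiability of `s` is
needed, so corners are allowed. -/
lemma ContDiffWithinAt.exists_fderiv_bound {E F : Type*} [NormedAddCommGroup E] [NormedSpace ℝ E]
    [NormedAddCommGroup F] [NormedSpace ℝ F] {f : E → F} {s : Set E} {x : E}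
    (h : ContDiffWithinAt ℝ 1 f s x) (hx : x ∈ s) :
    ∃ C, ∀ᶠ y in 𝓝 x, y ∈ interior s →
      DifferentiableAt ℝ f y ∧ ‖f y‖ ≤ C ∧ ‖fderiv ℝ f y‖ ≤ C := by
  have h1 : ContDiffWithinAt ℝ (0 + 1) f s x := by simpa using h
  obtain ⟨u, hu, -, f', hf', hc⟩ := (contDiffWithinAt_succ_iff_hasFDerivWithinAt (by simp)).1 h1
  rw [insert_eq_of_mem hx] at hu
  have hcu : ContinuousWithinAt f' u x := hc.continuousWithinAt
  have hb1 : ∀ᶠ y in 𝓝[u] x, ‖f' y‖ < ‖f' x‖ + 1 :=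
    hcu.norm.eventually (gt_mem_nhds (by linarith))
  have hb2 : ∀ᶠ y in 𝓝[s] x, ‖f y‖ < ‖f x‖ + 1 :=
    h.continuousWithinAt.norm.eventually (gt_mem_nhds (by linarith))
  have hu2 : ∀ᶠ y in 𝓝[s] x, y ∈ u := hu
  rw [eventually_nhdsWithin_iff] at hb1 hb2 hu2
  refine ⟨max (‖f' x‖ + 1) (‖f x‖ + 1), ?_⟩
  filter_upwards [hb1, hb2, eventually_eventually_nhds.2 hu2] with y h1 h2 h3 hy
  have hyu : u ∈ 𝓝 y := by
    filter_upwards [h3, mem_interior_iff_mem_nhds.1 hy] with z hz hzs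
    exact hz hzs
  have hd := (hf' y (mem_of_mem_nhds hyu)).hasFDerivAt hyu
  refine ⟨hd.differentiableAt, (h2 (interior_subset hy)).le.trans (le_max_right _ _), ?_⟩
  rw [hd.fderiv]
  exact (h1 (mem_of_mem_nhds hyu)).le.trans (le_max_left _ _)

variable {n : ℕ} {M : Type*} [TopologicalSpace M] [ChartedSpace (EuclideanSpace ℝ (Fin n)) M]
  {F : Type*} [NormedAddCommGroup F] [NormedSpace ℝ F]

lemma ContMDiffOn.contDiffOn_comp_symm {r : WithTop ℕ∞} (hr : r ≤ ∞) {f : M → F} {S : Set M}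
    (h : ContMDiffOn (𝓡 n) 𝓘(ℝ, F) r f S) {φ : OpenPartialHomeomorph M (Euc n)}
    (hφ : φ ∈ IsManifold.maximalAtlas (𝓡 n) ∞ M) :
    ContDiffOn ℝ r (f ∘ φ.symm) (φ.target ∩ φ.symm ⁻¹' S) := by
  rw [← contMDiffOn_iff_contDiffOn]
  exact h.comp (((contMDiffOn_symm_of_mem_maximalAtlas hφ).of_le hr).mono inter_subset_left)
    fun u hu => hu.2

lemma ContMDiffAt.contDiffAt_comp_symm {r : WithTop ℕ∞} (hr : r ≤ ∞) {f : M → F} {p : M}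
    (h : ContMDiffAt (𝓡 n) 𝓘(ℝ, F) r f p) {φ : OpenPartialHomeomorph M (Euc n)}
    (hφ : φ ∈ IsManifold.maximalAtlas (𝓡 n) ∞ M) (hp : p ∈ φ.source) :
    ContDiffAt ℝ r (f ∘ φ.symm) (φ p) := by
  rw [← contMDiffAt_iff_contDiffAt]
  refine ContMDiffAt.comp (φ p) (by rwa [φ.left_inv hp]) ?_
  exact ((contMDiffOn_symm_of_mem_maximalAtlas hφ).of_le hr).contMDiffAt
    (φ.open_target.mem_nhds (φ.map_source hp))

lemma mem_interior_image {φ : OpenPartialHomeomorph M (Euc n)} {S : Set M} {q : M}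
    (hq : q ∈ φ.source) (hS : q ∈ interior S) : φ q ∈ interior (φ.target ∩ φ.symm ⁻¹' S) := by
  rw [mem_interior_iff_mem_nhds]
  refine inter_mem (φ.open_target.mem_nhds (φ.map_source hq))
    ((φ.continuousAt_symm (φ.map_source hq)).preimage_mem_nhds ?_)
  rw [φ.left_inv hq]
  exact mem_interior_iff_mem_nhds.1 hS

/-- A function which is `C^r` on each of the pieces. -/
def PieceSmooth {k : ℕ} (r : WithTop ℕ∞) (P : Fin k → Set M) (f : M → F) : Prop :=
  ∀ i, ∃ g : M → F, ContMDiffOn (𝓡 n) 𝓘(ℝ, F) r g (P i) ∧ EqOn f g (interior (P i))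

variable {k : ℕ} {P : Fin k → Set M}

lemma PieceSmooth.of_contMDiffOn {r : WithTop ℕ∞} {f : M → F}
    (h : ∀ i, ContMDiffOn (𝓡 n) 𝓘(ℝ, F) r f (P i)) : PieceSmooth (n := n) r P f :=
  fun i => ⟨f, h i, fun _ _ => rfl⟩

lemma PieceSmooth.of_le {r s : WithTop ℕ∞} {f : M → F} (h : PieceSmooth (n := n) s P f)
    (hrs : r ≤ s) : PieceSmooth (n := n) r P f := fun i => by
  obtain ⟨g, hg, he⟩ := h i
  exact ⟨g, hg.of_le hrs, he⟩

lemma PieceSmooth.contMDiffAt {r : WithTop ℕ∞} {f : M → F} (h : PieceSmooth (n := n) r P f)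
    {q : M} (hq : q ∈ regSet P) : ContMDiffAt (𝓡 n) 𝓘(ℝ, F) r f q := by
  obtain ⟨i, hi⟩ := mem_iUnion.1 hq
  obtain ⟨g, hg, he⟩ := h i
  refine (hg.contMDiffAt (mem_interior_iff_mem_nhds.1 hi)).congr_of_eventuallyEq ?_
  filter_upwards [isOpen_interior.mem_nhds hi] with y hy using he hy

lemma PieceSmooth.contDiffAt {r : WithTop ℕ∞} (hr : r ≤ ∞) {f : M → F}
    (h : PieceSmooth (n := n) r P f) {q : M} (hq : q ∈ regSet P)
    {φ : OpenPartialHomeomorph M (Euc n)} (hφ : φ ∈ IsManifold.maximalAtlas (𝓡 n) ∞ M)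
    (hqs : q ∈ φ.source) : ContDiffAt ℝ r (f ∘ φ.symm) (φ q) :=
  ContMDiffAt.contDiffAt_comp_symm hr (h.contMDiffAt hq) hφ hqs

lemma continuousOn_derivIn {f : M → F} {S : Set M} {φ : OpenPartialHomeomorph M (Euc n)}
    (h : ∀ q ∈ S, ContDiffAt ℝ 1 (f ∘ φ.symm) (φ q)) (hS : S ⊆ φ.source) :
    ContinuousOn (derivIn φ f) S := by
  intro q hq
  have h1 : ContinuousAt (fderiv ℝ (f ∘ φ.symm)) (φ q) :=
    ((h q hq).fderiv_right (m := 0) (by simp)).continuousAt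
  exact (ContinuousAt.comp h1 (φ.continuousAt (hS hq))).continuousWithinAt

lemma PieceSmooth.continuousOn_derivIn {f : M → F} (h : PieceSmooth (n := n) 1 P f)
    {φ : OpenPartialHomeomorph M (Euc n)} (hφ : φ ∈ IsManifold.maximalAtlas (𝓡 n) ∞ M) :
    ContinuousOn (derivIn φ f) (regSet P ∩ φ.source) :=
  AnisoSurface.continuousOn_derivIn
    (fun _ hq => h.contDiffAt (by exact_mod_cast le_top) hq.1 hφ hq.2) inter_subset_right

lemma PieceSmooth.continuousOn {r : WithTop ℕ∞} {f : M → F} (h : PieceSmooth (n := n) r P f) :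
    ContinuousOn f (regSet P) := fun _ hq => (h.contMDiffAt hq).continuousAt.continuousWithinAt

lemma exists_bound_of_locally {K S : Set M} (hK : IsCompact K) {g : M → ℝ}
    (h : ∀ p ∈ K, ∃ C, ∀ᶠ q in 𝓝 p, q ∈ S → g q ≤ C) : ∃ C, ∀ q ∈ K, q ∈ S → g q ≤ C := by
  refine hK.induction_on (p := fun K => ∃ C, ∀ q ∈ K, q ∈ S → g q ≤ C) ⟨0, by simp⟩ ?_ ?_ ?_
  · rintro s t hst ⟨C, hC⟩
    exact ⟨C, fun q hq => hC q (hst hq)⟩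
  · rintro s t ⟨C, hC⟩ ⟨D, hD⟩
    refine ⟨max C D, fun q hq hqS => ?_⟩
    rcases hq with hq | hq
    · exact (hC q hq hqS).trans (le_max_left _ _)
    · exact (hD q hq hqS).trans (le_max_right _ _)
  · intro p hp
    obtain ⟨C, hC⟩ := h p hp
    exact ⟨_, nhdsWithin_le_nhds hC, C, fun q hq => hq⟩

lemma exists_eventually_of_pieces {p : M} (hcl : ∀ i, IsClosed (P i)) {g : M → ℝ}
    (h : ∀ i, p ∈ P i → ∃ C, ∀ᶠ q in 𝓝 p, q ∈ interior (P i) → g q ≤ C) :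
    ∃ C, ∀ᶠ q in 𝓝 p, q ∈ regSet P → g q ≤ C := by
  have h1 : ∀ i, ∃ C, ∀ᶠ q in 𝓝 p, q ∈ interior (P i) → g q ≤ C := by
    intro i
    by_cases hp : p ∈ P i
    · exact h i hp
    · refine ⟨0, ?_⟩
      filter_upwards [(hcl i).isOpen_compl.mem_nhds hp] with q hq hqi
      exact absurd (interior_subset hqi) hq
  choose C hC using h1
  refine ⟨∑ i, |C i|, ?_⟩
  filter_upwards [eventually_all.2 hC] with q hq hqr
  obtain ⟨i, hi⟩ := mem_iUnion.1 hqr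
  exact ((hq i hi).trans (le_abs_self _)).trans
    (Finset.single_le_sum (f := fun i => |C i|) (fun _ _ => abs_nonneg _) (Finset.mem_univ i))

/-- A function which is `C¹` on the pieces is bounded with bounded derivatives on compact subsets
of a chart domain. -/
lemma PieceSmooth.exists_bound (hcl : ∀ i, IsClosed (P i)) {f : M → F}
    (h : PieceSmooth (n := n) 1 P f) {φ : OpenPartialHomeomorph M (Euc n)}
    (hφ : φ ∈ IsManifold.maximalAtlas (𝓡 n) ∞ M) {K : Set M} (hK : IsCompact K)
    (hKs : K ⊆ φ.source) :
    ∃ C, 0 ≤ C ∧ ∀ q ∈ K, q ∈ regSet P → ‖f q‖ ≤ C ∧ ‖derivIn φ f q‖ ≤ C := by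
  have : ∃ C, ∀ q ∈ K, q ∈ regSet P → ‖f q‖ + ‖derivIn φ f q‖ ≤ C := by
    refine exists_bound_of_locally hK fun p hp => exists_eventually_of_pieces hcl fun i hi => ?_
    obtain ⟨g, hg, he⟩ := h i
    have hps := hKs hp
    have hmem : φ p ∈ φ.target ∩ φ.symm ⁻¹' (P i) :=
      ⟨φ.map_source hps, by rwa [mem_preimage, φ.left_inv hps]⟩
    obtain ⟨C, hC⟩ := ContDiffWithinAt.exists_fderiv_bound
      (ContMDiffOn.contDiffOn_comp_symm (by exact_mod_cast le_top) hg hφ _ hmem) hmem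
    refine ⟨C + C, ?_⟩
    filter_upwards [(φ.continuousAt hps).eventually hC, φ.open_source.mem_nhds hps] with q hq hqs
      hqi
    obtain ⟨-, h1, h2⟩ := hq (mem_interior_image hqs hqi)
    have hfe : f ∘ φ.symm =ᶠ[𝓝 (φ q)] g ∘ φ.symm := by
      filter_upwards [isOpen_interior.mem_nhds (mem_interior_image hqs
        (by rwa [interior_interior] : q ∈ interior (interior (P i))))] with u hu
      exact he (interior_subset hu).2
    refine add_le_add ?_ ?_
    · rw [he hqi]
      simpa [φ.left_inv hqs] using h1
    · rw [derivIn, hfe.fderiv_eq]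
      exact h2
  obtain ⟨C, hC⟩ := this
  refine ⟨max C 0, le_max_right _ _, fun q hq hqr => ?_⟩
  have h1 := hC q hq hqr
  have h2 := norm_nonneg (f q)
  have h3 := norm_nonneg (derivIn φ f q)
  exact ⟨(by linarith : _ ≤ C).trans (le_max_left _ _), (by linarith : _ ≤ C).trans (le_max_left _ _)⟩

end Regularity

/-! ### Integrals of `n`-forms over the union of the pieces -/

section Forms

open Filter Topology

variable {n : ℕ} {M : Type*} [TopologicalSpace M] [ChartedSpace (EuclideanSpace ℝ (Fin n)) M]
  {k : ℕ} {P : Fin k → Set M}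

/-- `n`-forms on an open subset of `M`, given by their coefficients in the charts of `M`. -/
def IsForm (S : Set M) (α : OpenPartialHomeomorph M (Euc n) → M → ℝ) : Prop :=
  ∀ φ ∈ IsManifold.maximalAtlas (𝓡 n) ∞ M, ∀ e ∈ IsManifold.maximalAtlas (𝓡 n) ∞ M,
    ∀ p ∈ S, p ∈ φ.source → p ∈ e.source → α φ p = (transD φ e p).det * α e p

/-- The form `⟪Z, dN(W)⟫`, where `dN(W)` is the derivative of the normal of `X` in the
direction `W`. -/
noncomputable def pairForm (X Z W : M → Euc (n + 1)) (φ : OpenPartialHomeomorph M (Euc n))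
    (p : M) : ℝ :=
  ⟪Z p, crossDer (derivIn φ X p) (derivIn φ W p)⟫

/-- The form `⟪W, N⟫` where `N` is the normal of `X`. -/
noncomputable def volForm (X W : M → Euc (n + 1)) (φ : OpenPartialHomeomorph M (Euc n))
    (p : M) : ℝ :=
  ⟪W p, normalIn φ X p⟫

lemma isForm_pairForm (S : Set M) (X Z W : M → Euc (n + 1)) : IsForm S (pairForm X Z W) := by
  intro φ hφ e he p _ hp hp'
  rw [pairForm, pairForm, derivIn_change hφ he hp hp', derivIn_change hφ he hp hp' W, crossDer_comp,
    inner_smul_right]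

lemma isForm_volForm (S : Set M) (X W : M → Euc (n + 1)) : IsForm S (volForm X W) := by
  intro φ hφ e he p _ hp hp'
  rw [volForm, volForm, normalIn_change hφ he hp hp', inner_smul_right]

lemma IsForm.smul {S : Set M} {α : OpenPartialHomeomorph M (Euc n) → M → ℝ} (h : IsForm S α)
    (g : M → ℝ) : IsForm S (fun φ p => g p * α φ p) := by
  intro φ hφ e he p hS hp hp'
  simp only [h φ hφ e he p hS hp hp']
  ring

lemma continuousOn_pairForm {X Z W : M → Euc (n + 1)} (hX : PieceSmooth (n := n) 1 P X)
    (hZ : PieceSmooth (n := n) 1 P Z) (hW : PieceSmooth (n := n) 1 P W)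
    {φ : OpenPartialHomeomorph M (Euc n)} (hφ : φ ∈ IsManifold.maximalAtlas (𝓡 n) ∞ M) :
    ContinuousOn (pairForm X Z W φ) (regSet P ∩ φ.source) :=
  (hZ.continuousOn.mono inter_subset_left).inner
    (continuous_crossDer.comp_continuousOn
      ((hX.continuousOn_derivIn hφ).prodMk (hW.continuousOn_derivIn hφ)))

lemma continuousOn_normalIn {X : M → Euc (n + 1)} (hX : PieceSmooth (n := n) 1 P X)
    {φ : OpenPartialHomeomorph M (Euc n)} (hφ : φ ∈ IsManifold.maximalAtlas (𝓡 n) ∞ M) :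
    ContinuousOn (normalIn φ X) (regSet P ∩ φ.source) :=
  (contDiff_crossL (r := 0)).continuous.comp_continuousOn (hX.continuousOn_derivIn hφ)

lemma continuousOn_volForm {X W : M → Euc (n + 1)} (hX : PieceSmooth (n := n) 1 P X)
    (hW : PieceSmooth (n := n) 1 P W)
    {φ : OpenPartialHomeomorph M (Euc n)} (hφ : φ ∈ IsManifold.maximalAtlas (𝓡 n) ∞ M) :
    ContinuousOn (volForm X W φ) (regSet P ∩ φ.source) :=
  (hW.continuousOn.mono inter_subset_left).inner (continuousOn_normalIn hX hφ)

/-- A continuous function of the derivatives is bounded if the derivatives are. -/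
lemma exists_bound_comp {G : Type*} [NormedAddCommGroup G] [ProperSpace G] {g : G → ℝ}
    (hg : Continuous g) (C : ℝ) : ∃ D, ∀ x, ‖x‖ ≤ C → |g x| ≤ D := by
  obtain ⟨D, hD⟩ := (isCompact_closedBall (0 : G) C).exists_bound_of_continuousOn hg.continuousOn
  exact ⟨D, fun x hx => hD x (mem_closedBall_zero_iff.2 hx)⟩

lemma exists_bound_pairForm (hcl : ∀ i, IsClosed (P i)) {X Z W : M → Euc (n + 1)}
    (hX : PieceSmooth (n := n) 1 P X) (hZ : PieceSmooth (n := n) 1 P Z)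
    (hW : PieceSmooth (n := n) 1 P W) {φ : OpenPartialHomeomorph M (Euc n)}
    (hφ : φ ∈ IsManifold.maximalAtlas (𝓡 n) ∞ M) {K : Set M} (hK : IsCompact K)
    (hKs : K ⊆ φ.source) : ∃ C, ∀ q ∈ K, q ∈ regSet P → |pairForm X Z W φ q| ≤ C := by
  obtain ⟨C1, -, h1⟩ := hX.exists_bound hcl hφ hK hKs
  obtain ⟨C2, -, h2⟩ := hZ.exists_bound hcl hφ hK hKs
  obtain ⟨C3, -, h3⟩ := hW.exists_bound hcl hφ hK hKs
  let g : Euc (n + 1) × (Euc n →L[ℝ] Euc (n + 1)) × (Euc n →L[ℝ] Euc (n + 1)) → ℝ :=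
    fun x => ⟪x.1, crossDer x.2.1 x.2.2⟫
  have hg : Continuous g := continuous_fst.inner (continuous_crossDer.comp continuous_snd)
  obtain ⟨D, hD⟩ := exists_bound_comp hg (max C2 (max C1 C3))
  refine ⟨D, fun q hq hqr => hD (Z q, derivIn φ X q, derivIn φ W q) ?_⟩
  rw [Prod.norm_def, Prod.norm_def]
  exact max_le_max (h2 q hq hqr).1 (max_le_max (h1 q hq hqr).2 (h3 q hq hqr).2)

lemma exists_bound_volForm (hcl : ∀ i, IsClosed (P i)) {X W : M → Euc (n + 1)}
    (hX : PieceSmooth (n := n) 1 P X) (hW : PieceSmooth (n := n) 1 P W)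
    {φ : OpenPartialHomeomorph M (Euc n)}
    (hφ : φ ∈ IsManifold.maximalAtlas (𝓡 n) ∞ M) {K : Set M} (hK : IsCompact K)
    (hKs : K ⊆ φ.source) : ∃ C, ∀ q ∈ K, q ∈ regSet P → |volForm X W φ q| ≤ C := by
  obtain ⟨C1, -, h1⟩ := hX.exists_bound hcl hφ hK hKs
  obtain ⟨C3, -, h3⟩ := hW.exists_bound hcl hφ hK hKs
  let g : Euc (n + 1) × (Euc n →L[ℝ] Euc (n + 1)) → ℝ := fun x => ⟪x.1, crossL x.2⟫
  have hg : Continuous g :=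
    continuous_fst.inner ((contDiff_crossL (r := 0)).continuous.comp continuous_snd)
  obtain ⟨D, hD⟩ := exists_bound_comp hg (max C3 C1)
  refine ⟨D, fun q hq hqr => hD (W q, derivIn φ X q) ?_⟩
  rw [Prod.norm_def]
  exact max_le_max (h3 q hq hqr).1 (h1 q hq hqr).2

variable [MeasurableSpace M] [BorelSpace M]

/-- The form `α` is integrable on compact subsets of the domain of the chart `φ`. -/
def FormIntegrable (P : Fin k → Set M) (α : OpenPartialHomeomorph M (Euc n) → M → ℝ) : Prop :=
  ∀ φ ∈ IsManifold.maximalAtlas (𝓡 n) ∞ M, ∀ K : Set M, IsCompact K → IsClosed K →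
    K ⊆ φ.source → IntegrableOn (fun u => α φ (φ.symm u)) (φ '' (K ∩ regSet P))

lemma integrableOn_chart {φ : OpenPartialHomeomorph M (Euc n)} {f : M → ℝ}
    (hf : ContinuousOn f (regSet P ∩ φ.source)) {K : Set M} (hK : IsCompact K) (hKc : IsClosed K)
    (hKs : K ⊆ φ.source) {C : ℝ} (hC : ∀ q ∈ K, q ∈ regSet P → |f q| ≤ C) :
    IntegrableOn (fun u => f (φ.symm u)) (φ '' (K ∩ regSet P)) := by
  have hsub : K ∩ regSet P ⊆ φ.source := inter_subset_left.trans hKs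
  have hm : MeasurableSet (φ '' (K ∩ regSet P)) :=
    measurableSet_image hsub (hKc.measurableSet.inter (isOpen_regSet P).measurableSet)
  have hfin : volume (φ '' (K ∩ regSet P)) < ⊤ :=
    (measure_mono (image_mono inter_subset_left)).trans_lt
      (hK.image_of_continuousOn (φ.continuousOn.mono hKs)).measure_lt_top
  refine IntegrableOn.of_bound hfin ?_ C ?_
  · refine ContinuousOn.aestronglyMeasurable (f := fun u => f (φ.symm u)) ?_ hm
    refine hf.comp (φ.continuousOn_symm.mono ?_) ?_
    · rintro _ ⟨q, hq, rfl⟩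
      exact φ.map_source (hsub hq)
    · rintro _ ⟨q, hq, rfl⟩
      rw [φ.left_inv (hsub hq)]
      exact ⟨hq.2, hsub hq⟩
  · refine (ae_restrict_iff' hm).2 (Eventually.of_forall ?_)
    rintro _ ⟨q, hq, rfl⟩
    rw [φ.left_inv (hsub hq)]
    exact hC q hq.1 hq.2

lemma formIntegrable_pairForm (hcl : ∀ i, IsClosed (P i)) {X Z W : M → Euc (n + 1)}
    (hX : PieceSmooth (n := n) 1 P X) (hZ : PieceSmooth (n := n) 1 P Z)
    (hW : PieceSmooth (n := n) 1 P W) : FormIntegrable P (pairForm X Z W) := by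
  intro φ hφ K hK hKc hKs
  obtain ⟨C, hC⟩ := exists_bound_pairForm hcl hX hZ hW hφ hK hKs
  exact integrableOn_chart (continuousOn_pairForm hX hZ hW hφ) hK hKc hKs hC

lemma formIntegrable_volForm (hcl : ∀ i, IsClosed (P i)) {X W : M → Euc (n + 1)}
    (hX : PieceSmooth (n := n) 1 P X)
    (hW : PieceSmooth (n := n) 1 P W) : FormIntegrable P (volForm X W) := by
  intro φ hφ K hK hKc hKs
  obtain ⟨C, hC⟩ := exists_bound_volForm hcl hX hW hφ hK hKs
  exact integrableOn_chart (continuousOn_volForm hX hW hφ) hK hKc hKs hC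

/-- The integral of a form over the union of the interiors of the pieces. -/
noncomputable def formInt (𝒞 : ChartPartition n M) (P : Fin k → Set M)
    (α : OpenPartialHomeomorph M (Euc n) → M → ℝ) : ℝ :=
  ∑ a, ∫ u in 𝒞.chart a '' (𝒞.part a ∩ regSet P), α (𝒞.chart a) ((𝒞.chart a).symm u)

variable [IsManifold (𝓡 n) ∞ M]

lemma FormIntegrable.integrableOn_part [CompactSpace M]
    {α : OpenPartialHomeomorph M (Euc n) → M → ℝ} (h : FormIntegrable P α)
    (𝒞 : ChartPartition n M) (a : Fin 𝒞.size) :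
    IntegrableOn (fun u => α (𝒞.chart a) ((𝒞.chart a).symm u))
      (𝒞.chart a '' (𝒞.part a ∩ regSet P)) :=
  (h _ (𝒞.chart_mem a) (closure (𝒞.part a)) isClosed_closure.isCompact isClosed_closure
    (𝒞.closure_subset a)).mono_set (image_mono (inter_subset_inter_left _ subset_closure))

lemma measurableSet_image_part (𝒞 : ChartPartition n M) (P : Fin k → Set M) (a : Fin 𝒞.size) :
    MeasurableSet (𝒞.chart a '' (𝒞.part a ∩ regSet P)) :=
  measurableSet_image (inter_subset_left.trans (𝒞.part_subset a))
    ((𝒞.measurableSet_part a).inter (isOpen_regSet P).measurableSet)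

lemma formInt_congr (𝒞 : ChartPartition n M)
    {α α' : OpenPartialHomeomorph M (Euc n) → M → ℝ}
    (h : ∀ φ ∈ atlas (Euc n) M, ∀ p ∈ regSet P, p ∈ φ.source → α φ p = α' φ p) :
    formInt 𝒞 P α = formInt 𝒞 P α' := by
  refine Finset.sum_congr rfl fun a _ => setIntegral_congr_fun (measurableSet_image_part 𝒞 P a) ?_
  rintro _ ⟨q, hq, rfl⟩
  have hs := 𝒞.part_subset a hq.1
  simp only [(𝒞.chart a).left_inv hs]
  exact h _ (𝒞.chart_mem_atlas a) q hq.2 hs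

lemma formInt_add [CompactSpace M] (𝒞 : ChartPartition n M)
    {α α' : OpenPartialHomeomorph M (Euc n) → M → ℝ} (h : FormIntegrable P α)
    (h' : FormIntegrable P α') :
    formInt 𝒞 P (fun φ p => α φ p + α' φ p) = formInt 𝒞 P α + formInt 𝒞 P α' := by
  rw [formInt, formInt, formInt, ← Finset.sum_add_distrib]
  exact Finset.sum_congr rfl fun a _ =>
    integral_add (h.integrableOn_part 𝒞 a) (h'.integrableOn_part 𝒞 a)

lemma formInt_smul (𝒞 : ChartPartition n M)
    {α : OpenPartialHomeomorph M (Euc n) → M → ℝ} (c : ℝ) :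
    formInt 𝒞 P (fun φ p => c * α φ p) = c * formInt 𝒞 P α := by
  rw [formInt, formInt, Finset.mul_sum]
  exact Finset.sum_congr rfl fun a _ => integral_const_mul _ _

/-- The integral of a form which vanishes outside of a subset of a chart domain. -/
lemma formInt_eq_chart (𝒞 : ChartPartition n M)
    {α : OpenPartialHomeomorph M (Euc n) → M → ℝ} (hα : IsForm (regSet P) α)
    {φ : OpenPartialHomeomorph M (Euc n)} (hφ : φ ∈ IsManifold.maximalAtlas (𝓡 n) ∞ M) {σ : ℝ}
    (hσ : σ * σ = 1) (hs : HasSign φ σ) {A : Set M} (hA : A ⊆ φ.source) (hAm : MeasurableSet A)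
    (h0 : ∀ e ∈ atlas (Euc n) M, ∀ p ∈ regSet P, p ∈ e.source → p ∉ A →
      α e p = 0)
    (hi : IntegrableOn (fun u => α φ (φ.symm u)) (φ '' (A ∩ regSet P))) :
    formInt 𝒞 P α = σ * ∫ u in φ '' (A ∩ regSet P), α φ (φ.symm u) := by
  have hregm := (isOpen_regSet P).measurableSet
  have hBs : ∀ a, 𝒞.part a ∩ regSet P ∩ A ⊆ φ.source := fun a => inter_subset_right.trans hA
  have hBs' : ∀ a, 𝒞.part a ∩ regSet P ∩ A ⊆ (𝒞.chart a).source := fun a =>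
    inter_subset_left.trans (inter_subset_left.trans (𝒞.part_subset a))
  have hBm : ∀ a, MeasurableSet (𝒞.part a ∩ regSet P ∩ A) := fun a =>
    ((𝒞.measurableSet_part a).inter hregm).inter hAm
  have hunion : φ '' (A ∩ regSet P) = ⋃ a, φ '' (𝒞.part a ∩ regSet P ∩ A) := by
    rw [← image_iUnion, ← iUnion_inter, ← iUnion_inter, 𝒞.iUnion_part, univ_inter, inter_comm]
  have hdisj : Pairwise (Function.onFun Disjoint fun a => φ '' (𝒞.part a ∩ regSet P ∩ A)) := by
    intro a b hab
    have h := (φ.injOn.mono hA).image_inter (s := 𝒞.part a ∩ regSet P ∩ A)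
      (t := 𝒞.part b ∩ regSet P ∩ A) inter_subset_right inter_subset_right
    rw [Function.onFun, disjoint_iff_inter_eq_empty, ← h]
    have := 𝒞.disjoint_part hab
    rw [Function.onFun, disjoint_iff_inter_eq_empty] at this
    rw [image_eq_empty, ← subset_empty_iff, ← this]
    exact fun x hx => ⟨hx.1.1.1, hx.2.1.1⟩
  rw [hunion] at hi ⊢
  rw [integral_iUnion_fintype (fun a => measurableSet_image (hBs a) (hBm a)) hdisj fun a =>
    hi.mono_set (subset_iUnion_of_subset a subset_rfl), Finset.mul_sum]
  refine Finset.sum_congr rfl fun a _ => ?_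
  have h1 : ∫ u in 𝒞.chart a '' (𝒞.part a ∩ regSet P), α (𝒞.chart a) ((𝒞.chart a).symm u) =
      ∫ u in 𝒞.chart a '' (𝒞.part a ∩ regSet P ∩ A), α (𝒞.chart a) ((𝒞.chart a).symm u) := by
    refine setIntegral_eq_of_subset_of_forall_sdiff_eq_zero (measurableSet_image_part 𝒞 P a)
      (image_mono inter_subset_left) ?_
    rintro _ ⟨⟨q, hq, rfl⟩, hq'⟩
    have hqs := 𝒞.part_subset a hq.1
    rw [(𝒞.chart a).left_inv hqs]
    exact h0 _ (𝒞.chart_mem_atlas a) q hq.2 hqs fun hqA => hq' ⟨q, ⟨hq, hqA⟩, rfl⟩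
  -- Change of variables to `φ`. Since `|det| = σ det`, the Jacobian factor and the transformation
  -- law of `α` combine to `σ α φ`.
  rw [h1, ← image_image_transition (φ := φ) (hBs a), integral_image_eq_integral_abs_det_fderiv_smul
    volume (measurableSet_image (hBs a) (hBm a)) (f' := fun u => transD φ (𝒞.chart a) (φ.symm u)) _
    (injOn_transition (hBs a) (hBs' a)), ← integral_const_mul]
  · refine setIntegral_congr_fun (measurableSet_image (hBs a) (hBm a)) ?_
    rintro _ ⟨q, hq, rfl⟩
    have hq1 := hBs a hq
    have hq2 := hBs' a hq
    simp only [Function.comp_apply, φ.left_inv hq1, (𝒞.chart a).left_inv hq2, smul_eq_mul]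
    rw [hα φ hφ _ (𝒞.chart_mem a) q hq.1.2 hq1 hq2]
    have hd := hs q hq1 _ (𝒞.chart_mem_atlas a) hq2
    have habs : |(transD φ (𝒞.chart a) q).det| = σ * (transD φ (𝒞.chart a) q).det := by
      have h1 : |σ| = 1 := by
        have : |σ| * |σ| = 1 := by rw [← abs_mul, hσ, abs_one]
        nlinarith [abs_nonneg σ]
      rw [← abs_of_pos hd, abs_mul, h1, one_mul]
    rw [habs]
    ring
  · rintro _ ⟨q, hq, rfl⟩
    rw [φ.left_inv (hBs a hq)]
    exact (hasFDerivAt_transition hφ (𝒞.chart_mem a) (hBs a hq) (hBs' a hq)).hasFDerivWithinAt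

end Forms

/-! ### The flux through an edge and integration by parts on a box in one piece -/

section LocalStokes

open Filter Topology

variable {n : ℕ} {M : Type*} [TopologicalSpace M] [ChartedSpace (EuclideanSpace ℝ (Fin n)) M]
  {F : Type*} [NormedAddCommGroup F] [NormedSpace ℝ F] {k : ℕ} {P : Fin k → Set M}

lemma two_le_infty : (2 : WithTop ℕ∞) ≤ ∞ :=
  WithTop.coe_le_coe.2 (le_top : (2 : ℕ∞) ≤ ⊤)

/-- `g i` is a `C^r` extension to `P i` of the restriction of `f` to the interior of `P i`. -/
def PieceRep (r : WithTop ℕ∞) (P : Fin k → Set M) (f : M → F) (g : Fin k → M → F) : Prop :=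
  ∀ i, ContMDiffOn (𝓡 n) 𝓘(ℝ, F) r (g i) (P i) ∧ EqOn f (g i) (interior (P i))

lemma PieceRep.pieceSmooth {r : WithTop ℕ∞} {f : M → F} {g : Fin k → M → F}
    (h : PieceRep (n := n) r P f g) : PieceSmooth (n := n) r P f := fun i => ⟨g i, h i⟩

/-- The coordinate derivatives of `X` at a point of the edge. -/
noncomputable def edgeFrame (X : M → Euc (n + 1)) (φ : OpenPartialHomeomorph M (Euc n)) (p : M) :
    Fin n → Euc (n + 1) :=
  fun l => edgeDeriv X p φ (EuclideanSpace.single l 1)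

/-- The determinant of `z`, `w` and the tangent vectors of the edge. -/
noncomputable def edgeFlux [NeZero n] (X : M → Euc (n + 1)) (φ : OpenPartialHomeomorph M (Euc n))
    (z w : Euc (n + 1)) (p : M) : ℝ :=
  ⟪z, crossProd (Function.update (edgeFrame X φ p) 0 w)⟫

lemma edgeFlux_zero_right [NeZero n] (X : M → Euc (n + 1)) (φ : OpenPartialHomeomorph M (Euc n))
    (z : Euc (n + 1)) (p : M) : edgeFlux X φ z 0 p = 0 := by
  have : crossProd (Function.update (edgeFrame X φ p) 0 (0 : Euc (n + 1))) = 0 :=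
    (crossMulti n).toMultilinearMap.map_update_zero _ _
  rw [edgeFlux, this, inner_zero_right]

lemma edgeFlux_sub_left [NeZero n] (X : M → Euc (n + 1)) (φ : OpenPartialHomeomorph M (Euc n))
    (z z' w : Euc (n + 1)) (p : M) :
    edgeFlux X φ (z - z') w p = edgeFlux X φ z w p - edgeFlux X φ z' w p :=
  inner_sub_left _ _ _

lemma edgeFlux_smul_right [NeZero n] (X : M → Euc (n + 1)) (φ : OpenPartialHomeomorph M (Euc n))
    (z w : Euc (n + 1)) (p : M) (c : ℝ) : edgeFlux X φ z (c • w) p = c * edgeFlux X φ z w p := by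
  have : crossProd (Function.update (edgeFrame X φ p) 0 (c • w)) =
      c • crossProd (Function.update (edgeFrame X φ p) 0 w) :=
    (crossMulti n).toMultilinearMap.map_update_smul _ _ _ _
  rw [edgeFlux, this, inner_smul_right, edgeFlux]

/-- The tangential derivatives on a face of a box are line derivatives. -/
lemma fderivWithin_euBox_single {x : Euc n → F} {a b : Fin n → ℝ} {u : Euc n}
    (hu : u ∈ euBox a b) (hx : DifferentiableWithinAt ℝ x (euBox a b) u) {l : Fin n}
    (hl : u l ∈ Ioo (a l) (b l)) :
    fderivWithin ℝ x (euBox a b) u (EuclideanSpace.single l 1) =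
      lineDeriv ℝ x u (EuclideanSpace.single l 1) := by
  have h1 := hx.hasFDerivWithinAt.hasLineDerivWithinAt (EuclideanSpace.single l 1)
  have h2 : (fun t : ℝ => u + t • (EuclideanSpace.single l 1 : Euc n)) ⁻¹' euBox a b ∈ 𝓝 (0 : ℝ) := by
    have h3 : ∀ᶠ t : ℝ in 𝓝 0, u l + t ∈ Ioo (a l) (b l) := by
      have : ContinuousAt (fun t : ℝ => u l + t) 0 := by fun_prop
      refine this.eventually (p := fun s => s ∈ Ioo (a l) (b l)) ?_
      simp only [add_zero]
      exact Ioo_mem_nhds hl.1 hl.2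
    filter_upwards [h3] with t ht j
    by_cases hj : j = l
    · subst hj
      simpa using Ioo_subset_Icc_self ht
    · simpa [hj] using hu j
  have h4 : HasLineDerivAt ℝ x (fderivWithin ℝ x (euBox a b) u (EuclideanSpace.single l 1)) u
      (EuclideanSpace.single l 1) := HasDerivWithinAt.hasDerivAt h1 h2
  exact h4.lineDeriv.symm

/-- The flux through the face `{x₀ = const}` of a box, for a field which vanishes on the
other faces. -/
lemma boxFlux_eq_edgeFlux [NeZero n] {φ : OpenPartialHomeomorph M (Euc n)} {a b : Fin n → ℝ}
    {X Z W : M → Euc (n + 1)} {u : Euc n} (hut : u ∈ φ.target)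
    (hu : u ∈ euBox a b)
    (hx : DifferentiableWithinAt ℝ (X ∘ φ.symm) (euBox a b) u)
    (hW : (∃ l, l ≠ 0 ∧ (u l = a l ∨ u l = b l)) → W (φ.symm u) = 0) :
    boxFlux (X ∘ φ.symm) (Z ∘ φ.symm) (W ∘ φ.symm) (euBox a b) 0 u =
      edgeFlux X φ (Z (φ.symm u)) (W (φ.symm u)) (φ.symm u) := by
  by_cases h : ∃ l, l ≠ 0 ∧ (u l = a l ∨ u l = b l)
  · rw [boxFlux_of_eq_zero (by simpa using hW h), hW h, edgeFlux_zero_right]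
  · push Not at h
    rw [boxFlux, edgeFlux]
    congr 2
    ext1 l
    by_cases hl : l = 0
    · subst hl
      simp
    · rw [Function.update_of_ne hl, Function.update_of_ne hl, frame, edgeFrame, edgeDeriv,
        φ.right_inv hut]
      exact fderivWithin_euBox_single hu hx
        ⟨lt_of_le_of_ne (hu l).1 (h l hl).1.symm, lt_of_le_of_ne (hu l).2 (h l hl).2⟩

lemma mem_interior_of_mem_interior_box {φ : OpenPartialHomeomorph M (Euc n)} {A : Set M}
    {Q : Set (Euc n)} (hQ : Q ⊆ φ.target ∩ φ.symm ⁻¹' A) {u : Euc n} (hu : u ∈ interior Q) :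
    φ.symm u ∈ interior A := by
  have hut := (hQ (interior_subset hu)).1
  rw [mem_interior_iff_mem_nhds]
  have h1 : φ.symm.symm ⁻¹' Q ∈ 𝓝 (φ.symm u) := by
    refine (φ.continuousAt (φ.map_target hut)).preimage_mem_nhds ?_
    rw [φ.right_inv hut]
    exact mem_interior_iff_mem_nhds.1 hu
  filter_upwards [h1, φ.open_source.mem_nhds (φ.map_target hut)] with q hq hqs
  have := (hQ hq).2
  rwa [mem_preimage, OpenPartialHomeomorph.symm_symm, φ.left_inv hqs] at this

/-- Integration by parts on a box in a piece, for a field which vanishes on all faces except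
those in the `0`-th direction. -/
lemma integral_box_pairForm {m : ℕ} {M : Type*} [TopologicalSpace M]
    [ChartedSpace (EuclideanSpace ℝ (Fin (m + 1))) M] {P : Fin k → Set M} {i : Fin k}
    {X Z W : M → Euc (m + 1 + 1)} {Zr : Fin k → M → Euc (m + 1 + 1)}
    (hX : ContMDiffOn (𝓡 (m + 1)) 𝓘(ℝ, Euc (m + 1 + 1)) 2 X (P i))
    (hZ : PieceRep (n := m + 1) 1 P Z Zr)
    (hW : ContMDiffOn (𝓡 (m + 1)) 𝓘(ℝ, Euc (m + 1 + 1)) 1 W (P i))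
    {φ : OpenPartialHomeomorph M (Euc (m + 1))}
    (hφ : φ ∈ IsManifold.maximalAtlas (𝓡 (m + 1)) ∞ M) {a b : Fin (m + 1) → ℝ}
    (hab : ∀ k, a k < b k) (hQ : euBox a b ⊆ φ.target ∩ φ.symm ⁻¹' (P i))
    (hW0 : ∀ u ∈ euBox a b, (∃ l, l ≠ 0 ∧ (u l = a l ∨ u l = b l)) → W (φ.symm u) = 0) :
    (ContinuousOn (fun y => edgeFlux X φ (Zr i (φ.symm (WithLp.toLp 2 (Fin.insertNth 0 (a 0) y))))
        (W (φ.symm (WithLp.toLp 2 (Fin.insertNth 0 (a 0) y))))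
        (φ.symm (WithLp.toLp 2 (Fin.insertNth 0 (a 0) y))))
      (Icc (a ∘ Fin.succAbove 0) (b ∘ Fin.succAbove 0))) ∧
    (ContinuousOn (fun y => edgeFlux X φ (Zr i (φ.symm (WithLp.toLp 2 (Fin.insertNth 0 (b 0) y))))
        (W (φ.symm (WithLp.toLp 2 (Fin.insertNth 0 (b 0) y))))
        (φ.symm (WithLp.toLp 2 (Fin.insertNth 0 (b 0) y))))
      (Icc (a ∘ Fin.succAbove 0) (b ∘ Fin.succAbove 0))) ∧
    ∫ u in euBox a b, (pairForm X Z W φ (φ.symm u) - pairForm X W Z φ (φ.symm u)) =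
      (∫ y in Icc (a ∘ Fin.succAbove 0) (b ∘ Fin.succAbove 0),
        edgeFlux X φ (Zr i (φ.symm (WithLp.toLp 2 (Fin.insertNth 0 (b 0) y))))
          (W (φ.symm (WithLp.toLp 2 (Fin.insertNth 0 (b 0) y))))
          (φ.symm (WithLp.toLp 2 (Fin.insertNth 0 (b 0) y)))) -
      ∫ y in Icc (a ∘ Fin.succAbove 0) (b ∘ Fin.succAbove 0),
        edgeFlux X φ (Zr i (φ.symm (WithLp.toLp 2 (Fin.insertNth 0 (a 0) y))))
          (W (φ.symm (WithLp.toLp 2 (Fin.insertNth 0 (a 0) y))))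
          (φ.symm (WithLp.toLp 2 (Fin.insertNth 0 (a 0) y))) := by
  have hx : ContDiffOn ℝ 2 (X ∘ φ.symm) (euBox a b) :=
    (ContMDiffOn.contDiffOn_comp_symm two_le_infty hX hφ).mono hQ
  have hz : ContDiffOn ℝ 1 (Zr i ∘ φ.symm) (euBox a b) :=
    (ContMDiffOn.contDiffOn_comp_symm (by exact_mod_cast le_top) (hZ i).1 hφ).mono hQ
  have hw : ContDiffOn ℝ 1 (W ∘ φ.symm) (euBox a b) :=
    (ContMDiffOn.contDiffOn_comp_symm (by exact_mod_cast le_top) hW hφ).mono hQ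
  obtain ⟨-, hint⟩ := integral_box_crossForm hab hx hz hw
  -- `Z` may be replaced by its extension `Zr i`, as the two agree off the faces, which form a null
  -- set.
  have hcongr : ∫ u in euBox a b, (pairForm X Z W φ (φ.symm u) - pairForm X W Z φ (φ.symm u)) =
      ∫ u in euBox a b, crossForm (X ∘ φ.symm) (Zr i ∘ φ.symm) (W ∘ φ.symm) u := by
    have hnull := volume_euBox_diff_interior a b
    refine setIntegral_congr_ae (isCompact_euBox a b).measurableSet ?_
    filter_upwards [compl_mem_ae_iff.2 hnull] with u hu huQ
    have hui : u ∈ interior (euBox a b) := by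
      by_contra hc
      exact hu ⟨huQ, hc⟩
    have hut := (hQ huQ).1
    have hze : Z ∘ φ.symm =ᶠ[𝓝 u] Zr i ∘ φ.symm := by
      filter_upwards [isOpen_interior.mem_nhds hui] with v hv
      exact (hZ i).2 (mem_interior_of_mem_interior_box hQ hv)
    simp only [pairForm, crossForm, derivIn, φ.right_inv hut, hze.fderiv_eq, Function.comp_apply]
    rw [(hZ i).2 (mem_interior_of_mem_interior_box hQ hui)]
  have hins : ∀ (l : Fin (m + 1)) (c : ℝ) (y : Fin m → ℝ), c ∈ Icc (a l) (b l) →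
      y ∈ Icc (a ∘ Fin.succAbove l) (b ∘ Fin.succAbove l) →
      (WithLp.toLp 2 (Fin.insertNth l c y) : Euc (m + 1)) ∈ euBox a b := by
    intro l c y hc hy j
    refine Fin.succAboveCases l ?_ (fun j => ?_) j
    · simpa using hc
    · simpa using ⟨hy.1 j, hy.2 j⟩
  have hflux : ∀ c ∈ Icc (a 0) (b 0), ∀ y ∈ Icc (a ∘ Fin.succAbove 0) (b ∘ Fin.succAbove 0),
      boxFlux (X ∘ φ.symm) (Zr i ∘ φ.symm) (W ∘ φ.symm) (euBox a b) 0
        (WithLp.toLp 2 (Fin.insertNth 0 c y)) =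
      edgeFlux X φ (Zr i (φ.symm (WithLp.toLp 2 (Fin.insertNth 0 c y))))
        (W (φ.symm (WithLp.toLp 2 (Fin.insertNth 0 c y))))
        (φ.symm (WithLp.toLp 2 (Fin.insertNth 0 c y))) := by
    intro c hc y hy
    have hu := hins 0 c y hc hy
    exact boxFlux_eq_edgeFlux (hQ hu).1 hu ((hx _ hu).differentiableWithinAt (by norm_num))
      (hW0 _ hu)
  have hm : MeasurableSet (Icc (a ∘ Fin.succAbove 0) (b ∘ Fin.succAbove 0)) := measurableSet_Icc
  have hcont : ∀ c ∈ Icc (a 0) (b 0), ContinuousOn (fun y => boxFlux (X ∘ φ.symm) (Zr i ∘ φ.symm)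
      (W ∘ φ.symm) (euBox a b) 0 (WithLp.toLp 2 (Fin.insertNth 0 c y)))
        (Icc (a ∘ Fin.succAbove 0) (b ∘ Fin.succAbove 0)) := by
    intro c hc
    refine (contDiffOn_boxFlux (uniqueDiffOn_euBox hab) hx hz hw 0).continuousOn.comp ?_ ?_
    · have : Continuous fun y : Fin m → ℝ => (Fin.insertNth 0 c y : Fin (m + 1) → ℝ) := by
        fun_prop
      exact ((PiLp.continuous_toLp 2 _).comp this).continuousOn
    · exact fun y hy => hins 0 c y hc hy
  have ha : a 0 ∈ Icc (a 0) (b 0) := ⟨le_rfl, (hab 0).le⟩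
  have hb : b 0 ∈ Icc (a 0) (b 0) := ⟨(hab 0).le, le_rfl⟩
  refine ⟨(hcont _ ha).congr fun y hy => (hflux _ ha y hy).symm,
    (hcont _ hb).congr fun y hy => (hflux _ hb y hy).symm, ?_⟩
  rw [hcongr, hint, Finset.sum_eq_single 0]
  · rw [setIntegral_congr_fun hm fun y hy => hflux _ hb y hy,
      setIntegral_congr_fun hm fun y hy => hflux _ ha y hy]
  · intro l _ hl
    have h0 : ∀ c, (c = a l ∨ c = b l) →
        ∫ y in Icc (a ∘ Fin.succAbove l) (b ∘ Fin.succAbove l), boxFlux (X ∘ φ.symm)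
          (Zr i ∘ φ.symm) (W ∘ φ.symm) (euBox a b) l (WithLp.toLp 2 (Fin.insertNth l c y)) = 0 := by
      intro c hc
      refine setIntegral_eq_zero_of_forall_eq_zero fun y hy => boxFlux_of_eq_zero ?_
      have hc' : c ∈ Icc (a l) (b l) := by
        rcases hc with rfl | rfl
        · exact ⟨le_rfl, (hab l).le⟩
        · exact ⟨(hab l).le, le_rfl⟩
      exact hW0 _ (hins l c y hc' hy) ⟨l, hl, by simpa using hc⟩
    rw [h0 _ (Or.inl rfl), h0 _ (Or.inr rfl), sub_zero]
  · simp

end LocalStokes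

/-! ### The defect of symmetry for fields supported in a box -/

section LocalDefect

open Filter Topology

variable {n : ℕ} {M : Type*} [TopologicalSpace M] [ChartedSpace (EuclideanSpace ℝ (Fin n)) M]
  [MeasurableSpace M] [BorelSpace M] {k : ℕ} {P : Fin k → Set M}

/-- The defect of symmetry of the integral of `pairForm X Z W` in `Z` and `W`. -/
noncomputable def stokesDefect (𝒞 : ChartPartition n M) (P : Fin k → Set M)
    (X Z W : M → Euc (n + 1)) : ℝ :=
  formInt 𝒞 P (pairForm X Z W) - formInt 𝒞 P (pairForm X W Z)

lemma pairForm_eq_zero_right {X Z W : M → Euc (n + 1)} {φ : OpenPartialHomeomorph M (Euc n)} {p : M}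
    (hp : p ∈ φ.source) (h : W =ᶠ[𝓝 p] 0) : pairForm X Z W φ p = 0 := by
  have h1 : W ∘ φ.symm =ᶠ[𝓝 (φ p)] fun _ => (0 : Euc (n + 1)) := by
    have h2 := φ.continuousAt_symm (φ.map_source hp)
    rw [ContinuousAt, φ.left_inv hp] at h2
    exact h2.eventually h
  have h3 : crossDer (derivIn φ X p) (0 : Euc n →L[ℝ] Euc (n + 1)) = 0 := by
    rw [crossDer, map_zero]
  have h4 : derivIn φ W p = 0 := by rw [derivIn, h1.fderiv_eq, fderiv_const_apply]
  rw [pairForm, h4, h3, inner_zero_right]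

lemma pairForm_eq_zero_left {X Z W : M → Euc (n + 1)} {φ : OpenPartialHomeomorph M (Euc n)} {p : M}
    (h : W p = 0) : pairForm X W Z φ p = 0 := by
  rw [pairForm, h, inner_zero_left]

variable [IsManifold (𝓡 n) ∞ M] [T2Space M] [CompactSpace M]

/-- One form contains the value of `W`, the other its derivative; both vanish off `A`, the second
because `A` is closed and `W` vanishes near every point outside. -/
lemma stokesDefect_eq_chart (hcl : ∀ i, IsClosed (P i)) (𝒞 : ChartPartition n M)
    {X Z W : M → Euc (n + 1)} (hX : PieceSmooth (n := n) 1 P X) (hZ : PieceSmooth (n := n) 1 P Z)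
    (hW : PieceSmooth (n := n) 1 P W) {φ : OpenPartialHomeomorph M (Euc n)}
    (hφ : φ ∈ IsManifold.maximalAtlas (𝓡 n) ∞ M) {σ : ℝ} (hσ : σ * σ = 1) (hs : HasSign φ σ)
    {A : Set M} (hA : A ⊆ φ.source) (hAc : IsCompact A) (h0 : ∀ p, p ∉ A → W p = 0) :
    IntegrableOn (fun u => pairForm X Z W φ (φ.symm u) - pairForm X W Z φ (φ.symm u))
      (φ '' (A ∩ regSet P)) ∧
    stokesDefect 𝒞 P X Z W =
      σ * ∫ u in φ '' (A ∩ regSet P),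
        (pairForm X Z W φ (φ.symm u) - pairForm X W Z φ (φ.symm u)) := by
  have i1 := formIntegrable_pairForm hcl hX hZ hW φ hφ A hAc hAc.isClosed hA
  have i2 := formIntegrable_pairForm hcl hX hW hZ φ hφ A hAc hAc.isClosed hA
  have hloc : ∀ p, p ∉ A → W =ᶠ[𝓝 p] 0 := fun p hp => by
    filter_upwards [hAc.isClosed.isOpen_compl.mem_nhds hp] with q hq using h0 q hq
  refine ⟨i1.sub i2, ?_⟩
  rw [integral_sub i1 i2, mul_sub, stokesDefect,
    formInt_eq_chart 𝒞 (isForm_pairForm _ X Z W) hφ hσ hs hA hAc.measurableSet ?_ i1,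
    formInt_eq_chart 𝒞 (isForm_pairForm _ X W Z) hφ hσ hs hA hAc.measurableSet ?_ i2]
  · exact fun e _ p _ _ hp => pairForm_eq_zero_left (h0 p hp)
  · exact fun e _ p _ hpe hp => pairForm_eq_zero_right hpe (hloc p hp)

lemma image_symm_inter {φ : OpenPartialHomeomorph M (Euc n)} {Q : Set (Euc n)} (hQ : Q ⊆ φ.target)
    (S : Set M) : φ '' (φ.symm '' Q ∩ S) = Q ∩ φ.symm ⁻¹' S := by
  ext u
  constructor
  · rintro ⟨_, ⟨⟨v, hv, rfl⟩, hS⟩, rfl⟩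
    rw [φ.right_inv (hQ hv)]
    exact ⟨hv, hS⟩
  · rintro ⟨hu, hS⟩
    exact ⟨φ.symm u, ⟨⟨u, hu, rfl⟩, hS⟩, φ.right_inv (hQ hu)⟩

lemma isCompact_image_symm {φ : OpenPartialHomeomorph M (Euc n)} {Q : Set (Euc n)}
    (hQ : Q ⊆ φ.target) (hc : IsCompact Q) : IsCompact (φ.symm '' Q) :=
  hc.image_of_continuousOn (φ.continuousOn_symm.mono hQ)

lemma image_symm_subset {φ : OpenPartialHomeomorph M (Euc n)} {Q : Set (Euc n)}
    (hQ : Q ⊆ φ.target) : φ.symm '' Q ⊆ φ.source := by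
  rintro _ ⟨u, hu, rfl⟩
  exact φ.map_target (hQ hu)

lemma notMem_interior_box {a b : Fin n → ℝ} {u : Euc n} {l : Fin n} (h : u l = a l ∨ u l = b l) :
    u ∉ interior (euBox a b) := by
  rw [interior_euBox]
  intro hu
  have := hu l
  rcases h with h | h
  · exact this.1.ne h.symm
  · exact this.2.ne h

variable [NeZero n]

/-- The box lies in the interior of one piece and the field vanishes on all its faces, so there is
no flux at all. -/
lemma stokesDefect_interior (hcl : ∀ i, IsClosed (P i)) (𝒞 : ChartPartition n M)
    {X Z W : M → Euc (n + 1)} {Zr : Fin k → M → Euc (n + 1)}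
    (hX : ∀ i, ContMDiffOn (𝓡 n) 𝓘(ℝ, Euc (n + 1)) 2 X (P i)) (hZ : PieceRep (n := n) 1 P Z Zr)
    (hW : ∀ i, ContMDiffOn (𝓡 n) 𝓘(ℝ, Euc (n + 1)) 1 W (P i))
    {φ : OpenPartialHomeomorph M (Euc n)} (hφ : φ ∈ IsManifold.maximalAtlas (𝓡 n) ∞ M) {σ : ℝ}
    (hσ : σ * σ = 1) (hs : HasSign φ σ) {i : Fin k} {a b : Fin n → ℝ} (hab : ∀ l, a l < b l)
    (hQ : euBox a b ⊆ φ.target) (hQi : euBox a b ⊆ φ.symm ⁻¹' interior (P i))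
    (hW0 : ∀ p, p ∉ φ.symm '' interior (euBox a b) → W p = 0) :
    stokesDefect 𝒞 P X Z W = 0 := by
  obtain ⟨m, rfl⟩ := Nat.exists_eq_succ_of_ne_zero (NeZero.ne n)
  have hface : ∀ u ∈ euBox a b, (∃ l, u l = a l ∨ u l = b l) → W (φ.symm u) = 0 := by
    rintro u hu ⟨l, hl⟩
    refine hW0 _ ?_
    rintro ⟨v, hv, hvu⟩
    have := φ.symm.injOn (hQ (interior_subset hv)) (hQ hu) hvu
    exact notMem_interior_box hl (this ▸ hv)
  obtain ⟨-, h2⟩ := stokesDefect_eq_chart hcl 𝒞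
    ((PieceSmooth.of_contMDiffOn hX).of_le (by norm_num)) hZ.pieceSmooth
    (PieceSmooth.of_contMDiffOn hW) hφ hσ hs (image_symm_subset hQ)
    (isCompact_image_symm hQ (isCompact_euBox a b))
    fun p hp => hW0 p fun h => hp (image_mono interior_subset h)
  have hQr : euBox a b ∩ φ.symm ⁻¹' regSet P = euBox a b :=
    inter_eq_left.2 fun u hu => mem_iUnion.2 ⟨i, hQi hu⟩
  rw [h2, image_symm_inter hQ, hQr]
  obtain ⟨-, -, h3⟩ := integral_box_pairForm (hX i) hZ (hW i) hφ hab
    (fun u hu => ⟨hQ hu, (interior_subset : interior (P i) ⊆ P i) (hQi hu)⟩) fun u hu ⟨l, _, hl⟩ => hface u hu ⟨l, hl⟩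
  have hins : ∀ (c : ℝ) (y : Fin m → ℝ), (c = a 0 ∨ c = b 0) →
      y ∈ Icc (a ∘ Fin.succAbove 0) (b ∘ Fin.succAbove 0) →
      W (φ.symm (WithLp.toLp 2 (Fin.insertNth 0 c y))) = 0 := by
    intro c y hc hy
    refine hface _ ?_ ⟨0, by simpa using hc⟩
    intro j
    refine Fin.succAboveCases 0 ?_ (fun j => ?_) j
    · rcases hc with rfl | rfl
      · simpa using (hab 0).le
      · simpa using (hab 0).le
    · simpa using ⟨hy.1 j, hy.2 j⟩
  rw [h3, setIntegral_eq_zero_of_forall_eq_zero, setIntegral_eq_zero_of_forall_eq_zero]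
  · simp
  · intro y hy
    rw [hins _ y (Or.inl rfl) hy, edgeFlux_zero_right]
  · intro y hy
    rw [hins _ y (Or.inr rfl) hy, edgeFlux_zero_right]

lemma update_lt_left {a b : Fin n → ℝ} (hab : ∀ l, a l < b l) (hb : 0 < b 0) (l : Fin n) :
    Function.update a 0 0 l < b l := by
  by_cases hl : l = 0
  · subst hl
    simpa using hb
  · rw [Function.update_of_ne hl]
    exact hab l

lemma lt_update_right {a b : Fin n → ℝ} (hab : ∀ l, a l < b l) (ha : a 0 < 0) (l : Fin n) :
    a l < Function.update b 0 0 l := by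
  by_cases hl : l = 0
  · subst hl
    simpa using ha
  · rw [Function.update_of_ne hl]
    exact hab l

lemma mem_euBox_update_left {a b : Fin n → ℝ} (ha : a 0 < 0) {u : Euc n} :
    u ∈ euBox (Function.update a 0 0) b ↔ u ∈ euBox a b ∧ 0 ≤ u 0 := by
  constructor
  · intro h
    have h0 : 0 ≤ u 0 := by simpa using (h 0).1
    refine ⟨fun l => ⟨?_, (h l).2⟩, h0⟩
    by_cases hl : l = 0
    · subst hl
      exact ha.le.trans h0
    · simpa [hl] using (h l).1
  · rintro ⟨h, h0⟩ l
    refine ⟨?_, (h l).2⟩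
    by_cases hl : l = 0
    · subst hl
      simpa using h0
    · simpa [hl] using (h l).1

lemma mem_euBox_update_right {a b : Fin n → ℝ} (hb : 0 < b 0) {u : Euc n} :
    u ∈ euBox a (Function.update b 0 0) ↔ u ∈ euBox a b ∧ u 0 ≤ 0 := by
  constructor
  · intro h
    have h0 : u 0 ≤ 0 := by simpa using (h 0).2
    refine ⟨fun l => ⟨(h l).1, ?_⟩, h0⟩
    by_cases hl : l = 0
    · subst hl
      exact h0.trans hb.le
    · simpa [hl] using (h l).2
  · rintro ⟨h, h0⟩ l
    refine ⟨(h l).1, ?_⟩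
    by_cases hl : l = 0
    · subst hl
      simpa using h0
    · simpa [hl] using (h l).2

lemma mem_regSet_of_edge {φ : OpenPartialHomeomorph M (Euc n)} {i j : Fin k}
    (hφe : ∀ q ∈ φ.source, (q ∈ P i ↔ 0 ≤ φ q 0) ∧ (q ∈ P j ↔ φ q 0 ≤ 0)) {q : M}
    (hq : q ∈ φ.source) (h : φ q 0 ≠ 0) : q ∈ regSet P := by
  rcases lt_or_gt_of_ne h with h | h
  · exact mem_iUnion.2 ⟨j, _root_.mem_interior.2
      ⟨_, fun r hr => (hφe r hr.1).2.2 hr.2.le, isOpen_coord_neg φ, hq, h⟩⟩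
  · exact mem_iUnion.2 ⟨i, _root_.mem_interior.2
      ⟨_, fun r hr => (hφe r hr.1).1.2 hr.2.le, isOpen_coord_pos φ, hq, h⟩⟩

/-- The defect of symmetry for a field which is supported near a point of an edge. -/
lemma stokesDefect_edge {m : ℕ} {M : Type*} [TopologicalSpace M]
    [ChartedSpace (EuclideanSpace ℝ (Fin (m + 1))) M] [MeasurableSpace M] [BorelSpace M]
    [IsManifold (𝓡 (m + 1)) ∞ M] [T2Space M] [CompactSpace M] {P : Fin k → Set M}
    (hcl : ∀ i, IsClosed (P i)) (𝒞 : ChartPartition (m + 1) M)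
    {X Z W : M → Euc (m + 1 + 1)} {Zr : Fin k → M → Euc (m + 1 + 1)}
    (hX : ∀ i, ContMDiffOn (𝓡 (m + 1)) 𝓘(ℝ, Euc (m + 1 + 1)) 2 X (P i))
    (hZ : PieceRep (n := m + 1) 1 P Z Zr)
    (hW : ∀ i, ContMDiffOn (𝓡 (m + 1)) 𝓘(ℝ, Euc (m + 1 + 1)) 1 W (P i))
    {φ : OpenPartialHomeomorph M (Euc (m + 1))}
    (hφ : φ ∈ IsManifold.maximalAtlas (𝓡 (m + 1)) ∞ M) {σ : ℝ}
    (hσ : σ * σ = 1) (hs : HasSign φ σ) {i j : Fin k}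
    (hφe : ∀ q ∈ φ.source, (q ∈ P i ↔ 0 ≤ φ q 0) ∧ (q ∈ P j ↔ φ q 0 ≤ 0))
    {a b : Fin (m + 1) → ℝ} (hab : ∀ l, a l < b l) (ha : a 0 < 0) (hb : 0 < b 0)
    (hQ : euBox a b ⊆ φ.target)
    (hW0 : ∀ p, p ∉ φ.symm '' interior (euBox a b) → W p = 0) :
    ContinuousOn (fun y => edgeFlux X φ
        (Zr i (φ.symm (WithLp.toLp 2 (Fin.insertNth 0 0 y))) -
          Zr j (φ.symm (WithLp.toLp 2 (Fin.insertNth 0 0 y))))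
        (W (φ.symm (WithLp.toLp 2 (Fin.insertNth 0 0 y))))
        (φ.symm (WithLp.toLp 2 (Fin.insertNth 0 0 y))))
      (Icc (a ∘ Fin.succAbove 0) (b ∘ Fin.succAbove 0)) ∧
    stokesDefect 𝒞 P X Z W = -σ * ∫ y in Icc (a ∘ Fin.succAbove 0) (b ∘ Fin.succAbove 0),
      edgeFlux X φ
        (Zr i (φ.symm (WithLp.toLp 2 (Fin.insertNth 0 0 y))) -
          Zr j (φ.symm (WithLp.toLp 2 (Fin.insertNth 0 0 y))))
        (W (φ.symm (WithLp.toLp 2 (Fin.insertNth 0 0 y))))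
        (φ.symm (WithLp.toLp 2 (Fin.insertNth 0 0 y))) := by
  have hface : ∀ u ∈ euBox a b, (∃ l, u l = a l ∨ u l = b l) → W (φ.symm u) = 0 := by
    rintro u hu ⟨l, hl⟩
    refine hW0 _ ?_
    rintro ⟨v, hv, hvu⟩
    have := φ.symm.injOn (hQ (interior_subset hv)) (hQ hu) hvu
    exact notMem_interior_box hl (this ▸ hv)
  obtain ⟨h1, h2⟩ := stokesDefect_eq_chart hcl 𝒞
    ((PieceSmooth.of_contMDiffOn hX).of_le (by norm_num)) hZ.pieceSmooth
    (PieceSmooth.of_contMDiffOn hW) hφ hσ hs (image_symm_subset hQ)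
    (isCompact_image_symm hQ (isCompact_euBox a b))
    fun p hp => hW0 p fun h => hp (image_mono interior_subset h)
  rw [image_symm_inter hQ] at h1 h2
  have hae : (euBox a b ∩ φ.symm ⁻¹' regSet P : Set (Euc (m + 1))) =ᵐ[volume] euBox a b := by
    filter_upwards [compl_mem_ae_iff.2 (volume_coord_zero (n := m + 1))] with u hu
    refine propext ⟨fun h => h.1, fun h => ⟨h, ?_⟩⟩
    exact mem_regSet_of_edge hφe (φ.map_target (hQ h)) (by rwa [φ.right_inv (hQ h)])
  -- The box is cut along `{x₀ = 0}` into its parts in `P i` and in `P j`; integration by parts is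
  -- valid on each half separately.
  have hunion : euBox a b = euBox (Function.update a 0 0) b ∪ euBox a (Function.update b 0 0) := by
    ext u
    rw [mem_union, mem_euBox_update_left ha, mem_euBox_update_right hb, ← and_or_left]
    exact ⟨fun h => ⟨h, le_total _ _⟩, fun h => h.1⟩
  have hdisj : AEDisjoint volume (euBox (Function.update a 0 0) b)
      (euBox a (Function.update b 0 0)) := by
    refine measure_mono_null (fun u hu => ?_) (volume_coord_zero (n := m + 1))
    exact le_antisymm ((mem_euBox_update_right hb).1 hu.2).2 ((mem_euBox_update_left ha).1 hu.1).2
  have hint : IntegrableOn (fun u => pairForm X Z W φ (φ.symm u) - pairForm X W Z φ (φ.symm u))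
      (euBox a b) := h1.congr_set_ae hae.symm
  have hsub1 : euBox (Function.update a 0 0) b ⊆ euBox a b := fun u hu =>
    ((mem_euBox_update_left ha).1 hu).1
  have hsub2 : euBox a (Function.update b 0 0) ⊆ euBox a b := fun u hu =>
    ((mem_euBox_update_right hb).1 hu).1
  -- The edge is the lower face of the half in `P i`, where its flux enters with a minus sign, and
  -- the upper face of the half in `P j`. Hence the jump `Zr i - Zr j` and the factor `-σ`.
  obtain ⟨c1, -, I1⟩ := integral_box_pairForm (hX i) hZ (hW i) hφ
    (update_lt_left hab hb) (fun u hu => ⟨hQ (hsub1 hu),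
      (hφe _ (φ.map_target (hQ (hsub1 hu)))).1.2 (by
        rw [φ.right_inv (hQ (hsub1 hu))]
        exact ((mem_euBox_update_left ha).1 hu).2)⟩)
    fun u hu ⟨l, hl, hl'⟩ => hface u (hsub1 hu) ⟨l, by rwa [Function.update_of_ne hl] at hl'⟩
  obtain ⟨-, c2, I2⟩ := integral_box_pairForm (hX j) hZ (hW j) hφ
    (lt_update_right hab ha) (fun u hu => ⟨hQ (hsub2 hu),
      (hφe _ (φ.map_target (hQ (hsub2 hu)))).2.2 (by
        rw [φ.right_inv (hQ (hsub2 hu))]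
        exact ((mem_euBox_update_right hb).1 hu).2)⟩)
    fun u hu ⟨l, hl, hl'⟩ => hface u (hsub2 hu) ⟨l, by rwa [Function.update_of_ne hl] at hl'⟩
  have hs1 : Function.update a 0 0 ∘ Fin.succAbove (0 : Fin (m + 1)) = a ∘ Fin.succAbove 0 := by
    ext l
    simp
  have hs2 : Function.update b 0 0 ∘ Fin.succAbove (0 : Fin (m + 1)) = b ∘ Fin.succAbove 0 := by
    ext l
    simp
  have hins : ∀ (c : ℝ) (y : Fin m → ℝ), (c = a 0 ∨ c = b 0) →
      y ∈ Icc (a ∘ Fin.succAbove 0) (b ∘ Fin.succAbove 0) →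
      W (φ.symm (WithLp.toLp 2 (Fin.insertNth 0 c y))) = 0 := by
    intro c y hc hy
    refine hface _ ?_ ⟨0, by simpa using hc⟩
    intro j
    refine Fin.succAboveCases 0 ?_ (fun j => ?_) j
    · rcases hc with rfl | rfl
      · simpa using (hab 0).le
      · simpa using (hab 0).le
    · simpa using ⟨hy.1 j, hy.2 j⟩
  simp only [Function.update_self, hs1, hs2] at c1 c2 I1 I2
  have z1 : ∫ y in Icc (a ∘ Fin.succAbove 0) (b ∘ Fin.succAbove 0),
      edgeFlux X φ (Zr i (φ.symm (WithLp.toLp 2 (Fin.insertNth 0 (b 0) y))))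
        (W (φ.symm (WithLp.toLp 2 (Fin.insertNth 0 (b 0) y))))
        (φ.symm (WithLp.toLp 2 (Fin.insertNth 0 (b 0) y))) = 0 :=
    setIntegral_eq_zero_of_forall_eq_zero fun y hy => by
      rw [hins _ y (Or.inr rfl) hy, edgeFlux_zero_right]
  have z2 : ∫ y in Icc (a ∘ Fin.succAbove 0) (b ∘ Fin.succAbove 0),
      edgeFlux X φ (Zr j (φ.symm (WithLp.toLp 2 (Fin.insertNth 0 (a 0) y))))
        (W (φ.symm (WithLp.toLp 2 (Fin.insertNth 0 (a 0) y))))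
        (φ.symm (WithLp.toLp 2 (Fin.insertNth 0 (a 0) y))) = 0 :=
    setIntegral_eq_zero_of_forall_eq_zero fun y hy => by
      rw [hins _ y (Or.inl rfl) hy, edgeFlux_zero_right]
  rw [z1] at I1
  rw [z2] at I2
  simp only [edgeFlux_sub_left]
  refine ⟨c1.sub c2, ?_⟩
  rw [h2, setIntegral_congr_set hae, hunion, setIntegral_union₀ hdisj
    (isCompact_euBox _ _).measurableSet.nullMeasurableSet (hint.mono_set hsub1)
    (hint.mono_set hsub2), I1, I2, integral_sub (c1.integrableOn_compact isCompact_Icc)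
    (c2.integrableOn_compact isCompact_Icc)]
  ring

lemma stokesDefect_edge_eq_zero (hcl : ∀ i, IsClosed (P i)) (𝒞 : ChartPartition n M)
    {X Z W : M → Euc (n + 1)} {Zr : Fin k → M → Euc (n + 1)}
    (hX : ∀ i, ContMDiffOn (𝓡 n) 𝓘(ℝ, Euc (n + 1)) 2 X (P i)) (hZ : PieceRep (n := n) 1 P Z Zr)
    (hW : ∀ i, ContMDiffOn (𝓡 n) 𝓘(ℝ, Euc (n + 1)) 1 W (P i))
    {φ : OpenPartialHomeomorph M (Euc n)} (hφ : φ ∈ IsManifold.maximalAtlas (𝓡 n) ∞ M) {σ : ℝ}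
    (hσ : σ * σ = 1) (hs : HasSign φ σ) {i j : Fin k}
    (hφe : ∀ q ∈ φ.source, (q ∈ P i ↔ 0 ≤ φ q 0) ∧ (q ∈ P j ↔ φ q 0 ≤ 0))
    {a b : Fin n → ℝ} (hab : ∀ l, a l < b l) (ha : a 0 < 0) (hb : 0 < b 0)
    (hQ : euBox a b ⊆ φ.target)
    (hW0 : ∀ p, p ∉ φ.symm '' interior (euBox a b) → W p = 0)
    (h0 : ∀ q ∈ φ.source, φ q 0 = 0 → edgeFlux X φ (Zr i q - Zr j q) (W q) q = 0) :
    stokesDefect 𝒞 P X Z W = 0 := by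
  obtain ⟨m, rfl⟩ := Nat.exists_eq_succ_of_ne_zero (NeZero.ne n)
  rw [(stokesDefect_edge hcl 𝒞 hX hZ hW hφ hσ hs hφe hab ha hb hQ hW0).2,
    setIntegral_eq_zero_of_forall_eq_zero, mul_zero]
  intro y hy
  have hmem : (WithLp.toLp 2 (Fin.insertNth 0 0 y) : Euc (m + 1)) ∈ euBox a b := by
    intro j
    refine Fin.succAboveCases 0 ?_ (fun j => ?_) j
    · simpa using ⟨ha.le, hb.le⟩
    · simpa using ⟨hy.1 j, hy.2 j⟩
  refine h0 _ (φ.map_target (hQ hmem)) ?_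
  rw [φ.right_inv (hQ hmem)]
  simp

/-- A continuous nonnegative flux that does not vanish at `ζ` has a positive integral over the face.
-/
lemma stokesDefect_edge_ne_zero (hcl : ∀ i, IsClosed (P i)) (𝒞 : ChartPartition n M)
    {X Z W : M → Euc (n + 1)} {Zr : Fin k → M → Euc (n + 1)}
    (hX : ∀ i, ContMDiffOn (𝓡 n) 𝓘(ℝ, Euc (n + 1)) 2 X (P i)) (hZ : PieceRep (n := n) 1 P Z Zr)
    (hW : ∀ i, ContMDiffOn (𝓡 n) 𝓘(ℝ, Euc (n + 1)) 1 W (P i))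
    {φ : OpenPartialHomeomorph M (Euc n)} (hφ : φ ∈ IsManifold.maximalAtlas (𝓡 n) ∞ M) {σ : ℝ}
    (hσ : σ * σ = 1) (hs : HasSign φ σ) {i j : Fin k}
    (hφe : ∀ q ∈ φ.source, (q ∈ P i ↔ 0 ≤ φ q 0) ∧ (q ∈ P j ↔ φ q 0 ≤ 0))
    {a b : Fin n → ℝ} (hab : ∀ l, a l < b l) (ha : a 0 < 0) (hb : 0 < b 0)
    (hQ : euBox a b ⊆ φ.target)
    (hW0 : ∀ p, p ∉ φ.symm '' interior (euBox a b) → W p = 0)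
    (h0 : ∀ q ∈ φ.symm '' euBox a b, φ q 0 = 0 → 0 ≤ edgeFlux X φ (Zr i q - Zr j q) (W q) q)
    {ζ : M} (hζ : ζ ∈ φ.source) (hζ0 : φ ζ 0 = 0)
    (hpos : edgeFlux X φ (Zr i ζ - Zr j ζ) (W ζ) ζ ≠ 0) :
    stokesDefect 𝒞 P X Z W ≠ 0 := by
  obtain ⟨m, rfl⟩ := Nat.exists_eq_succ_of_ne_zero (NeZero.ne n)
  obtain ⟨hc, heq⟩ := stokesDefect_edge hcl 𝒞 hX hZ hW hφ hσ hs hφe hab ha hb hQ hW0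
  rw [heq]
  have hσ0 : -σ ≠ 0 := by
    rintro h
    rw [neg_eq_zero] at h
    simp [h] at hσ
  refine mul_ne_zero hσ0 (ne_of_gt ?_)
  -- Off the open box `W` vanishes and with it the flux.
  have hζb : φ ζ ∈ interior (euBox a b) := by
    by_contra hn
    refine hpos ?_
    rw [hW0 ζ, edgeFlux_zero_right]
    rintro ⟨v, hv, rfl⟩
    rw [φ.right_inv (hQ (interior_subset hv))] at hn
    exact hn hv
  rw [interior_euBox] at hζb
  set y₀ : Fin m → ℝ := fun l => φ ζ (Fin.succAbove 0 l) with hy₀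
  have hins : (WithLp.toLp 2 (Fin.insertNth 0 0 y₀) : Euc (m + 1)) = φ ζ := by
    ext l
    refine Fin.succAboveCases 0 ?_ (fun l => ?_) l
    · simpa using hζ0.symm
    · simp [hy₀]
  have hmem : ∀ y ∈ Icc (a ∘ Fin.succAbove 0) (b ∘ Fin.succAbove 0),
      (WithLp.toLp 2 (Fin.insertNth 0 0 y) : Euc (m + 1)) ∈ euBox a b := by
    intro y hy j
    refine Fin.succAboveCases 0 ?_ (fun j => ?_) j
    · simpa using ⟨ha.le, hb.le⟩
    · simpa using ⟨hy.1 j, hy.2 j⟩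
  have hy₀I : Icc (a ∘ Fin.succAbove 0) (b ∘ Fin.succAbove 0) ∈ 𝓝 y₀ := by
    rw [← pi_univ_Icc]
    refine set_pi_mem_nhds finite_univ fun l _ => Icc_mem_nhds ?_ ?_
    · exact (hζb (Fin.succAbove 0 l)).1
    · exact (hζb (Fin.succAbove 0 l)).2
  set g : (Fin m → ℝ) → ℝ := fun y => edgeFlux X φ
        (Zr i (φ.symm (WithLp.toLp 2 (Fin.insertNth 0 0 y))) -
          Zr j (φ.symm (WithLp.toLp 2 (Fin.insertNth 0 0 y))))
        (W (φ.symm (WithLp.toLp 2 (Fin.insertNth 0 0 y))))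
        (φ.symm (WithLp.toLp 2 (Fin.insertNth 0 0 y))) with hg
  have hg0 : ∀ y ∈ Icc (a ∘ Fin.succAbove 0) (b ∘ Fin.succAbove 0), 0 ≤ g y := by
    intro y hy
    refine h0 _ (mem_image_of_mem _ (hmem y hy)) ?_
    rw [φ.right_inv (hQ (hmem y hy))]
    simp
  have hgy : g y₀ ≠ 0 := by
    simp only [hg, hins, φ.left_inv hζ]
    exact hpos
  have hgpos : 0 < g y₀ := lt_of_le_of_ne (hg0 _ (mem_of_mem_nhds hy₀I)) hgy.symm
  have hcat : ContinuousAt g y₀ := hc.continuousAt hy₀I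
  rw [setIntegral_pos_iff_support_of_nonneg_ae
    ((ae_restrict_iff' measurableSet_Icc).2 (Eventually.of_forall hg0))
    (hc.integrableOn_compact isCompact_Icc)]
  refine Measure.measure_pos_of_mem_nhds volume (x := y₀) ?_
  exact inter_mem (hcat.eventually_ne hgy) hy₀I

end LocalDefect

/-! ### Additivity of the defect and partitions of unity -/

section Additivity

open Filter Topology

variable {n : ℕ} {M : Type*} [TopologicalSpace M] [ChartedSpace (EuclideanSpace ℝ (Fin n)) M]
  {F : Type*} [NormedAddCommGroup F] [NormedSpace ℝ F] {k : ℕ} {P : Fin k → Set M}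

lemma PieceSmooth.add {r : WithTop ℕ∞} {f g : M → F} (hf : PieceSmooth (n := n) r P f)
    (hg : PieceSmooth (n := n) r P g) : PieceSmooth (n := n) r P (f + g) := by
  intro i
  obtain ⟨f', hf', ef⟩ := hf i
  obtain ⟨g', hg', eg⟩ := hg i
  exact ⟨f' + g', hf'.add hg', fun p hp => by simp [ef hp, eg hp]⟩

lemma derivIn_add [IsManifold (𝓡 n) ∞ M] {f g : M → F} (hf : PieceSmooth (n := n) 1 P f)
    (hg : PieceSmooth (n := n) 1 P g)
    {φ : OpenPartialHomeomorph M (Euc n)} (hφ : φ ∈ IsManifold.maximalAtlas (𝓡 n) ∞ M) {p : M}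
    (hp : p ∈ regSet P) (hps : p ∈ φ.source) :
    derivIn φ (f + g) p = derivIn φ f p + derivIn φ g p :=
  fderiv_add ((hf.contDiffAt (by exact_mod_cast le_top) hp hφ hps).differentiableAt (by norm_num))
    ((hg.contDiffAt (by exact_mod_cast le_top) hp hφ hps).differentiableAt (by norm_num))

lemma pairForm_add_right [IsManifold (𝓡 n) ∞ M] {X Z W W' : M → Euc (n + 1)}
    (hW : PieceSmooth (n := n) 1 P W) (hW' : PieceSmooth (n := n) 1 P W')
    {φ : OpenPartialHomeomorph M (Euc n)} (hφ : φ ∈ IsManifold.maximalAtlas (𝓡 n) ∞ M) {p : M}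
    (hp : p ∈ regSet P) (hps : p ∈ φ.source) :
    pairForm X Z (W + W') φ p = pairForm X Z W φ p + pairForm X Z W' φ p := by
  rw [pairForm, derivIn_add hW hW' hφ hp hps, crossDer_add, inner_add_right, pairForm, pairForm]

lemma pairForm_add_left {X Z W W' : M → Euc (n + 1)}
    {φ : OpenPartialHomeomorph M (Euc n)} {p : M} :
    pairForm X (W + W') Z φ p = pairForm X W Z φ p + pairForm X W' Z φ p := by
  rw [pairForm, Pi.add_apply, inner_add_left, pairForm, pairForm]

variable [MeasurableSpace M] [BorelSpace M] [IsManifold (𝓡 n) ∞ M] [T2Space M] [CompactSpace M]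

lemma stokesDefect_add (hcl : ∀ i, IsClosed (P i)) (𝒞 : ChartPartition n M)
    {X Z W W' : M → Euc (n + 1)} (hX : PieceSmooth (n := n) 1 P X) (hZ : PieceSmooth (n := n) 1 P Z)
    (hW : PieceSmooth (n := n) 1 P W) (hW' : PieceSmooth (n := n) 1 P W') :
    stokesDefect 𝒞 P X Z (W + W') = stokesDefect 𝒞 P X Z W + stokesDefect 𝒞 P X Z W' := by
  have h1 : formInt 𝒞 P (pairForm X Z (W + W')) =
      formInt 𝒞 P (pairForm X Z W) + formInt 𝒞 P (pairForm X Z W') := by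
    rw [← formInt_add 𝒞 (formIntegrable_pairForm hcl hX hZ hW)
      (formIntegrable_pairForm hcl hX hZ hW')]
    exact formInt_congr 𝒞 fun φ hφ p hp hps =>
      pairForm_add_right hW hW' (mem_maximalAtlas_of_mem_atlas hφ) hp hps
  have h2 : formInt 𝒞 P (pairForm X (W + W') Z) =
      formInt 𝒞 P (pairForm X W Z) + formInt 𝒞 P (pairForm X W' Z) := by
    rw [← formInt_add 𝒞 (formIntegrable_pairForm hcl hX hW hZ)
      (formIntegrable_pairForm hcl hX hW' hZ)]
    exact formInt_congr 𝒞 fun φ hφ p hp hps => pairForm_add_left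
  rw [stokesDefect, stokesDefect, stokesDefect, h1, h2]
  ring

lemma stokesDefect_sum_eq_zero (hcl : ∀ i, IsClosed (P i)) (𝒞 : ChartPartition n M)
    {X Z : M → Euc (n + 1)} (hX : PieceSmooth (n := n) 1 P X) (hZ : PieceSmooth (n := n) 1 P Z)
    {ι : Type*} (s : Finset ι) {W : ι → M → Euc (n + 1)}
    (hW : ∀ i ∈ s, PieceSmooth (n := n) 1 P (W i)) (h : ∀ i ∈ s, stokesDefect 𝒞 P X Z (W i) = 0) :
    PieceSmooth (n := n) 1 P (∑ i ∈ s, W i) ∧ stokesDefect 𝒞 P X Z (∑ i ∈ s, W i) = 0 := by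
  classical
  induction s using Finset.induction_on with
  | empty =>
    refine ⟨fun i => ⟨0, contMDiffOn_const, fun _ _ => rfl⟩, ?_⟩
    have h1 : formInt 𝒞 P (pairForm X Z 0) = formInt 𝒞 P (pairForm X 0 Z) :=
      formInt_congr 𝒞 fun φ _ p _ hps => by
        rw [pairForm_eq_zero_left (W := 0) rfl,
          pairForm_eq_zero_right (W := 0) hps (EventuallyEq.refl _ _)]
    rw [Finset.sum_empty, stokesDefect, h1, sub_self]
  | insert i s hi ih =>
    obtain ⟨ih1, ih2⟩ := ih (fun j hj => hW j (Finset.mem_insert_of_mem hj))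
      fun j hj => h j (Finset.mem_insert_of_mem hj)
    have hWi := hW i (Finset.mem_insert_self _ _)
    rw [Finset.sum_insert hi, stokesDefect_add hcl 𝒞 hX hZ hWi ih1, ih2,
      h i (Finset.mem_insert_self _ _), add_zero]
    exact ⟨hWi.add ih1, rfl⟩

lemma exists_finite_partition {V : M → Set M} (hV : ∀ p, V p ∈ 𝓝 p) :
    ∃ (t : Finset M) (f : t → M → ℝ), (∀ i, ContMDiff (𝓡 n) 𝓘(ℝ, ℝ) ∞ (f i)) ∧
      (∀ i, tsupport (f i) ⊆ V i) ∧ ∀ p, ∑ i, f i p = 1 := by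
  obtain ⟨t, -, ht⟩ := isCompact_univ.elim_nhds_subcover (fun p => interior (V p))
    fun p _ => isOpen_interior.mem_nhds (mem_interior_iff_mem_nhds.2 (hV p))
  obtain ⟨f, hf⟩ := SmoothPartitionOfUnity.exists_isSubordinate (𝓡 n) isClosed_univ
    (fun i : t => interior (V i)) (fun _ => isOpen_interior) (by
      intro p hp
      obtain ⟨i, hi, hp⟩ := mem_iUnion₂.1 (ht hp)
      exact mem_iUnion.2 ⟨⟨i, hi⟩, hp⟩)
  refine ⟨t, fun i => f i, fun i => (f i).contMDiff, fun i => (hf i).trans interior_subset,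
    fun p => ?_⟩
  rw [← finsum_eq_sum_of_fintype]
  exact f.sum_eq_one (mem_univ p)

/-- The vanishing of the defect of symmetry is a local question. -/
lemma stokesDefect_eq_zero_of_locally (hcl : ∀ i, IsClosed (P i)) (𝒞 : ChartPartition n M)
    {X Z W : M → Euc (n + 1)} (hX : PieceSmooth (n := n) 1 P X) (hZ : PieceSmooth (n := n) 1 P Z)
    (hW : ∀ i, ContMDiffOn (𝓡 n) 𝓘(ℝ, Euc (n + 1)) 1 W (P i))
    (h : ∀ p, ∃ V ∈ 𝓝 p, ∀ ρ : M → ℝ, ContMDiff (𝓡 n) 𝓘(ℝ, ℝ) ∞ ρ → tsupport ρ ⊆ V →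
      stokesDefect 𝒞 P X Z (fun q => ρ q • W q) = 0) :
    stokesDefect 𝒞 P X Z W = 0 := by
  choose V hV h using h
  obtain ⟨t, f, hf1, hf2, hf3⟩ := exists_finite_partition (n := n) hV
  have := (stokesDefect_sum_eq_zero hcl 𝒞 hX hZ Finset.univ (W := fun i q => f i q • W q)
    (fun i _ => PieceSmooth.of_contMDiffOn fun j =>
      ((hf1 i).of_le (by exact_mod_cast le_top)).contMDiffOn.smul (hW j))
    fun i _ => h i (f i) (hf1 i) (hf2 i)).2
  rw [← this]
  congr 1
  ext1 q
  rw [Finset.sum_apply, ← Finset.sum_smul, hf3, one_smul]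

end Additivity

/-! ### Vanishing of the defect away from the corners -/

section Localization

open Filter Topology

variable {n : ℕ} {M : Type*} [TopologicalSpace M] [ChartedSpace (EuclideanSpace ℝ (Fin n)) M]
  {k : ℕ} {P : Fin k → Set M}

lemma exists_euBox_subset {O : Set (Euc n)} {c : Euc n} (hO : O ∈ 𝓝 c) :
    ∃ a b : Fin n → ℝ, (∀ l, a l < c l ∧ c l < b l) ∧ euBox a b ⊆ O := by
  have h1 : (WithLp.toLp 2 : (Fin n → ℝ) → Euc n) ⁻¹' O ∈ 𝓝 c.ofLp :=
    (PiLp.continuous_toLp 2 _).continuousAt.preimage_mem_nhds hO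
  obtain ⟨r, hr, hrO⟩ := Metric.mem_nhds_iff.1 h1
  refine ⟨fun l => c l - r / 2, fun l => c l + r / 2,
    fun l => ⟨by linarith, by linarith⟩, fun u hu => ?_⟩
  have : u.ofLp ∈ Metric.ball c.ofLp r := by
    refine lt_of_le_of_lt ((dist_pi_le_iff (by positivity)).2 fun l => ?_) (half_lt_self hr)
    rw [Real.dist_eq, abs_le]
    have := hu l
    constructor <;> linarith [this.1, this.2]
  exact hrO this

variable [IsManifold (𝓡 n) ∞ M]

/-- Every smooth chart can be restricted such that it preserves or reverses the orientation. -/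
lemma exists_restr_hasSign (hM : IsOrientedAtlas n M) {φ : OpenPartialHomeomorph M (Euc n)}
    (hφ : φ ∈ IsManifold.maximalAtlas (𝓡 n) ∞ M) {p : M} (hp : p ∈ φ.source) :
    ∃ U : Set M, IsOpen U ∧ p ∈ U ∧ φ.restr U ∈ IsManifold.maximalAtlas (𝓡 n) ∞ M ∧
      ∃ σ : ℝ, σ * σ = 1 ∧ HasSign (φ.restr U) σ := by
  set e := chartAt (Euc n) p with he
  have hem := chartAt_mem_maximalAtlas (n := n) p
  have hpe := mem_chart_source (Euc n) p
  have hdet0 : ∀ q ∈ φ.source, q ∈ e.source → (transD φ e q).det ≠ 0 := fun q hq hqe h0 => by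
    have := transD_comp hφ hem hq hqe
    rw [h0, mul_zero] at this
    exact zero_ne_one this
  have hcont : ContinuousAt (fun q => (transD φ e q).det) p := by
    have h1 : ContinuousAt (fderiv ℝ (e ∘ φ.symm)) (φ p) :=
      ((contDiffAt_transition hφ hem hp hpe).fderiv_right (m := 0) (by simp)).continuousAt
    have h2 : ContinuousAt (fun q => transD φ e q) p := ContinuousAt.comp h1 (φ.continuousAt hp)
    exact (ContinuousLinearMap.continuous_det).continuousAt.comp h2
  obtain ⟨σ, hσ, hσp⟩ : ∃ σ : ℝ, σ * σ = 1 ∧ 0 < σ * (transD φ e p).det := by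
    rcases lt_or_gt_of_ne (hdet0 p hp hpe) with h | h
    · exact ⟨-1, by norm_num, by linarith⟩
    · exact ⟨1, by norm_num, by linarith⟩
  have hev : ∀ᶠ q in 𝓝 p, 0 < σ * (transD φ e q).det :=
    (continuousAt_const.mul hcont).eventually (lt_mem_nhds hσp)
  obtain ⟨U, hUs, hUo, hpU⟩ := mem_nhds_iff.1 (inter_mem hev (e.open_source.mem_nhds hpe))
  refine ⟨U, hUo, hpU, restr_mem_maximalAtlas _ hφ hUo, σ, hσ, ?_⟩
  intro q hq e' he' hqe'
  rw [OpenPartialHomeomorph.restr_source, hUo.interior_eq] at hq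
  have h1 := hUs hq.2
  have h2 := hasSign_of_mem_atlas hM (chart_mem_atlas (Euc n) p) q h1.2 e' he' hqe'
  have h3 : transD (φ.restr U) e' q = transD φ e' q := rfl
  have h4 : (transD φ e' q).det = (transD e e' q).det * (transD φ e q).det := by
    rw [transD_trans hφ hem hq.1 h1.2]
    exact LinearMap.det_comp _ _
  rw [one_mul] at h2
  have := mul_pos h1.1 h2
  rw [h3, h4]
  linarith

variable [MeasurableSpace M] [BorelSpace M] [T2Space M] [CompactSpace M] [NeZero n]

lemma image_symm_mem_nhds {φ : OpenPartialHomeomorph M (Euc n)} {p : M} (hp : p ∈ φ.source)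
    {Q : Set (Euc n)} (hQ : Q ∈ 𝓝 (φ p)) : φ.symm '' Q ∈ 𝓝 p := by
  filter_upwards [(φ.continuousAt hp).preimage_mem_nhds hQ, φ.open_source.mem_nhds hp] with q hq hqs
  exact ⟨φ q, hq, φ.left_inv hqs⟩

lemma interior_euBox_mem_nhds {a b : Fin n → ℝ} {c : Euc n} (h : ∀ l, a l < c l ∧ c l < b l) :
    interior (euBox a b) ∈ 𝓝 c :=
  isOpen_interior.mem_nhds (by
    rw [interior_euBox]
    exact h)

/-- Away from the corners, the defect of symmetry vanishes locally if the jump of `Z` is tangent. -/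
lemma exists_nhds_stokesDefect_eq_zero (hM : IsOrientedAtlas n M)
    (hP : IsPieceDecomposition (n := n) P) (𝒞 : ChartPartition n M)
    {X Z W : M → Euc (n + 1)} {Zr : Fin k → M → Euc (n + 1)}
    (hX : ∀ i, ContMDiffOn (𝓡 n) 𝓘(ℝ, Euc (n + 1)) 2 X (P i)) (hZ : PieceRep (n := n) 1 P Z Zr)
    (hW : ∀ i, ContMDiffOn (𝓡 n) 𝓘(ℝ, Euc (n + 1)) 1 W (P i))
    (hj : ∀ i j ζ φ, IsEdgeChart (n := n) P i j ζ φ → edgeFlux X φ (Zr i ζ - Zr j ζ) (W ζ) ζ = 0)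
    {p : M} (hp : p ∉ allCorners (n := n) P) :
    ∃ V ∈ 𝓝 p, ∀ ρ : M → ℝ, ContMDiff (𝓡 n) 𝓘(ℝ, ℝ) ∞ ρ → tsupport ρ ⊆ V →
      stokesDefect 𝒞 P X Z (fun q => ρ q • W q) = 0 := by
  have hcl := isClosed_piece hP
  have hρW : ∀ ρ : M → ℝ, ContMDiff (𝓡 n) 𝓘(ℝ, ℝ) ∞ ρ → ∀ i,
      ContMDiffOn (𝓡 n) 𝓘(ℝ, Euc (n + 1)) 1 (fun q => ρ q • W q) (P i) := fun ρ hρ i =>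
    (hρ.of_le (by exact_mod_cast le_top)).contMDiffOn.smul (hW i)
  by_cases hr : p ∈ regSet P
  · obtain ⟨i, hi⟩ := mem_iUnion.1 hr
    set φ := chartAt (Euc n) p with hφ
    have hps : p ∈ φ.source := mem_chart_source _ p
    have hO : φ.target ∩ φ.symm ⁻¹' interior (P i) ∈ 𝓝 (φ p) := by
      refine inter_mem (φ.open_target.mem_nhds (φ.map_source hps))
        ((φ.continuousAt_symm (φ.map_source hps)).preimage_mem_nhds ?_)
      rw [φ.left_inv hps]
      exact isOpen_interior.mem_nhds hi
    obtain ⟨a, b, hab, hQ⟩ := exists_euBox_subset hO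
    refine ⟨φ.symm '' interior (euBox a b), image_symm_mem_nhds hps
      (interior_euBox_mem_nhds hab),
      fun ρ hρ hs => ?_⟩
    refine stokesDefect_interior hcl 𝒞 hX hZ (hρW ρ hρ) (chartAt_mem_maximalAtlas p) (one_mul 1)
      (hasSign_of_mem_atlas hM (chart_mem_atlas _ p)) (i := i)
      (fun l => (hab l).1.trans (hab l).2) (fun u hu => (hQ hu).1) (fun u hu => (hQ hu).2)
      fun q hq => ?_
    rw [image_eq_zero_of_notMem_tsupport fun h => hq (hs h), zero_smul]
  · obtain ⟨i, j, φ, hφm, hps, hp0, hφe⟩ := exists_isEdgeChart hP hr hp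
    obtain ⟨U, hUo, hpU, hUm, σ, hσ, hs⟩ := exists_restr_hasSign hM hφm hps
    set ψ := φ.restr U with hψ
    have hψs : ψ.source = φ.source ∩ U := by
      rw [hψ, OpenPartialHomeomorph.restr_source, hUo.interior_eq]
    have hpψ : p ∈ ψ.source := by
      rw [hψs]
      exact ⟨hps, hpU⟩
    have hψe : ∀ q ∈ ψ.source, (q ∈ P i ↔ 0 ≤ ψ q 0) ∧ (q ∈ P j ↔ ψ q 0 ≤ 0) := fun q hq =>
      hφe q (hψs ▸ hq).1
    obtain ⟨a, b, hab, hQ⟩ := exists_euBox_subset (ψ.open_target.mem_nhds (ψ.map_source hpψ))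
    refine ⟨ψ.symm '' interior (euBox a b), image_symm_mem_nhds hpψ
      (interior_euBox_mem_nhds hab), fun ρ hρ hsupp => ?_⟩
    have h0 := hab 0
    have hp0' : ψ p 0 = 0 := hp0
    rw [hp0'] at h0
    refine stokesDefect_edge_eq_zero hcl 𝒞 hX hZ (hρW ρ hρ) hUm hσ hs hψe
      (fun l => (hab l).1.trans (hab l).2) h0.1 h0.2 hQ (fun q hq => ?_) fun q hq hq0 => ?_
    · rw [image_eq_zero_of_notMem_tsupport fun h => hq (hsupp h), zero_smul]
    · rw [edgeFlux_smul_right, hj i j q ψ ⟨hUm, hq, hq0, hψe⟩, mul_zero]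

/-! ### Removal of the corners and the global integration by parts -/

section Corners

variable {X Z W : M → Euc (n + 1)} {Zr : Fin k → M → Euc (n + 1)}

/-- The product of a vector field supported in the domain of `e` with a function of the
coordinates. -/
lemma contMDiffOn_coord_smul {e : OpenPartialHomeomorph M (Euc n)}
    (he : e ∈ IsManifold.maximalAtlas (𝓡 n) ∞ M) {A K : Set M} (hK : IsClosed K)
    (hKs : K ⊆ e.source) {η : Euc n → ℝ} (hη : ContDiff ℝ ∞ η)
    (hW : ContMDiffOn (𝓡 n) 𝓘(ℝ, Euc (n + 1)) 1 W A) (hW0 : ∀ q, q ∉ K → W q = 0) :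
    ContMDiffOn (𝓡 n) 𝓘(ℝ, Euc (n + 1)) 1 (fun q => η (e q) • W q) A := by
  intro q hq
  by_cases hqe : q ∈ e.source
  · have h1 : ContMDiffAt (𝓡 n) 𝓘(ℝ, ℝ) 1 (fun q => η (e q)) q := by
      refine ContMDiffAt.comp q (g := η) (I' := 𝓘(ℝ, Euc n))
        ((hη.of_le (by exact_mod_cast le_top)).contMDiff.contMDiffAt) ?_
      exact ((contMDiffOn_of_mem_maximalAtlas he).of_le (by exact_mod_cast le_top)).contMDiffAt
        (e.open_source.mem_nhds hqe)
    exact h1.contMDiffWithinAt.smul (hW q hq)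
  · have h0 : (fun q => η (e q) • W q) =ᶠ[𝓝 q] fun _ => (0 : Euc (n + 1)) := by
      filter_upwards [hK.isOpen_compl.mem_nhds fun h => hqe (hKs h)] with r hr
      rw [hW0 r hr, smul_zero]
    exact ((contMDiffAt_const (c := (0 : Euc (n + 1)))).congr_of_eventuallyEq h0).contMDiffWithinAt

lemma derivIn_coord_smul (hW : PieceSmooth (n := n) 1 P W) {e : OpenPartialHomeomorph M (Euc n)}
    (he : e ∈ IsManifold.maximalAtlas (𝓡 n) ∞ M) {η : Euc n → ℝ} (hη : ContDiff ℝ ∞ η)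
    {q : M} (hq : q ∈ regSet P) (hqs : q ∈ e.source) :
    derivIn e (fun q => η (e q) • W q) q =
      η (e q) • derivIn e W q + (fderiv ℝ η (e q)).smulRight (W q) := by
  have h1 : (fun q => η (e q) • W q) ∘ e.symm =ᶠ[𝓝 (e q)] fun u => η u • (W ∘ e.symm) u := by
    filter_upwards [e.open_target.mem_nhds (e.map_source hqs)] with u hu
    simp [e.right_inv hu]
  have h2 : DifferentiableAt ℝ (W ∘ e.symm) (e q) :=
    (hW.contDiffAt (by exact_mod_cast le_top) hq he hqs).differentiableAt (by norm_num)
  have h3 : DifferentiableAt ℝ η (e q) := hη.contDiffAt.differentiableAt (by simp)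
  rw [derivIn, h1.fderiv_eq, fderiv_fun_smul h3 h2, Function.comp_apply, e.left_inv hqs, derivIn]

lemma exists_norm_crossDer_le (n : ℕ) (C : ℝ) : ∃ D, 0 ≤ D ∧ ∀ L : Euc n →L[ℝ] Euc (n + 1),
    ‖L‖ ≤ C → ∀ B, ‖crossDer L B‖ ≤ D * ‖B‖ := by
  have hc : Continuous fun L : Euc n →L[ℝ] Euc (n + 1) => ‖fderiv ℝ (crossL (n := n)) L‖ :=
    continuous_norm.comp ((contDiff_crossL (r := 1)).continuous_fderiv (by norm_num))
  obtain ⟨D, hD⟩ := exists_bound_comp hc C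
  refine ⟨|D|, abs_nonneg _, fun L hL B => ?_⟩
  refine (ContinuousLinearMap.le_opNorm _ _).trans (mul_le_mul_of_nonneg_right ?_ (norm_nonneg _))
  have := hD L hL
  exact (le_abs_self _).trans (this.trans (le_abs_self _))

/-- The effect of multiplying the field by a cutoff function. -/
lemma exists_abs_stokesDefect_le (hM : IsOrientedAtlas n M) (hcl : ∀ i, IsClosed (P i))
    (𝒞 : ChartPartition n M) (hX : PieceSmooth (n := n) 1 P X) (hZ : PieceSmooth (n := n) 1 P Z)
    (hW : ∀ i, ContMDiffOn (𝓡 n) 𝓘(ℝ, Euc (n + 1)) 1 W (P i))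
    {e : OpenPartialHomeomorph M (Euc n)} (he : e ∈ atlas (Euc n) M) {K : Set M} (hK : IsCompact K)
    (hKs : K ⊆ e.source) (hW0 : ∀ q, q ∉ K → W q = 0) :
    ∃ C, 0 ≤ C ∧ ∀ η : Euc n → ℝ, ContDiff ℝ ∞ η → HasCompactSupport η →
      (∀ u, 0 ≤ η u ∧ η u ≤ 1) → |stokesDefect 𝒞 P X Z (fun q => η (e q) • W q)| ≤
        C * ((∫ u, η u) + ∫ u, ‖fderiv ℝ η u‖) := by
  have hem := mem_maximalAtlas_of_mem_atlas he
  have hWp := PieceSmooth.of_contMDiffOn (n := n) hW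
  obtain ⟨C1, -, h1⟩ := hX.exists_bound hcl hem hK hKs
  obtain ⟨C2, h20, h2⟩ := hZ.exists_bound hcl hem hK hKs
  obtain ⟨C3, h30, h3⟩ := hWp.exists_bound hcl hem hK hKs
  obtain ⟨D, hD0, hD⟩ := exists_norm_crossDer_le n C1
  -- The first summand bounds the term with the derivative of `η W`, the second the term with the
  -- derivative of `Z`. The constant does not depend on `η`.
  refine ⟨C2 * (D * C3) + C3 * (D * C2), by positivity, fun η hη hηc hη1 => ?_⟩
  set C := C2 * (D * C3) + C3 * (D * C2) with hC
  have hηW := fun i => contMDiffOn_coord_smul hem hK.isClosed hKs hη (hW i) hW0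
  obtain ⟨hi, heq⟩ := stokesDefect_eq_chart hcl 𝒞 hX hZ (PieceSmooth.of_contMDiffOn hηW) hem
    (one_mul 1) (hasSign_of_mem_atlas hM he) hKs hK fun q hq => by rw [hW0 q hq, smul_zero]
  obtain ⟨j1, j2⟩ := integrable_of_contDiff_hasCompactSupport hη hηc
  have hm : MeasurableSet (e '' (K ∩ regSet P)) := measurableSet_image
    (inter_subset_left.trans hKs) (hK.measurableSet.inter (isOpen_regSet P).measurableSet)
  have j3 : Integrable fun u => C * (η u + ‖fderiv ℝ η u‖) := (j1.add j2).const_mul C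
  rw [heq, one_mul]
  calc |∫ u in e '' (K ∩ regSet P), (pairForm X Z (fun q => η (e q) • W q) e (e.symm u) -
        pairForm X (fun q => η (e q) • W q) Z e (e.symm u))|
      ≤ ∫ u in e '' (K ∩ regSet P), C * (η u + ‖fderiv ℝ η u‖) := by
        rw [← Real.norm_eq_abs]
        refine norm_integral_le_of_norm_le j3.integrableOn ?_
        refine (ae_restrict_iff' hm).2 (Eventually.of_forall ?_)
        rintro _ ⟨q, ⟨hqK, hqr⟩, rfl⟩
        have hqs := hKs hqK
        have b1 := (h1 q hqK hqr).2
        obtain ⟨b2, b2'⟩ := h2 q hqK hqr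
        obtain ⟨b3, b3'⟩ := h3 q hqK hqr
        have hη0 := (hη1 (e q)).1
        rw [e.left_inv hqs, pairForm, pairForm, derivIn_coord_smul hWp hem hη hqr hqs]
        have e1 : |⟪Z q, crossDer (derivIn e X q) (η (e q) • derivIn e W q +
            (fderiv ℝ η (e q)).smulRight (W q))⟫| ≤
            C2 * (D * (C3 * (η (e q) + ‖fderiv ℝ η (e q)‖))) := by
          refine (abs_real_inner_le_norm _ _).trans (mul_le_mul b2 ((hD _ b1 _).trans
            (mul_le_mul_of_nonneg_left ?_ hD0)) (norm_nonneg _) h20)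
          refine (norm_add_le _ _).trans ?_
          rw [norm_smul, ContinuousLinearMap.norm_smulRight_apply, Real.norm_of_nonneg hη0]
          nlinarith [mul_le_mul_of_nonneg_left b3' hη0,
            mul_le_mul_of_nonneg_left b3 (norm_nonneg (fderiv ℝ η (e q)))]
        have e2 : |⟪η (e q) • W q, crossDer (derivIn e X q) (derivIn e Z q)⟫| ≤
            η (e q) * (C3 * (D * C2)) := by
          rw [real_inner_smul_left, abs_mul, abs_of_nonneg hη0]
          refine mul_le_mul_of_nonneg_left ?_ hη0
          exact (abs_real_inner_le_norm _ _).trans (mul_le_mul b3 ((hD _ b1 _).trans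
            (mul_le_mul_of_nonneg_left b2' hD0)) (norm_nonneg _) h30)
        rw [Real.norm_eq_abs]
        refine (abs_sub _ _).trans ((add_le_add e1 e2).trans ?_)
        have : 0 ≤ ‖fderiv ℝ η (e q)‖ * (C3 * (D * C2)) := by positivity
        rw [hC]
        nlinarith
    _ ≤ ∫ u, C * (η u + ‖fderiv ℝ η u‖) := by
        refine setIntegral_le_integral j3 (Eventually.of_forall fun u => ?_)
        have := (hη1 u).1
        have hC0 : 0 ≤ C := by positivity
        exact mul_nonneg hC0 (add_nonneg this (norm_nonneg _))
    _ = C * ((∫ u, η u) + ∫ u, ‖fderiv ℝ η u‖) := by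
        rw [integral_const_mul, integral_add j1 j2]

/-- The integral of `⟪Z, dN(W)⟫` is symmetric in `Z` and `W` if the jump of `Z` across the edges
has no normal component in the direction of `W`. -/
theorem stokesDefect_eq_zero (hM : IsOrientedAtlas n M)
    (hP : IsPieceDecomposition (n := n) P) (𝒞 : ChartPartition n M)
    (hX : ∀ i, ContMDiffOn (𝓡 n) 𝓘(ℝ, Euc (n + 1)) 2 X (P i)) (hZ : PieceRep (n := n) 1 P Z Zr)
    (hW : ∀ i, ContMDiffOn (𝓡 n) 𝓘(ℝ, Euc (n + 1)) 1 W (P i))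
    (hj : ∀ i j ζ φ, IsEdgeChart (n := n) P i j ζ φ → edgeFlux X φ (Zr i ζ - Zr j ζ) (W ζ) ζ = 0) :
    stokesDefect 𝒞 P X Z W = 0 := by
  have hcl := isClosed_piece hP
  have hX1 : PieceSmooth (n := n) 1 P X := (PieceSmooth.of_contMDiffOn hX).of_le (by norm_num)
  -- fields vanishing near the corners
  have hoff : ∀ W' : M → Euc (n + 1), (∀ i, ContMDiffOn (𝓡 n) 𝓘(ℝ, Euc (n + 1)) 1 W' (P i)) →
      (∀ q, ∃ c : ℝ, W' q = c • W q) → (∀ p ∈ allCorners (n := n) P, W' =ᶠ[𝓝 p] 0) →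
      stokesDefect 𝒞 P X Z W' = 0 := by
    intro W' hW' hc h0
    refine stokesDefect_eq_zero_of_locally hcl 𝒞 hX1 hZ.pieceSmooth hW' fun p => ?_
    by_cases hp : p ∈ allCorners (n := n) P
    · refine ⟨_, h0 p hp, fun ρ hρ hs => ?_⟩
      have : (fun q => ρ q • W' q) = ∑ i ∈ (∅ : Finset (Fin 0)), fun _ => 0 := by
        ext1 q
        rw [Finset.sum_empty, Pi.zero_apply]
        by_cases hq : q ∈ tsupport ρ
        · have : W' q = 0 := hs hq
          rw [this, smul_zero]
        · rw [image_eq_zero_of_notMem_tsupport hq, zero_smul]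
      rw [this]
      exact (stokesDefect_sum_eq_zero hcl 𝒞 hX1 hZ.pieceSmooth ∅ (by simp) (by simp)).2
    · refine exists_nhds_stokesDefect_eq_zero hM hP 𝒞 hX hZ hW' (fun i j ζ φ hφ => ?_) hp
      obtain ⟨c, hc⟩ := hc ζ
      rw [hc, edgeFlux_smul_right, hj i j ζ φ hφ, mul_zero]
  refine stokesDefect_eq_zero_of_locally hcl 𝒞 hX1 hZ.pieceSmooth hW fun p => ?_
  set e := chartAt (Euc n) p with hedef
  have hea : e ∈ atlas (Euc n) M := chart_mem_atlas _ p
  have hem := mem_maximalAtlas_of_mem_atlas hea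
  refine ⟨e.source, e.open_source.mem_nhds (mem_chart_source _ p), fun ρ hρ hs => ?_⟩
  set V : M → Euc (n + 1) := fun q => ρ q • W q with hV
  set K := tsupport ρ with hKdef
  have hK : IsCompact K := (isClosed_tsupport ρ).isCompact
  have hVs : ∀ i, ContMDiffOn (𝓡 n) 𝓘(ℝ, Euc (n + 1)) 1 V (P i) := fun i =>
    (hρ.of_le (by exact_mod_cast le_top)).contMDiffOn.smul (hW i)
  have hV0 : ∀ q, q ∉ K → V q = 0 := fun q hq => by
    rw [hV]
    simp only
    rw [image_eq_zero_of_notMem_tsupport hq, zero_smul]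
  obtain ⟨C, hC0, hC⟩ := exists_abs_stokesDefect_le hM hcl 𝒞 hX1 hZ.pieceSmooth hVs hea hK hs hV0
  set T := e '' (allCorners (n := n) P ∩ K) with hT
  have hTc : IsCompact T := (hK.inter_left (isClosed_allCorners hP)).image_of_continuousOn
    (e.continuousOn.mono (inter_subset_right.trans hs))
  have hT0 : μH[(n : ℝ) - 1] T = 0 := by
    refine measure_mono_null (t := ⋃ i, e '' (cornerSet (n := n) (P i) ∩ e.source)) ?_
      (measure_iUnion_null fun i => (hP.isPiece i).corner_null e hea)
    rintro _ ⟨q, ⟨hq, hqK⟩, rfl⟩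
    obtain ⟨i, hi⟩ := mem_iUnion.1 hq
    exact mem_iUnion.2 ⟨i, q, ⟨hi, hs hqK⟩, rfl⟩
  have hle : ∀ ε : ℝ, 0 < ε → |stokesDefect 𝒞 P X Z V| ≤ C * (ε + ε) := by
    intro ε hε
    obtain ⟨U, hUo, hTU, η, g1, g2, g3, g4, g5, g6⟩ :=
      exists_cutoff_of_hausdorffMeasure_eq_zero hTc hT0 hε
    have s1 := fun i => contMDiffOn_coord_smul hem hK.isClosed hs g1 (hVs i) hV0
    have s2 := fun i => contMDiffOn_coord_smul hem hK.isClosed hs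
      (contDiff_const.sub g1 : ContDiff ℝ ∞ fun u => 1 - η u) (hVs i) hV0
    -- The second field vanishes near the corners, so its defect is zero; the first one is
    -- controlled by the integrals of `η` and its gradient, which are at most `ε`.
    have hsum : V = (fun q => η (e q) • V q) + fun q => (1 - η (e q)) • V q := by
      ext1 q
      rw [Pi.add_apply, ← add_smul]
      simp
    rw [hsum, stokesDefect_add hcl 𝒞 hX1 hZ.pieceSmooth (PieceSmooth.of_contMDiffOn s1)
      (PieceSmooth.of_contMDiffOn s2), hoff _ s2, add_zero]
    · exact (hC η g1 g2 g3).trans (mul_le_mul_of_nonneg_left (add_le_add g5 g6) hC0)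
    · exact fun q => ⟨(1 - η (e q)) * ρ q, by rw [mul_smul]⟩
    · intro q hq
      by_cases hqK : q ∈ K
      · filter_upwards [(e.continuousAt (hs hqK)).preimage_mem_nhds
          (hUo.mem_nhds (hTU (mem_image_of_mem e ⟨hq, hqK⟩)))] with r hr
        simp [g4 _ hr]
      · filter_upwards [hK.isClosed.isOpen_compl.mem_nhds hqK] with r hr
        simp [hV0 r hr]
  by_contra hne
  have hpos := abs_pos.2 hne
  -- With this `ε` the upper bound is at most half of the defect itself.
  have := hle (|stokesDefect 𝒞 P X Z V| / (4 * (C + 1))) (by positivity)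
  have h4 : C * (|stokesDefect 𝒞 P X Z V| / (4 * (C + 1)) +
      |stokesDefect 𝒞 P X Z V| / (4 * (C + 1))) ≤ |stokesDefect 𝒞 P X Z V| / 2 := by
    rw [← add_div, mul_div_assoc', div_le_div_iff₀ (by positivity) (by positivity)]
    nlinarith
  linarith

end Corners

end Localization

/-! ### Regularity and uniform bounds for variations -/

section Variation

open Filter Topology

/-- The first-order bound is applied to `f` and to its derivative within `s`, which near interior
points is the derivative of `f`. -/
lemma ContDiffWithinAt.exists_fderiv_fderiv_bound {E F : Type*} [NormedAddCommGroup E]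
    [NormedSpace ℝ E] [NormedAddCommGroup F] [NormedSpace ℝ F] {f : E → F} {s : Set E} {x : E}
    (h : ContDiffWithinAt ℝ 2 f s x) (hx : x ∈ s) :
    ∃ C, ∀ᶠ y in 𝓝 x, y ∈ interior s →
      ‖f y‖ ≤ C ∧ ‖fderiv ℝ f y‖ ≤ C ∧ ‖fderiv ℝ (fderiv ℝ f) y‖ ≤ C := by
  obtain ⟨C₀, hC₀⟩ := ContDiffWithinAt.exists_fderiv_bound (h.of_le (by norm_num)) hx
  have h1 : ContDiffWithinAt ℝ (1 + 1) f s x := by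
    rw [one_add_one_eq_two]
    exact h
  obtain ⟨u, hu, -, f', hf', hc⟩ := (contDiffWithinAt_succ_iff_hasFDerivWithinAt (by simp)).1 h1
  have hxu : x ∈ u := mem_of_mem_nhdsWithin (mem_insert _ _) hu
  rw [insert_eq_of_mem hx] at hu
  obtain ⟨C, hC⟩ := ContDiffWithinAt.exists_fderiv_bound hc hxu
  have hu2 : ∀ᶠ y in 𝓝[s] x, y ∈ u := hu
  rw [eventually_nhdsWithin_iff] at hu2
  refine ⟨max C₀ C, ?_⟩
  filter_upwards [hC₀, hC, eventually_eventually_nhds.2 hu2] with y h0 h2 h3 hy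
  have hint : ∀ᶠ z in 𝓝 y, z ∈ interior u := by
    filter_upwards [eventually_eventually_nhds.2 h3, isOpen_interior.mem_nhds hy] with z hz hzs
    rw [mem_interior_iff_mem_nhds]
    filter_upwards [hz, mem_interior_iff_mem_nhds.1 hzs] with w hw hws
    exact hw hws
  have he : fderiv ℝ f =ᶠ[𝓝 y] f' := by
    filter_upwards [hint] with z hz
    exact ((hf' z (interior_subset hz)).hasFDerivAt (mem_interior_iff_mem_nhds.1 hz)).fderiv
  obtain ⟨-, k1, k2⟩ := h2 (mem_of_mem_nhds hint)
  refine ⟨(h0 hy).2.1.trans (le_max_left _ _), ?_, ?_⟩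
  · rw [he.self_of_nhds]
    exact k1.trans (le_max_right _ _)
  · rw [he.fderiv_eq]
    exact k2.trans (le_max_right _ _)

/-- The partial derivative in the direction of a real parameter is of class `C¹`. -/
lemma ContDiffWithinAt.deriv_param {E F : Type*} [NormedAddCommGroup E] [NormedSpace ℝ E]
    [NormedAddCommGroup F] [NormedSpace ℝ F] {G : ℝ × E → F} {I : Set ℝ} {S : Set E} {t : ℝ} {x : E}
    (hI : IsOpen I) (ht : t ∈ I) (hx : x ∈ S) (h : ContDiffWithinAt ℝ 2 G (I ×ˢ S) (t, x)) :
    ContDiffWithinAt ℝ 1 (fun y => deriv (fun s => G (s, y)) t) S x := by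
  have h1 : ContDiffWithinAt ℝ (1 + 1) G (I ×ˢ S) (t, x) := by
    rw [one_add_one_eq_two]
    exact h
  obtain ⟨u, hu, -, f', hf', hc⟩ := (contDiffWithinAt_succ_iff_hasFDerivWithinAt (by simp)).1 h1
  have hmem : (t, x) ∈ I ×ˢ S := ⟨ht, hx⟩
  rw [insert_eq_of_mem hmem] at hu
  have hc' : ContDiffWithinAt ℝ 1 f' (I ×ˢ S) (t, x) := hc.mono_of_mem_nhdsWithin hu
  have h2 : ContDiffWithinAt ℝ 1 (fun y : E => f' (t, y) (1, 0)) S x := by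
    have h3 : ContDiffWithinAt ℝ 1 (fun y : E => f' (t, y)) S x :=
      ContDiffWithinAt.comp (g := f') (f := fun y : E => (t, y)) x hc'
        (contDiff_const.prodMk contDiff_id).contDiffWithinAt fun y hy => ⟨ht, hy⟩
    exact h3.clm_apply contDiffWithinAt_const
  -- The parameter runs through an open set, so a derivative within `I ×ˢ S` determines the
  -- parameter derivative even at boundary points of `S`.
  have hpt : ∀ y ∈ S, (∀ᶠ z in 𝓝[I ×ˢ S] (t, y), z ∈ u) →
      deriv (fun s => G (s, y)) t = f' (t, y) (1, 0) := by
    intro y hy hyu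
    have k1 : (t, y) ∈ u := mem_of_mem_nhdsWithin (mk_mem_prod ht hy) hyu
    have k2 := (hf' _ k1).mono_of_mem_nhdsWithin hyu
    have k3 : HasDerivWithinAt (fun s : ℝ => (s, y)) ((1 : ℝ), (0 : E)) I t :=
      ((hasDerivAt_id t).prodMk (hasDerivAt_const t y)).hasDerivWithinAt
    have k4 := k2.comp_hasDerivWithinAt t k3 fun s hs => mk_mem_prod hs hy
    exact (k4.hasDerivAt (hI.mem_nhds ht)).deriv
  have hev : ∀ᶠ y in 𝓝[S] x, ∀ᶠ z in 𝓝[I ×ˢ S] (t, y), z ∈ u := by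
    have h3 : ∀ᶠ z in 𝓝[I ×ˢ S] (t, x), ∀ᶠ w in 𝓝[I ×ˢ S] z, w ∈ u :=
      eventually_eventually_nhdsWithin.2 hu
    have h4 : Tendsto (fun y : E => (t, y)) (𝓝[S] x) (𝓝[I ×ˢ S] (t, x)) := by
      refine tendsto_nhdsWithin_iff.2 ⟨?_, ?_⟩
      · exact (Continuous.prodMk_right t).continuousAt.tendsto.mono_left nhdsWithin_le_nhds
      · filter_upwards [self_mem_nhdsWithin] with y hy
        exact ⟨ht, hy⟩
    exact h4.eventually h3
  refine h2.congr_of_eventuallyEq ?_ (hpt x hx hu)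
  filter_upwards [hev, self_mem_nhdsWithin] with y hy hyS
  exact hpt y hyS hy

variable {n : ℕ} {M : Type*} [TopologicalSpace M] [ChartedSpace (EuclideanSpace ℝ (Fin n)) M]
  {k : ℕ} {P : Fin k → Set M} {X : M → Euc (n + 1)} {ε₀ : ℝ} {Y : ℝ → M → Euc (n + 1)}

/-- The velocity of a variation. -/
noncomputable def velocity (Y : ℝ → M → Euc (n + 1)) (ε : ℝ) (p : M) : Euc (n + 1) :=
  deriv (fun s => Y s p) ε

lemma IsVariation.contDiffOn (hY : IsVariation P X ε₀ Y) {e : OpenPartialHomeomorph M (Euc n)}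
    (he : e ∈ IsManifold.maximalAtlas (𝓡 n) ∞ M) (i : Fin k) :
    ContDiffOn ℝ 2 (fun z : ℝ × Euc n => Y z.1 (e.symm z.2))
      (Ioo (-ε₀) ε₀ ×ˢ (e.target ∩ e.symm ⁻¹' P i)) := by
  rw [← contMDiffOn_iff_contDiffOn]
  have h1 : ContMDiffOn 𝓘(ℝ, ℝ × Euc n) (𝓘(ℝ, ℝ).prod (𝓡 n)) 2
      (fun z : ℝ × Euc n => (z.1, e.symm z.2)) (Ioo (-ε₀) ε₀ ×ˢ (e.target ∩ e.symm ⁻¹' P i)) := by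
    refine ContMDiffOn.prodMk contDiff_fst.contMDiff.contMDiffOn ?_
    exact ((contMDiffOn_symm_of_mem_maximalAtlas he).of_le two_le_infty).comp
      contDiff_snd.contMDiff.contMDiffOn fun z hz => hz.2.1
  exact (hY.contMDiffOn i).comp h1 fun z hz => ⟨hz.1, hz.2.2⟩

variable [IsManifold (𝓡 n) ∞ M]

lemma IsVariation.contMDiffOn_velocity (hY : IsVariation P X ε₀ Y) (i : Fin k) :
    ContMDiffOn (𝓡 n) 𝓘(ℝ, Euc (n + 1)) 1 (velocity Y 0) (P i) := by
  intro p hp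
  set e := chartAt (Euc n) p
  have hem := chartAt_mem_maximalAtlas (n := n) p
  have hps : p ∈ e.source := mem_chart_source _ p
  have hpS : e p ∈ e.target ∩ e.symm ⁻¹' P i :=
    ⟨e.map_source hps, by rwa [mem_preimage, e.left_inv hps]⟩
  have h0 : (0 : ℝ) ∈ Ioo (-ε₀) ε₀ := ⟨neg_lt_zero.2 hY.pos, hY.pos⟩
  have h1 := ContDiffWithinAt.deriv_param isOpen_Ioo h0 hpS (hY.contDiffOn hem i _ ⟨h0, hpS⟩)
  have h2 : ContMDiffWithinAt (𝓡 n) 𝓘(ℝ, Euc (n + 1)) 1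
      (fun q => deriv (fun s => Y s (e.symm (e q))) 0) (P i ∩ e.source) p := by
    refine ContMDiffWithinAt.comp (I' := 𝓘(ℝ, Euc n)) p h1.contMDiffWithinAt
      (((contMDiffOn_of_mem_maximalAtlas hem).of_le (by exact_mod_cast le_top)).contMDiffAt
        (e.open_source.mem_nhds hps)).contMDiffWithinAt ?_
    intro q hq
    exact ⟨e.map_source hq.2, by rw [mem_preimage, e.left_inv hq.2]; exact hq.1⟩
  have h3 := h2.mono_of_mem_nhdsWithin
    (inter_mem_nhdsWithin (P i) (e.open_source.mem_nhds hps))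
  refine h3.congr_of_eventuallyEq ?_ (by simp only [e.left_inv hps]; rfl)
  filter_upwards [nhdsWithin_le_nhds (e.open_source.mem_nhds hps)] with q hq
  simp only [e.left_inv hq]
  rfl

/-- The derivative with respect to the parameter of a variation commutes with the derivatives
in a chart. -/
lemma IsVariation.hasDerivAt_derivIn (hY : IsVariation P X ε₀ Y)
    {e : OpenPartialHomeomorph M (Euc n)} (he : e ∈ IsManifold.maximalAtlas (𝓡 n) ∞ M) {q : M}
    (hq : q ∈ regSet P) (hqs : q ∈ e.source) {ε : ℝ} (hε : ε ∈ Ioo (-ε₀) ε₀) :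
    HasDerivAt (fun s => (Y s q, derivIn e (Y s) q))
      (velocity Y ε q, derivIn e (velocity Y ε) q) ε ∧
    velocity Y ε q = fderiv ℝ (fun z : ℝ × Euc n => Y z.1 (e.symm z.2)) (ε, e q) (1, 0) ∧
    derivIn e (Y ε) q = fderiv ℝ (fun z : ℝ × Euc n => Y z.1 (e.symm z.2)) (ε, e q) ∘L
      ContinuousLinearMap.inr ℝ ℝ (Euc n) ∧
    ∀ v, derivIn e (velocity Y ε) q v =
      fderiv ℝ (fderiv ℝ fun z : ℝ × Euc n => Y z.1 (e.symm z.2)) (ε, e q) (0, v) (1, 0) := by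
  obtain ⟨i, hi⟩ := mem_iUnion.1 hq
  set G : ℝ × Euc n → Euc (n + 1) := fun z => Y z.1 (e.symm z.2) with hG
  set O : Set (ℝ × Euc n) := Ioo (-ε₀) ε₀ ×ˢ (e.target ∩ e.symm ⁻¹' interior (P i)) with hO
  have hOo : IsOpen O := isOpen_Ioo.prod (e.isOpen_inter_preimage_symm isOpen_interior)
  have hGO : ∀ z ∈ O, ContDiffAt ℝ 2 G z := fun z hz =>
    ((hY.contDiffOn he i).mono (prod_mono subset_rfl
      (inter_subset_inter_right _ (preimage_mono interior_subset)))).contDiffAt (hOo.mem_nhds hz)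
  have hGd : ∀ z ∈ O, HasFDerivAt G (fderiv ℝ G z) z := fun z hz =>
    ((hGO z hz).differentiableAt (by norm_num)).hasFDerivAt
  have hqO : ∀ s ∈ Ioo (-ε₀) ε₀, (s, e q) ∈ O := fun s hs =>
    ⟨hs, e.map_source hqs, by rw [mem_preimage, e.left_inv hqs]; exact hi⟩
  have hder : ∀ s ∈ Ioo (-ε₀) ε₀, derivIn e (Y s) q =
      fderiv ℝ G (s, e q) ∘L ContinuousLinearMap.inr ℝ ℝ (Euc n) := fun s hs =>
    (HasFDerivAt.comp (g := G) (f := fun v : Euc n => (s, v)) (e q) (hGd _ (hqO s hs))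
      (hasFDerivAt_prodMk_right s (e q))).fderiv
  have hvel : ∀ z ∈ O, deriv (fun s => G (s, z.2)) z.1 = fderiv ℝ G z (1, 0) := by
    rintro ⟨s, v⟩ hz
    have h1 : HasDerivAt (fun s : ℝ => (s, v)) ((1 : ℝ), (0 : Euc n)) s :=
      (hasDerivAt_id s).prodMk (hasDerivAt_const s v)
    exact ((hGd _ hz).comp_hasDerivAt s h1).deriv
  have hvq : velocity Y ε q = fderiv ℝ G (ε, e q) (1, 0) := by
    rw [← hvel _ (hqO ε hε)]
    simp only [velocity, hG, e.left_inv hqs]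
  have hD2 : HasFDerivAt (fderiv ℝ G) (fderiv ℝ (fderiv ℝ G) (ε, e q)) (ε, e q) :=
    (((hGO _ (hqO ε hε)).fderiv_right (m := 1) (by norm_num)).differentiableAt
      (by norm_num)).hasFDerivAt
  have hW : ∀ v, derivIn e (velocity Y ε) q v = fderiv ℝ (fderiv ℝ G) (ε, e q) (0, v) (1, 0) := by
    intro v
    have h1 : velocity Y ε ∘ e.symm =ᶠ[𝓝 (e q)] fun v => fderiv ℝ G (ε, v) (1, 0) := by
      have : ∀ᶠ v in 𝓝 (e q), (ε, v) ∈ O :=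
        (Continuous.prodMk_right ε).continuousAt.eventually (hOo.mem_nhds (hqO ε hε))
      filter_upwards [this] with v hv
      rw [← hvel _ hv]
      rfl
    have h2 : HasFDerivAt (fun v : Euc n => fderiv ℝ G (ε, v)) _ (e q) :=
      HasFDerivAt.comp (g := fderiv ℝ G) (f := fun v : Euc n => (ε, v)) (e q) hD2
        (hasFDerivAt_prodMk_right ε (e q))
    have h3 := h2.clm_apply (hasFDerivAt_const ((1 : ℝ), (0 : Euc n)) (e q))
    rw [derivIn, h1.fderiv_eq, h3.fderiv]
    simp
  refine ⟨?_, hvq, hder ε hε, hW⟩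
  have h1 : HasDerivAt (fun s => Y s q) (velocity Y ε q) ε := by
    rw [hvq]
    have h2 : HasDerivAt (fun s : ℝ => (s, e q)) ((1 : ℝ), (0 : Euc n)) ε :=
      (hasDerivAt_id ε).prodMk (hasDerivAt_const ε (e q))
    have := (hGd _ (hqO ε hε)).comp_hasDerivAt ε h2
    simpa [hG, Function.comp_def, e.left_inv hqs] using this
  refine h1.prodMk ?_
  have h2 : HasDerivAt (fun s : ℝ => (s, e q)) ((1 : ℝ), (0 : Euc n)) ε :=
    (hasDerivAt_id ε).prodMk (hasDerivAt_const ε (e q))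
  have h3 : HasDerivAt (fun s => fderiv ℝ G (s, e q)) (fderiv ℝ (fderiv ℝ G) (ε, e q) (1, 0)) ε :=
    hD2.comp_hasDerivAt ε h2
  have h4 : HasDerivAt (fun s => fderiv ℝ G (s, e q) ∘L ContinuousLinearMap.inr ℝ ℝ (Euc n))
      (fderiv ℝ (fderiv ℝ G) (ε, e q) (1, 0) ∘L ContinuousLinearMap.inr ℝ ℝ (Euc n)) ε :=
    (((ContinuousLinearMap.compL ℝ (Euc n) (ℝ × Euc n) (Euc (n + 1))).flip
      (ContinuousLinearMap.inr ℝ ℝ (Euc n))).hasFDerivAt).comp_hasDerivAt ε h3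
  have h5 : fderiv ℝ (fderiv ℝ G) (ε, e q) (1, 0) ∘L ContinuousLinearMap.inr ℝ ℝ (Euc n) =
      derivIn e (velocity Y ε) q := by
    ext1 v
    -- Schwarz's theorem in the joint variables exchanges the two derivatives.
    have hs : IsSymmSndFDerivAt ℝ G (ε, e q) := (hGO _ (hqO ε hε)).isSymmSndFDerivAt (by simp)
    rw [hW]
    exact hs.eq _ _
  rw [← h5]
  refine h4.congr_of_eventuallyEq ?_
  filter_upwards [Ioo_mem_nhds hε.1 hε.2] with s hs
  exact hder s hs

/-- Uniform bounds for a variation on compact subsets of a chart domain. -/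
lemma IsVariation.exists_bound (hcl : ∀ i, IsClosed (P i)) (hY : IsVariation P X ε₀ Y)
    {e : OpenPartialHomeomorph M (Euc n)} (he : e ∈ IsManifold.maximalAtlas (𝓡 n) ∞ M) {K : Set M}
    (hK : IsCompact K) (hKs : K ⊆ e.source) :
    ∃ C, ∀ᶠ ε in 𝓝 (0 : ℝ), ∀ q ∈ K, q ∈ regSet P → ‖(Y ε q, derivIn e (Y ε) q)‖ ≤ C ∧
      ‖(velocity Y ε q, derivIn e (velocity Y ε) q)‖ ≤ C := by
  have h0 : (0 : ℝ) ∈ Ioo (-ε₀) ε₀ := ⟨neg_lt_zero.2 hY.pos, hY.pos⟩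
  set G : ℝ × Euc n → Euc (n + 1) := fun z => Y z.1 (e.symm z.2) with hG
  have hloc : ∀ p ∈ K, ∀ i, ∃ C, ∀ᶠ z in 𝓝 (0 : ℝ) ×ˢ 𝓝 p, z.2 ∈ interior (P i) →
      ‖(Y z.1 z.2, derivIn e (Y z.1) z.2)‖ ≤ C ∧
      ‖(velocity Y z.1 z.2, derivIn e (velocity Y z.1) z.2)‖ ≤ C := by
    intro p hp i
    have hps := hKs hp
    by_cases hpi : p ∈ P i
    swap
    · refine ⟨0, ?_⟩
      filter_upwards [tendsto_snd.eventually ((hcl i).isOpen_compl.mem_nhds hpi)] with z hz hzi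
      exact absurd (interior_subset hzi) hz
    have hpS : e p ∈ e.target ∩ e.symm ⁻¹' P i :=
      ⟨e.map_source hps, by rwa [mem_preimage, e.left_inv hps]⟩
    obtain ⟨C, hC⟩ := ContDiffWithinAt.exists_fderiv_fderiv_bound
      (hY.contDiffOn he i (0, e p) ⟨h0, hpS⟩) (mk_mem_prod h0 hpS)
    have ht : Tendsto (fun z : ℝ × M => (z.1, e z.2)) (𝓝 (0 : ℝ) ×ˢ 𝓝 p) (𝓝 ((0 : ℝ), e p)) := by
      rw [nhds_prod_eq]
      exact tendsto_id.prodMap (e.continuousAt hps)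
    refine ⟨C, ?_⟩
    filter_upwards [ht.eventually hC, tendsto_snd.eventually (e.open_source.mem_nhds hps),
      tendsto_fst.eventually (Ioo_mem_nhds h0.1 h0.2)] with z hz hzs hz1 hzi
    have hzint : (z.1, e z.2) ∈ interior (Ioo (-ε₀) ε₀ ×ˢ (e.target ∩ e.symm ⁻¹' P i)) := by
      rw [interior_prod_eq, isOpen_Ioo.interior_eq]
      exact ⟨hz1, mem_interior_image hzs hzi⟩
    obtain ⟨b1, b2, b3⟩ := hz hzint
    obtain ⟨-, e1, e2, e3⟩ := hY.hasDerivAt_derivIn he (mem_iUnion.2 ⟨i, hzi⟩) hzs hz1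
    have hC0 : 0 ≤ C := (norm_nonneg _).trans b1
    rw [Prod.norm_def, Prod.norm_def]
    refine ⟨max_le ?_ ?_, max_le ?_ ?_⟩
    · simpa [e.left_inv hzs] using b1
    · change ‖derivIn e (Y z.1) z.2‖ ≤ C
      rw [e2]
      refine ContinuousLinearMap.opNorm_le_bound _ hC0 fun v => ?_
      have h3 : ‖((0 : ℝ), v)‖ ≤ ‖v‖ := by simp
      exact (ContinuousLinearMap.le_opNorm (fderiv ℝ G (z.1, e z.2)) ((0 : ℝ), v)).trans
        (mul_le_mul b2 h3 (norm_nonneg _) hC0)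
    · change ‖velocity Y z.1 z.2‖ ≤ C
      rw [e1]
      refine ((ContinuousLinearMap.le_opNorm _ _).trans ?_).trans_eq (mul_one C)
      refine mul_le_mul b2 ?_ (norm_nonneg _) hC0
      simp [Prod.norm_def]
    · refine ContinuousLinearMap.opNorm_le_bound _ hC0 fun v => ?_
      rw [e3]
      refine (ContinuousLinearMap.le_opNorm _ _).trans ?_
      have h2 : ‖((1 : ℝ), (0 : Euc n))‖ ≤ 1 := by simp [Prod.norm_def]
      have h3 : ‖((0 : ℝ), v)‖ ≤ ‖v‖ := by simp [Prod.norm_def]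
      refine (mul_le_mul_of_nonneg_left h2 (norm_nonneg _)).trans ?_
      rw [mul_one]
      exact (ContinuousLinearMap.le_opNorm _ _).trans (mul_le_mul b3 h3 (norm_nonneg _) hC0)
  refine hK.induction_on (p := fun K => ∃ C, ∀ᶠ ε in 𝓝 (0 : ℝ), ∀ q ∈ K, q ∈ regSet P →
    ‖(Y ε q, derivIn e (Y ε) q)‖ ≤ C ∧ ‖(velocity Y ε q, derivIn e (velocity Y ε) q)‖ ≤ C)
    ⟨0, by simp⟩ ?_ ?_ ?_
  · rintro s t hst ⟨C, hC⟩
    exact ⟨C, hC.mono fun ε h q hq => h q (hst hq)⟩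
  · rintro s t ⟨C, hC⟩ ⟨D, hD⟩
    refine ⟨max C D, ?_⟩
    filter_upwards [hC, hD] with ε hc hd q hq hqr
    rcases hq with hq | hq
    · exact ⟨(hc q hq hqr).1.trans (le_max_left _ _), (hc q hq hqr).2.trans (le_max_left _ _)⟩
    · exact ⟨(hd q hq hqr).1.trans (le_max_right _ _), (hd q hq hqr).2.trans (le_max_right _ _)⟩
  · intro p hp
    choose C hC using hloc p hp
    have hall := eventually_all.2 hC
    obtain ⟨pa, hpa, pb, hpb, hab⟩ := eventually_prod_iff.1 hall
    refine ⟨{q | pb q}, nhdsWithin_le_nhds hpb, ∑ i, |C i|, hpa.mono fun ε hε q hq hqr => ?_⟩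
    obtain ⟨i, hi⟩ := mem_iUnion.1 hqr
    have hle : C i ≤ ∑ i, |C i| := (le_abs_self _).trans
      (Finset.single_le_sum (f := fun i => |C i|) (fun _ _ => abs_nonneg _) (Finset.mem_univ i))
    have := hab hε hq i hi
    exact ⟨this.1.trans hle, this.2.trans hle⟩

end Variation

/-! ### Energy and volume as integrals of forms in `X` and `dX` -/

section Functionals

open Filter Topology

variable {n : ℕ} {M : Type*} [TopologicalSpace M] [ChartedSpace (EuclideanSpace ℝ (Fin n)) M]
  {k : ℕ} {P : Fin k → Set M} {X : M → Euc (n + 1)} [IsManifold (𝓡 n) ∞ M]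

lemma normalIn_ne_zero {φ : OpenPartialHomeomorph M (Euc n)}
    (hφ : φ ∈ IsManifold.maximalAtlas (𝓡 n) ∞ M) {p : M} (hp : p ∈ φ.source)
    (h : Function.Injective (diffAt X p)) : normalIn φ X p ≠ 0 := by
  have hc := mem_chart_source (Euc n) p
  rw [normalIn_change hφ (chartAt_mem_maximalAtlas p) hp hc]
  refine smul_ne_zero (fun h0 => ?_) ?_
  · have := transD_comp hφ (chartAt_mem_maximalAtlas p) hp hc
    rw [h0, mul_zero] at this
    exact zero_ne_one this
  · rw [normalIn, crossL_ne_zero_iff, ← diffAt_eq_derivIn]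
    exact h

lemma injective_derivIn {φ : OpenPartialHomeomorph M (Euc n)}
    (hφ : φ ∈ IsManifold.maximalAtlas (𝓡 n) ∞ M) {p : M} (hp : p ∈ φ.source)
    (h : Function.Injective (diffAt X p)) : Function.Injective (derivIn φ X p) :=
  crossL_ne_zero_iff.1 (normalIn_ne_zero hφ hp h)

lemma continuousOn_of_local_charts {F : Type*} [TopologicalSpace F] {S : Set M} {f : M → F}
    (h : ∀ e ∈ atlas (Euc n) M, ∃ g : M → F, ContinuousOn g (S ∩ e.source) ∧
      EqOn f g (S ∩ e.source)) : ContinuousOn f S := by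
  intro p hp
  obtain ⟨g, hg, hfg⟩ := h _ (chart_mem_atlas (Euc n) p)
  have h1 := (hg.congr hfg) p ⟨hp, mem_chart_source _ p⟩
  exact h1.mono_of_mem_nhdsWithin (inter_mem_nhdsWithin _
    ((chartAt (Euc n) p).open_source.mem_nhds (mem_chart_source _ p)))

lemma unitNormal_eq_of_mem_atlas (hM : IsOrientedAtlas n M) {e : OpenPartialHomeomorph M (Euc n)}
    (he : e ∈ atlas (Euc n) M) {p : M} (hp : p ∈ e.source) (X : M → Euc (n + 1)) :
    unitNormal X p = ‖normalIn e X p‖⁻¹ • normalIn e X p := by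
  rw [unitNormal_eq_of_hasSign (mem_maximalAtlas_of_mem_atlas he) (one_mul 1)
    (hasSign_of_mem_atlas hM he) hp, one_smul]

lemma norm_unitNormal {p : M} (h : Function.Injective (diffAt X p)) : ‖unitNormal X p‖ = 1 := by
  have := normalIn_ne_zero (chartAt_mem_maximalAtlas p) (mem_chart_source (Euc n) p) h
  rw [unitNormal_eq, norm_smul, norm_inv, norm_norm, inv_mul_cancel₀ (norm_ne_zero_iff.2 this)]

lemma continuousOn_unitNormal (hM : IsOrientedAtlas n M) (hX : PieceSmooth (n := n) 1 P X)
    (hi : ∀ p ∈ regSet P, Function.Injective (diffAt X p)) :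
    ContinuousOn (unitNormal X) (regSet P) := by
  refine continuousOn_of_local_charts fun e he => ⟨fun p => ‖normalIn e X p‖⁻¹ • normalIn e X p, ?_,
    fun p hp => unitNormal_eq_of_mem_atlas hM he hp.2 X⟩
  have hem := mem_maximalAtlas_of_mem_atlas he
  have hN := continuousOn_normalIn hX hem
  exact (hN.norm.inv₀ fun p hp =>
    norm_ne_zero_iff.2 (normalIn_ne_zero hem hp.2 (hi p hp.1))).smul hN

lemma IsPiecewiseWeakImmersion.pieceSmooth {r : ℕ} {ν : Fin k → M → Euc (n + 1)}
    (hX : IsPiecewiseWeakImmersion r P X ν) : PieceSmooth (n := n) r P X :=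
  PieceSmooth.of_contMDiffOn hX.contMDiffOn

lemma IsPiecewiseWeakImmersion.pieceSmooth_one {ν : Fin k → M → Euc (n + 1)}
    (hX : IsPiecewiseWeakImmersion 2 P X ν) : PieceSmooth (n := n) 1 P X :=
  hX.pieceSmooth.of_le (by norm_num)

lemma IsPiecewiseWeakImmersion.injective {r : ℕ} {ν : Fin k → M → Euc (n + 1)}
    (hX : IsPiecewiseWeakImmersion r P X ν) {p : M} (hp : p ∈ regSet P) :
    Function.Injective (diffAt X p) := by
  obtain ⟨i, hi⟩ := mem_iUnion.1 hp
  exact hX.immersion i p hi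

variable [MeasurableSpace M] [BorelSpace M] [T2Space M] [CompactSpace M] [NeZero n]

lemma areaMeasure_part_lt_top (hcl : ∀ i, IsClosed (P i)) (𝒞 : ChartPartition n M)
    (hX : PieceSmooth (n := n) 1 P X) (a : Fin 𝒞.size) :
    areaMeasure X (𝒞.part a ∩ regSet P) < ⊤ := by
  have hm := (𝒞.measurableSet_part a).inter (isOpen_regSet P).measurableSet
  have hs : 𝒞.part a ∩ regSet P ⊆ (𝒞.chart a).source := inter_subset_left.trans (𝒞.part_subset a)
  rw [areaMeasure_apply X (𝒞.pt a) hm hs, chartArea_apply _ _ hm]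
  obtain ⟨C, hC0, hC⟩ := hX.exists_bound hcl (𝒞.chart_mem a)
    (isClosed_closure (s := 𝒞.part a)).isCompact (𝒞.closure_subset a)
  obtain ⟨D, hD⟩ := exists_bound_comp
    (g := fun L : Euc n →L[ℝ] Euc (n + 1) => ‖crossL L‖)
    (continuous_norm.comp (contDiff_crossL (r := 0)).continuous) C
  have hfin : volume (𝒞.chart a '' (𝒞.part a ∩ regSet P)) < ⊤ :=
    (measure_mono (image_mono (inter_subset_left.trans subset_closure))).trans_lt
      (((isClosed_closure (s := 𝒞.part a)).isCompact.image_of_continuousOn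
        ((𝒞.chart a).continuousOn.mono (𝒞.closure_subset a))).measure_lt_top)
  refine (setLIntegral_mono' (g := fun _ => ENNReal.ofReal D) (measurableSet_image
    (inter_subset_left.trans hs) (hm.inter (𝒞.chart a).open_source.measurableSet)) ?_).trans_lt ?_
  · rintro _ ⟨q, hq, rfl⟩
    have hqs := hs hq.1
    refine ENNReal.ofReal_le_ofReal ?_
    refine (areaDensity_eq X ((𝒞.chart a).map_source hqs)).le.trans ?_
    rw [(𝒞.chart a).left_inv hqs]
    exact (le_abs_self _).trans (hD _ (hC q (subset_closure hq.1.1) hq.1.2).2)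
  · rw [setLIntegral_const]
    refine ENNReal.mul_lt_top ENNReal.ofReal_lt_top
      ((measure_mono (image_mono inter_subset_left)).trans_lt hfin)

/-- Integrals with respect to the area measure of functions which are continuous in the interiors
of the pieces. -/
lemma integral_areaMeasure (hP : IsPieceDecomposition (n := n) P) (𝒞 : ChartPartition n M)
    (hX : PieceSmooth (n := n) 1 P X) {f : M → ℝ} (hf : ContinuousOn f (regSet P)) {C : ℝ}
    (hC : ∀ p ∈ regSet P, |f p| ≤ C) :
    ∫ p, f p ∂(areaMeasure X) = formInt 𝒞 P fun φ p => ‖normalIn φ X p‖ * f p := by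
  have hcl := isClosed_piece hP
  have hregm := (isOpen_regSet P).measurableSet
  have h0 : areaMeasure X (regSet P)ᶜ = 0 := areaMeasure_eq_zero X hregm.compl fun q =>
    volume_image_compl_regSet hP (chartAt_mem_maximalAtlas q)
  have h1 : ∫ p, f p ∂(areaMeasure X) = ∫ p in regSet P, f p ∂(areaMeasure X) := by
    rw [Measure.restrict_eq_self_of_ae_mem]
    exact h0
  have hsplit : regSet P = ⋃ a, 𝒞.part a ∩ regSet P := by
    rw [← iUnion_inter, 𝒞.iUnion_part, univ_inter]
  have hm : ∀ a, MeasurableSet (𝒞.part a ∩ regSet P) := fun a =>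
    (𝒞.measurableSet_part a).inter hregm
  have haes : ∀ a, AEStronglyMeasurable f ((areaMeasure X).restrict (𝒞.part a ∩ regSet P)) :=
    fun a => (hf.aestronglyMeasurable hregm).mono_measure
      (Measure.restrict_mono_set _ inter_subset_right)
  rw [h1, hsplit, integral_iUnion_fintype hm
    (fun a b hab => (𝒞.disjoint_part hab).mono inter_subset_left inter_subset_left)]
  · exact Finset.sum_congr rfl fun a _ => setIntegral_areaMeasure X (𝒞.pt a) (hm a)
      (inter_subset_left.trans (𝒞.part_subset a)) (haes a)
  · intro a
    exact IntegrableOn.of_bound (areaMeasure_part_lt_top hcl 𝒞 hX a) (haes a) C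
      ((ae_restrict_iff' (hm a)).2 (Eventually.of_forall fun p hp => hC p hp.2))

variable {γ : Metric.sphere (0 : EuclideanSpace ℝ (Fin (n + 1))) 1 → ℝ}

/-- The area density `‖N‖` times `γ(N/‖N‖)` is the homogeneous extension at `N`. Boundaries of
pieces are null, so only the interiors, where `N` does not vanish, are integrated over. -/
lemma anisoEnergy_eq_formInt (hM : IsOrientedAtlas n M) (hγ : ContMDiff (𝓡 n) 𝓘(ℝ, ℝ) 2 γ)
    (hP : IsPieceDecomposition (n := n) P) (𝒞 : ChartPartition n M) {ν : Fin k → M → Euc (n + 1)}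
    (hX : IsPiecewiseWeakImmersion 2 P X ν) :
    anisoEnergy γ X = formInt 𝒞 P fun φ p => homExt γ (normalIn φ X p) := by
  have hinj : ∀ p ∈ regSet P, Function.Injective (diffAt X p) := fun p hp => hX.injective hp
  have hc := continuousOn_unitNormal hM hX.pieceSmooth_one hinj
  obtain ⟨C, -, hC⟩ := exists_abs_homExt_le hγ
  rw [anisoEnergy, integral_areaMeasure hP 𝒞 hX.pieceSmooth_one (C := C)]
  · refine formInt_congr 𝒞 fun φ hφ p hp hps => ?_
    have h0 := normalIn_ne_zero (mem_maximalAtlas_of_mem_atlas hφ) hps (hinj p hp)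
    rw [unitNormal_eq_of_mem_atlas hM hφ hps, radialExt_smul (inv_pos.2 (norm_pos_iff.2 h0)), homExt]
  · intro p hp
    have h1 : unitNormal X p ≠ 0 := fun h => by
      have := norm_unitNormal (hinj p hp)
      rw [h, norm_zero] at this
      exact zero_ne_one this
    exact ((contDiffAt_radialExt hγ h1).continuousAt.comp_continuousWithinAt (hc p hp))
  · intro p hp
    have h1 := norm_unitNormal (hinj p hp)
    have := hC (unitNormal X p)
    rwa [homExt, h1, one_mul, mul_one] at this

lemma enclosedVolume_eq_formInt (hM : IsOrientedAtlas n M)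
    (hP : IsPieceDecomposition (n := n) P) (𝒞 : ChartPartition n M) {ν : Fin k → M → Euc (n + 1)}
    (hX : IsPiecewiseWeakImmersion 2 P X ν) :
    enclosedVolume X = ((n : ℝ) + 1)⁻¹ * formInt 𝒞 P (volForm X X) := by
  have hinj : ∀ p ∈ regSet P, Function.Injective (diffAt X p) := fun p hp => hX.injective hp
  have hc := continuousOn_unitNormal hM hX.pieceSmooth_one hinj
  obtain ⟨C, hC⟩ := (isCompact_univ (X := M)).exists_bound_of_continuousOn hX.continuous.continuousOn
  rw [enclosedVolume, integral_areaMeasure hP 𝒞 hX.pieceSmooth_one (C := C)]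
  · congr 1
    refine formInt_congr 𝒞 fun φ hφ p hp hps => ?_
    have h0 := normalIn_ne_zero (mem_maximalAtlas_of_mem_atlas hφ) hps (hinj p hp)
    rw [unitNormal_eq_of_mem_atlas hM hφ hps, inner_smul_right, volForm, ← mul_assoc,
      mul_inv_cancel₀ (norm_ne_zero_iff.2 h0), one_mul]
  · exact hX.continuous.continuousOn.inner hc
  · intro p hp
    have h1 := norm_unitNormal (hinj p hp)
    refine (abs_real_inner_le_norm _ _).trans ?_
    rw [h1, mul_one]
    exact hC p (mem_univ p)

end Functionals

/-! ### Differentiation under the integral sign -/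

section FirstVariation

open Filter Topology

variable {n : ℕ} {M : Type*} [TopologicalSpace M] [ChartedSpace (EuclideanSpace ℝ (Fin n)) M]
  {k : ℕ} {P : Fin k → Set M} {X : M → Euc (n + 1)} [IsManifold (𝓡 n) ∞ M]
  [MeasurableSpace M] [BorelSpace M] [T2Space M] [CompactSpace M] [NeZero n]
  {ε₀ : ℝ} {Y : ℝ → M → Euc (n + 1)}

/-- Differentiation under the integral sign for functionals depending on the values and the first
derivatives of a variation. -/
lemma IsVariation.hasDerivAt_formInt (hP : IsPieceDecomposition (n := n) P)
    (𝒞 : ChartPartition n M) (hY : IsVariation P X ε₀ Y)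
    {Ψ : Euc (n + 1) × (Euc n →L[ℝ] Euc (n + 1)) → ℝ}
    (hΨ : ∀ z, crossL z.2 ≠ 0 → ContDiffAt ℝ 1 Ψ z)
    (hb : ∀ C, ∃ D, ∀ z, ‖z‖ ≤ C → crossL z.2 ≠ 0 → |Ψ z| ≤ D ∧ ‖fderiv ℝ Ψ z‖ ≤ D) :
    HasDerivAt (fun ε => formInt 𝒞 P fun φ p => Ψ (Y ε p, derivIn φ (Y ε) p))
      (formInt 𝒞 P fun φ p => fderiv ℝ Ψ (X p, derivIn φ X p)
        (velocity Y 0 p, derivIn φ (velocity Y 0) p)) 0 := by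
  have hcl := isClosed_piece hP
  have h0 : (0 : ℝ) ∈ Ioo (-ε₀) ε₀ := ⟨neg_lt_zero.2 hY.pos, hY.pos⟩
  refine HasDerivAt.fun_sum fun a _ => ?_
  set e := 𝒞.chart a with he
  have hem := 𝒞.chart_mem a
  have hsrc := 𝒞.part_subset a
  have hm := measurableSet_image_part 𝒞 P a
  obtain ⟨C, hC⟩ := hY.exists_bound hcl hem (isClosed_closure (s := 𝒞.part a)).isCompact
    (𝒞.closure_subset a)
  obtain ⟨D, hD⟩ := hb C
  -- The integrand need not be differentiable where the normal vanishes; every member of the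
  -- variation is an immersion in the interiors of the pieces.
  have hne : ∀ ε ∈ Ioo (-ε₀) ε₀, ∀ q ∈ regSet P, q ∈ e.source → crossL (derivIn e (Y ε) q) ≠ 0 := by
    intro ε hε q hq hqs
    obtain ⟨ν, hν⟩ := hY.weakImmersion ε hε
    exact normalIn_ne_zero hem hqs (hν.injective hq)
  have hfin : volume (e '' (𝒞.part a ∩ regSet P)) < ⊤ :=
    (measure_mono (image_mono (inter_subset_left.trans subset_closure))).trans_lt
      (((isClosed_closure (s := 𝒞.part a)).isCompact.image_of_continuousOn
        (e.continuousOn.mono (𝒞.closure_subset a))).measure_lt_top)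
  have hsymm : ContinuousOn e.symm (e '' (𝒞.part a ∩ regSet P)) :=
    e.continuousOn_symm.mono (by
      rintro _ ⟨q, hq, rfl⟩
      exact e.map_source (hsrc hq.1))
  have hmaps : MapsTo e.symm (e '' (𝒞.part a ∩ regSet P)) (regSet P ∩ e.source) := by
    rintro _ ⟨q, hq, rfl⟩
    rw [e.left_inv (hsrc hq.1)]
    exact ⟨hq.2, hsrc hq.1⟩
  have hcY : ∀ ε ∈ Ioo (-ε₀) ε₀, ContinuousOn (fun q => (Y ε q, derivIn e (Y ε) q))
      (regSet P ∩ e.source) := by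
    intro ε hε
    obtain ⟨ν, hν⟩ := hY.weakImmersion ε hε
    exact (hν.pieceSmooth.continuousOn.mono inter_subset_left).prodMk
      (hν.pieceSmooth_one.continuousOn_derivIn hem)
  have hFm : ∀ ε ∈ Ioo (-ε₀) ε₀, AEStronglyMeasurable
      (fun u => Ψ (Y ε (e.symm u), derivIn e (Y ε) (e.symm u)))
      (volume.restrict (e '' (𝒞.part a ∩ regSet P))) := by
    intro ε hε
    refine ContinuousOn.aestronglyMeasurable (f := fun u => Ψ (Y ε (e.symm u),
      derivIn e (Y ε) (e.symm u))) ?_ hm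
    refine ContinuousOn.comp (g := fun q => Ψ (Y ε q, derivIn e (Y ε) q)) ?_ hsymm hmaps
    intro q hq
    exact (hΨ _ (hne ε hε q hq.1 hq.2)).continuousAt.comp_continuousWithinAt (hcY ε hε q hq)
  have hW : PieceSmooth (n := n) 1 P (velocity Y 0) :=
    PieceSmooth.of_contMDiffOn hY.contMDiffOn_velocity
  have key := hasDerivAt_integral_of_dominated_loc_of_deriv_le (𝕜 := ℝ)
    (μ := volume.restrict (e '' (𝒞.part a ∩ regSet P)))
    (F := fun ε u => Ψ (Y ε (e.symm u), derivIn e (Y ε) (e.symm u)))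
    (F' := fun ε u => fderiv ℝ Ψ (Y ε (e.symm u), derivIn e (Y ε) (e.symm u))
      (velocity Y ε (e.symm u), derivIn e (velocity Y ε) (e.symm u)))
    -- A constant dominates, as the domain has finite volume: `C` bounds the velocity with its
    -- derivative, and `D` the differential of `Ψ`.
    (x₀ := (0 : ℝ)) (bound := fun _ => D * C) (inter_mem hC (Ioo_mem_nhds h0.1 h0.2)) ?_ ?_ ?_ ?_ ?_ ?_
  · have h2 := key.2
    simp only [hY.zero] at h2
    exact h2
  · filter_upwards [Ioo_mem_nhds h0.1 h0.2] with ε hε using hFm ε hε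
  · refine IntegrableOn.of_bound hfin (hFm 0 h0) D ((ae_restrict_iff' hm).2 (Eventually.of_forall ?_))
    rintro _ ⟨q, hq, rfl⟩
    rw [e.left_inv (hsrc hq.1)]
    exact (hD _ (hC.self_of_nhds q (subset_closure hq.1) hq.2).1 (hne 0 h0 q hq.2 (hsrc hq.1))).1
  · refine ContinuousOn.aestronglyMeasurable (f := fun u => fderiv ℝ Ψ (Y 0 (e.symm u),
      derivIn e (Y 0) (e.symm u)) (velocity Y 0 (e.symm u), derivIn e (velocity Y 0) (e.symm u))) ?_ hm
    refine ContinuousOn.comp (g := fun q => fderiv ℝ Ψ (Y 0 q, derivIn e (Y 0) q)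
      (velocity Y 0 q, derivIn e (velocity Y 0) q)) ?_ hsymm hmaps
    refine ContinuousOn.clm_apply (fun q hq => ?_)
      ((hW.continuousOn.mono inter_subset_left).prodMk (hW.continuousOn_derivIn hem))
    exact ((hΨ _ (hne 0 h0 q hq.1 hq.2)).fderiv_right (m := 0) (by norm_num)).continuousAt.comp_continuousWithinAt
      (f := fun q => (Y 0 q, derivIn e (Y 0) q)) (hcY 0 h0 q hq)
  · refine (ae_restrict_iff' hm).2 (Eventually.of_forall ?_)
    rintro _ ⟨q, hq, rfl⟩ ε ⟨hε1, hε⟩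
    rw [e.left_inv (hsrc hq.1)]
    obtain ⟨b1, b2⟩ := hε1 q (subset_closure hq.1) hq.2
    have b3 := (hD _ b1 (hne ε hε q hq.2 (hsrc hq.1))).2
    have hD0 : 0 ≤ D := le_trans (norm_nonneg (fderiv ℝ Ψ _)) b3
    exact (ContinuousLinearMap.le_opNorm _ _).trans (mul_le_mul b3 b2 (norm_nonneg _) hD0)
  · exact integrableOn_const hfin.ne
  · refine (ae_restrict_iff' hm).2 (Eventually.of_forall ?_)
    rintro _ ⟨q, hq, rfl⟩ ε ⟨-, hε⟩
    rw [e.left_inv (hsrc hq.1)]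
    exact ((hΨ _ (hne ε hε q hq.2 (hsrc hq.1))).differentiableAt
      (by norm_num)).hasFDerivAt.comp_hasDerivAt ε
      (hY.hasDerivAt_derivIn hem hq.2 (hsrc hq.1) hε).1

end FirstVariation

/-! ### The Cahn-Hoffman field and the anisotropic mean curvature -/

section ShapeOperator

open Filter Topology

variable {n : ℕ} {M : Type*} [TopologicalSpace M] [ChartedSpace (EuclideanSpace ℝ (Fin n)) M]
  {k : ℕ} {P : Fin k → Set M} {X : M → Euc (n + 1)}
  {γ : Metric.sphere (0 : EuclideanSpace ℝ (Fin (n + 1))) 1 → ℝ}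

/-- The range of `L` is contained in the hyperplane orthogonal to the normal and has the same
dimension `n`. -/
lemma mem_range_of_inner_crossL_eq_zero {L : Euc n →L[ℝ] Euc (n + 1)} (hL : Function.Injective L)
    {v : Euc (n + 1)} (hv : ⟪crossL L, v⟫ = 0) : ∃ u, L u = v := by
  have h0 := crossL_ne_zero_iff.2 hL
  have hle : LinearMap.range (L : Euc n →ₗ[ℝ] Euc (n + 1)) ≤ (ℝ ∙ crossL L)ᗮ := by
    rintro _ ⟨u, rfl⟩
    rw [Submodule.mem_orthogonal_singleton_iff_inner_right]
    exact inner_crossL_apply L u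
  have heq := Submodule.eq_of_le_of_finrank_eq hle (by
    rw [Submodule.finrank_orthogonal_span_singleton (n := n) h0, LinearMap.finrank_range_of_inj hL,
      finrank_euclideanSpace_fin])
  have : v ∈ LinearMap.range (L : Euc n →ₗ[ℝ] Euc (n + 1)) := by
    rw [heq, Submodule.mem_orthogonal_singleton_iff_inner_right]
    exact hv
  exact this

variable (γ) in
/-- The Cahn-Hoffman field of `X`. -/
noncomputable def cahnField (X : M → Euc (n + 1)) (p : M) : Euc (n + 1) :=
  cahnHoffman γ (unitNormal X p)

variable [IsManifold (𝓡 n) ∞ M]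

lemma cahnField_eq (hM : IsOrientedAtlas n M) (hγ : ContMDiff (𝓡 n) 𝓘(ℝ, ℝ) 2 γ)
    {e : OpenPartialHomeomorph M (Euc n)} (he : e ∈ atlas (Euc n) M) {p : M} (hp : p ∈ e.source)
    (hN : normalIn e X p ≠ 0) : cahnField γ X p = homGrad γ (normalIn e X p) := by
  rw [cahnField, unitNormal_eq_of_mem_atlas hM he hp, homGrad_eq_cahnHoffman_normalize hγ hN]

lemma IsRegularPoint.contDiffAt (h : IsRegularPoint X p) {e : OpenPartialHomeomorph M (Euc n)}
    (he : e ∈ IsManifold.maximalAtlas (𝓡 n) ∞ M) (hp : p ∈ e.source) :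
    ContDiffAt ℝ 2 (X ∘ e.symm) (e p) :=
  ContMDiffAt.contDiffAt_comp_symm two_le_infty h.1 he hp

lemma IsRegularPoint.eventually {p : M} (h : IsRegularPoint X p) :
    ∀ᶠ q in 𝓝 p, IsRegularPoint X q := by
  set e := chartAt (Euc n) p
  have hem := chartAt_mem_maximalAtlas (n := n) p
  have hps : p ∈ e.source := mem_chart_source _ p
  have hc : ContinuousAt (normalIn e X) p := by
    have h1 : ContinuousAt (fderiv ℝ (X ∘ e.symm)) (e p) :=
      ((h.contDiffAt hem hps).fderiv_right (m := 1) (by norm_num)).continuousAt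
    have h2 : ContinuousAt (derivIn e X) p := ContinuousAt.comp h1 (e.continuousAt hps)
    exact (contDiff_crossL (r := 0)).continuous.continuousAt.comp h2
  have h2 : ∀ᶠ q in 𝓝 p, ContMDiffAt (𝓡 n) 𝓘(ℝ, Euc (n + 1)) 2 X q :=
    (contMDiffAt_iff_contMDiffAt_nhds (by simp)).1 h.1
  filter_upwards [h2, hc.eventually_ne (normalIn_ne_zero hem hps h.2),
    e.open_source.mem_nhds hps] with q hq1 hq2 hqs
  refine ⟨hq1, ?_⟩
  have hq := mem_chart_source (Euc n) q
  rw [diffAt_eq_derivIn, ← crossL_ne_zero_iff]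
  change normalIn _ X q ≠ 0
  intro h0
  rw [normalIn_change hem (chartAt_mem_maximalAtlas q) hqs hq, h0, smul_zero] at hq2
  exact hq2 rfl

lemma IsRegularPoint.cahnField_eventuallyEq (hM : IsOrientedAtlas n M)
    (hγ : ContMDiff (𝓡 n) 𝓘(ℝ, ℝ) 2 γ) {p : M} (h : IsRegularPoint X p)
    {e : OpenPartialHomeomorph M (Euc n)} (he : e ∈ atlas (Euc n) M) (hp : p ∈ e.source) :
    cahnField γ X ∘ e.symm =ᶠ[𝓝 (e p)] fun u => homGrad γ (crossL (fderiv ℝ (X ∘ e.symm) u)) := by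
  have h1 : ∀ᶠ u in 𝓝 (e p), IsRegularPoint X (e.symm u) := by
    have := e.continuousAt_symm (e.map_source hp)
    rw [ContinuousAt, e.left_inv hp] at this
    exact this.eventually h.eventually
  filter_upwards [h1, e.open_target.mem_nhds (e.map_source hp)] with u hu hut
  have hus := e.map_target hut
  rw [Function.comp_apply, cahnField_eq hM hγ he hus
    (normalIn_ne_zero (mem_maximalAtlas_of_mem_atlas he) hus hu.2), normalIn, derivIn,
    e.right_inv hut]

lemma IsRegularPoint.contDiffAt_homGrad (hγ : ContMDiff (𝓡 n) 𝓘(ℝ, ℝ) 2 γ) {p : M}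
    (h : IsRegularPoint X p) {e : OpenPartialHomeomorph M (Euc n)}
    (he : e ∈ IsManifold.maximalAtlas (𝓡 n) ∞ M) (hp : p ∈ e.source) :
    ContDiffAt ℝ 1 (fun u => homGrad γ (crossL (fderiv ℝ (X ∘ e.symm) u))) (e p) := by
  have h1 : ContDiffAt ℝ 1 (fun u => crossL (fderiv ℝ (X ∘ e.symm) u)) (e p) :=
    contDiff_crossL.contDiffAt.comp (e p)
      ((h.contDiffAt he hp).fderiv_right (m := 1) (by norm_num))
  exact (AnisoSurface.contDiffAt_homGrad hγ (normalIn_ne_zero he hp h.2)).comp (e p) h1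

lemma IsRegularPoint.contDiffAt_cahnField (hM : IsOrientedAtlas n M)
    (hγ : ContMDiff (𝓡 n) 𝓘(ℝ, ℝ) 2 γ) {p : M} (h : IsRegularPoint X p)
    {e : OpenPartialHomeomorph M (Euc n)} (he : e ∈ atlas (Euc n) M) (hp : p ∈ e.source) :
    ContDiffAt ℝ 1 (cahnField γ X ∘ e.symm) (e p) :=
  (h.contDiffAt_homGrad hγ (mem_maximalAtlas_of_mem_atlas he) hp).congr_of_eventuallyEq
    (h.cahnField_eventuallyEq hM hγ he hp)

/-- The Hessian of the 1-homogeneous extension at `N` takes values orthogonal to `N`. Hence `dξ` is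
tangential, which is what makes a shape operator exist. -/
lemma IsRegularPoint.inner_normalIn_derivIn_cahnField (hM : IsOrientedAtlas n M)
    (hγ : ContMDiff (𝓡 n) 𝓘(ℝ, ℝ) 2 γ) {p : M} (h : IsRegularPoint X p)
    {e : OpenPartialHomeomorph M (Euc n)} (he : e ∈ atlas (Euc n) M) (hp : p ∈ e.source)
    (v : Euc n) : ⟪normalIn e X p, derivIn e (cahnField γ X) p v⟫ = 0 := by
  have hem := mem_maximalAtlas_of_mem_atlas he
  have hN := normalIn_ne_zero hem hp h.2
  have h1 : HasFDerivAt (fun u => crossL (fderiv ℝ (X ∘ e.symm) u))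
      (fderiv ℝ (fun u => crossL (fderiv ℝ (X ∘ e.symm) u)) (e p)) (e p) :=
    (ContDiffAt.differentiableAt (n := 1) (contDiff_crossL.contDiffAt.comp (e p)
      ((h.contDiffAt hem hp).fderiv_right (m := 1) (by norm_num))) (by norm_num)).hasFDerivAt
  have h2 : HasFDerivAt (homGrad γ) (fderiv ℝ (homGrad γ) (normalIn e X p)) (normalIn e X p) :=
    ((AnisoSurface.contDiffAt_homGrad hγ hN).differentiableAt (by norm_num)).hasFDerivAt
  have h3 : HasFDerivAt (fun u => homGrad γ (crossL (fderiv ℝ (X ∘ e.symm) u))) _ (e p) :=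
    HasFDerivAt.comp (g := homGrad γ) (e p) h2 h1
  rw [derivIn, (h.cahnField_eventuallyEq hM hγ he hp).fderiv_eq, h3.fderiv, real_inner_comm]
  exact inner_fderiv_homGrad hγ hN _

/-- The derivative of the normal in the direction of the Cahn-Hoffman field is given by the
anisotropic mean curvature. -/
lemma IsRegularPoint.crossDer_cahnField [NeZero n] (hM : IsOrientedAtlas n M)
    (hγ : ContMDiff (𝓡 n) 𝓘(ℝ, ℝ) 2 γ) {p : M} (h : IsRegularPoint X p)
    {φ : OpenPartialHomeomorph M (Euc n)} (hφ : φ ∈ IsManifold.maximalAtlas (𝓡 n) ∞ M)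
    (hp : p ∈ φ.source) : crossDer (derivIn φ X p) (derivIn φ (cahnField γ X) p) =
      -(n * anisoMeanCurvature γ X p) • normalIn φ X p := by
  have hce := mem_chart_source (Euc n) p
  have hcm := chartAt_mem_maximalAtlas (n := n) p
  rw [derivIn_change hφ hcm hp hce, derivIn_change hφ hcm hp hce (cahnField γ X), crossDer_comp,
    normalIn_change hφ hcm hp hce, smul_comm]
  congr 1
  set L := derivIn (chartAt (Euc n) p) X p with hL
  have hLd : diffAt X p = L := diffAt_eq_derivIn X p
  have hinj : Function.Injective L := hLd ▸ h.2
  set B := derivIn (chartAt (Euc n) p) (cahnField γ X) p with hB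
  have hBd : diffAt (fun q => cahnHoffman γ (unitNormal X q)) p = B := diffAt_eq_derivIn _ p
  -- Since `B` takes values in the range of `L`, a left inverse of `L` turns it into an endomorphism
  -- without loss.
  have hex : ∃ S, IsAnisoShapeOperator γ X p S := by
    obtain ⟨g, hg⟩ := LinearMap.exists_leftInverse_of_injective (L : Euc n →ₗ[ℝ] Euc (n + 1))
      (LinearMap.ker_eq_bot.2 hinj)
    refine ⟨-(g ∘ₗ (B : Euc n →ₗ[ℝ] Euc (n + 1))), fun v => ?_⟩
    rw [hLd, hBd]
    obtain ⟨u, hu⟩ := mem_range_of_inner_crossL_eq_zero hinj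
      (h.inner_normalIn_derivIn_cahnField hM hγ (chart_mem_atlas _ p) hce v)
    have hgu : g (B v) = u := by
      rw [← hu]
      exact LinearMap.congr_fun hg u
    simp only [LinearMap.neg_apply, LinearMap.comp_apply, ContinuousLinearMap.coe_coe, map_neg, hgu]
    rw [hu]
  -- Any operator with the defining property gives the formula, so uniqueness plays no role.
  have hS := hex.choose_spec
  have hcomp : B = -(L ∘L LinearMap.toContinuousLinearMap hex.choose) := by
    ext1 v
    have := hS v
    rw [hLd, hBd] at this
    simp only [neg_apply, ContinuousLinearMap.comp_apply]
    rw [eq_comm, neg_eq_iff_eq_neg]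
    exact this
  have hn : (n : ℝ) ≠ 0 := Nat.cast_ne_zero.2 (NeZero.ne n)
  rw [hcomp, crossDer_neg, crossDer_comp_right, anisoMeanCurvature, dif_pos hex, neg_smul,
    mul_div_cancel₀ _ hn]
  rfl

lemma PieceSmooth.isRegularPoint (hX : PieceSmooth (n := n) 2 P X) {p : M} (hp : p ∈ regSet P)
    (hi : Function.Injective (diffAt X p)) : IsRegularPoint X p :=
  ⟨hX.contMDiffAt hp, hi⟩

variable {ν : Fin k → M → Euc (n + 1)}

lemma IsPiecewiseWeakImmersion.isRegularPoint (hX : IsPiecewiseWeakImmersion 2 P X ν) {p : M}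
    (hp : p ∈ regSet P) : IsRegularPoint X p :=
  hX.pieceSmooth.isRegularPoint hp (hX.injective hp)

/-- True in the interior, where `ν i` is the unit normal, and extended by continuity because a piece
is the closure of its interior. -/
lemma IsPiecewiseWeakImmersion.norm_normal [NeZero n] (hP : IsPieceDecomposition (n := n) P)
    (hX : IsPiecewiseWeakImmersion 2 P X ν) {i : Fin k} {p : M} (hp : p ∈ P i) : ‖ν i p‖ = 1 := by
  have hc : ContinuousOn (fun q => ‖ν i q‖) (closure (interior (P i))) := by
    rw [(hP.isPiece i).closure_interior]
    exact (hX.normal_contMDiffOn i).continuousOn.norm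
  have h1 : EqOn (fun q => ‖ν i q‖) (fun _ => 1) (interior (P i)) := fun q hq => by
    simp only [hX.normal_eq i q hq]
    exact norm_unitNormal (hX.immersion i q hq)
  have := h1.of_subset_closure hc continuousOn_const subset_closure subset_rfl
  exact this ((hP.isPiece i).closure_interior.symm ▸ hp)

/-- The Cahn-Hoffman field is of class `C¹` on the pieces. -/
lemma IsPiecewiseWeakImmersion.pieceRep_cahnField [NeZero n] (hγ : ContMDiff (𝓡 n) 𝓘(ℝ, ℝ) 2 γ)
    (hP : IsPieceDecomposition (n := n) P) (hX : IsPiecewiseWeakImmersion 2 P X ν) :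
    PieceRep (n := n) 1 P (cahnField γ X) fun i p => homGrad γ (ν i p) := by
  intro i
  constructor
  · intro p hp
    have h0 : ν i p ≠ 0 := fun h => by
      have := hX.norm_normal hP hp
      rw [h, norm_zero] at this
      exact zero_ne_one this
    exact ContMDiffAt.comp_contMDiffWithinAt p (contDiffAt_homGrad hγ h0).contMDiffAt
      (hX.normal_contMDiffOn i p hp)
  · intro p hp
    change cahnField γ X p = homGrad γ (ν i p)
    rw [homGrad_eq_cahnHoffman hγ (hX.norm_normal hP (interior_subset hp)), cahnField,
      hX.normal_eq i p hp]

lemma IsPiecewiseWeakImmersion.pairForm_cahnField [NeZero n] (hM : IsOrientedAtlas n M)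
    (hγ : ContMDiff (𝓡 n) 𝓘(ℝ, ℝ) 2 γ) (hX : IsPiecewiseWeakImmersion 2 P X ν)
    (W : M → Euc (n + 1)) {φ : OpenPartialHomeomorph M (Euc n)}
    (hφ : φ ∈ IsManifold.maximalAtlas (𝓡 n) ∞ M) {p : M} (hp : p ∈ regSet P)
    (hps : p ∈ φ.source) : pairForm X W (cahnField γ X) φ p =
      -n * (anisoMeanCurvature γ X p * volForm X W φ p) := by
  rw [pairForm, (hX.isRegularPoint hp).crossDer_cahnField hM hγ hφ hps, inner_smul_right, volForm]
  ring

end ShapeOperator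

/-! ### First variations of energy and volume -/

section FirstVariationFormulas

open Filter Topology

variable {n : ℕ} {M : Type*} [TopologicalSpace M] [ChartedSpace (EuclideanSpace ℝ (Fin n)) M]
  {k : ℕ} {P : Fin k → Set M} {X : M → Euc (n + 1)} [IsManifold (𝓡 n) ∞ M]
  [MeasurableSpace M] [BorelSpace M] [T2Space M] [CompactSpace M] [NeZero n]
  {ε₀ : ℝ} {Y : ℝ → M → Euc (n + 1)} {γ : Metric.sphere (0 : EuclideanSpace ℝ (Fin (n + 1))) 1 → ℝ}
  {ν : Fin k → M → Euc (n + 1)}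

/-- The first variation of the anisotropic energy. -/
lemma IsVariation.hasDerivAt_anisoEnergy (hM : IsOrientedAtlas n M)
    (hγ : ContMDiff (𝓡 n) 𝓘(ℝ, ℝ) 2 γ) (hP : IsPieceDecomposition (n := n) P)
    (𝒞 : ChartPartition n M) (hX : IsPiecewiseWeakImmersion 2 P X ν) (hY : IsVariation P X ε₀ Y) :
    HasDerivAt (fun ε => anisoEnergy γ (Y ε))
      (formInt 𝒞 P (pairForm X (cahnField γ X) (velocity Y 0))) 0 := by
  let Ψ : Euc (n + 1) × (Euc n →L[ℝ] Euc (n + 1)) → ℝ := fun z => homExt γ (crossL z.2)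
  have hc : ∀ z : Euc (n + 1) × (Euc n →L[ℝ] Euc (n + 1)), crossL z.2 ≠ 0 → ContDiffAt ℝ 2 Ψ z :=
    fun z hz => (contDiffAt_homExt hγ hz).comp z ((contDiff_crossL.comp contDiff_snd).contDiffAt)
  have hd : ∀ z : Euc (n + 1) × (Euc n →L[ℝ] Euc (n + 1)), crossL z.2 ≠ 0 → ∀ w,
      fderiv ℝ Ψ z w = ⟪homGrad γ (crossL z.2), crossDer z.2 w.2⟫ := by
    intro z hz w
    have h1 : HasFDerivAt (homExt γ) (fderiv ℝ (homExt γ) (crossL z.2)) (crossL z.2) :=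
      ((contDiffAt_homExt hγ hz).differentiableAt (by norm_num)).hasFDerivAt
    have h2 : HasFDerivAt (fun z : Euc (n + 1) × (Euc n →L[ℝ] Euc (n + 1)) => crossL z.2)
        (fderiv ℝ crossL z.2 ∘L ContinuousLinearMap.snd ℝ _ _) z :=
      (hasFDerivAt_crossL z.2).comp z hasFDerivAt_snd
    have h3 : HasFDerivAt Ψ _ z := HasFDerivAt.comp (g := homExt γ) z h1 h2
    rw [h3.fderiv, ContinuousLinearMap.comp_apply, fderiv_homExt_apply]
    rfl
  -- The bounds stay uniform as the normal tends to zero, because the gradient of the homogeneous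
  -- extension is globally bounded.
  have hb : ∀ C, ∃ D, ∀ z : Euc (n + 1) × (Euc n →L[ℝ] Euc (n + 1)), ‖z‖ ≤ C → crossL z.2 ≠ 0 →
      |Ψ z| ≤ D ∧ ‖fderiv ℝ Ψ z‖ ≤ D := by
    intro C
    obtain ⟨C₁, hC₁, h1⟩ := exists_abs_homExt_le hγ
    obtain ⟨C₂, hC₂, h2⟩ := exists_norm_homGrad_le hγ
    obtain ⟨C₃, hC₃, h3⟩ := exists_norm_crossDer_le n C
    obtain ⟨C₄, h4⟩ := exists_bound_comp
      (g := fun L : Euc n →L[ℝ] Euc (n + 1) => ‖crossL L‖)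
      (continuous_norm.comp (contDiff_crossL (r := 0)).continuous) C
    refine ⟨max (C₁ * C₄) (C₂ * C₃), fun z hz hz0 => ⟨?_, ?_⟩⟩
    · have h5 := h4 z.2 ((norm_snd_le z).trans hz)
      exact ((h1 _).trans (mul_le_mul_of_nonneg_left ((le_abs_self _).trans h5) hC₁)).trans
        (le_max_left _ _)
    · refine (ContinuousLinearMap.opNorm_le_bound _ (mul_nonneg hC₂ hC₃) fun w => ?_).trans
        (le_max_right _ _)
      rw [hd z hz0 w, mul_assoc]
      refine (abs_real_inner_le_norm _ _).trans (mul_le_mul (h2 _ hz0) ?_ (norm_nonneg _) hC₂)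
      exact (h3 z.2 ((norm_snd_le z).trans hz) w.2).trans
        (mul_le_mul_of_nonneg_left (norm_snd_le w) hC₃)
  have key := hY.hasDerivAt_formInt hP 𝒞 (fun z hz => (hc z hz).of_le (by norm_num)) hb
  have hval : (formInt 𝒞 P fun φ p => fderiv ℝ Ψ (X p, derivIn φ X p)
      (velocity Y 0 p, derivIn φ (velocity Y 0) p)) =
      formInt 𝒞 P (pairForm X (cahnField γ X) (velocity Y 0)) := by
    refine formInt_congr 𝒞 fun φ hφ p hp hps => ?_
    have hN := normalIn_ne_zero (mem_maximalAtlas_of_mem_atlas hφ) hps (hX.injective hp)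
    rw [hd (X p, derivIn φ X p) hN, pairForm, cahnField_eq hM hγ hφ hps hN]
    rfl
  rw [hval] at key
  refine key.congr_of_eventuallyEq ?_
  filter_upwards [Ioo_mem_nhds (neg_lt_zero.2 hY.pos) hY.pos] with ε hε
  obtain ⟨ν', hν⟩ := hY.weakImmersion ε hε
  exact anisoEnergy_eq_formInt hM hγ hP 𝒞 hν

lemma isEdgeChart_edgeFlux_zero (Z W : M → Euc (n + 1)) (i j : Fin k) (ζ : M)
    (φ : OpenPartialHomeomorph M (Euc n)) :
    edgeFlux X φ ((fun (_ : Fin k) p => Z p) i ζ - (fun (_ : Fin k) p => Z p) j ζ) (W ζ) ζ = 0 := by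
  simp [edgeFlux]

/-- The first variation of the enclosed volume. -/
lemma IsVariation.hasDerivAt_enclosedVolume (hM : IsOrientedAtlas n M)
    (hP : IsPieceDecomposition (n := n) P)
    (𝒞 : ChartPartition n M) (hX : IsPiecewiseWeakImmersion 2 P X ν) (hY : IsVariation P X ε₀ Y) :
    HasDerivAt (fun ε => enclosedVolume (Y ε)) (formInt 𝒞 P (volForm X (velocity Y 0))) 0 := by
  have hcl := isClosed_piece hP
  have hW := hY.contMDiffOn_velocity
  let Ψ : Euc (n + 1) × (Euc n →L[ℝ] Euc (n + 1)) → ℝ := fun z => ⟪z.1, crossL z.2⟫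
  have hc : ContDiff ℝ 1 Ψ := contDiff_fst.inner ℝ (contDiff_crossL.comp contDiff_snd)
  have hd : ∀ z w, fderiv ℝ Ψ z w = ⟪w.1, crossL z.2⟫ + ⟪z.1, crossDer z.2 w.2⟫ := by
    intro z w
    have h2 : HasFDerivAt (fun z : Euc (n + 1) × (Euc n →L[ℝ] Euc (n + 1)) => crossL z.2)
        (fderiv ℝ crossL z.2 ∘L ContinuousLinearMap.snd ℝ _ _) z :=
      (hasFDerivAt_crossL z.2).comp z hasFDerivAt_snd
    have h3 : HasFDerivAt Ψ _ z := HasFDerivAt.inner ℝ (hasFDerivAt_fst (p := z)) h2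
    rw [h3.fderiv]
    simp [crossDer, add_comm]
  have hb : ∀ C, ∃ D, ∀ z : Euc (n + 1) × (Euc n →L[ℝ] Euc (n + 1)), ‖z‖ ≤ C → crossL z.2 ≠ 0 →
      |Ψ z| ≤ D ∧ ‖fderiv ℝ Ψ z‖ ≤ D := by
    intro C
    obtain ⟨D₁, h1⟩ := exists_bound_comp hc.continuous C
    obtain ⟨D₂, h2⟩ := exists_bound_comp
      (continuous_norm.comp (hc.continuous_fderiv (by norm_num))) C
    exact ⟨max D₁ D₂, fun z hz _ => ⟨(h1 z hz).trans (le_max_left _ _),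
      ((le_abs_self _).trans (h2 z hz)).trans (le_max_right _ _)⟩⟩
  have key := hY.hasDerivAt_formInt hP 𝒞 (fun z _ => hc.contDiffAt) hb
  have hWp : PieceSmooth (n := n) 1 P (velocity Y 0) := PieceSmooth.of_contMDiffOn hW
  -- `X` is its own extension on every piece, so it has no jump, and the derivative can be moved
  -- from the velocity to `X`.
  have hstokes := stokesDefect_eq_zero hM hP 𝒞 hX.contMDiffOn (Z := X) (Zr := fun _ p => X p)
    (fun i => ⟨(hX.contMDiffOn i).of_le (by norm_num), fun _ _ => rfl⟩) hW
    fun i j ζ φ _ => isEdgeChart_edgeFlux_zero X _ i j ζ φ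
  have hself : formInt 𝒞 P (pairForm X (velocity Y 0) X) =
      n * formInt 𝒞 P (volForm X (velocity Y 0)) := by
    rw [← formInt_smul]
    refine formInt_congr 𝒞 fun φ hφ p hp hps => ?_
    rw [pairForm, crossDer_self, inner_smul_right, volForm, normalIn]
  -- One copy of `∫ ⟪W, N⟫` comes from varying the position and `n` copies from varying the normal;
  -- together they cancel the factor `1/(n+1)`.
  have hval : (formInt 𝒞 P fun φ p => fderiv ℝ Ψ (X p, derivIn φ X p)
      (velocity Y 0 p, derivIn φ (velocity Y 0) p)) =
      (n + 1) * formInt 𝒞 P (volForm X (velocity Y 0)) := by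
    have h1 : (formInt 𝒞 P fun φ p => fderiv ℝ Ψ (X p, derivIn φ X p)
        (velocity Y 0 p, derivIn φ (velocity Y 0) p)) =
        formInt 𝒞 P fun φ p => volForm X (velocity Y 0) φ p + pairForm X X (velocity Y 0) φ p :=
      formInt_congr 𝒞 fun φ hφ p hp hps => hd _ _
    rw [h1, formInt_add 𝒞 (formIntegrable_volForm hcl hX.pieceSmooth_one hWp)
      (formIntegrable_pairForm hcl hX.pieceSmooth_one hX.pieceSmooth_one hWp)]
    rw [stokesDefect, sub_eq_zero] at hstokes
    rw [hstokes, hself]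
    ring
  rw [hval] at key
  have key2 := key.const_mul ((n : ℝ) + 1)⁻¹
  rw [inv_mul_cancel_left₀ (by positivity)] at key2
  refine key2.congr_of_eventuallyEq ?_
  filter_upwards [Ioo_mem_nhds (neg_lt_zero.2 hY.pos) hY.pos] with ε hε
  obtain ⟨ν', hν⟩ := hY.weakImmersion ε hε
  exact enclosedVolume_eq_formInt hM hP 𝒞 hν

end FirstVariationFormulas

/-! ### Linear algebra of the flux at an edge point -/

section Edge

open Filter Topology

variable {n : ℕ} [NeZero n] {M : Type*} [TopologicalSpace M]
  [ChartedSpace (EuclideanSpace ℝ (Fin n)) M] {k : ℕ} {P : Fin k → Set M} {X : M → Euc (n + 1)}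
  {i j : Fin k} {ζ : M} {φ : OpenPartialHomeomorph M (Euc n)}

lemma IsEdgeChart.eventually_mem (hφ : IsEdgeChart P i j ζ φ) :
    ∀ᶠ u in 𝓝 (φ ζ), u 0 = 0 → u ∈ φ.target ∩ φ.symm ⁻¹' P i := by
  filter_upwards [φ.open_target.mem_nhds (φ.map_source hφ.2.1)] with u hu h0
  refine ⟨hu, (hφ.2.2.2 _ (φ.map_target hu)).1.2 ?_⟩
  rw [φ.right_inv hu, h0]

/-- `X` need not be differentiable at `ζ`, but the hyperplane `{x₀ = 0}` lies locally in `P i`, on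
which `X` is of class `C²`. -/
lemma IsEdgeChart.hasFDerivWithinAt (hφ : IsEdgeChart P i j ζ φ)
    (hX : ∀ i, ContMDiffOn (𝓡 n) 𝓘(ℝ, Euc (n + 1)) 2 X (P i)) :
    ∃ f' : Euc n →L[ℝ] Euc (n + 1),
      HasFDerivWithinAt (X ∘ φ.symm) f' {u | u 0 = 0} (φ ζ) := by
  have h1 := ContMDiffOn.contDiffOn_comp_symm two_le_infty (hX i) hφ.1
  have hev := hφ.eventually_mem
  have hmem := hev.self_of_nhds hφ.2.2.1
  refine ⟨_, ((h1 _ hmem).differentiableWithinAt (by norm_num)).hasFDerivWithinAt.mono_of_mem_nhdsWithin ?_⟩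
  filter_upwards [nhdsWithin_le_nhds hev, self_mem_nhdsWithin] with u hu h0 using hu h0

lemma edgeDeriv_eq (hφ : φ ζ 0 = 0) {f' : Euc n →L[ℝ] Euc (n + 1)}
    (hf : HasFDerivWithinAt (X ∘ φ.symm) f' {u | u 0 = 0} (φ ζ)) {v : Euc n} (hv : v 0 = 0) :
    edgeDeriv X ζ φ v = f' v := by
  have h1 := hf.hasLineDerivWithinAt v
  have h2 : (fun t : ℝ => φ ζ + t • v) ⁻¹' {u : Euc n | u 0 = 0} ∈ 𝓝 (0 : ℝ) := by
    filter_upwards with t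
    simp [hφ, hv]
  have h3 : HasLineDerivAt ℝ (X ∘ φ.symm) (f' v) (φ ζ) v := HasDerivWithinAt.hasDerivAt h1 h2
  exact h3.lineDeriv

lemma edgeFrame_eq (hφ : φ ζ 0 = 0) {f' : Euc n →L[ℝ] Euc (n + 1)}
    (hf : HasFDerivWithinAt (X ∘ φ.symm) f' {u | u 0 = 0} (φ ζ)) {l : Fin n} (hl : l ≠ 0) :
    edgeFrame X φ ζ l = f' (EuclideanSpace.single l 1) :=
  edgeDeriv_eq hφ hf (by simp [hl.symm])

lemma sum_smul_update_edgeFrame (hφ : φ ζ 0 = 0) {f' : Euc n →L[ℝ] Euc (n + 1)}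
    (hf : HasFDerivWithinAt (X ∘ φ.symm) f' {u | u 0 = 0} (φ ζ)) (z : Euc (n + 1)) (c : Fin n → ℝ) :
    ∑ l, c l • Function.update (edgeFrame X φ ζ) 0 z l =
      c 0 • z + edgeDeriv X ζ φ (WithLp.toLp 2 (Function.update c 0 0)) := by
  have hv : (WithLp.toLp 2 (Function.update c 0 0) : Euc n) =
      ∑ l, Function.update c 0 0 l • EuclideanSpace.single l (1 : ℝ) := by
    have := (EuclideanSpace.basisFun (Fin n) ℝ).toBasis.sum_repr
      (WithLp.toLp 2 (Function.update c 0 0) : Euc n)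
    simpa using this.symm
  rw [edgeDeriv_eq hφ hf (by simp), hv, map_sum,
    ← Finset.add_sum_erase _ _ (Finset.mem_univ (0 : Fin n)),
    ← Finset.add_sum_erase (f := fun l => f' (Function.update c 0 0 l • EuclideanSpace.single l 1)) _
      (Finset.mem_univ (0 : Fin n))]
  simp only [Function.update_self, zero_smul, map_zero, zero_add]
  congr 1
  refine Finset.sum_congr rfl fun l hl => ?_
  have hl0 := Finset.ne_of_mem_erase hl
  rw [Function.update_of_ne hl0, Function.update_of_ne hl0, edgeFrame_eq hφ hf hl0, map_smul]

/-- The normal of the hyperplane spanned by the tangent space of the edge and `z`. -/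
noncomputable def edgeNormal (X : M → Euc (n + 1)) (φ : OpenPartialHomeomorph M (Euc n))
    (z : Euc (n + 1)) (p : M) : Euc (n + 1) :=
  crossProd (Function.update (edgeFrame X φ p) 0 z)

lemma edgeFlux_eq_inner_edgeNormal (z w : Euc (n + 1)) (p : M) :
    edgeFlux X φ z w p = -⟪w, edgeNormal X φ z p⟫ :=
  inner_crossProd_update_swap _ _ _ _

lemma edgeNormal_eq_zero_iff {z : Euc (n + 1)} {p : M} : edgeNormal X φ z p = 0 ↔
    ¬ LinearIndependent ℝ (Function.update (edgeFrame X φ p) 0 z) := by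
  rw [← crossProd_ne_zero_iff, not_not, edgeNormal]

/-- A tangent `z` is a combination of the other vectors in the cross product. -/
lemma edgeNormal_eq_zero_of_mem_edgeTangent (hφ : IsEdgeChart P i j ζ φ)
    (hX : ∀ i, ContMDiffOn (𝓡 n) 𝓘(ℝ, Euc (n + 1)) 2 X (P i)) {z : Euc (n + 1)}
    (hz : z ∈ edgeTangent X ζ φ) : edgeNormal X φ z ζ = 0 := by
  obtain ⟨f', hf⟩ := hφ.hasFDerivWithinAt hX
  obtain ⟨v, hv, rfl⟩ := hz
  rw [edgeNormal_eq_zero_iff, Fintype.not_linearIndependent_iff]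
  refine ⟨Function.update (-v.ofLp) 0 1, ?_, 0, by simp⟩
  rw [sum_smul_update_edgeFrame hφ.2.2.1 hf, Function.update_self, Function.update_idem, one_smul,
    edgeDeriv_eq hφ.2.2.1 hf hv, edgeDeriv_eq hφ.2.2.1 hf (by simp), ← map_add]
  have : v + WithLp.toLp 2 (Function.update (-v.ofLp) 0 0) = 0 := by
    ext l
    by_cases hl : l = 0
    · subst hl
      simpa using hv
    · simp [hl]
  rw [this, map_zero]

/-- Here the tangent vectors of the edge are already dependent, so the flux vanishes whatever `z`
is. This is why the edge condition concerns immersed points only. -/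
lemma edgeNormal_eq_zero_of_not_isEdgeImmersionAt (hφ : IsEdgeChart P i j ζ φ)
    (hX : ∀ i, ContMDiffOn (𝓡 n) 𝓘(ℝ, Euc (n + 1)) 2 X (P i)) (z : Euc (n + 1))
    (h : ¬ IsEdgeImmersionAt X ζ φ) : edgeNormal X φ z ζ = 0 := by
  obtain ⟨f', hf⟩ := hφ.hasFDerivWithinAt hX
  rw [IsEdgeImmersionAt] at h
  push Not at h
  obtain ⟨v, hv0, hv, hne⟩ := h
  rw [edgeNormal_eq_zero_iff, Fintype.not_linearIndependent_iff]
  have hup : Function.update v.ofLp 0 0 = v.ofLp := by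
    rw [← hv0, Function.update_eq_self]
  refine ⟨v.ofLp, ?_, ?_⟩
  · rw [sum_smul_update_edgeFrame hφ.2.2.1 hf, hup, hv0, zero_smul, zero_add]
    exact hv
  · by_contra! h0
    exact hne (by ext l; exact h0 l)

/-- In a linear relation, the coefficient of `z` is zero since `z` is not tangent, and the remaining
ones are zero by the immersion property. -/
lemma edgeNormal_ne_zero (hφ : IsEdgeChart P i j ζ φ)
    (hX : ∀ i, ContMDiffOn (𝓡 n) 𝓘(ℝ, Euc (n + 1)) 2 X (P i)) {z : Euc (n + 1)}
    (h : IsEdgeImmersionAt X ζ φ) (hz : z ∉ edgeTangent X ζ φ) : edgeNormal X φ z ζ ≠ 0 := by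
  obtain ⟨f', hf⟩ := hφ.hasFDerivWithinAt hX
  rw [Ne, edgeNormal_eq_zero_iff, not_not, Fintype.linearIndependent_iff]
  intro c hc
  rw [sum_smul_update_edgeFrame hφ.2.2.1 hf] at hc
  set v : Euc n := WithLp.toLp 2 (Function.update c 0 0) with hv
  have hv0 : v 0 = 0 := by simp [hv]
  have hc0 : c 0 = 0 := by
    by_contra hne
    refine hz ⟨-(c 0)⁻¹ • v, by simp [hv0], ?_⟩
    rw [edgeDeriv_eq hφ.2.2.1 hf (by simp [hv0]), map_smul, ← edgeDeriv_eq hφ.2.2.1 hf hv0,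
      eq_neg_of_add_eq_zero_right hc, smul_neg, neg_smul, neg_neg, inv_smul_smul₀ hne]
  rw [hc0, zero_smul, zero_add] at hc
  have h0 := h v hv0 hc
  intro l
  by_cases hl : l = 0
  · rw [hl, hc0]
  · have : v l = 0 := by rw [h0]; rfl
    simpa [hv, hl] using this

lemma IsEdgeChart.mem_left (hφ : IsEdgeChart P i j ζ φ) : ζ ∈ P i :=
  (hφ.2.2.2 ζ hφ.2.1).1.2 hφ.2.2.1.ge

lemma IsEdgeChart.mem_right (hφ : IsEdgeChart P i j ζ φ) : ζ ∈ P j :=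
  (hφ.2.2.2 ζ hφ.2.1).2.2 hφ.2.2.1.le

end Edge

/-! ### The Euler-Lagrange equations imply criticality -/

section Sufficiency

open Filter Topology

variable {n : ℕ} {M : Type*} [TopologicalSpace M] [ChartedSpace (EuclideanSpace ℝ (Fin n)) M]
  {k : ℕ} {P : Fin k → Set M} {X : M → Euc (n + 1)} [IsManifold (𝓡 n) ∞ M]
  [MeasurableSpace M] [BorelSpace M] [T2Space M] [CompactSpace M] [NeZero n]
  {γ : Metric.sphere (0 : EuclideanSpace ℝ (Fin (n + 1))) 1 → ℝ}
  {ν : Fin k → M → Euc (n + 1)}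

lemma IsPiecewiseWeakImmersion.homGrad_sub_homGrad (hγ : ContMDiff (𝓡 n) 𝓘(ℝ, ℝ) 2 γ)
    (hP : IsPieceDecomposition (n := n) P) (hX : IsPiecewiseWeakImmersion 2 P X ν)
    {i j : Fin k} {ζ : M} {φ : OpenPartialHomeomorph M (Euc n)} (hφ : IsEdgeChart P i j ζ φ) :
    homGrad γ (ν i ζ) - homGrad γ (ν j ζ) = cahnHoffman γ (ν i ζ) - cahnHoffman γ (ν j ζ) := by
  rw [homGrad_eq_cahnHoffman hγ (hX.norm_normal hP hφ.mem_left),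
    homGrad_eq_cahnHoffman hγ (hX.norm_normal hP hφ.mem_right)]

/-- The edge condition removes the boundary term, and constancy of `Λ` turns the first variation of
energy into `-nΛ₀` times that of volume, which is zero for a volume-preserving variation. -/
lemma isCritical_of_eulerLagrange (hM : IsOrientedAtlas n M)
    (hγ : ContMDiff (𝓡 n) 𝓘(ℝ, ℝ) 2 γ) (hP : IsPieceDecomposition (n := n) P)
    (hX : IsPiecewiseWeakImmersion 2 P X ν) {Λ₀ : ℝ}
    (hΛ : ∀ p, IsRegularPoint X p → anisoMeanCurvature γ X p = Λ₀)
    (hedge : ∀ (i j : Fin k) (ζ : M) (φ : OpenPartialHomeomorph M (EuclideanSpace ℝ (Fin n))),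
        IsEdgeChart P i j ζ φ → IsEdgeImmersionAt X ζ φ →
          cahnHoffman γ (ν i ζ) - cahnHoffman γ (ν j ζ) ∈ edgeTangent X ζ φ) :
    IsCritical γ P X := by
  intro ε₀ Y hY hvol
  obtain ⟨𝒞⟩ := exists_chartPartition n M
  have hE := hY.hasDerivAt_anisoEnergy hM hγ hP 𝒞 hX
  have hV := hY.hasDerivAt_enclosedVolume hM hP 𝒞 hX
  have hV0 : formInt 𝒞 P (volForm X (velocity Y 0)) = 0 := by
    refine hV.unique ((hasDerivAt_const (0 : ℝ) (enclosedVolume X)).congr_of_eventuallyEq ?_)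
    filter_upwards [Ioo_mem_nhds (neg_lt_zero.2 hY.pos) hY.pos] with ε hε using hvol ε hε
  have hstokes := stokesDefect_eq_zero hM hP 𝒞 hX.contMDiffOn (hX.pieceRep_cahnField hγ hP)
    hY.contMDiffOn_velocity fun i j ζ φ hφ => by
      rw [hX.homGrad_sub_homGrad hγ hP hφ, edgeFlux_eq_inner_edgeNormal]
      by_cases him : IsEdgeImmersionAt X ζ φ
      · rw [edgeNormal_eq_zero_of_mem_edgeTangent hφ hX.contMDiffOn (hedge i j ζ φ hφ him),
          inner_zero_right, neg_zero]
      · rw [edgeNormal_eq_zero_of_not_isEdgeImmersionAt hφ hX.contMDiffOn _ him,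
          inner_zero_right, neg_zero]
  rw [stokesDefect, sub_eq_zero] at hstokes
  have hval : formInt 𝒞 P (pairForm X (velocity Y 0) (cahnField γ X)) =
      -n * Λ₀ * formInt 𝒞 P (volForm X (velocity Y 0)) := by
    rw [← formInt_smul]
    refine formInt_congr 𝒞 fun φ hφ p hp hps => ?_
    rw [hX.pairForm_cahnField hM hγ _ (mem_maximalAtlas_of_mem_atlas hφ) hp hps,
      hΛ p (hX.isRegularPoint hp), mul_assoc]
  rwa [hstokes, hval, hV0, mul_zero] at hE

end Sufficiency

/-! ### Variations in a fixed direction -/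

section TestFun

open Filter Topology

variable {n : ℕ} {M : Type*} [TopologicalSpace M] [ChartedSpace (EuclideanSpace ℝ (Fin n)) M]
  {k : ℕ} {P : Fin k → Set M} {X : M → Euc (n + 1)}

/-- A function `η`, of class `C²` on the pieces, whose differential is `⟪θ, dX⟫` for a vector field
`θ` of class `C¹` on the pieces: the maps `X + ε η w` are weak immersions for small `ε`. -/
structure IsTestFun (P : Fin k → Set M) (X : M → Euc (n + 1)) (η : M → ℝ)
    (θ : Fin k → M → Euc (n + 1)) : Prop where
  continuous : Continuous η
  contMDiffOn : ∀ i, ContMDiffOn (𝓡 n) 𝓘(ℝ, ℝ) 2 η (P i)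
  contMDiffOn_field : ∀ i, ContMDiffOn (𝓡 n) 𝓘(ℝ, Euc (n + 1)) 1 (θ i) (P i)
  derivIn_eq : ∀ i, ∀ p ∈ interior (P i), ∀ e ∈ IsManifold.maximalAtlas (𝓡 n) ∞ M, p ∈ e.source →
    ∀ v, derivIn e η p v = ⟪θ i p, derivIn e X p v⟫

/-- The variation of `X` in the fixed direction `w`, weighted with a function. -/
noncomputable def pushVar (X : M → Euc (n + 1)) (η : M → ℝ) (w : Euc (n + 1)) (ε : ℝ) (p : M) :
    Euc (n + 1) :=
  X p + (ε * η p) • w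

lemma velocity_pushVar (η : M → ℝ) (w : Euc (n + 1)) :
    velocity (pushVar X η w) 0 = fun p => η p • w := by
  funext p
  have h : HasDerivAt (fun s : ℝ => X p + (s * η p) • w) ((1 * η p) • w) 0 :=
    (((hasDerivAt_id (0 : ℝ)).mul_const (η p)).smul_const w).const_add (X p)
  rw [one_mul] at h
  exact h.deriv

variable [IsManifold (𝓡 n) ∞ M] {η : M → ℝ} {θ : Fin k → M → Euc (n + 1)}

lemma IsTestFun.pieceSmooth_smul (h : IsTestFun P X η θ) (w : Euc (n + 1)) :
    PieceSmooth (n := n) 2 P fun p => η p • w :=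
  PieceSmooth.of_contMDiffOn fun i => (h.contMDiffOn i).smul contMDiffOn_const

lemma IsTestFun.contMDiffOn_smul (h : IsTestFun P X η θ) (w : Euc (n + 1)) (i : Fin k) :
    ContMDiffOn (𝓡 n) 𝓘(ℝ, Euc (n + 1)) 2 (fun p => η p • w) (P i) :=
  (h.contMDiffOn i).smul contMDiffOn_const

lemma IsTestFun.linear_comb {η' : M → ℝ} {θ' : Fin k → M → Euc (n + 1)} (h : IsTestFun P X η θ)
    (h' : IsTestFun P X η' θ') (a b : ℝ) :
    IsTestFun P X (fun p => a * η p + b * η' p) fun i p => a • θ i p + b • θ' i p where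
  continuous := (continuous_const.mul h.continuous).add (continuous_const.mul h'.continuous)
  contMDiffOn i := (contMDiffOn_const.mul (h.contMDiffOn i)).add
    (contMDiffOn_const.mul (h'.contMDiffOn i))
  contMDiffOn_field i := by
    have h1 : ContMDiffOn (𝓡 n) 𝓘(ℝ, Euc (n + 1)) 1 (fun p => a • θ i p) (P i) :=
      (contMDiffOn_const (I' := 𝓘(ℝ, ℝ)) (c := a)).smul (h.contMDiffOn_field i)
    have h2 : ContMDiffOn (𝓡 n) 𝓘(ℝ, Euc (n + 1)) 1 (fun p => b • θ' i p) (P i) :=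
      (contMDiffOn_const (I' := 𝓘(ℝ, ℝ)) (c := b)).smul (h'.contMDiffOn_field i)
    exact h1.add h2
  derivIn_eq i p hp e he hps v := by
    have hr : p ∈ regSet P := mem_iUnion.2 ⟨i, hp⟩
    have h1 := ((PieceSmooth.of_contMDiffOn h.contMDiffOn).contDiffAt two_le_infty hr he
      hps).differentiableAt (by norm_num)
    have h2 := ((PieceSmooth.of_contMDiffOn h'.contMDiffOn).contDiffAt two_le_infty hr he
      hps).differentiableAt (by norm_num)
    have h3 : HasFDerivAt ((fun p => a * η p + b * η' p) ∘ e.symm) _ (e p) :=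
      (h1.hasFDerivAt.const_mul a).add (h2.hasFDerivAt.const_mul b)
    rw [derivIn, h3.fderiv, inner_add_left, real_inner_smul_left, real_inner_smul_left,
      ← h.derivIn_eq i p hp e he hps, ← h'.derivIn_eq i p hp e he hps]
    rfl

lemma IsTestFun.derivIn_pushVar (hX : PieceSmooth (n := n) 2 P X) (h : IsTestFun P X η θ)
    (w : Euc (n + 1)) (ε : ℝ) {i : Fin k} {p : M} (hp : p ∈ interior (P i))
    {e : OpenPartialHomeomorph M (Euc n)} (he : e ∈ IsManifold.maximalAtlas (𝓡 n) ∞ M)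
    (hps : p ∈ e.source) (v : Euc n) : derivIn e (pushVar X η w ε) p v =
      derivIn e X p v + ⟪ε • θ i p, derivIn e X p v⟫ • w := by
  have hr : p ∈ regSet P := mem_iUnion.2 ⟨i, hp⟩
  have h1 := ((PieceSmooth.of_contMDiffOn h.contMDiffOn).contDiffAt two_le_infty hr he
    hps).differentiableAt (by norm_num)
  have h2 := (hX.contDiffAt two_le_infty hr he hps).differentiableAt (by norm_num)
  have h3 : HasFDerivAt (pushVar X η w ε ∘ e.symm) _ (e p) :=
    h2.hasFDerivAt.add ((h1.hasFDerivAt.const_mul ε).smul_const w)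
  rw [derivIn, h3.fderiv, real_inner_smul_left, ← h.derivIn_eq i p hp e he hps]
  rfl

/-- The differential changes by the rank one transformation `y ↦ y + ε ⟪θ, y⟫ w` of `ℝ^{n+1}`. The
new normal depends linearly on the old one, with coefficients that are `C¹` on the piece; therefore
its direction survives where `dX` degenerates. -/
lemma IsTestFun.normalIn_pushVar (hX : PieceSmooth (n := n) 2 P X) (h : IsTestFun P X η θ)
    (w : Euc (n + 1)) {ε : ℝ} {i : Fin k} {p : M} (hp : p ∈ interior (P i))
    (h1 : 0 < 1 + ε * ⟪θ i p, w⟫)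
    {e : OpenPartialHomeomorph M (Euc n)} (he : e ∈ IsManifold.maximalAtlas (𝓡 n) ∞ M)
    (hps : p ∈ e.source) : normalIn e (pushVar X η w ε) p =
      (1 + ε * ⟪θ i p, w⟫) • normalIn e X p - (ε * ⟪w, normalIn e X p⟫) • θ i p := by
  have hd : derivIn e (pushVar X η w ε) p = derivIn e X p +
      (derivIn e (pushVar X η w ε) p - derivIn e X p) := by abel
  rw [normalIn, hd, crossL_rank_one _ _ (ε • θ i p) w, real_inner_smul_left, smul_smul,
    mul_comm _ ε]
  · rfl
  · intro v
    rw [sub_apply, h.derivIn_pushVar hX w ε hp he hps, add_sub_cancel_left]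
  · rw [real_inner_smul_left]
    exact h1.ne'

/-- The transformation `y ↦ y + ε ⟪θ, y⟫ w` is injective: pairing a kernel equation with `ε θ` gives
`(1 + ε ⟪θ, w⟫) ⟪ε θ, y⟫ = 0`. -/
lemma IsTestFun.injective_pushVar (hX : PieceSmooth (n := n) 2 P X) (h : IsTestFun P X η θ)
    (w : Euc (n + 1)) {ε : ℝ} {i : Fin k} {p : M} (hp : p ∈ interior (P i))
    (h1 : 0 < 1 + ε * ⟪θ i p, w⟫) (hinj : Function.Injective (diffAt X p)) :
    Function.Injective (diffAt (pushVar X η w ε) p) := by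
  have hm := chartAt_mem_maximalAtlas (n := n) p
  have hs := mem_chart_source (Euc n) p
  rw [diffAt_eq_derivIn] at hinj ⊢
  rw [injective_iff_map_eq_zero]
  intro v hv
  rw [h.derivIn_pushVar hX w ε hp hm hs] at hv
  have h2 : (1 + ε * ⟪θ i p, w⟫) * ⟪ε • θ i p, derivIn (chartAt (Euc n) p) X p v⟫ = 0 := by
    have h3 := congrArg (fun z => ⟪ε • θ i p, z⟫) hv
    simp only [inner_add_right, inner_zero_right, real_inner_smul_right] at h3
    rw [real_inner_smul_left _ w] at h3
    linarith
  have h4 := (mul_eq_zero.1 h2).resolve_left h1.ne'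
  rw [h4, zero_smul, add_zero] at hv
  exact (injective_iff_map_eq_zero _).1 hinj v hv

/-- The volume density is affine in the parameter. -/
lemma IsTestFun.volForm_pushVar (hX : PieceSmooth (n := n) 2 P X) (h : IsTestFun P X η θ)
    (w : Euc (n + 1)) {ε : ℝ} {i : Fin k} {p : M} (hp : p ∈ interior (P i))
    (h1 : 0 < 1 + ε * ⟪θ i p, w⟫)
    {e : OpenPartialHomeomorph M (Euc n)} (he : e ∈ IsManifold.maximalAtlas (𝓡 n) ∞ M)
    (hps : p ∈ e.source) : volForm (pushVar X η w ε) (pushVar X η w ε) e p = volForm X X e p +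
      ε * (η p * ⟪w, normalIn e X p⟫ + ⟪θ i p, w⟫ * volForm X X e p -
        ⟪w, normalIn e X p⟫ * ⟪X p, θ i p⟫) := by
  -- Both quadratic terms are `ε² η ⟪θ, w⟫ ⟪w, N⟫`, with opposite signs.
  rw [volForm, h.normalIn_pushVar hX w hp h1 he hps, pushVar, volForm]
  simp only [inner_add_left, inner_sub_right, real_inner_smul_left, real_inner_smul_right,
    real_inner_comm w (θ i p)]
  ring

variable {ν : Fin k → M → Euc (n + 1)}

lemma IsTestFun.exists_bound [CompactSpace M] (hcl : ∀ i, IsClosed (P i))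
    (h : IsTestFun P X η θ) : ∃ C, 0 ≤ C ∧ ∀ i, ∀ p ∈ P i, ‖θ i p‖ ≤ C := by
  have h1 : ∀ i, ∃ C, ∀ p ∈ P i, ‖θ i p‖ ≤ C := fun i =>
    (hcl i).isCompact.exists_bound_of_continuousOn (h.contMDiffOn_field i).continuousOn
  choose C hC using h1
  refine ⟨∑ i, |C i|, by positivity, fun i p hp => (hC i p hp).trans ((le_abs_self _).trans ?_)⟩
  exact Finset.single_le_sum (f := fun i => |C i|) (fun _ _ => abs_nonneg _) (Finset.mem_univ i)

/-- The new unit normal is the normalization of `m = (1 + ε ⟪θ, w⟫) ν - ε ⟪w, ν⟫ θ`, which is `C¹`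
on the closed piece. The factor `2` in the smallness condition bounds the two terms of `⟪m, ν⟫ - 1`
and so keeps `m` away from zero. -/
lemma IsTestFun.isPiecewiseWeakImmersion_pushVar [NeZero n] [T2Space M]
    (hP : IsPieceDecomposition (n := n) P)
    (hX : IsPiecewiseWeakImmersion 2 P X ν) (h : IsTestFun P X η θ) (w : Euc (n + 1)) {ε : ℝ}
    (hε : ∀ i, ∀ p ∈ P i, |ε| * (2 * (‖θ i p‖ * ‖w‖)) < 1) :
    ∃ ν', IsPiecewiseWeakImmersion 2 P (pushVar X η w ε) ν' := by
  have hpos : ∀ i, ∀ p ∈ P i, 0 < 1 + ε * ⟪θ i p, w⟫ := by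
    intro i p hp
    have h1 : |ε * ⟪θ i p, w⟫| ≤ |ε| * (‖θ i p‖ * ‖w‖) := by
      rw [abs_mul]
      exact mul_le_mul_of_nonneg_left (abs_real_inner_le_norm _ _) (abs_nonneg _)
    have h2 := hε i p hp
    have h3 := neg_abs_le (ε * ⟪θ i p, w⟫)
    have h4 : 0 ≤ |ε| * (‖θ i p‖ * ‖w‖) := by positivity
    linarith
  set m : Fin k → M → Euc (n + 1) := fun i p =>
    (1 + ε * ⟪θ i p, w⟫) • ν i p - (ε * ⟪w, ν i p⟫) • θ i p with hm
  have hm0 : ∀ i, ∀ p ∈ P i, m i p ≠ 0 := by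
    intro i p hp h0
    have hν := hX.norm_normal hP hp
    have h1 : ⟪m i p, ν i p⟫ = 1 + ε * (⟪θ i p, w⟫ - ⟪w, ν i p⟫ * ⟪θ i p, ν i p⟫) := by
      simp only [hm, inner_sub_left, real_inner_smul_left, real_inner_self_eq_norm_sq, hν]
      ring
    rw [h0, inner_zero_left] at h1
    have h2 : |⟪θ i p, w⟫ - ⟪w, ν i p⟫ * ⟪θ i p, ν i p⟫| ≤ 2 * (‖θ i p‖ * ‖w‖) := by
      refine (abs_sub _ _).trans ?_
      have e1 := abs_real_inner_le_norm (θ i p) w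
      have e2 := abs_real_inner_le_norm w (ν i p)
      have e3 := abs_real_inner_le_norm (θ i p) (ν i p)
      rw [hν, mul_one] at e2 e3
      rw [abs_mul]
      nlinarith [mul_le_mul e2 e3 (abs_nonneg _) (norm_nonneg _)]
    have h3 : |ε * (⟪θ i p, w⟫ - ⟪w, ν i p⟫ * ⟪θ i p, ν i p⟫)| < 1 := by
      rw [abs_mul]
      exact (mul_le_mul_of_nonneg_left h2 (abs_nonneg _)).trans_lt (hε i p hp)
    have h4 := (abs_lt.1 h3).1
    linarith
  refine ⟨fun i p => ‖m i p‖⁻¹ • m i p, ?_, ?_, ?_, ?_, ?_⟩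
  · exact hX.continuous.add ((continuous_const.mul h.continuous).smul continuous_const)
  · exact fun i => (hX.contMDiffOn i).add
      ((contMDiffOn_const.mul (h.contMDiffOn i)).smul contMDiffOn_const)
  · exact fun i p hp => h.injective_pushVar hX.pieceSmooth w hp (hpos i p (interior_subset hp))
      (hX.immersion i p hp)
  · intro i
    have hν : ContMDiffOn (𝓡 n) 𝓘(ℝ, Euc (n + 1)) 1 (ν i) (P i) := hX.normal_contMDiffOn i
    have hθ := h.contMDiffOn_field i
    intro p hp
    have hF : ContDiffAt ℝ 1 (fun z : Euc (n + 1) × Euc (n + 1) =>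
        ‖(1 + ε * ⟪z.1, w⟫) • z.2 - (ε * ⟪w, z.2⟫) • z.1‖⁻¹ •
          ((1 + ε * ⟪z.1, w⟫) • z.2 - (ε * ⟪w, z.2⟫) • z.1)) (θ i p, ν i p) := by
      have h1 : ContDiffAt ℝ 1 (fun z : Euc (n + 1) × Euc (n + 1) =>
          (1 + ε * ⟪z.1, w⟫) • z.2 - (ε * ⟪w, z.2⟫) • z.1) (θ i p, ν i p) :=
        ((contDiff_const.add (contDiff_const.mul (contDiff_fst.inner ℝ contDiff_const))).smul
          contDiff_snd).sub ((contDiff_const.mul (contDiff_const.inner ℝ contDiff_snd)).smul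
          contDiff_fst) |>.contDiffAt
      exact ((h1.norm ℝ (hm0 i p hp)).inv (norm_ne_zero_iff.2 (hm0 i p hp))).smul h1
    exact ContMDiffAt.comp_contMDiffWithinAt (I' := 𝓘(ℝ, Euc (n + 1) × Euc (n + 1)))
      (f := fun p => (θ i p, ν i p)) (g := fun z : Euc (n + 1) × Euc (n + 1) =>
        ‖(1 + ε * ⟪z.1, w⟫) • z.2 - (ε * ⟪w, z.2⟫) • z.1‖⁻¹ •
          ((1 + ε * ⟪z.1, w⟫) • z.2 - (ε * ⟪w, z.2⟫) • z.1)) p hF.contMDiffAt ((hθ p hp).prodMk_space (hν p hp))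
  · intro i p hp
    have hc := mem_chart_source (Euc n) p
    have hN := normalIn_ne_zero (chartAt_mem_maximalAtlas p) hc (hX.immersion i p hp)
    set N := normalIn (chartAt (Euc n) p) X p with hNdef
    have hmN : m i p = ‖N‖⁻¹ • normalIn (chartAt (Euc n) p) (pushVar X η w ε) p := by
      rw [h.normalIn_pushVar hX.pieceSmooth w hp (hpos i p (interior_subset hp))
        (chartAt_mem_maximalAtlas p) hc, ← hNdef]
      simp only [hm, hX.normal_eq i p hp, unitNormal_eq, ← hNdef, real_inner_smul_right, smul_sub,
        smul_smul]
      congr 2 <;> ring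
    change ‖m i p‖⁻¹ • m i p = _
    rw [unitNormal_eq, hmN, norm_smul, norm_inv, norm_norm, smul_smul, mul_inv, inv_inv,
      mul_right_comm, mul_inv_cancel₀ (norm_ne_zero_iff.2 hN), one_mul]

lemma IsTestFun.exists_isVariation [NeZero n] [T2Space M] [CompactSpace M]
    (hP : IsPieceDecomposition (n := n) P) (hX : IsPiecewiseWeakImmersion 2 P X ν)
    (h : IsTestFun P X η θ) (w : Euc (n + 1)) : ∃ ε₀, IsVariation P X ε₀ (pushVar X η w) ∧
      ∀ ε ∈ Ioo (-ε₀) ε₀, ∀ i, ∀ p ∈ P i, 0 < 1 + ε * ⟪θ i p, w⟫ := by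
  obtain ⟨C, hC0, hC⟩ := h.exists_bound (isClosed_piece hP)
  -- The summand `1` keeps the bound `ε₀ = 1 / (2 C ‖w‖ + 1)` meaningful when `C` or `w` is zero.
  have hpos : 0 < 2 * (C * ‖w‖) + 1 := by positivity
  have hb : ∀ ε ∈ Ioo (-(2 * (C * ‖w‖) + 1)⁻¹) (2 * (C * ‖w‖) + 1)⁻¹, ∀ i, ∀ p ∈ P i,
      |ε| * (2 * (‖θ i p‖ * ‖w‖)) < 1 := by
    intro ε hε i p hp
    have h1 : |ε| < (2 * (C * ‖w‖) + 1)⁻¹ := abs_lt.2 hε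
    have h2 : |ε| * (2 * (C * ‖w‖) + 1) < 1 := by
      rwa [← one_div, lt_div_iff₀ hpos] at h1
    have h3 : ‖θ i p‖ * ‖w‖ ≤ C * ‖w‖ := mul_le_mul_of_nonneg_right (hC i p hp) (norm_nonneg _)
    nlinarith [abs_nonneg ε, mul_le_mul_of_nonneg_left h3 (abs_nonneg ε)]
  refine ⟨(2 * (C * ‖w‖) + 1)⁻¹, ⟨inv_pos.2 hpos, ?_, ?_, ?_, ?_⟩, ?_⟩
  · funext p
    simp [pushVar]
  · exact fun ε hε => h.isPiecewiseWeakImmersion_pushVar hP hX w (hb ε hε)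
  · intro p
    unfold pushVar
    exact ContDiff.contDiffOn (by fun_prop)
  · intro i
    have h1 : ContMDiffOn (𝓘(ℝ, ℝ).prod (𝓡 n)) 𝓘(ℝ, ℝ) 2 (fun z : ℝ × M => z.1)
        (Ioo (-(2 * (C * ‖w‖) + 1)⁻¹) (2 * (C * ‖w‖) + 1)⁻¹ ×ˢ P i) := contMDiffOn_fst
    have h2 := (hX.contMDiffOn i).comp (contMDiffOn_snd (I := 𝓘(ℝ, ℝ)) (J := 𝓡 n) (n := 2)
      (s := Ioo (-(2 * (C * ‖w‖) + 1)⁻¹) (2 * (C * ‖w‖) + 1)⁻¹ ×ˢ P i)) fun z hz => hz.2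
    have h3 := (h.contMDiffOn i).comp (contMDiffOn_snd (I := 𝓘(ℝ, ℝ)) (J := 𝓡 n) (n := 2)
      (s := Ioo (-(2 * (C * ‖w‖) + 1)⁻¹) (2 * (C * ‖w‖) + 1)⁻¹ ×ˢ P i)) fun z hz => hz.2
    exact h2.add ((h1.mul h3).smul contMDiffOn_const)
  · intro ε hε i p hp
    have h1 : |ε * ⟪θ i p, w⟫| ≤ |ε| * (‖θ i p‖ * ‖w‖) := by
      rw [abs_mul]
      exact mul_le_mul_of_nonneg_left (abs_real_inner_le_norm _ _) (abs_nonneg _)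
    have h2 := hb ε hε i p hp
    have h3 := neg_abs_le (ε * ⟪θ i p, w⟫)
    have h4 : 0 ≤ |ε| * (‖θ i p‖ * ‖w‖) := by positivity
    linarith

end TestFun

/-! ### The Lagrange multiplier rule -/

section CriticalTest

open Filter Topology

variable {n : ℕ} {M : Type*} [TopologicalSpace M] [ChartedSpace (EuclideanSpace ℝ (Fin n)) M]
  {k : ℕ} {P : Fin k → Set M} {X : M → Euc (n + 1)} [IsManifold (𝓡 n) ∞ M]
  [MeasurableSpace M] [BorelSpace M] [T2Space M] [CompactSpace M] [NeZero n]
  {γ : Metric.sphere (0 : EuclideanSpace ℝ (Fin (n + 1))) 1 → ℝ}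
  {ν : Fin k → M → Euc (n + 1)} {η : M → ℝ} {θ : Fin k → M → Euc (n + 1)}

lemma FormIntegrable.const_mul {α : OpenPartialHomeomorph M (Euc n) → M → ℝ}
    (h : FormIntegrable P α) (c : ℝ) : FormIntegrable P fun φ p => c * α φ p :=
  fun φ hφ K hK hKc hKs => Integrable.const_mul (h φ hφ K hK hKc hKs) c

/-- The enclosed volume is affine in the parameter. -/
lemma IsTestFun.enclosedVolume_pushVar_eq (hM : IsOrientedAtlas n M)
    (hP : IsPieceDecomposition (n := n) P) (𝒞 : ChartPartition n M)
    (hX : IsPiecewiseWeakImmersion 2 P X ν) (h : IsTestFun P X η θ) {w : Euc (n + 1)} {ε₀ : ℝ}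
    (hY : IsVariation P X ε₀ (pushVar X η w))
    (hpos : ∀ ε ∈ Ioo (-ε₀) ε₀, ∀ i, ∀ p ∈ P i, 0 < 1 + ε * ⟪θ i p, w⟫)
    {ε₁ : ℝ} (hε₁ : ε₁ ∈ Ioo (-ε₀) ε₀) (hne : ε₁ ≠ 0) {s : ℝ} (hs : s ∈ Ioo (-ε₀) ε₀) :
    enclosedVolume (pushVar X η w s) = enclosedVolume X +
      s * (ε₁⁻¹ * (enclosedVolume (pushVar X η w ε₁) - enclosedVolume X)) := by
  have hcl := isClosed_piece hP
  obtain ⟨ν₁, hX₁⟩ := hY.weakImmersion _ hε₁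
  obtain ⟨ν₂, hX₂⟩ := hY.weakImmersion _ hs
  -- The affine dependence is expressed through its values at `0` and `ε₁`. Both are volume forms of
  -- weak immersions and known to be integrable, so the slope need not be studied.
  have haff : ∀ A B : ℝ, A + s * B = (1 - s * ε₁⁻¹) * A + s * ε₁⁻¹ * (A + ε₁ * B) := by
    intro A B
    field_simp
    ring
  have h1 : formInt 𝒞 P (volForm (pushVar X η w s) (pushVar X η w s)) = formInt 𝒞 P fun φ p =>
      (1 - s * ε₁⁻¹) * volForm X X φ p + (s * ε₁⁻¹) *
        volForm (pushVar X η w ε₁) (pushVar X η w ε₁) φ p := by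
    refine formInt_congr 𝒞 fun φ hφ p hp hps => ?_
    obtain ⟨i, hi⟩ := mem_iUnion.1 hp
    have hm := mem_maximalAtlas_of_mem_atlas hφ
    rw [h.volForm_pushVar hX.pieceSmooth w hi (hpos _ hs i p (interior_subset hi)) hm hps,
      h.volForm_pushVar hX.pieceSmooth w hi (hpos _ hε₁ i p (interior_subset hi)) hm hps]
    exact haff _ _
  rw [enclosedVolume_eq_formInt hM hP 𝒞 hX, enclosedVolume_eq_formInt hM hP 𝒞 hX₁,
    enclosedVolume_eq_formInt hM hP 𝒞 hX₂, h1, formInt_add 𝒞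
    ((formIntegrable_volForm hcl hX.pieceSmooth_one hX.pieceSmooth_one).const_mul _)
    ((formIntegrable_volForm hcl hX₁.pieceSmooth_one hX₁.pieceSmooth_one).const_mul _),
    formInt_smul, formInt_smul]
  ring

/-- A variation in a fixed direction which preserves the volume to first order preserves it. -/
lemma IsTestFun.enclosedVolume_pushVar (hM : IsOrientedAtlas n M)
    (hP : IsPieceDecomposition (n := n) P) (𝒞 : ChartPartition n M)
    (hX : IsPiecewiseWeakImmersion 2 P X ν) (h : IsTestFun P X η θ) {w : Euc (n + 1)} {ε₀ : ℝ}
    (hY : IsVariation P X ε₀ (pushVar X η w))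
    (hpos : ∀ ε ∈ Ioo (-ε₀) ε₀, ∀ i, ∀ p ∈ P i, 0 < 1 + ε * ⟪θ i p, w⟫)
    (h0 : formInt 𝒞 P (volForm X fun p => η p • w) = 0) {ε : ℝ} (hε : ε ∈ Ioo (-ε₀) ε₀) :
    enclosedVolume (pushVar X η w ε) = enclosedVolume X := by
  obtain ⟨ε₁, hε₁, hne⟩ : ∃ ε₁ ∈ Ioo (-ε₀) ε₀, ε₁ ≠ 0 :=
    ⟨ε₀ / 2, ⟨by linarith [hY.pos], by linarith [hY.pos]⟩, (half_pos hY.pos).ne'⟩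
  obtain ⟨c, hc⟩ : ∃ c, ∀ s ∈ Ioo (-ε₀) ε₀,
      enclosedVolume (pushVar X η w s) = enclosedVolume X + s * c :=
    ⟨_, fun s hs => h.enclosedVolume_pushVar_eq hM hP 𝒞 hX hY hpos hε₁ hne hs⟩
  have hd := hY.hasDerivAt_enclosedVolume hM hP 𝒞 hX
  rw [velocity_pushVar] at hd
  have hd2 : HasDerivAt (fun s => enclosedVolume (pushVar X η w s)) (1 * c) 0 := by
    refine (((hasDerivAt_id (0 : ℝ)).mul_const c).const_add (enclosedVolume X)).congr_of_eventuallyEq ?_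
    filter_upwards [Ioo_mem_nhds (neg_lt_zero.2 hY.pos) hY.pos] with s hs using hc s hs
  have hz := hd.unique hd2
  rw [h0, one_mul] at hz
  rw [hc ε hε, ← hz, mul_zero, add_zero]

/-- As the volume is affine along these variations, vanishing of its first variation makes them
volume-preserving; no correction by an implicit function argument is required. -/
lemma IsCritical.formInt_eq_zero (hM : IsOrientedAtlas n M) (hγ : ContMDiff (𝓡 n) 𝓘(ℝ, ℝ) 2 γ)
    (hP : IsPieceDecomposition (n := n) P) (𝒞 : ChartPartition n M)
    (hX : IsPiecewiseWeakImmersion 2 P X ν) (hcrit : IsCritical γ P X) (h : IsTestFun P X η θ)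
    {w : Euc (n + 1)} (h0 : formInt 𝒞 P (volForm X fun p => η p • w) = 0) :
    formInt 𝒞 P (pairForm X (cahnField γ X) fun p => η p • w) = 0 := by
  obtain ⟨ε₀, hY, hpos⟩ := h.exists_isVariation hP hX w
  have h1 := hY.hasDerivAt_anisoEnergy hM hγ hP 𝒞 hX
  rw [velocity_pushVar] at h1
  exact h1.unique (hcrit ε₀ _ hY fun ε hε => h.enclosedVolume_pushVar hM hP 𝒞 hX hY hpos h0 hε)

lemma derivIn_const_smul {e : OpenPartialHomeomorph M (Euc n)} {W : M → Euc (n + 1)} {p : M}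
    (hW : DifferentiableAt ℝ (W ∘ e.symm) (e p)) (c : ℝ) :
    derivIn e (fun q => c • W q) p = c • derivIn e W p := by
  have h : HasFDerivAt ((fun q => c • W q) ∘ e.symm) _ (e p) := hW.hasFDerivAt.const_smul c
  rw [derivIn, h.fderiv]
  rfl

lemma PieceSmooth.const_smul {r : WithTop ℕ∞} {W : M → Euc (n + 1)}
    (h : PieceSmooth (n := n) r P W) (c : ℝ) : PieceSmooth (n := n) r P fun p => c • W p := by
  intro i
  obtain ⟨g, hg, he⟩ := h i
  exact ⟨fun p => c • g p, (contMDiffOn_const (I' := 𝓘(ℝ, ℝ)) (c := c)).smul hg, fun p hp => by simp [he hp]⟩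

lemma formInt_pairForm_linear_comb (hcl : ∀ i, IsClosed (P i)) (𝒞 : ChartPartition n M)
    {Z W W' : M → Euc (n + 1)} (hX : PieceSmooth (n := n) 1 P X) (hZ : PieceSmooth (n := n) 1 P Z)
    (hW : PieceSmooth (n := n) 1 P W) (hW' : PieceSmooth (n := n) 1 P W') (a b : ℝ) :
    formInt 𝒞 P (pairForm X Z fun p => a • W p + b • W' p) =
      a * formInt 𝒞 P (pairForm X Z W) + b * formInt 𝒞 P (pairForm X Z W') := by
  have h1 : ∀ {W : M → Euc (n + 1)}, PieceSmooth (n := n) 1 P W → ∀ c : ℝ,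
      formInt 𝒞 P (pairForm X Z fun p => c • W p) = c * formInt 𝒞 P (pairForm X Z W) := by
    intro W hW c
    rw [← formInt_smul]
    refine formInt_congr 𝒞 fun φ hφ p hp hps => ?_
    rw [pairForm, derivIn_const_smul ((hW.contDiffAt (by exact_mod_cast le_top) hp
      (mem_maximalAtlas_of_mem_atlas hφ) hps).differentiableAt (by norm_num)), crossDer_smul,
      inner_smul_right]
    rfl
  rw [← h1 hW, ← h1 hW', ← formInt_add 𝒞 (formIntegrable_pairForm hcl hX hZ (hW.const_smul a))
    (formIntegrable_pairForm hcl hX hZ (hW'.const_smul b))]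
  exact formInt_congr 𝒞 fun φ hφ p hp hps => pairForm_add_right (hW.const_smul a)
    (hW'.const_smul b) (mem_maximalAtlas_of_mem_atlas hφ) hp hps

lemma formInt_volForm_linear_comb (hcl : ∀ i, IsClosed (P i)) (𝒞 : ChartPartition n M)
    {W W' : M → Euc (n + 1)} (hX : PieceSmooth (n := n) 1 P X)
    (hW : PieceSmooth (n := n) 1 P W) (hW' : PieceSmooth (n := n) 1 P W') (a b : ℝ) :
    formInt 𝒞 P (volForm X fun p => a • W p + b • W' p) =
      a * formInt 𝒞 P (volForm X W) + b * formInt 𝒞 P (volForm X W') := by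
  have h1 : ∀ (W : M → Euc (n + 1)) (c : ℝ),
      formInt 𝒞 P (volForm X fun p => c • W p) = c * formInt 𝒞 P (volForm X W) := by
    intro W c
    rw [← formInt_smul]
    exact formInt_congr 𝒞 fun φ hφ p hp hps => real_inner_smul_left _ _ _
  rw [← h1 W, ← h1 W', ← formInt_add 𝒞 (formIntegrable_volForm hcl hX (hW.const_smul a))
    (formIntegrable_volForm hcl hX (hW'.const_smul b))]
  exact formInt_congr 𝒞 fun φ hφ p hp hps => inner_add_left _ _ _

/-- For a critical point, the first variations of the energy and of the volume in a fixed direction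
are proportional. -/
lemma IsCritical.formInt_proportional (hM : IsOrientedAtlas n M)
    (hγ : ContMDiff (𝓡 n) 𝓘(ℝ, ℝ) 2 γ)
    (hP : IsPieceDecomposition (n := n) P) (𝒞 : ChartPartition n M)
    (hX : IsPiecewiseWeakImmersion 2 P X ν) (hcrit : IsCritical γ P X) (h : IsTestFun P X η θ)
    {η' : M → ℝ} {θ' : Fin k → M → Euc (n + 1)} (h' : IsTestFun P X η' θ') (w : Euc (n + 1)) :
    formInt 𝒞 P (volForm X fun p => η p • w) *
        formInt 𝒞 P (pairForm X (cahnField γ X) fun p => η' p • w) =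
      formInt 𝒞 P (volForm X fun p => η' p • w) *
        formInt 𝒞 P (pairForm X (cahnField γ X) fun p => η p • w) := by
  have hcl := isClosed_piece hP
  set v := formInt 𝒞 P (volForm X fun p => η p • w)
  set v' := formInt 𝒞 P (volForm X fun p => η' p • w)
  have hs := (h.pieceSmooth_smul w).of_le (r := 1) (by norm_num)
  have hs' := (h'.pieceSmooth_smul w).of_le (r := 1) (by norm_num)
  have hcomb : (fun p => (v' * η p + (-v) * η' p) • w) =
      fun p => v' • (η p • w) + (-v) • (η' p • w) := by
    funext p
    rw [add_smul, mul_smul, mul_smul]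
  -- The combination `v' η - v η'` has zero first variation of volume. Forming it needs no division,
  -- so `v` may vanish.
  have h1 := IsCritical.formInt_eq_zero hM hγ hP 𝒞 hX hcrit (h.linear_comb h' v' (-v)) (w := w) (by
    rw [hcomb, formInt_volForm_linear_comb hcl 𝒞 hX.pieceSmooth_one hs hs']
    ring)
  rw [hcomb, formInt_pairForm_linear_comb hcl 𝒞 hX.pieceSmooth_one
    (hX.pieceRep_cahnField hγ hP).pieceSmooth hs hs'] at h1
  linarith

end CriticalTest

/-! ### Construction of test functions -/

section Existence

open Filter Topology

variable {n : ℕ} {M : Type*} [TopologicalSpace M] [ChartedSpace (EuclideanSpace ℝ (Fin n)) M]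
  {k : ℕ} {P : Fin k → Set M} {X : M → Euc (n + 1)} [IsManifold (𝓡 n) ∞ M]
  {ν : Fin k → M → Euc (n + 1)}

lemma inner_dualVec_apply {L : Euc n →L[ℝ] Euc (n + 1)} (hL : Function.Injective L)
    (A : Euc n →L[ℝ] ℝ) (v : Euc n) :
    ⟪dualVec L fun l => A (EuclideanSpace.single l 1), L v⟫ = A v := by
  have hv : v = ∑ l, v l • EuclideanSpace.single l (1 : ℝ) := by
    simpa using ((EuclideanSpace.basisFun (Fin n) ℝ).toBasis.sum_repr v).symm
  rw [hv]
  simp only [map_sum, map_smul, inner_sum, real_inner_smul_right]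
  exact Finset.sum_congr rfl fun l _ => by
    congr 1
    exact inner_dualVec hL _ l

lemma contDiffAt_dualVec {E : Type*} [NormedAddCommGroup E] [NormedSpace ℝ E]
    {L : E → Euc n →L[ℝ] Euc (n + 1)} {A : E → Euc n →L[ℝ] ℝ} {u : E} {r : WithTop ℕ∞}
    (hL : ContDiffAt ℝ r L u) (hA : ContDiffAt ℝ r A u) (h0 : Function.Injective (L u)) :
    ContDiffAt ℝ r (fun x => dualVec (L x) fun l => A x (EuclideanSpace.single l 1)) u := by
  have hc : ContDiffAt ℝ r (fun x => crossL (L x)) u := contDiff_crossL.contDiffAt.comp u hL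
  have hN := crossL_ne_zero_iff.2 h0
  have h1 : ContDiffAt ℝ r (fun x => -(‖crossL (L x)‖ ^ 2)⁻¹) u :=
    (((hc.norm ℝ hN).pow 2).inv (pow_ne_zero 2 (norm_ne_zero_iff.2 hN))).neg
  have h2 : ContDiffAt ℝ r (fun x => ∑ j, A x (EuclideanSpace.single j 1) •
      crossProd (Function.update (frame (L x)) j (crossL (L x)))) u := by
    refine ContDiffAt.sum fun j _ => (hA.clm_apply contDiffAt_const).smul ?_
    have hw : ContDiffAt ℝ r (fun x => Function.update (frame (L x)) j (crossL (L x))) u := by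
      refine contDiffAt_pi.2 fun l => ?_
      by_cases hl : l = j
      · subst hl
        simpa using hc
      · simp only [Function.update_of_ne hl]
        exact hL.clm_apply contDiffAt_const
    exact contDiff_crossProd.contDiffAt.comp u hw
  exact h1.smul h2

/-- The product of a cutoff function on `M` and a function of `X` is a test function if `X` is an
immersion wherever the first factor varies on the support of the second one. -/
lemma exists_isTestFun (hX : IsPiecewiseWeakImmersion 2 P X ν)
    {e : OpenPartialHomeomorph M (Euc n)} (he : e ∈ IsManifold.maximalAtlas (𝓡 n) ∞ M)
    {ρ : M → ℝ} (hρ : ContMDiff (𝓡 n) 𝓘(ℝ, ℝ) ∞ ρ) {ψ : Euc (n + 1) → ℝ} (hψ : ContDiff ℝ ∞ ψ)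
    {K : Set M} (hK : IsClosed K) (hKr : K ⊆ regSet P) (hKs : K ⊆ e.source)
    (h0 : ∀ q ∈ regSet P, q ∉ K → ψ (X q) = 0 ∨
      ∀ e' ∈ IsManifold.maximalAtlas (𝓡 n) ∞ M, q ∈ e'.source → derivIn e' ρ q = 0) :
    ∃ θ, IsTestFun P X (fun p => ρ p * ψ (X p)) θ := by
  classical
  have hρ2 : ContMDiff (𝓡 n) 𝓘(ℝ, ℝ) 2 ρ := hρ.of_le two_le_infty
  have hψ2 : ContDiff ℝ 2 ψ := hψ.of_le two_le_infty
  have hψX : ∀ i, ContMDiffOn (𝓡 n) 𝓘(ℝ, ℝ) 2 (fun p => ψ (X p)) (P i) := fun i =>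
    hψ2.contMDiff.comp_contMDiffOn (hX.contMDiffOn i)
  have hρe : ∀ e' ∈ IsManifold.maximalAtlas (𝓡 n) ∞ M, ∀ q ∈ e'.source,
      ContDiffAt ℝ 2 (ρ ∘ e'.symm) (e' q) := fun e' he' q hq =>
    ContMDiffAt.contDiffAt_comp_symm two_le_infty hρ2.contMDiffAt he' hq
  -- Where `X` is an immersion, `D` represents the part `ψ(X) dρ` of the differential as `⟪D, dX⟫`;
  -- that part vanishes at the points of the regular set off `K`, so `D` can be continued by zero.
  set D : M → Euc (n + 1) := fun p =>
    ψ (X p) • dualVec (derivIn e X p) fun l => derivIn e ρ p (EuclideanSpace.single l 1) with hD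
  set T : M → Euc (n + 1) := fun p => if p ∈ K then D p else 0 with hT
  have hTD : ∀ q ∈ regSet P, q ∈ e.source → T q = D q := by
    intro q hq hqs
    by_cases hqK : q ∈ K
    · exact if_pos hqK
    · rw [hT]
      simp only [if_neg hqK, hD]
      rcases h0 q hq hqK with h1 | h1
      · rw [h1, zero_smul]
      · rw [h1 e he hqs]
        simp [dualVec]
  have hDs : ∀ p ∈ regSet P, p ∈ e.source → ContMDiffAt (𝓡 n) 𝓘(ℝ, Euc (n + 1)) 1 D p := by
    intro p hp hps
    have hXe := hX.pieceSmooth.contDiffAt two_le_infty hp he hps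
    have h1 : ContDiffAt ℝ 1 (fun u => ψ (X (e.symm u))) (e p) :=
      (hψ2.of_le (by norm_num)).contDiffAt.comp (e p) (hXe.of_le (by norm_num))
    have h2 := contDiffAt_dualVec (hXe.fderiv_right (m := 1) (by norm_num))
      ((hρe e he p hps).fderiv_right (m := 1) (by norm_num))
      (injective_derivIn he hps (hX.injective hp))
    have h3 := ContMDiffAt.comp (I' := 𝓘(ℝ, Euc n)) p (h1.smul h2).contMDiffAt
      (((contMDiffOn_of_mem_maximalAtlas he).of_le (by exact_mod_cast le_top)).contMDiffAt
        (e.open_source.mem_nhds hps))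
    refine h3.congr_of_eventuallyEq ?_
    filter_upwards [e.open_source.mem_nhds hps] with q hq
    simp only [hD, Function.comp_apply, derivIn]
    simp [e.left_inv hq]
  have hTs : ∀ p, ContMDiffAt (𝓡 n) 𝓘(ℝ, Euc (n + 1)) 1 T p := by
    intro p
    by_cases hpK : p ∈ K
    · refine (hDs p (hKr hpK) (hKs hpK)).congr_of_eventuallyEq ?_
      filter_upwards [(isOpen_regSet P).mem_nhds (hKr hpK), e.open_source.mem_nhds (hKs hpK)]
        with q h1 h2 using hTD q h1 h2
    · refine (contMDiffAt_const (c := (0 : Euc (n + 1)))).congr_of_eventuallyEq ?_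
      filter_upwards [hK.isOpen_compl.mem_nhds hpK] with q hq using if_neg hq
  have hTd : ∀ p ∈ regSet P, ∀ e' ∈ IsManifold.maximalAtlas (𝓡 n) ∞ M, p ∈ e'.source → ∀ v,
      ⟪T p, derivIn e' X p v⟫ = ψ (X p) * derivIn e' ρ p v := by
    intro p hp e' he' hpe v
    by_cases hpK : p ∈ K
    · have hps := hKs hpK
      rw [hTD p hp hps, hD, derivIn_change he' he hpe hps X, derivIn_change he' he hpe hps ρ]
      simp only [real_inner_smul_left, ContinuousLinearMap.comp_apply]
      rw [inner_dualVec_apply (injective_derivIn he hps (hX.injective hp))]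
    · have hT0 : T p = 0 := if_neg hpK
      rw [hT0, inner_zero_left]
      rcases h0 p hp hpK with h1 | h1
      · rw [h1, zero_mul]
      · rw [h1 e' he' hpe]
        simp
  have hgrad : ContDiff ℝ 1 (gradient ψ) :=
    (InnerProductSpace.toDual ℝ (Euc (n + 1))).symm.contDiff.comp
      (hψ2.fderiv_right (m := 1) (by norm_num))
  -- The remaining part `ρ d(ψ(X)) = ⟪ρ ∇ψ(X), dX⟫` has the required shape even where `dX`
  -- degenerates.
  refine ⟨fun _ p => ρ p • gradient ψ (X p) + T p, ?_, ?_, ?_, ?_⟩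
  · exact hρ.continuous.mul (hψ.continuous.comp hX.continuous)
  · exact fun i => hρ2.contMDiffOn.mul (hψX i)
  · intro i
    have h1 : ContMDiffOn (𝓡 n) 𝓘(ℝ, Euc (n + 1)) 1 (fun p => gradient ψ (X p)) (P i) :=
      hgrad.contMDiff.comp_contMDiffOn ((hX.contMDiffOn i).of_le (by norm_num))
    exact ((hρ2.of_le (by norm_num)).contMDiffOn.smul h1).add fun p _ =>
      (hTs p).contMDiffWithinAt
  · intro i p hp e' he' hpe v
    have hr : p ∈ regSet P := mem_iUnion.2 ⟨i, hp⟩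
    have h1 : HasFDerivAt (ρ ∘ e'.symm) (derivIn e' ρ p) (e' p) :=
      ((hρe e' he' p hpe).differentiableAt (by norm_num)).hasFDerivAt
    have h2 : HasFDerivAt (X ∘ e'.symm) (derivIn e' X p) (e' p) :=
      ((hX.pieceSmooth.contDiffAt two_le_infty hr he' hpe).differentiableAt
        (by norm_num)).hasFDerivAt
    have h3 : HasFDerivAt ψ (fderiv ℝ ψ (X p)) ((X ∘ e'.symm) (e' p)) := by
      rw [Function.comp_apply, e'.left_inv hpe]
      exact ((hψ2.differentiable (by norm_num)) (X p)).hasFDerivAt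
    have h4 : HasFDerivAt ((fun p => ρ p * ψ (X p)) ∘ e'.symm) _ (e' p) := h1.mul (h3.comp _ h2)
    rw [derivIn, h4.fderiv, inner_add_left, hTd p hr e' he' hpe, real_inner_smul_left, gradient,
      InnerProductSpace.toDual_symm_apply]
    simp [e'.left_inv hpe]

end Existence

/-! ### Test functions supported in the regular set -/

section Bump

open Filter Topology

variable {n : ℕ} {M : Type*} [TopologicalSpace M] [ChartedSpace (EuclideanSpace ℝ (Fin n)) M]
  {k : ℕ} {P : Fin k → Set M} {X : M → Euc (n + 1)} [IsManifold (𝓡 n) ∞ M]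
  {ν : Fin k → M → Euc (n + 1)}

lemma derivIn_eq_zero_of_eventuallyEq_const {e : OpenPartialHomeomorph M (Euc n)} {ρ : M → ℝ}
    {q : M} (hq : q ∈ e.source) {c : ℝ} (h : ρ =ᶠ[𝓝 q] fun _ => c) : derivIn e ρ q = 0 := by
  have h1 := e.continuousAt_symm (e.map_source hq)
  rw [ContinuousAt, e.left_inv hq] at h1
  have h2 : ρ ∘ e.symm =ᶠ[𝓝 (e q)] fun _ => c := h1.eventually h
  rw [derivIn, h2.fderiv_eq, fderiv_const_apply]

/-- The case `ψ = 1`: the cutoff varies only inside its support, where `X` is an immersion. -/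
lemma exists_isTestFun_of_tsupport_subset (hX : IsPiecewiseWeakImmersion 2 P X ν)
    {e : OpenPartialHomeomorph M (Euc n)} (he : e ∈ IsManifold.maximalAtlas (𝓡 n) ∞ M)
    {ρ : M → ℝ} (hρ : ContMDiff (𝓡 n) 𝓘(ℝ, ℝ) ∞ ρ) (hs : tsupport ρ ⊆ regSet P ∩ e.source) :
    ∃ θ, IsTestFun P X ρ θ := by
  obtain ⟨θ, hθ⟩ := exists_isTestFun hX he hρ (ψ := fun _ => 1) contDiff_const
    (isClosed_tsupport ρ) (hs.trans inter_subset_left) (hs.trans inter_subset_right)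
    fun q _ hq => Or.inr fun e' _ hqe => derivIn_eq_zero_of_eventuallyEq_const hqe
      (notMem_tsupport_iff_eventuallyEq.1 hq)
  simp only [mul_one] at hθ
  exact ⟨θ, hθ⟩

variable [MeasurableSpace M] [BorelSpace M] [T2Space M] [CompactSpace M] [NeZero n]

/-- A continuous form which does not vanish at a point of the regular set has a nonzero integral
against a test function. -/
lemma exists_formInt_mul_ne_zero (hM : IsOrientedAtlas n M) (𝒞 : ChartPartition n M)
    (hX : IsPiecewiseWeakImmersion 2 P X ν)
    {α : OpenPartialHomeomorph M (Euc n) → M → ℝ} (hα : IsForm (regSet P) α)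
    {e : OpenPartialHomeomorph M (Euc n)} (he : e ∈ atlas (Euc n) M)
    (hc : ContinuousOn (α e) (regSet P ∩ e.source)) {p : M} (hp : p ∈ regSet P)
    (hps : p ∈ e.source) (hne : α e p ≠ 0) :
    ∃ η θ, IsTestFun P X η θ ∧ (∀ q, q ∉ regSet P → η q = 0) ∧
      formInt 𝒞 P (fun φ q => η q * α φ q) ≠ 0 := by
  have hem := mem_maximalAtlas_of_mem_atlas he
  have hO : IsOpen (regSet P ∩ e.source) := (isOpen_regSet P).inter e.open_source
  have hat : ContinuousAt (α e) p := hc.continuousAt (hO.mem_nhds ⟨hp, hps⟩)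
  have hU : {q | q ∈ regSet P ∩ e.source ∧ 0 < α e p * α e q} ∈ 𝓝 p := by
    filter_upwards [hO.mem_nhds ⟨hp, hps⟩,
      (continuousAt_const.mul hat).eventually (lt_mem_nhds (mul_self_pos.2 hne))] with q h1 h2
      using ⟨h1, h2⟩
  obtain ⟨f, -, hf⟩ := (SmoothBumpFunction.nhds_basis_tsupport (I := 𝓡 n) p).mem_iff.1 hU
  have hfs : tsupport f ⊆ regSet P ∩ e.source := fun q hq => (hf hq).1
  obtain ⟨θ, hθ⟩ := exists_isTestFun_of_tsupport_subset hX hem f.contMDiff hfs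
  have hf0 : ∀ q, q ∉ tsupport f → f q = 0 := fun q hq => image_eq_zero_of_notMem_tsupport hq
  refine ⟨f, θ, hθ, fun q hq => hf0 q fun h => hq (hfs h).1, ?_⟩
  have hA : tsupport f ∩ regSet P = tsupport f := inter_eq_left.2 (hfs.trans inter_subset_left)
  have hAs := hfs.trans inter_subset_right
  have hcomp : IsCompact (e '' tsupport f) :=
    (isClosed_tsupport f).isCompact.image_of_continuousOn (e.continuousOn.mono hAs)
  have hsub : e '' tsupport f ⊆ e.target := by
    rintro _ ⟨q, hq, rfl⟩
    exact e.map_source (hAs hq)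
  have hmaps : MapsTo e.symm (e '' tsupport f) (tsupport f) := by
    rintro _ ⟨q, hq, rfl⟩
    rwa [e.left_inv (hAs hq)]
  have hcont : ContinuousOn (fun u => f (e.symm u) * α e (e.symm u)) (e '' tsupport f) :=
    (f.continuous.comp_continuousOn (e.continuousOn_symm.mono hsub)).mul
      ((hc.mono hfs).comp (e.continuousOn_symm.mono hsub) hmaps)
  have hint : IntegrableOn (fun u => f (e.symm u) * α e (e.symm u)) (e '' tsupport f) :=
    hcont.integrableOn_compact hcomp
  rw [formInt_eq_chart 𝒞 (hα.smul f) hem (one_mul 1) (hasSign_of_mem_atlas hM he) hAs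
    (isClosed_tsupport f).measurableSet
    (fun e' _ q _ _ hq => by rw [hf0 q hq, zero_mul]) (by rwa [hA]), one_mul, hA]
  intro hz
  have hpos : 0 < ∫ u in e '' tsupport f, α e p * (f (e.symm u) * α e (e.symm u)) := by
    rw [setIntegral_pos_iff_support_of_nonneg_ae]
    · refine Measure.measure_pos_of_mem_nhds volume (x := e p) (inter_mem ?_ ?_)
      · have h1 := e.continuousAt_symm (e.map_source hps)
        rw [ContinuousAt, e.left_inv hps] at h1
        filter_upwards [h1.eventually hU, h1.eventually f.eventuallyEq_one] with u h2 h3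
        rw [Function.mem_support, h3, Pi.one_apply, one_mul]
        exact h2.2.ne'
      · refine e.image_mem_nhds hps ?_
        filter_upwards [f.eventuallyEq_one] with q hq
        refine subset_tsupport _ ?_
        rw [Function.mem_support, hq]
        exact one_ne_zero
    · rw [EventuallyLE, ae_restrict_iff' hcomp.measurableSet]
      refine Eventually.of_forall fun u hu => ?_
      have h2 := (hf (hmaps hu)).2
      have h3 : 0 ≤ f (e.symm u) := f.nonneg
      change 0 ≤ α e p * (f (e.symm u) * α e (e.symm u))
      nlinarith [mul_nonneg h3 h2.le]
    · exact hint.const_mul _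
  rw [integral_const_mul, hz, mul_zero] at hpos
  exact lt_irrefl _ hpos

end Bump

/-! ### Constancy of the anisotropic mean curvature -/

section Curvature

open Filter Topology

variable {n : ℕ} {M : Type*} [TopologicalSpace M] [ChartedSpace (EuclideanSpace ℝ (Fin n)) M]
  {k : ℕ} {P : Fin k → Set M} {X : M → Euc (n + 1)} [IsManifold (𝓡 n) ∞ M]
  [MeasurableSpace M] [BorelSpace M] [T2Space M] [CompactSpace M] [NeZero n]
  {γ : Metric.sphere (0 : EuclideanSpace ℝ (Fin (n + 1))) 1 → ℝ}
  {ν : Fin k → M → Euc (n + 1)} {η : M → ℝ} {θ : Fin k → M → Euc (n + 1)}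

lemma IsForm.add {S : Set M} {α β : OpenPartialHomeomorph M (Euc n) → M → ℝ} (hα : IsForm S α)
    (hβ : IsForm S β) : IsForm S fun φ p => α φ p + β φ p :=
  fun φ hφ e he p hp hpφ hpe => by
    change α φ p + β φ p = (transD φ e p).det * (α e p + β e p)
    rw [hα φ hφ e he p hp hpφ hpe, hβ φ hφ e he p hp hpφ hpe, mul_add]

lemma dense_regSet (hP : IsPieceDecomposition (n := n) P) : Dense (regSet P) := by
  intro p
  obtain ⟨i, hi⟩ := mem_iUnion.1 (hP.cover.symm ▸ mem_univ p)
  rw [← (hP.isPiece i).closure_interior] at hi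
  exact closure_mono (subset_iUnion (fun i => interior (P i)) i) hi

/-- Points with negative coordinate arbitrarily near `ζ` are not in `P i`, and the interior of any
other piece does not meet `P i`, which contains `ζ`. -/
lemma IsEdgeChart.notMem_regSet (hP : IsPieceDecomposition (n := n) P) {i j : Fin k} {ζ : M}
    {φ : OpenPartialHomeomorph M (Euc n)} (hφ : IsEdgeChart P i j ζ φ) : ζ ∉ regSet P := by
  intro hr
  obtain ⟨l, hl⟩ := mem_iUnion.1 hr
  by_cases hli : l = i
  · subst hli
    obtain ⟨t, ⟨h1, h2, h3⟩, ht⟩ := ((eventually_shift φ hφ.2.1 (-EuclideanSpace.single 0 1)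
      (isOpen_interior.mem_nhds hl)).and self_mem_nhdsWithin).exists
    have h4 := (hφ.2.2.2 _ h2).1.1 (interior_subset h1)
    rw [h3] at h4
    simp only [PiLp.add_apply, PiLp.smul_apply, PiLp.neg_apply, hφ.2.2.1,
      PiLp.single_apply, if_true, smul_eq_mul, mul_neg, mul_one, zero_add] at h4
    exact absurd (mem_Ioi.1 ht) (by linarith)
  · exact notMem_of_mem_interior hP hli hl hφ.mem_left

/-- For test functions that vanish off the regular set, there is no boundary term. -/
lemma IsTestFun.stokesDefect_eq_zero (hM : IsOrientedAtlas n M)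
    (hγ : ContMDiff (𝓡 n) 𝓘(ℝ, ℝ) 2 γ)
    (hP : IsPieceDecomposition (n := n) P) (𝒞 : ChartPartition n M)
    (hX : IsPiecewiseWeakImmersion 2 P X ν) (h : IsTestFun P X η θ)
    (h0 : ∀ q, q ∉ regSet P → η q = 0) (w : Euc (n + 1)) :
    stokesDefect 𝒞 P X (cahnField γ X) (fun p => η p • w) = 0 := by
  refine AnisoSurface.stokesDefect_eq_zero hM hP 𝒞 hX.contMDiffOn (hX.pieceRep_cahnField hγ hP)
    (fun i => (h.contMDiffOn_smul w i).of_le (by norm_num)) fun i j ζ φ hφ => ?_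
  simp only [h0 ζ (hφ.notMem_regSet hP), zero_smul, edgeFlux_zero_right]

lemma formInt_volForm_smul_const (𝒞 : ChartPartition n M) (w : Euc (n + 1)) :
    formInt 𝒞 P (volForm X fun p => η p • w) =
      formInt 𝒞 P fun φ p => η p * volForm X (fun _ => w) φ p :=
  formInt_congr 𝒞 fun _ _ _ _ _ => real_inner_smul_left _ _ _

lemma pieceSmooth_const (r : WithTop ℕ∞) (w : Euc (n + 1)) :
    PieceSmooth (n := n) r P fun _ => w :=
  PieceSmooth.of_contMDiffOn fun _ => contMDiffOn_const

lemma exists_volForm_test_ne_zero (hM : IsOrientedAtlas n M) (𝒞 : ChartPartition n M)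
    (hX : IsPiecewiseWeakImmersion 2 P X ν) {w : Euc (n + 1)} {p : M} (hp : p ∈ regSet P)
    (hw : ⟪w, normalIn (chartAt (Euc n) p) X p⟫ ≠ 0) :
    ∃ η θ, IsTestFun P X η θ ∧ (∀ q, q ∉ regSet P → η q = 0) ∧
      formInt 𝒞 P (volForm X fun p => η p • w) ≠ 0 := by
  obtain ⟨η, θ, h1, h2, h3⟩ := exists_formInt_mul_ne_zero hM 𝒞 hX
    (isForm_volForm (regSet P) X fun _ => w) (chart_mem_atlas (Euc n) p)
    (continuousOn_volForm hX.pieceSmooth_one (pieceSmooth_const 1 w) (chartAt_mem_maximalAtlas p))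
    hp (mem_chart_source _ p) hw
  refine ⟨η, θ, h1, h2, ?_⟩
  rwa [formInt_volForm_smul_const]

/-- The anisotropic mean curvature of a critical point is constant on the regular set. -/
lemma IsCritical.anisoMeanCurvature_eq (hM : IsOrientedAtlas n M)
    (hγ : ContMDiff (𝓡 n) 𝓘(ℝ, ℝ) 2 γ)
    (hP : IsPieceDecomposition (n := n) P) (𝒞 : ChartPartition n M)
    (hX : IsPiecewiseWeakImmersion 2 P X ν) (hcrit : IsCritical γ P X) {w : Euc (n + 1)} {p q : M}
    (hp : p ∈ regSet P) (hpw : ⟪w, normalIn (chartAt (Euc n) p) X p⟫ ≠ 0)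
    (hq : q ∈ regSet P) (hqw : ⟪w, normalIn (chartAt (Euc n) q) X q⟫ ≠ 0) :
    anisoMeanCurvature γ X p = anisoMeanCurvature γ X q := by
  have hcl := isClosed_piece hP
  have hξ := (hX.pieceRep_cahnField hγ hP).pieceSmooth
  obtain ⟨η, θ, hη, hη0, hV⟩ := exists_volForm_test_ne_zero hM 𝒞 hX hp hpw
  -- The Lagrange multiplier belonging to the direction `w`.
  set c := formInt 𝒞 P (pairForm X (cahnField γ X) fun p => η p • w) /
    formInt 𝒞 P (volForm X fun p => η p • w) with hc
  have key : ∀ p ∈ regSet P, ⟪w, normalIn (chartAt (Euc n) p) X p⟫ ≠ 0 →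
      -n * anisoMeanCurvature γ X p = c := by
    intro p hp hpw
    by_contra hne
    have hm := chartAt_mem_maximalAtlas (n := n) p
    have hs := mem_chart_source (Euc n) p
    -- The form is `(-nΛ - c) ⟪w, N⟫`, nonzero at `p`; a test function concentrated there would
    -- violate proportionality.
    obtain ⟨η', θ', hη', hη0', hne'⟩ := exists_formInt_mul_ne_zero hM 𝒞 hX
      ((isForm_pairForm (regSet P) X (fun _ => w) (cahnField γ X)).add
        ((isForm_volForm (regSet P) X fun _ => w).smul fun _ => -c)) (chart_mem_atlas (Euc n) p)
      ((continuousOn_pairForm hX.pieceSmooth_one (pieceSmooth_const 1 w) hξ hm).add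
        (continuousOn_const.mul (continuousOn_volForm hX.pieceSmooth_one
          (pieceSmooth_const 1 w) hm))) hp hs (by
        rw [hX.pairForm_cahnField hM hγ _ hm hp hs, ← mul_assoc, ← add_mul]
        exact mul_ne_zero (fun h => hne (by linarith)) hpw)
    apply hne'
    have h1 : (formInt 𝒞 P fun φ q => η' q * (pairForm X (fun _ => w) (cahnField γ X) φ q +
        -c * volForm X (fun _ => w) φ q)) =
        formInt 𝒞 P fun φ q => pairForm X (fun p => η' p • w) (cahnField γ X) φ q +
          -c * volForm X (fun p => η' p • w) φ q := by
      refine formInt_congr 𝒞 fun φ hφ q hq hqs => ?_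
      simp only [pairForm, volForm, real_inner_smul_left]
      ring
    have hs' := (hη'.pieceSmooth_smul w).of_le (r := 1) (by norm_num)
    have h2 := hη'.stokesDefect_eq_zero hM hγ hP 𝒞 hX hη0' w
    rw [stokesDefect, sub_eq_zero] at h2
    rw [h1, formInt_add 𝒞 (formIntegrable_pairForm hcl hX.pieceSmooth_one hs' hξ)
      ((formIntegrable_volForm hcl hX.pieceSmooth_one hs').const_mul _), formInt_smul, ← h2]
    have h3 := IsCritical.formInt_proportional hM hγ hP 𝒞 hX hcrit hη hη' w
    rw [hc]
    field_simp
    linarith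
  have h1 := (key p hp hpw).trans (key q hq hqw).symm
  exact mul_left_cancel₀ (neg_ne_zero.2 (Nat.cast_ne_zero.2 (NeZero.ne n))) h1

/-- Multipliers are compared for one fixed direction at a time, so a direction transversal to the
surface at two given points is required. -/
lemma exists_inner_ne_zero {E : Type*} [NormedAddCommGroup E] [InnerProductSpace ℝ E] {x y : E}
    (hx : x ≠ 0) (hy : y ≠ 0) : ∃ w : E, ⟪w, x⟫ ≠ 0 ∧ ⟪w, y⟫ ≠ 0 := by
  by_cases h : ⟪x, y⟫ = 0
  · refine ⟨x + y, ?_, ?_⟩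
    · rw [inner_add_left, real_inner_comm x y, h, add_zero]
      exact inner_self_ne_zero.2 hx
    · rw [inner_add_left, h, zero_add]
      exact inner_self_ne_zero.2 hy
  · exact ⟨x, inner_self_ne_zero.2 hx, h⟩

/-- The anisotropic mean curvature of a critical point is constant. -/
lemma IsCritical.exists_anisoMeanCurvature_eq [Nonempty M] (hM : IsOrientedAtlas n M)
    (hγ : ContMDiff (𝓡 n) 𝓘(ℝ, ℝ) 2 γ)
    (hP : IsPieceDecomposition (n := n) P)
    (hX : IsPiecewiseWeakImmersion 2 P X ν) (hcrit : IsCritical γ P X) :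
    ∃ Λ₀ : ℝ, ∀ p, IsRegularPoint X p → anisoMeanCurvature γ X p = Λ₀ := by
  obtain ⟨𝒞⟩ := exists_chartPartition n M
  obtain ⟨p₀, hp₀⟩ := (dense_regSet hP).nonempty
  refine ⟨anisoMeanCurvature γ X p₀, fun p hp => ?_⟩
  have hreg : ∀ q ∈ regSet P, anisoMeanCurvature γ X q = anisoMeanCurvature γ X p₀ := by
    intro q hq
    obtain ⟨w, h1, h2⟩ := exists_inner_ne_zero
      (normalIn_ne_zero (chartAt_mem_maximalAtlas q) (mem_chart_source _ q) (hX.injective hq))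
      (normalIn_ne_zero (chartAt_mem_maximalAtlas p₀) (mem_chart_source _ p₀) (hX.injective hp₀))
    exact IsCritical.anisoMeanCurvature_eq hM hγ hP 𝒞 hX hcrit hq h1 hp₀ h2
  set e := chartAt (Euc n) p
  have hm := chartAt_mem_maximalAtlas (n := n) p
  have hps : p ∈ e.source := mem_chart_source _ p
  -- At regular points `g` is `n (Λ(p₀) - Λ) ‖N‖²`. It is visibly continuous at `p`, whereas `Λ` is
  -- defined through a choice, and it vanishes on the dense set of interior points of the pieces.
  set g : M → ℝ := fun q => ⟪normalIn e X q,
    crossDer (derivIn e X q) (derivIn e (cahnField γ X) q) +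
      (n * anisoMeanCurvature γ X p₀) • normalIn e X q⟫ with hg
  have hgv : ∀ q, IsRegularPoint X q → q ∈ e.source → g q =
      n * (anisoMeanCurvature γ X p₀ - anisoMeanCurvature γ X q) * ‖normalIn e X q‖ ^ 2 := by
    intro q hq hqs
    rw [hg]
    simp only
    rw [hq.crossDer_cahnField hM hγ hm hqs, inner_add_right, real_inner_smul_right,
      real_inner_smul_right, real_inner_self_eq_norm_sq]
    ring
  have hcont : ContinuousAt g p := by
    have hd : ∀ {f : M → Euc (n + 1)}, ContDiffAt ℝ 1 (f ∘ e.symm) (e p) →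
        ContinuousAt (derivIn e f) p := fun {f} hf =>
      ContinuousAt.comp ((hf.fderiv_right (m := 0) (by norm_num)).continuousAt)
        (e.continuousAt hps)
    have h1 := hd ((hp.contDiffAt hm hps).of_le (by norm_num))
    have h2 := hd (hp.contDiffAt_cahnField hM hγ (chart_mem_atlas _ p) hps)
    have h3 : ContinuousAt (normalIn e X) p :=
      (contDiff_crossL (r := 0)).continuous.continuousAt.comp h1
    have h4 : ContinuousAt (fun q => (n * anisoMeanCurvature γ X p₀) • normalIn e X q) p :=
      h3.const_smul (n * anisoMeanCurvature γ X p₀)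
    exact h3.inner ((continuous_crossDer.continuousAt.comp (h1.prodMk h2)).add h4)
  have hzero : g p = 0 := by
    by_contra hne
    have hev : ∀ᶠ q in 𝓝 p, g q ≠ 0 ∧ q ∈ e.source :=
      (hcont.eventually_ne hne).and (e.open_source.mem_nhds hps)
    obtain ⟨q, ⟨h1, h2⟩, h3⟩ := (mem_closure_iff_nhds.1 (dense_regSet hP p)) _ hev
    apply h1
    rw [hgv q (hX.isRegularPoint h3) h2, hreg q h3, sub_self, mul_zero, zero_mul]
  rw [hgv p hp hps] at hzero
  have hN : ‖normalIn e X p‖ ^ 2 ≠ 0 :=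
    pow_ne_zero 2 (norm_ne_zero_iff.2 (normalIn_ne_zero hm hps hp.2))
  have hn : (n : ℝ) ≠ 0 := Nat.cast_ne_zero.2 (NeZero.ne n)
  have := (mul_eq_zero.1 ((mul_eq_zero.1 hzero).resolve_right hN)).resolve_left hn
  linarith

end Curvature

/-! ### Necessity of the edge condition -/

section EdgeTest

open Filter Topology

variable {n : ℕ} [NeZero n] {M : Type*} [TopologicalSpace M]
  [ChartedSpace (EuclideanSpace ℝ (Fin n)) M] {k : ℕ} {P : Fin k → Set M} {X : M → Euc (n + 1)}
  {i j : Fin k} {ζ : M} {φ : OpenPartialHomeomorph M (Euc n)}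

lemma IsEdgeChart.restr (hφ : IsEdgeChart P i j ζ φ) {U : Set M} (hU : IsOpen U) (hζ : ζ ∈ U)
    (hm : φ.restr U ∈ IsManifold.maximalAtlas (𝓡 n) ∞ M) : IsEdgeChart P i j ζ (φ.restr U) := by
  refine ⟨hm, ?_, hφ.2.2.1, fun q hq => hφ.2.2.2 q ?_⟩
  · rw [OpenPartialHomeomorph.restr_source, hU.interior_eq]
    exact ⟨hφ.2.1, hζ⟩
  · rw [OpenPartialHomeomorph.restr_source] at hq
    exact hq.1

/-- Near a point at which the restriction of `X` to the edge is an immersion, `X` is injective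
on the edge. -/
lemma IsEdgeChart.eventually_ne (hφ : IsEdgeChart P i j ζ φ)
    (hX : ∀ i, ContMDiffOn (𝓡 n) 𝓘(ℝ, Euc (n + 1)) 2 X (P i)) (h : IsEdgeImmersionAt X ζ φ) :
    ∀ᶠ q in 𝓝 ζ, φ q 0 = 0 → q ≠ ζ → X q ≠ X ζ := by
  obtain ⟨f', hf⟩ := hφ.hasFDerivWithinAt hX
  set π : Euc n →L[ℝ] ℝ := EuclideanSpace.proj (0 : Fin n) with hπ
  -- `f'` is controlled only along `{x₀ = 0}`; appending the coordinate `x₀`, which is zero there,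
  -- gives a derivative that is injective on the whole space.
  have hg : HasFDerivWithinAt (fun u => ((X ∘ φ.symm) u, π u)) (f'.prod π) {u | u 0 = 0} (φ ζ) :=
    hf.prodMk π.hasFDerivWithinAt
  have hinj : Function.Injective (f'.prod π) := by
    rw [injective_iff_map_eq_zero]
    intro v hv
    have hv1 : f' v = 0 := congrArg Prod.fst hv
    have hv0 : v 0 = 0 := congrArg Prod.snd hv
    exact h v hv0 (by rw [edgeDeriv_eq hφ.2.2.1 hf hv0, hv1])
  obtain ⟨C, -, hC⟩ := LinearMap.exists_antilipschitzWith (f'.prod π).toLinearMap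
    (LinearMap.ker_eq_bot.2 hinj)
  have hne := hg.eventually_ne (c := (X ζ, (0 : ℝ))) ⟨C, hC⟩
  rw [eventually_nhdsWithin_iff] at hne
  filter_upwards [(φ.continuousAt hφ.2.1).eventually hne, φ.open_source.mem_nhds hφ.2.1]
    with q hq hqs h0 hqζ hXq
  refine hq ⟨h0, fun heq => hqζ (φ.injOn hqs hφ.2.1 heq)⟩ ?_
  rw [Function.comp_apply, φ.left_inv hqs, hXq]
  exact congrArg _ h0

/-- The boundary flux density is continuous along the edge. -/
lemma IsEdgeChart.eventually_edgeFlux_pos (hφ : IsEdgeChart P i j ζ φ)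
    (hX : ∀ i, ContMDiffOn (𝓡 n) 𝓘(ℝ, Euc (n + 1)) 2 X (P i)) {Zr : Fin k → M → Euc (n + 1)}
    (hZ : ∀ i, ContinuousOn (Zr i) (P i)) {w : Euc (n + 1)}
    (h : 0 < edgeFlux X φ (Zr i ζ - Zr j ζ) w ζ) :
    ∀ᶠ q in 𝓝 ζ, φ q 0 = 0 → 0 < edgeFlux X φ (Zr i q - Zr j q) w q := by
  obtain ⟨a, b, hab, hQ⟩ := exists_euBox_subset (φ.open_target.mem_nhds (φ.map_source hφ.2.1))
  have ha : a 0 < 0 := hφ.2.2.1 ▸ (hab 0).1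
  have hb : 0 < b 0 := hφ.2.2.1 ▸ (hab 0).2
  have hab' : ∀ l, a l < b l := fun l => (hab l).1.trans (hab l).2
  -- On this half box in `P i` the derivative within is continuous up to the edge, where its
  -- tangential components are the edge derivatives.
  set H : Set (Euc n) := euBox (Function.update a 0 0) b with hH
  have hHu : UniqueDiffOn ℝ H := uniqueDiffOn_euBox (update_lt_left hab' hb)
  have hxH : ContDiffOn ℝ 2 (X ∘ φ.symm) H := by
    refine (ContMDiffOn.contDiffOn_comp_symm two_le_infty (hX i) hφ.1).mono fun u hu => ?_
    rw [hH, mem_euBox_update_left ha] at hu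
    have hut := hQ hu.1
    exact ⟨hut, (hφ.2.2.2 _ (φ.map_target hut)).1.2 (by rw [φ.right_inv hut]; exact hu.2)⟩
  have hdc : ContinuousOn (fderivWithin ℝ (X ∘ φ.symm) H) H :=
    hxH.continuousOn_fderivWithin hHu (by norm_num)
  set S : Set M := {q | q ∈ φ.source ∧ φ q 0 = 0} with hS
  have hζS : ζ ∈ S := ⟨hφ.2.1, hφ.2.2.1⟩
  have hint : interior (euBox a b) ∈ 𝓝 (φ ζ) := interior_euBox_mem_nhds hab
  have hφc := φ.continuousAt hφ.2.1
  have hmemH : ∀ q ∈ S, φ q ∈ interior (euBox a b) → φ q ∈ H := by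
    intro q hq hqi
    rw [hH, mem_euBox_update_left ha]
    exact ⟨interior_subset hqi, hq.2.ge⟩
  have hev : ∀ᶠ q in 𝓝[S] ζ, q ∈ S ∧ φ q ∈ interior (euBox a b) := by
    filter_upwards [self_mem_nhdsWithin, nhdsWithin_le_nhds (hφc.eventually hint)] with q h1 h2
      using ⟨h1, h2⟩
  have hPi : S ⊆ P i := fun q hq => (hφ.2.2.2 q hq.1).1.2 hq.2.ge
  have hPj : S ⊆ P j := fun q hq => (hφ.2.2.2 q hq.1).2.2 hq.2.le
  set G : M → Fin n → Euc (n + 1) := fun q => Function.update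
    (fun l => fderivWithin ℝ (X ∘ φ.symm) H (φ q) (EuclideanSpace.single l 1)) 0 w with hG
  have hGeq : ∀ q, q ∈ S ∧ φ q ∈ interior (euBox a b) →
      edgeFlux X φ (Zr i q - Zr j q) w q = ⟪Zr i q - Zr j q, crossProd (G q)⟫ := by
    rintro q ⟨hq, hqi⟩
    have hqH := hmemH q hq hqi
    rw [edgeFlux, hG]
    congr 2
    funext l
    by_cases hl : l = 0
    · subst hl
      simp
    · simp only [Function.update_of_ne hl, edgeFrame]
      rw [interior_euBox] at hqi
      rw [fderivWithin_euBox_single hqH ((hxH _ hqH).differentiableWithinAt (by norm_num))]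
      · rfl
      · rw [Function.update_of_ne hl]
        exact hqi l
  have hGc : ContinuousWithinAt G S ζ := by
    have h1 : ContinuousWithinAt (fun q => fderivWithin ℝ (X ∘ φ.symm) H (φ q)) S ζ := by
      refine Tendsto.comp (hdc _ (hmemH ζ hζS (mem_of_mem_nhds hint)))
        (tendsto_nhdsWithin_iff.2 ⟨hφc.tendsto.mono_left nhdsWithin_le_nhds, ?_⟩)
      exact hev.mono fun q hq => hmemH q hq.1 hq.2
    refine continuousWithinAt_pi.2 fun l => ?_
    by_cases hl : l = 0
    · subst hl
      simp only [hG, Function.update_self]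
      exact continuousWithinAt_const
    · simp only [hG, Function.update_of_ne hl]
      exact h1.clm_apply continuousWithinAt_const
  have hcont : ContinuousWithinAt (fun q => ⟪Zr i q - Zr j q, crossProd (G q)⟫) S ζ :=
    ((((hZ i) ζ (hPi hζS)).mono hPi).sub (((hZ j) ζ (hPj hζS)).mono hPj)).inner
      ((contDiff_crossProd (r := 0)).continuous.continuousAt.comp_continuousWithinAt hGc)
  rw [hGeq ζ ⟨hζS, mem_of_mem_nhds hint⟩] at h
  have hpos : ∀ᶠ q in 𝓝[S] ζ, 0 < edgeFlux X φ (Zr i q - Zr j q) w q := by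
    filter_upwards [hcont.eventually (lt_mem_nhds h), hev] with q h1 h2
    rw [hGeq q h2]
    exact h1
  rw [eventually_nhdsWithin_iff] at hpos
  filter_upwards [hpos, φ.open_source.mem_nhds hφ.2.1] with q h1 h2 h3 using h1 ⟨h2, h3⟩

variable [IsManifold (𝓡 n) ∞ M] [T2Space M] [CompactSpace M] [MeasurableSpace M] [BorelSpace M]
  {ν : Fin k → M → Euc (n + 1)}

/-- Test functions supported near a point at which the edge is immersed. -/
lemma IsEdgeChart.exists_isTestFun (hX : IsPiecewiseWeakImmersion 2 P X ν)
    (hφ : IsEdgeChart P i j ζ φ) (him : IsEdgeImmersionAt X ζ φ) {O : Set M} (hO : O ∈ 𝓝 ζ) :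
    ∃ η θ, IsTestFun P X η θ ∧ (∀ q, 0 ≤ η q) ∧ η ζ = 1 ∧ ∀ q, q ∉ O → η q = 0 := by
  have hnhd : O ∩ φ.source ∩ {q | φ q 0 = 0 → q ≠ ζ → X q ≠ X ζ} ∈ 𝓝 ζ :=
    inter_mem (inter_mem hO (φ.open_source.mem_nhds hφ.2.1)) (hφ.eventually_ne hX.contMDiffOn him)
  obtain ⟨f, -, hf⟩ := (SmoothBumpFunction.nhds_basis_tsupport (I := 𝓡 n) ζ).mem_iff.1 hnhd
  have hf0 : ∀ q, q ∉ tsupport f → f q = 0 := fun q hq => image_eq_zero_of_notMem_tsupport hq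
  -- The region where the cutoff can vary. Its part `E` off the regular set lies on the edge and
  -- avoids `ζ`, so `X ζ` is not in the compact set `X(E)`.
  set T : Set M := tsupport f \ interior {q | f q = 1} with hT
  have hTc : IsClosed T := (isClosed_tsupport f).sdiff isOpen_interior
  have hζT : ζ ∉ T := fun h => h.2 (mem_interior_iff_mem_nhds.2 f.eventuallyEq_one)
  set E : Set M := T ∩ (regSet P)ᶜ with hE
  have hEc : IsCompact E := (hTc.inter (isOpen_regSet P).isClosed_compl).isCompact
  have hEζ : X ζ ∉ X '' E := by
    rintro ⟨q, ⟨hqT, hqr⟩, hq⟩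
    have hqf := hf hqT.1
    have h0 : φ q 0 = 0 := by
      by_contra hne
      exact hqr (mem_regSet_of_edge hφ.2.2.2 hqf.1.2 hne)
    exact hqf.2 h0 (fun h => hζT (h ▸ hqT)) hq
  obtain ⟨r, hr, hrE⟩ := Metric.isOpen_iff.1 (hEc.image hX.continuous).isClosed.isOpen_compl _ hEζ
  -- The ball of radius `r` around `X ζ` misses `X(E)`, so on the support of `ψ(X)` the cutoff
  -- varies only at points of the regular set.
  let ψ : ContDiffBump (X ζ) := ⟨r / 4, r / 2, by positivity, by linarith⟩
  set K : Set M := T ∩ X ⁻¹' Metric.closedBall (X ζ) (r / 2) with hK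
  have hKc : IsClosed K := hTc.inter (Metric.isClosed_closedBall.preimage hX.continuous)
  have hKr : K ⊆ regSet P := by
    intro q hq
    by_contra hqr
    refine hrE (Metric.closedBall_subset_ball (by linarith) hq.2) ⟨q, ⟨hq.1, hqr⟩, rfl⟩
  obtain ⟨θ, hθ⟩ := AnisoSurface.exists_isTestFun hX hφ.1 f.contMDiff (ψ := ψ) ψ.contDiff hKc hKr
    (fun q hq => (hf hq.1.1).1.2) (by
      intro q _ hqK
      by_cases hqT : q ∈ T
      · refine Or.inl (ψ.zero_of_le_dist ?_)
        by_contra! hlt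
        exact hqK ⟨hqT, Metric.mem_closedBall.2 hlt.le⟩
      · refine Or.inr fun e' _ hqe => ?_
        by_cases hqf : q ∈ tsupport f
        · have hq1 : q ∈ interior {q | f q = 1} := by
            by_contra hn
            exact hqT ⟨hqf, hn⟩
          exact derivIn_eq_zero_of_eventuallyEq_const hqe (c := 1)
            (mem_interior_iff_mem_nhds.1 hq1)
        · exact derivIn_eq_zero_of_eventuallyEq_const hqe
            (notMem_tsupport_iff_eventuallyEq.1 hqf))
  refine ⟨_, θ, hθ, fun q => mul_nonneg f.nonneg ψ.nonneg, ?_, fun q hq => ?_⟩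
  · rw [f.eq_one, one_mul]
    exact ψ.one_of_mem_closedBall (Metric.mem_closedBall_self (by positivity))
  · rw [hf0 q fun h => hq (hf h).1.1, zero_mul]

variable {γ : Metric.sphere (0 : EuclideanSpace ℝ (Fin (n + 1))) 1 → ℝ}

/-- If the jump is not tangent, some direction `w` has positive flux at `ζ`, and a test function
near `ζ` has nonzero defect. With constant mean curvature, the first variation of energy is `-nΛ₀`
times that of volume plus this defect. A test function in the same direction `w`, supported in the
regular set, has no defect and nonzero first variation of volume, so it fixes the multiplier as
`-nΛ₀`; the defect near `ζ` must then vanish. -/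
lemma IsCritical.mem_edgeTangent_of_hasSign [Nonempty M] (hM : IsOrientedAtlas n M)
    (hγ : ContMDiff (𝓡 n) 𝓘(ℝ, ℝ) 2 γ) (hP : IsPieceDecomposition (n := n) P)
    (hX : IsPiecewiseWeakImmersion 2 P X ν) (hcrit : IsCritical γ P X)
    (hφ : IsEdgeChart P i j ζ φ) (him : IsEdgeImmersionAt X ζ φ) {σ : ℝ} (hσ : σ * σ = 1)
    (hs : HasSign φ σ) :
    cahnHoffman γ (ν i ζ) - cahnHoffman γ (ν j ζ) ∈ edgeTangent X ζ φ := by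
  by_contra hnot
  obtain ⟨𝒞⟩ := exists_chartPartition n M
  have hZ := hX.pieceRep_cahnField hγ hP
  have hcl := isClosed_piece hP
  rw [← hX.homGrad_sub_homGrad hγ hP hφ] at hnot
  have hN := edgeNormal_ne_zero hφ hX.contMDiffOn him hnot
  obtain ⟨p₀, hp₀⟩ := (dense_regSet hP).nonempty
  -- One `w` serves both purposes: positive flux at `ζ`, after a change of sign if necessary, and
  -- transversality at a regular point `p₀`, where the comparison function lives.
  obtain ⟨w, hw, hw₀⟩ : ∃ w, 0 < edgeFlux X φ (homGrad γ (ν i ζ) - homGrad γ (ν j ζ)) w ζ ∧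
      ⟪w, normalIn (chartAt (Euc n) p₀) X p₀⟫ ≠ 0 := by
    obtain ⟨w, h1, h2⟩ := exists_inner_ne_zero hN
      (normalIn_ne_zero (chartAt_mem_maximalAtlas p₀) (mem_chart_source _ p₀) (hX.injective hp₀))
    rcases h1.lt_or_gt with h | h
    · exact ⟨w, by rw [edgeFlux_eq_inner_edgeNormal]; linarith, h2⟩
    · refine ⟨-w, ?_, ?_⟩
      · rw [edgeFlux_eq_inner_edgeNormal, inner_neg_left]
        linarith
      · rw [inner_neg_left]
        exact neg_ne_zero.2 h2
  have hev := hφ.eventually_edgeFlux_pos hX.contMDiffOn (Zr := fun i p => homGrad γ (ν i p))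
    (fun i => (hZ i).1.continuousOn) hw
  have hsymm := φ.continuousAt_symm (φ.map_source hφ.2.1)
  rw [ContinuousAt, φ.left_inv hφ.2.1] at hsymm
  obtain ⟨a, b, hab, hQ⟩ := exists_euBox_subset
    (inter_mem (φ.open_target.mem_nhds (φ.map_source hφ.2.1)) (hsymm.eventually hev))
  obtain ⟨η, θ, hη, hη0, hηζ, hηO⟩ := hφ.exists_isTestFun hX him
    (image_symm_mem_nhds hφ.2.1 (interior_euBox_mem_nhds hab))
  have hD : stokesDefect 𝒞 P X (cahnField γ X) (fun p => η p • w) ≠ 0 := by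
    refine stokesDefect_edge_ne_zero hcl 𝒞 hX.contMDiffOn hZ
      (fun i => (hη.contMDiffOn_smul w i).of_le (by norm_num)) hφ.1 hσ hs hφ.2.2.2
      (fun l => (hab l).1.trans (hab l).2) (hφ.2.2.1 ▸ (hab 0).1) (hφ.2.2.1 ▸ (hab 0).2)
      (hQ.trans inter_subset_left) (fun p hp => by rw [hηO p hp, zero_smul]) ?_ hφ.2.1 hφ.2.2.1 ?_
    · rintro _ ⟨u, hu, rfl⟩ h0
      rw [edgeFlux_smul_right]
      exact mul_nonneg (hη0 _) ((hQ hu).2 h0).le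
    · rw [edgeFlux_smul_right, hηζ, one_mul]
      exact hw.ne'
  obtain ⟨Λ₀, hΛ⟩ := IsCritical.exists_anisoMeanCurvature_eq hM hγ hP hX hcrit
  have hpair : ∀ W, formInt 𝒞 P (pairForm X W (cahnField γ X)) =
      -n * Λ₀ * formInt 𝒞 P (volForm X W) := by
    intro W
    rw [← formInt_smul]
    refine formInt_congr 𝒞 fun φ hφ p hp hps => ?_
    rw [hX.pairForm_cahnField hM hγ _ (mem_maximalAtlas_of_mem_atlas hφ) hp hps,
      hΛ p (hX.isRegularPoint hp), mul_assoc]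
  obtain ⟨η₁, θ₁, hη₁, hη₁0, hV₁⟩ := exists_volForm_test_ne_zero hM 𝒞 hX hp₀ hw₀
  have h1 := hη₁.stokesDefect_eq_zero hM hγ hP 𝒞 hX hη₁0 w
  have h2 := IsCritical.formInt_proportional hM hγ hP 𝒞 hX hcrit hη₁ hη w
  rw [stokesDefect, hpair] at h1 hD
  apply hD
  refine (mul_eq_zero.1 ?_).resolve_left hV₁
  rw [mul_sub, h2, sub_eq_zero.1 h1]
  ring

/-- The edge condition at a critical point. -/
lemma IsCritical.mem_edgeTangent [Nonempty M] (hM : IsOrientedAtlas n M)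
    (hγ : ContMDiff (𝓡 n) 𝓘(ℝ, ℝ) 2 γ) (hP : IsPieceDecomposition (n := n) P)
    (hX : IsPiecewiseWeakImmersion 2 P X ν) (hcrit : IsCritical γ P X)
    (hφ : IsEdgeChart P i j ζ φ) (him : IsEdgeImmersionAt X ζ φ) :
    cahnHoffman γ (ν i ζ) - cahnHoffman γ (ν j ζ) ∈ edgeTangent X ζ φ := by
  obtain ⟨U, hU, hζ, hm, σ, hσ, hs⟩ := exists_restr_hasSign hM hφ.1 hφ.2.1
  exact IsCritical.mem_edgeTangent_of_hasSign (φ := φ.restr U) hM hγ hP hX hcrit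
    (hφ.restr hU hζ hm) him hσ hs

end EdgeTest
end AnisoSurface

theorem proposition9p3 {n : ℕ} [NeZero n] {M : Type*} [TopologicalSpace M] [T2Space M]
    [CompactSpace M] [ConnectedSpace M] [ChartedSpace (EuclideanSpace ℝ (Fin n)) M]
    [IsManifold (𝓡 n) ∞ M] [MeasurableSpace M] [BorelSpace M] (hM : IsOrientedAtlas n M)
    (γ : Metric.sphere (0 : EuclideanSpace ℝ (Fin (n + 1))) 1 → ℝ)
    (hγ : ContMDiff (𝓡 n) 𝓘(ℝ, ℝ) 2 γ) (hγpos : ∀ ν, 0 < γ ν)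
    {k : ℕ} (P : Fin k → Set M) (hP : IsPieceDecomposition (n := n) P)
    (X : M → EuclideanSpace ℝ (Fin (n + 1))) (ν : Fin k → M → EuclideanSpace ℝ (Fin (n + 1)))
    (hX : IsPiecewiseWeakImmersion 2 P X ν) :
    IsCritical γ P X ↔
      (∃ Λ₀ : ℝ, ∀ p, IsRegularPoint X p → anisoMeanCurvature γ X p = Λ₀) ∧
      (∀ (i j : Fin k) (ζ : M) (φ : OpenPartialHomeomorph M (EuclideanSpace ℝ (Fin n))),
        IsEdgeChart P i j ζ φ → IsEdgeImmersionAt X ζ φ →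
          cahnHoffman γ (ν i ζ) - cahnHoffman γ (ν j ζ) ∈ edgeTangent X ζ φ) := by
  constructor
  · intro hcrit
    exact ⟨hcrit.exists_anisoMeanCurvature_eq hM hγ hP hX, fun i j ζ φ hφ him =>
      hcrit.mem_edgeTangent hM hγ hP hX hφ him⟩
  · rintro ⟨⟨Λ₀, hΛ⟩, hedge⟩
    exact isCritical_of_eulerLagrange hM hγ hP hX hΛ hedge
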